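/- Let $x^2\,dY/dx=A(x)Y$, $A\in M_N(\mathbb C\{x\})$, be a system with a formal fundamental solution $\widetilde F(x)\,x^L e^{Q(1/x)}$ of single level one in prepared form: $L=\bigoplus_{j=1}^J(\lambda_jI_{n_j}+J_{n_j})$, where $J_{n_j}$ is the nilpotent Jordan block of size $n_j\ge 1$ and $0\le\operatorname{Re}\lambda_j<1$; $Q(1/x)=\bigoplus_j\frac{-a_j}{x}I_{n_j}$ with $a_j\in\mathbb C$; and $\widetilde F(x)=I+\sum_{m\ge1}F_mx^m$ is a matrix of formal power series. Let ${\bf\Omega}=\{a_j-a_k\}$, let $\theta\in\mathbb R$ be a determination of an anti-Stokes direction (for instance the principal one, $-2\pi<\theta\le0$), and let $\omega\in{\bf\Omega}\setminus\{0\}$ have argument $\theta$. The Borel transform $\widehat F(\xi)=\sum_{m\ge1}F_m\xi^{m-1}/(m-1)!$ (the term $\delta I$ being left out) converges near $0$. It can be continued along the path $\gamma^+$ that follows the half line of argument $\theta$ from $0$ to a point just beyond $\omega$ and bypasses all points of ${\bf\Omega}$ in $]0,\omega]$ closely to the right, and from there to a punctured neighbourhood of $\omega$ on the Riemann surface of the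 logarithm of $\xi$, where the variable is $\omega+\xi$ and $\arg\xi=\theta$ at the end of $\gamma^+$. There are a unique constant matrix $K^+$ and a unique germ $\check F^+(\omega+\xi)$ at $\xi=0$ on the Riemann surface of the logarithm (the principal major of $\widehat F$ at $\omega$) such that $\check F^+$ differs from this continuation of $\widehat F$ by a function holomorphic at $\omega$, and $$\check F^+(\omega+\xi)=\frac1\xi\,\xi^LK^+\xi^{-L}+\mathrm{Rem}^+(\ln\xi),$$ where the $(j;k)$ block of the remainder has the form $\sum_{\ell:\,a_\ell-a_k=\omega}\xi^{\lambda_\ell-\lambda_k}R_\ell^{j;k}(\ln\xi)$ (subdominant powers, since $\operatorname{Re}\lambda_\ell>\operatorname{Re}\lambda_j-1$). Here $R_\ell^{j;k}$ is a matrix of polynomials in $\ln\xi$ whose coefficients are summable-resurgent functions of $\xi$ with singular support $S_k=\{a_i-a_k-\omega\}_{i}$, and the coefficient of $(\ln\xi)^0$ in $R_\ell^{j;k}$ is zero if $\lambda_\ell=\lambda_k$. The blocks $(K^+)^{j;k}$ vanish unless $a_j-a_k=\omega$; in particular all diagonal blocks of $K^+$ are zero. (A germ at $0$ is summable-resurgent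 with singular support $S$ if it is analytic at $0$, can be continued analytically along every path from $0$ that avoids $S\cup\{0\}$ after its start, and the resulting function has at most exponential growth at infinity on every sector of bounded opening at a positive distance from $S$ to which it is continued along such a path.) -/

import Mathlib

open Complex Filter Topology
open scoped Matrix PowerSeries

noncomputable section

namespace LevelOne

/-! ### The differential system and its formal fundamental solution -/

/-- Rows and columns of an `n × n` matrix split into `J` blocks of sizes `n 0, n 1, …`:
`⟨j, r⟩` is the `r`-th row (or column) of the `j`-th block. -/
abbrev Idx {J : ℕ} (n : Fin J → ℕ) : Type := (j : Fin J) × Fin (n j)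

/-- The irreducible nilpotent Jordan block of size `m`, with ones just above the diagonal. -/
def jordanNilpotent (m : ℕ) : Matrix (Fin m) (Fin m) ℂ :=
  Matrix.of fun r s => if (r : ℕ) + 1 = (s : ℕ) then 1 else 0

/-- The matrix of exponents of formal monodromy `L = ⨁ⱼ (λⱼ I + J)`. -/
def monodromyExponent {J : ℕ} (n : Fin J → ℕ) (lam : Fin J → ℂ) :
    Matrix (Idx n) (Idx n) ℂ :=
  Matrix.blockDiagonal' fun j => lam j • (1 : Matrix (Fin (n j)) (Fin (n j)) ℂ) +
    jordanNilpotent (n j)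

/-- The coefficient matrix `A₀(x) = ⨁ⱼ aⱼ I + x L` of the normal form `x² Y' = A₀(x) Y`,
whose formal solution is `x^L e^{Q(1/x)}`, `Q(1/x) = ⨁ⱼ (-aⱼ/x) I`. -/
def normalForm {J : ℕ} (n : Fin J → ℕ) (a lam : Fin J → ℂ) :
    Matrix (Idx n) (Idx n) ℂ⟦X⟧ :=
  Matrix.diagonal (fun p => PowerSeries.C (a p.1)) +
    (PowerSeries.X : ℂ⟦X⟧) • (monodromyExponent n lam).map PowerSeries.C

/-- `F(x) x^L e^{Q(1/x)}` is a formal solution of `x² Y' = A(x) Y`. Since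
`x² (x^L e^{Q(1/x)})' = A₀(x) x^L e^{Q(1/x)}`, this is the equation
`x² F' + F A₀ = A F` between matrices of formal power series. -/
def IsFormalSolution {J : ℕ} (n : Fin J → ℕ) (a lam : Fin J → ℂ)
    (A F : Matrix (Idx n) (Idx n) ℂ⟦X⟧) : Prop :=
  (PowerSeries.X ^ 2 : ℂ⟦X⟧) • F.map (PowerSeries.derivative ℂ) + F * normalForm n a lam = A * F

/-- The power series has a positive radius of convergence. -/
def IsConvergent (φ : ℂ⟦X⟧) : Prop :=
  ∃ r : ℝ, 0 < r ∧ Summable fun m : ℕ => ‖PowerSeries.coeff m φ‖ * r ^ m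

/-- The sum of a power series (meaningful near `0` for a convergent series). -/
def seriesSum (φ : ℂ⟦X⟧) (ξ : ℂ) : ℂ := ∑' m : ℕ, PowerSeries.coeff m φ * ξ ^ m

/-- The formal Borel transform `∑_{m ≥ 1} c_m x^m ↦ ∑_{m ≥ 1} c_m ξ^{m-1} / (m-1)!`
(the constant term of `φ` only contributes a multiple of the Dirac `δ`, which is not a part of
the function in the Borel plane). -/
def borelSeries (φ : ℂ⟦X⟧) : ℂ⟦X⟧ :=
  PowerSeries.mk fun m => PowerSeries.coeff (m + 1) φ / (Nat.factorial m : ℂ)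

/-! ### Stokes values -/

/-- All differences `a j - a k`: the Stokes values attached to the full matrix `F`. -/
def stokesValues {J : ℕ} (a : Fin J → ℂ) : Set ℂ := {z | ∃ j k, z = a j - a k}

/-- The non-zero Stokes values on the half line from `0` with argument `θ`. -/
def stokesValuesOnRay {J : ℕ} (a : Fin J → ℂ) (θ : ℝ) : Set ℂ :=
  {z | z ∈ stokesValues a ∧ z ≠ 0 ∧ z = (‖z‖ : ℂ) * exp (θ * I)}

/-! ### Analytic continuation and summable-resurgent functions -/

/-- `g s` is, for each `s`, the analytic continuation to `γ s` of the germ of `f` at `γ 0` along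
the path `γ`. -/
structure IsContinuationAlong (f : ℂ → ℂ) (γ : C(unitInterval, ℂ)) (g : unitInterval → ℂ → ℂ) :
    Prop where
  start : g 0 =ᶠ[𝓝 (γ 0)] f
  analytic : ∀ s, AnalyticAt ℂ (g s) (γ s)
  coherent : ∀ s, ∀ᶠ s' in 𝓝 s, g s' =ᶠ[𝓝 (γ s')] g s

/-- Paths issuing from `0` and lying in `ℂ \ (S ∪ {0})` but for their starting point. Their
homotopy classes are the points of the Riemann surface `R_S`. -/
def IsAdmissible (S : Set ℂ) (γ : C(unitInterval, ℂ)) : Prop :=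
  γ 0 = 0 ∧ ∀ s : unitInterval, s ≠ 0 → γ s ∉ S ∧ γ s ≠ 0

/-- A sector at infinity of bounded opening, in the coordinate `t = ln ζ`:
`|ζ| > e^ρ` and `α < arg ζ < β`. The opening may exceed `2π`. -/
def logSector (ρ α β : ℝ) : Set ℂ := {t | ρ < t.re ∧ α < t.im ∧ t.im < β}

/-- The germ of `f` at `0` is a summable-resurgent function with singular support `S, 0`:
it is analytic at `0`, it can be continued along all paths from `0` that avoid `S` (and `0`),
that is, to the Riemann surface `R_S`, and it grows at most exponentially at infinity on the
`ν`-sectorial regions of `R_S`. Such a region consists of a disc at `0`, of a bounded tube around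
a path, and of a sector of bounded opening at distance `> ν` from `S` into which the path leads;
so its part at infinity is the sector, on the sheet given by the path. -/
structure IsSummableResurgent (S : Set ℂ) (f : ℂ → ℂ) : Prop where
  analytic : AnalyticAt ℂ f 0
  continuable : ∀ γ, IsAdmissible S γ → ∃ g, IsContinuationAlong f γ g
  growth : ∀ γ g, IsAdmissible S γ → IsContinuationAlong f γ g →
    ∀ ν : ℝ, 0 < ν → ∀ ρ α β : ℝ, (∀ t ∈ logSector ρ α β, ∀ z ∈ S, ν < dist (exp t) z) →
    ∀ t₀ ∈ logSector ρ α β, γ 1 = exp t₀ →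
    ∃ h : ℂ → ℂ, AnalyticOnNhd ℂ h (logSector ρ α β) ∧
      h =ᶠ[𝓝 t₀] (fun t => g 1 (exp t)) ∧
      ∃ C A M : ℝ, ∀ t ∈ logSector ρ α β, M ≤ t.re →
        ‖h t‖ ≤ C * Real.exp (A * Real.exp t.re)

/-! ### Majors

Functions on the Riemann surface of the logarithm are written in the coordinate `t = ln ξ`,
so `ξ = exp t`, `ξ^μ = exp (μ t)`, `ξ^L = exp (t L)`. -/

/-- Neighbourhoods of `0` on the Riemann surface of the logarithm: `ξ → 0` is `Re t → -∞`. -/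
def logZero : Filter ℂ := comap re atBot

/-- The function `s ↦ (s (|ω| + r) - i y(s)) e^{iθ}`: it goes along the half line of argument `θ`
from `0` to the point `ω + r e^{iθ}` just beyond `ω = |ω| e^{iθ}`, being pushed by the amount
`y(s) ≥ 0` to the right. -/
def rightPath (θ : ℝ) (ω : ℂ) (r : ℝ) (y : C(unitInterval, ℝ)) : C(unitInterval, ℂ) where
  toFun := fun s : unitInterval => (((s : ℝ) * (‖ω‖ + r) : ℝ) - (y s : ℝ) * I) * exp (θ * I)
  continuous_toFun := by fun_prop

/-- `y` is an admissible deviation, of size at most `δ`: `rightPath θ ω r y` bypasses to the right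
every point of `S` (other than `0`) that lies on the segment. -/
def IsRightDeviation (S : Set ℂ) (θ : ℝ) (ω : ℂ) (r δ : ℝ) (y : C(unitInterval, ℝ)) : Prop :=
  y 0 = 0 ∧ y 1 = 0 ∧ (∀ s, 0 ≤ y s ∧ y s ≤ δ) ∧
    ∀ s : unitInterval, s ≠ 0 → (((s : ℝ) * (‖ω‖ + r) : ℝ) : ℂ) * exp (θ * I) ∈ S → 0 < y s

/-- `G` is the continuation of the germ of `f` at `0` along the path `γ⁺` from `0` towards `ω`
(bypassing to the right all points of `S` in `]0, ω]`), as a function of `t = ln ξ`, where the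
variable is `ω + ξ` and the argument of `ξ` is `θ` at the end point `ω + r e^{iθ}` of `γ⁺`. -/
def IsRightBranch (S : Set ℂ) (θ : ℝ) (ω : ℂ) (f G : ℂ → ℂ) : Prop :=
  ∃ δ : ℝ, 0 < δ ∧ AnalyticOnNhd ℂ G {t | Real.exp t.re < δ} ∧
    ∀ r : ℝ, 0 < r → r < δ → ∀ y, IsRightDeviation S θ ω r δ y →
      ∃ g, IsContinuationAlong f (rightPath θ ω r y) g ∧
        G =ᶠ[𝓝 ((Real.log r : ℂ) + θ * I)] fun t => g 1 (ω + exp t)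

/-- `Φ` (a function of `t = ln ξ`) is a major at `ω` of the continuation of `f` along `γ⁺`: it
differs from this continuation, at `ω + ξ`, by a function of `ω + ξ` holomorphic at `ω`. -/
def IsMajor (S : Set ℂ) (θ : ℝ) (ω : ℂ) (f Φ : ℂ → ℂ) : Prop :=
  ∃ G u : ℂ → ℂ, IsRightBranch S θ ω f G ∧ AnalyticAt ℂ u ω ∧
    ∀ᶠ t in logZero, G t = Φ t + u (ω + exp t)

/-- `(1/ξ) ξ^L K ξ^{-L}` as a function of `t = ln ξ`. -/
def leadingTerm {J : ℕ} (n : Fin J → ℕ) (lam : Fin J → ℂ) (K : Matrix (Idx n) (Idx n) ℂ)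
    (t : ℂ) : Matrix (Idx n) (Idx n) ℂ :=
  exp (-t) • (NormedSpace.exp (t • monodromyExponent n lam) * K *
    NormedSpace.exp (-(t • monodromyExponent n lam)))

/-- The remainders: in the `k`-th column-block,
`∑_{ℓ : a_ℓ - a_k = ω} ξ^{λ_ℓ - λ_k} ∑_{m < N} h_{ℓ,m}(ξ) (ln ξ)^m`
with summable-resurgent coefficients `h_{ℓ,m}` of singular support `{a_i - a_k - ω}`. When
`λ_ℓ = λ_k` the coefficient of `(ln ξ)^0` is zero, so that there is no holomorphic term.
As `0 ≤ Re λ < 1`, the powers are subdominant with respect to `ξ^{λ_j - λ_k - 1}`. -/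
def IsSubdominantRemainder {J : ℕ} (n : Fin J → ℕ) (a lam : Fin J → ℂ) (ω : ℂ)
    (Rem : ℂ → Matrix (Idx n) (Idx n) ℂ) : Prop :=
  ∃ (N : ℕ) (h : Fin J → ℕ → Idx n → Idx n → ℂ → ℂ),
    (∀ l m p q, a l - a q.1 = ω →
      IsSummableResurgent {z | ∃ i, z = a i - a q.1 - ω} (h l m p q)) ∧
    (∀ l p q, a l - a q.1 = ω → lam l = lam q.1 → h l 0 p q = 0) ∧
    ∀ᶠ t in logZero, ∀ p q : Idx n,
      Rem t p q = ∑ l with a l - a q.1 = ω,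
        exp ((lam l - lam q.1) * t) * ∑ m ∈ Finset.range N, h l m p q (exp t) * t ^ m

/-- `Φ` is the principal major of the Borel transform of `F` at `ω`, with `θ` as determination of
the argument of `ω`, and `K` is its constant matrix:
`Φ(ω + ξ) = (1/ξ) ξ^L K ξ^{-L} + Rem(ln ξ)`. -/
def IsPrincipalMajor {J : ℕ} (n : Fin J → ℕ) (a lam : Fin J → ℂ)
    (F : Matrix (Idx n) (Idx n) ℂ⟦X⟧) (θ : ℝ) (ω : ℂ)
    (Φ : ℂ → Matrix (Idx n) (Idx n) ℂ) (K : Matrix (Idx n) (Idx n) ℂ) : Prop :=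
  (∀ p q, IsMajor (stokesValues a) θ ω (seriesSum (borelSeries (F p q))) fun t => Φ t p q) ∧
  ∃ Rem : ℂ → Matrix (Idx n) (Idx n) ℂ, IsSubdominantRemainder n a lam ω Rem ∧
    ∀ᶠ t in logZero, Φ t = leadingTerm n lam K t + Rem t

end LevelOne

end

/-! Fix a column block `k`. The Borel transform turns the differential system for these columns of
`F` into a linear Volterra equation `(ζ - (a_j - a_k)) φ = w + ∫ κ(ζ - y) φ(y) dy`. Since `A`
converges, `w` and `κ` are entire of exponential type; the Gevrey estimate `gevrey` makes `φ` a
convergent germ at `0` (`exists_isSol_borel`). Singularities can only arise from the division by `ζ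
- (a_j - a_k)`.

Continuation. A solution is carried along together with its history `W t`, an entire function of `z`
that contains the inhomogeneous term and the integral over the path already travelled (`IsSol`). On
a convex open set free of singular points, the history at one point determines exactly one solution
(`exists_isSol`, `IsSol.unique`). Passing the history on from one convex set to the next continues
the solution along every admissible path, and Grönwall's inequality bounds it on sectors
(`IsSol.growth`). In the coordinate `t = ln ξ` a punctured neighbourhood of `ω` on the Riemann
surface of the logarithm is a half-plane, hence convex, so the branch along `γ⁺` is obtained in the
same way (`IsSol.exists_rightBranch`).

Structure at `ω`. Put `e = Re λ_k` and `μ = λ_j - λ_k`. For `a_j - a_k = ω` the functions `ξ φ_i`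
satisfy `dg/dt = μ g + nilpotent terms + forcing`. This shows that `φ_i` is `ξ^(μ-1) Q(ln ξ)` plus a
remainder of order `-e > -1` (`Resonance.exists_leading`). The equation is invariant under the
monodromy `T : t ↦ t + 2πi`. A polynomial `p(T)` kills all leading terms; then `(T - 1) p(T) φ` is a
solution of order `-e` whose history has positive order at `ω`, and such a solution is zero
(`Resonance.eventually_eq_zero`). Hence the remainder is killed by a polynomial in `T`, and linear
algebra writes it as a finite sum of `ξ^ν (ln ξ)^m` with single-valued coefficients
(`exists_expansion`). The coefficients are recovered from the remainder by operations that preserve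
orders and resurgence (`extraction`). Having order above `-1` they are holomorphic at `ξ = 0`, and
they are summable-resurgent. The coefficient of `ξ^0 (ln ξ)^0` is the holomorphic function by which
the major differs from the branch.

Multiplied by `ξ`, the leading terms of all columns form a matrix with `W' = L W - W L`, whence `W =
ξ^L K ξ^{-L}` (`exists_leadingTerm_eq`). Uniqueness holds because, for fixed `k`, the exponents `λ_ℓ
- λ_k` have real parts in a half-open interval of length one: distinct exponents have distinct
monodromy multipliers, so the products `ξ^ν (ln ξ)^m` are independent over germs with at most a
simple pole (`coeff_eq_zero_of_sum_eq_zero`). -/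

noncomputable section

namespace LevelOne

/-! ### Integrals along segments -/

section Segment

variable {F : Type*} [NormedAddCommGroup F] [NormedSpace ℂ F]

/-- The integral of `f` along the segment from `c` to `t`. -/
def segInt (c t : ℂ) (f : ℂ → F) : F := ∫ σ in (0 : ℝ)..1, (t - c) • f (c + σ * (t - c))

lemma segment_mem {U : Set ℂ} (hU : Convex ℝ U) {c t : ℂ} (hc : c ∈ U) (ht : t ∈ U) {σ : ℝ}
    (h0 : 0 ≤ σ) (h1 : σ ≤ 1) : c + σ * (t - c) ∈ U := by
  have := hU.add_smul_sub_mem hc ht (t := σ) ⟨h0, h1⟩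
  simpa using this

lemma segment_hasDerivAt (c t : ℂ) (σ : ℝ) :
    HasDerivAt (fun σ : ℝ => c + (σ : ℂ) * (t - c)) (t - c) σ := by
  have := ((Complex.ofRealCLM.hasDerivAt (x := σ)).mul_const (t - c)).const_add c
  simpa using this

lemma segInt_eq_sub {U : Set ℂ} (hU : Convex ℝ U) {c t : ℂ} (hc : c ∈ U)
    (ht : t ∈ U) [CompleteSpace F] {f g : ℂ → F} (hf : ContinuousOn f U)
    (hg : ∀ τ ∈ U, HasDerivAt g (f τ) τ) : segInt c t f = g t - g c := by
  have key : ∀ σ ∈ Set.uIcc (0 : ℝ) 1, HasDerivAt (fun σ : ℝ => g (c + (σ : ℂ) * (t - c)))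
      ((t - c) • f (c + σ * (t - c))) σ := by
    intro σ hσ
    rw [Set.uIcc_of_le zero_le_one] at hσ
    exact (hg _ (segment_mem hU hc ht hσ.1 hσ.2)).scomp σ (segment_hasDerivAt c t σ)
  have hcont : ContinuousOn (fun σ : ℝ => (t - c) • f (c + σ * (t - c))) (Set.uIcc 0 1) := by
    refine ContinuousOn.const_smul (hf.comp (by fun_prop) ?_) _
    intro σ hσ
    rw [Set.uIcc_of_le zero_le_one] at hσ
    exact segment_mem hU hc ht hσ.1 hσ.2
  rw [segInt, intervalIntegral.integral_eq_sub_of_hasDerivAt key hcont.intervalIntegrable]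
  simp

/-- A holomorphic function on a convex open set has a primitive, which represents the segment
integral for all end points at once. -/
lemma segInt_hasDerivAt [CompleteSpace F] {U : Set ℂ} (hU : Convex ℝ U) (hUo : IsOpen U) {c t : ℂ}
    (hc : c ∈ U) (ht : t ∈ U) {f : ℂ → F} (hf : DifferentiableOn ℂ f U) :
    HasDerivAt (fun t => segInt c t f) (f t) t := by
  obtain ⟨g, hg⟩ := hU.exists_forall_hasDerivWithinAt hf
  have hg' : ∀ τ ∈ U, HasDerivAt g (f τ) τ := fun τ hτ => (hg τ hτ).hasDerivAt (hUo.mem_nhds hτ)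
  refine ((hg' t ht).sub_const (g c)).congr_of_eventuallyEq ?_
  filter_upwards [hUo.mem_nhds ht] with τ hτ
  exact segInt_eq_sub hU hc hτ hf.continuousOn hg'

lemma segInt_self (c : ℂ) (f : ℂ → F) : segInt c c f = 0 := by simp [segInt]

/-- The weight `σ ^ n` integrates to `1 / (n + 1)`; iterated, this produces the factorials in the
bound for the Picard iterates. -/
lemma norm_segInt_le {c t : ℂ} {f : ℂ → F} {B : ℝ} {n : ℕ}
    (h : ∀ σ : ℝ, 0 ≤ σ → σ ≤ 1 → ‖f (c + σ * (t - c))‖ * ‖t - c‖ ≤ B * σ ^ n) :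
    ‖segInt c t f‖ ≤ B / (n + 1) := by
  have : ‖segInt c t f‖ ≤ ∫ σ in (0 : ℝ)..1, B * σ ^ n := by
    refine intervalIntegral.norm_integral_le_of_norm_le zero_le_one ?_ ?_
    · refine Filter.Eventually.of_forall fun σ hσ => ?_
      rw [norm_smul, mul_comm]
      exact h σ hσ.1.le hσ.2
    · exact (by fun_prop : Continuous fun σ : ℝ => B * σ ^ n).intervalIntegrable _ _
  refine this.trans (le_of_eq ?_)
  rw [intervalIntegral.integral_const_mul, integral_pow]
  simp [div_eq_mul_inv]

end Segment

/-! ### Functions of exponential type -/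

/-- At most exponential growth on the whole plane. -/
def ExpType {F : Type*} [Norm F] (w : ℂ → F) : Prop :=
  ∃ C A : ℝ, 0 ≤ C ∧ 0 ≤ A ∧ ∀ z, ‖w z‖ ≤ C * Real.exp (A * ‖z‖)

lemma ExpType.add {F : Type*} [SeminormedAddCommGroup F] {v w : ℂ → F} (hv : ExpType v)
    (hw : ExpType w) : ExpType fun z => v z + w z := by
  obtain ⟨C, A, hC, hA, h⟩ := hv
  obtain ⟨C', A', hC', hA', h'⟩ := hw
  refine ⟨C + C', max A A', by positivity, le_max_of_le_left hA, fun z => ?_⟩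
  refine (norm_add_le _ _).trans ?_
  rw [add_mul]
  refine add_le_add ((h z).trans ?_) ((h' z).trans ?_)
  · gcongr; exact le_max_left _ _
  · gcongr; exact le_max_right _ _

lemma ExpType.const_smul {F : Type*} [SeminormedAddCommGroup F] [NormedSpace ℂ F] {v : ℂ → F}
    (hv : ExpType v) (c : ℂ) : ExpType fun z => c • v z := by
  obtain ⟨C, A, hC, hA, h⟩ := hv
  refine ⟨‖c‖ * C, A, by positivity, hA, fun z => ?_⟩
  rw [norm_smul, mul_assoc]
  gcongr
  exact h z

/-! ### Linear Volterra equations with a diagonal singular factor -/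

/-- The data of the equation `(z - sᵢ) φᵢ(z) = wᵢ(z) + ∫ (κ(z - y) φ(y))ᵢ dy`: the points `sᵢ`
and the entire kernel `κ` of exponential type. -/
structure VolterraData (ι : Type*) [Fintype ι] where
  sing : ι → ℂ
  ker : ℂ → (ι → ℂ) →L[ℂ] (ι → ℂ)
  ker_diff : Differentiable ℂ ker
  ker_exp : ExpType ker

variable {ι : Type*} [Fintype ι]

/-- `φ` solves the Volterra equation on `U` in the coordinate `t`, `z = p t`. The function
`W t` of `z` collects the inhomogeneous term and the integral along the path run through up to
`t`; no base point is singled out. -/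
structure IsSol (V : VolterraData ι) (p : ℂ → ℂ) (U : Set ℂ) (φ : ℂ → ι → ℂ)
    (W : ℂ → ℂ → ι → ℂ) : Prop where
  diff : DifferentiableOn ℂ φ U
  entire : ∀ t ∈ U, Differentiable ℂ (W t)
  expType : ∀ t ∈ U, ExpType (W t)
  hasDeriv : ∀ t ∈ U, ∀ z, HasDerivAt (fun τ => W τ z) (deriv p t • V.ker (z - p t) (φ t)) t
  eq : ∀ t ∈ U, ∀ i, (p t - V.sing i) * φ t i = W t (p t) i

/-- Differentiation under the integral sign for a convolution-type integral. -/
lemma differentiable_kernel_integral {F G : Type*} [NormedAddCommGroup F] [NormedSpace ℂ F]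
    [NormedAddCommGroup G] [NormedSpace ℂ G] [CompleteSpace G]
    {k : ℂ → F →L[ℂ] G} (hk : Differentiable ℂ k) {q : ℝ → ℂ} {v : ℝ → F}
    (hq : ContinuousOn q (Set.Icc 0 1)) (hv : ContinuousOn v (Set.Icc 0 1)) :
    Differentiable ℂ fun z => ∫ σ in (0 : ℝ)..1, k (z - q σ) (v σ) := by
  intro z₀
  have hk' : Continuous (deriv k) := (hk.contDiff (n := 1)).continuous_deriv le_rfl
  have hsub : Set.uIoc (0 : ℝ) 1 ⊆ Set.Icc 0 1 := by
    rw [Set.uIoc_of_le zero_le_one]; exact Set.Ioc_subset_Icc_self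
  have hF : ∀ z, ContinuousOn (fun σ => k (z - q σ) (v σ)) (Set.Icc 0 1) := fun z =>
    (hk.continuous.comp_continuousOn (continuousOn_const.sub hq)).clm_apply hv
  have hF'2 : ContinuousOn (fun x : ℂ × ℝ => deriv k (x.1 - q x.2) (v x.2))
      (Metric.closedBall z₀ 1 ×ˢ Set.Icc 0 1) := by
    have h2 : Set.MapsTo Prod.snd (Metric.closedBall z₀ 1 ×ˢ Set.Icc (0 : ℝ) 1) (Set.Icc 0 1) :=
      fun x hx => hx.2
    exact (hk'.comp_continuousOn (continuousOn_fst.sub (hq.comp continuousOn_snd h2))).clm_apply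
      (hv.comp continuousOn_snd h2)
  obtain ⟨B, hB⟩ := ((isCompact_closedBall z₀ 1).prod isCompact_Icc).exists_bound_of_continuousOn
    hF'2
  have hF' : ContinuousOn (fun σ => deriv k (z₀ - q σ) (v σ)) (Set.Icc 0 1) :=
    (hk'.comp_continuousOn (continuousOn_const.sub hq)).clm_apply hv
  have := intervalIntegral.hasDerivAt_integral_of_dominated_loc_of_deriv_le
    (μ := MeasureTheory.volume) (a := 0) (b := 1)
    (F := fun z σ => k (z - q σ) (v σ)) (F' := fun z σ => deriv k (z - q σ) (v σ)) (x₀ := z₀)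
    (s := Metric.ball z₀ 1) (bound := fun _ => B) (Metric.ball_mem_nhds z₀ one_pos)
    (Filter.Eventually.of_forall fun z =>
      ((hF z).mono hsub).aestronglyMeasurable measurableSet_uIoc)
    (by
      refine ContinuousOn.intervalIntegrable ?_
      rw [Set.uIcc_of_le zero_le_one]; exact hF z₀)
    ((hF'.mono hsub).aestronglyMeasurable measurableSet_uIoc)
    (Filter.Eventually.of_forall fun σ hσ z hz =>
      hB (z, σ) ⟨Metric.ball_subset_closedBall hz, hsub hσ⟩)
    (by simp)
    (Filter.Eventually.of_forall fun σ hσ z hz => by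
      have h1 : HasDerivAt (fun z => k (z - q σ)) (deriv k (z - q σ)) z :=
        (hk _).hasDerivAt.comp_sub_const z (q σ)
      exact h1.clm_apply (hasDerivAt_const z (v σ)) |>.congr_deriv (by simp))
  exact this.2.differentiableAt

/-- The derivative of `t ↦ W t (p t)` when `t ↦ W t z` has a jointly continuous derivative. -/
lemma hasDerivAt_diagonal {F : Type*} [NormedAddCommGroup F] [NormedSpace ℂ F] {U : Set ℂ}
    (hUo : IsOpen U) {p : ℂ → ℂ} (hp : Differentiable ℂ p) {W G : ℂ → ℂ → F} {t : ℂ} (ht : t ∈ U)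
    (hW : Differentiable ℂ (W t)) (hd : ∀ τ ∈ U, ∀ z, HasDerivAt (fun τ => W τ z) (G τ z) τ)
    (hG : ContinuousAt (fun x : ℂ × ℂ => G x.1 x.2) (t, p t)) :
    HasDerivAt (fun t => W t (p t)) (G t (p t) + deriv p t • deriv (W t) (p t)) t := by
  have h2 : HasDerivAt (fun τ => W t (p τ)) (deriv p t • deriv (W t) (p t)) t :=
    (hW _).hasDerivAt.scomp t (hp t).hasDerivAt
  -- Here the second argument is `p τ` and not a fixed point. Joint continuity of `G` makes the mean
  -- value estimate in the first argument uniform for second arguments near `p t`.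
  have h1 : HasDerivAt (fun τ => W τ (p τ) - W t (p τ)) (G t (p t)) t := by
    rw [hasDerivAt_iff_isLittleO]
    refine Asymptotics.isLittleO_iff.2 fun ε hε => ?_
    have hev : ∀ᶠ x : ℂ × ℂ in 𝓝 t ×ˢ 𝓝 (p t), ‖G x.1 x.2 - G t (p t)‖ < ε := by
      rw [← nhds_prod_eq]
      have := Metric.continuousAt_iff'.1 hG ε hε
      simpa [dist_eq_norm] using this
    obtain ⟨P, hP, Q, hQ, hPQ⟩ := Filter.eventually_prod_iff.1 hev
    obtain ⟨r, hr, hrP⟩ := Metric.eventually_nhds_iff_ball.1 (hP.and (hUo.mem_nhds ht))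
    filter_upwards [Metric.ball_mem_nhds t hr, (hp t).continuousAt.eventually hQ] with τ hτ hτQ
    have hmv := (convex_ball t r).norm_image_sub_le_of_norm_hasDerivWithin_le
      (f := fun s => W s (p τ) - s • G t (p t)) (f' := fun s => G s (p τ) - G t (p t)) (C := ε)
      (fun s hs => ((hd s (hrP s hs).2 (p τ)).sub
        ((hasDerivAt_id s).smul_const (G t (p t)) |>.congr_deriv (one_smul _ _))).hasDerivWithinAt)
      (fun s hs => (hPQ (hrP s hs).1 hτQ).le) (Metric.mem_ball_self hr) hτ
    refine le_trans (le_of_eq ?_) hmv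
    congr 1
    simp only [sub_self, sub_zero, sub_smul]
    abel
  have := h1.add h2
  refine this.congr_of_eventuallyEq (Filter.Eventually.of_forall fun τ => ?_)
  simp

end LevelOne

end

/-! ### Existence of solutions by Picard iteration -/

noncomputable section

namespace LevelOne

variable {ι : Type*} [Fintype ι]

lemma differentiable_deriv_of_entire {p : ℂ → ℂ} (hp : Differentiable ℂ p) :
    Differentiable ℂ (deriv p) := by
  have : ContDiff ℂ 2 p := hp.contDiff
  exact ((contDiff_succ_iff_deriv (n := 1)).1 this).2.2.differentiable (by norm_num)

/-- The integral term of the Volterra equation along the segment from `c` to `t`. -/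
def history (V : VolterraData ι) (p : ℂ → ℂ) (c : ℂ) (φ : ℂ → ι → ℂ) (t z : ℂ) : ι → ℂ :=
  segInt c t fun τ => deriv p τ • V.ker (z - p τ) (φ τ)

section History

variable (V : VolterraData ι) {p : ℂ → ℂ} (hp : Differentiable ℂ p) {U : Set ℂ}
  (hU : Convex ℝ U) (hUo : IsOpen U) {c : ℂ} (hc : c ∈ U) {φ : ℂ → ι → ℂ}
  (hφ : DifferentiableOn ℂ φ U)

include hp hφ in
lemma history_integrand_differentiableOn (z : ℂ) :
    DifferentiableOn ℂ (fun τ => deriv p τ • V.ker (z - p τ) (φ τ)) U := by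
  have h1 : Differentiable ℂ fun τ => V.ker (z - p τ) :=
    V.ker_diff.comp ((differentiable_const z).sub hp)
  exact (differentiable_deriv_of_entire hp).differentiableOn.smul
    (h1.differentiableOn.clm_apply hφ)

include hp hU hUo hc hφ in
lemma history_hasDerivAt {t : ℂ} (ht : t ∈ U) (z : ℂ) :
    HasDerivAt (fun τ => history V p c φ τ z) (deriv p t • V.ker (z - p t) (φ t)) t :=
  segInt_hasDerivAt hU hUo hc ht (history_integrand_differentiableOn V hp hφ z)

include hU hc in
lemma segment_continuousOn {F : Type*} [TopologicalSpace F] {f : ℂ → F} (hf : ContinuousOn f U)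
    {t : ℂ} (ht : t ∈ U) :
    ContinuousOn (fun σ : ℝ => f (c + σ * (t - c))) (Set.Icc 0 1) :=
  hf.comp (by fun_prop) fun _ hσ => segment_mem hU hc ht hσ.1 hσ.2

-- As the kernel is entire, the integral over a path already travelled is entire in `z`. It can
-- therefore serve as the inhomogeneous term of an equation that starts afresh at `t`.
include hp hU hc hφ in
lemma history_entire {t : ℂ} (ht : t ∈ U) : Differentiable ℂ (history V p c φ t) := by
  have := differentiable_kernel_integral V.ker_diff
    (q := fun σ => p (c + σ * (t - c)))
    (v := fun σ => ((t - c) * deriv p (c + σ * (t - c))) • φ (c + σ * (t - c)))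
    (segment_continuousOn hU hc hp.continuous.continuousOn ht)
    (((continuousOn_const).mul (segment_continuousOn hU hc
      (differentiable_deriv_of_entire hp).continuous.continuousOn ht)).smul
      (segment_continuousOn hU hc hφ.continuousOn ht))
  simp only [map_smul, mul_smul] at this
  exact this

lemma VolterraData.ker_bound (V : VolterraData ι) : ∃ C A : ℝ, 0 ≤ C ∧ 0 ≤ A ∧
    ∀ z v, ‖V.ker z v‖ ≤ C * Real.exp (A * ‖z‖) * ‖v‖ := by
  obtain ⟨C, A, hC, hA, h⟩ := V.ker_exp
  exact ⟨C, A, hC, hA, fun z v => (V.ker z).le_of_opNorm_le (h z) v⟩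

include hp hU hc hφ in
lemma history_expType {t : ℂ} (ht : t ∈ U) : ExpType (history V p c φ t) := by
  obtain ⟨C, A, hC, hA, hker⟩ := V.ker_bound
  obtain ⟨P, hP⟩ := isCompact_Icc.exists_bound_of_continuousOn
    (segment_continuousOn hU hc hp.continuous.continuousOn ht)
  obtain ⟨P', hP'⟩ := isCompact_Icc.exists_bound_of_continuousOn
    (segment_continuousOn hU hc (differentiable_deriv_of_entire hp).continuous.continuousOn ht)
  obtain ⟨B, hB⟩ := isCompact_Icc.exists_bound_of_continuousOn
    (segment_continuousOn hU hc hφ.continuousOn ht)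
  have hB0 : 0 ≤ B := (norm_nonneg _).trans (hB 0 (by simp))
  have hP0 : 0 ≤ P' := (norm_nonneg _).trans (hP' 0 (by simp))
  refine ⟨P' * (C * Real.exp (A * P) * B) * ‖t - c‖, A, by positivity, hA, fun z => ?_⟩
  have := norm_segInt_le (c := c) (t := t) (f := fun τ => deriv p τ • V.ker (z - p τ) (φ τ))
    (B := P' * (C * Real.exp (A * P) * B) * ‖t - c‖ * Real.exp (A * ‖z‖)) (n := 0) ?_
  · simpa [history] using this
  intro σ h0 h1
  have hz : ‖z - p (c + σ * (t - c))‖ ≤ ‖z‖ + P :=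
    (norm_sub_le _ _).trans (by gcongr; exact hP σ ⟨h0, h1⟩)
  rw [norm_smul, pow_zero, mul_one]
  calc _ ≤ P' * (C * Real.exp (A * (‖z‖ + P)) * B) * ‖t - c‖ := by
        gcongr
        · exact hP' σ ⟨h0, h1⟩
        · refine (hker _ _).trans ?_
          gcongr
          exact hB σ ⟨h0, h1⟩
    _ = _ := by rw [mul_add, Real.exp_add]; ring

include hp hU hUo hc hφ in
lemma history_diagonal_differentiableOn :
    DifferentiableOn ℂ (fun t => history V p c φ t (p t)) U := by
  intro t ht
  refine (hasDerivAt_diagonal hUo hp ht (history_entire V hp hU hc hφ ht)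
    (G := fun t z => deriv p t • V.ker (z - p t) (φ t))
    (fun τ hτ z => history_hasDerivAt V hp hU hUo hc hφ hτ z) ?_).differentiableAt
    |>.differentiableWithinAt
  have hφc : ContinuousAt φ t := (hφ.differentiableAt (hUo.mem_nhds ht)).continuousAt
  have h1 : ContinuousAt (fun x : ℂ × ℂ => φ x.1) (t, p t) :=
    ContinuousAt.comp (f := Prod.fst) (x := (t, p t)) hφc continuousAt_fst
  have h2 : Continuous fun x : ℂ × ℂ => V.ker (x.2 - p x.1) :=
    V.ker_diff.continuous.comp (continuous_snd.sub (hp.continuous.comp continuous_fst))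
  have h3 : Continuous fun x : ℂ × ℂ => deriv p x.1 :=
    (differentiable_deriv_of_entire hp).continuous.comp continuous_fst
  exact h3.continuousAt.smul (h2.continuousAt.clm_apply h1)

end History

/-- The diagonal factor `1 / (p t - sᵢ)`. -/
def invFactor (V : VolterraData ι) (p : ℂ → ℂ) (t : ℂ) : ι → ℂ := fun i => (p t - V.sing i)⁻¹

lemma invFactor_differentiableOn (V : VolterraData ι) {p : ℂ → ℂ} (hp : Differentiable ℂ p)
    {U : Set ℂ} (hs : ∀ t ∈ U, ∀ i, p t ≠ V.sing i) :
    DifferentiableOn ℂ (invFactor V p) U := by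
  refine differentiableOn_pi.2 fun i t ht => ?_
  exact ((hp t).sub_const _).inv (sub_ne_zero.2 (hs t ht i)) |>.differentiableWithinAt

/-- The Picard iterates. -/
def picardIterate (V : VolterraData ι) (p : ℂ → ℂ) (c : ℂ) (w₀ : ℂ → ι → ℂ) : ℕ → ℂ → ι → ℂ
  | 0 => fun t => invFactor V p t * w₀ (p t)
  | n + 1 => fun t => invFactor V p t * history V p c (picardIterate V p c w₀ n) t (p t)

section Existence

variable (V : VolterraData ι) {p : ℂ → ℂ} (hp : Differentiable ℂ p) {U : Set ℂ}
  (hU : Convex ℝ U) (hUo : IsOpen U) {c : ℂ} (hc : c ∈ U)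
  (hs : ∀ t ∈ U, ∀ i, p t ≠ V.sing i) {w₀ : ℂ → ι → ℂ} (hw : Differentiable ℂ w₀)

include hp hU hUo hc hs hw in
lemma picardIterate_differentiableOn (n : ℕ) :
    DifferentiableOn ℂ (picardIterate V p c w₀ n) U := by
  induction n with
  | zero => exact (invFactor_differentiableOn V hp hs).mul (hw.comp hp).differentiableOn
  | succ n ih =>
    exact (invFactor_differentiableOn V hp hs).mul
      (history_diagonal_differentiableOn V hp hU hUo hc ih)

include hp hs hw in
/-- On a compact convex set, the Picard iterates decay factorially. -/
lemma picardIterate_bound {K : Set ℂ} (hK : IsCompact K) (hKc : Convex ℝ K)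
    (hKU : K ⊆ U) (hcK : c ∈ K) :
    ∃ B L : ℝ, 0 ≤ B ∧ 0 ≤ L ∧ ∀ n, ∀ t ∈ K, ∀ σ : ℝ, 0 ≤ σ → σ ≤ 1 →
      ‖picardIterate V p c w₀ n (c + σ * (t - c))‖ ≤ B * (L ^ n / n.factorial) * σ ^ n := by
  obtain ⟨C, A, hC, hA, hker⟩ := V.ker_bound
  obtain ⟨m, hm⟩ := hK.exists_bound_of_continuousOn
    ((invFactor_differentiableOn V hp hs).continuousOn.mono hKU)
  obtain ⟨P, hP⟩ := hK.exists_bound_of_continuousOn hp.continuous.continuousOn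
  obtain ⟨P', hP'⟩ := hK.exists_bound_of_continuousOn
    (differentiable_deriv_of_entire hp).continuous.continuousOn
  obtain ⟨b, hb⟩ := hK.exists_bound_of_continuousOn (hw.comp hp).continuous.continuousOn
  obtain ⟨R, hR⟩ := hK.exists_bound_of_continuousOn
    (continuous_id.sub continuous_const : Continuous fun t : ℂ => t - c).continuousOn
  have hm0 : 0 ≤ m := (norm_nonneg _).trans (hm c hcK)
  have hP0 : 0 ≤ P' := (norm_nonneg _).trans (hP' c hcK)
  have hb0 : 0 ≤ b := (norm_nonneg _).trans (hb c hcK)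
  have hR0 : 0 ≤ R := (norm_nonneg _).trans (hR c hcK)
  -- `m * b` bounds the zeroth iterate. The second constant bounds one Picard step: diagonal factor
  -- `m`, Jacobian `P'`, kernel at an argument of size at most `P + P`, length `R`.
  refine ⟨m * b, m * (P' * (C * Real.exp (A * (P + P)))) * R, by positivity, by positivity, ?_⟩
  set L := m * (P' * (C * Real.exp (A * (P + P)))) * R with hL
  intro n
  induction n with
  | zero =>
    intro t ht σ h0 h1
    have hmem := segment_mem hKc hcK ht h0 h1
    simp only [picardIterate, pow_zero, Nat.factorial_zero, Nat.cast_one, div_one, mul_one]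
    exact (norm_mul_le _ _).trans (mul_le_mul (hm _ hmem) (hb _ hmem) (norm_nonneg _) hm0)
  | succ n ih =>
    intro t ht σ h0 h1
    set s := c + σ * (t - c) with hsdef
    have hmem : s ∈ K := segment_mem hKc hcK ht h0 h1
    have hsc : s - c = σ * (t - c) := by rw [hsdef]; ring
    have hbd : ‖history V p c (picardIterate V p c w₀ n) s (p s)‖ ≤
        (P' * (C * Real.exp (A * (P + P)) * (m * b * (L ^ n / n.factorial) * σ ^ n)) * (σ * R)) /
          (n + 1) := by
      refine norm_segInt_le fun σ' h0' h1' => ?_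
      -- The segment from `c` to `s` is part of the one from `c` to `t`, so the induction hypothesis
      -- applies with the same `t` and the parameter `σ * σ'`. The length contributes the extra
      -- factor `σ`, and the integral of `σ' ^ n` the factor `1 / (n + 1)`.
      have e : c + σ' * (s - c) = c + ((σ * σ' : ℝ) : ℂ) * (t - c) := by
        rw [hsc]; push_cast; ring
      have hσσ : σ * σ' ≤ 1 := mul_le_one₀ h1 h0' h1'
      have hmem' : c + σ' * (s - c) ∈ K := segment_mem hKc hcK hmem h0' h1'
      have hi := ih t ht (σ * σ') (by positivity) hσσ
      rw [← e] at hi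
      have hz : ‖p s - p (c + σ' * (s - c))‖ ≤ P + P :=
        (norm_sub_le _ _).trans (add_le_add (hP _ hmem) (hP _ hmem'))
      have hsn : ‖s - c‖ ≤ σ * R := by
        rw [hsc, norm_mul, Complex.norm_real, Real.norm_of_nonneg h0]
        gcongr
        exact hR t ht
      rw [norm_smul]
      calc _ ≤ P' * (C * Real.exp (A * (P + P)) *
              (m * b * (L ^ n / n.factorial) * (σ * σ') ^ n)) * (σ * R) := by
            refine mul_le_mul (mul_le_mul (hP' _ hmem') ((hker _ _).trans ?_) (norm_nonneg _) hP0)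
              hsn (norm_nonneg _) (by positivity)
            gcongr
        _ = _ := by rw [mul_pow]; ring
    simp only [picardIterate]
    refine (norm_mul_le _ _).trans ((mul_le_mul (hm _ hmem) hbd (norm_nonneg _) hm0).trans
      (le_of_eq ?_))
    rw [Nat.factorial_succ, pow_succ L, pow_succ σ]
    have : (n.factorial : ℝ) ≠ 0 := by positivity
    push_cast
    rw [hL]
    field_simp

include hp hU hUo hc hs hw in
lemma picardIterate_summable : ∀ t ∈ U, ∃ r > 0, Metric.ball t r ⊆ U ∧ ∃ u : ℕ → ℝ, Summable u ∧
    ∀ n, ∀ s ∈ Metric.ball t r, ∀ σ : ℝ, 0 ≤ σ → σ ≤ 1 →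
      ‖picardIterate V p c w₀ n (c + σ * (s - c))‖ ≤ u n := by
  intro t ht
  obtain ⟨r, hr, hrU⟩ := Metric.nhds_basis_closedBall.mem_iff.1 (hUo.mem_nhds ht)
  -- The segments from `c` to the points of a closed ball fill a compact convex subset of `U`, on
  -- which the factorial bound is uniform.
  set K := convexHull ℝ (insert c (Metric.closedBall t r)) with hK
  have hKU : K ⊆ U := convexHull_min (Set.insert_subset hc hrU) hU
  have hKcomp : IsCompact K := by
    rw [hK, ← Set.singleton_union, convexHull_union (Set.singleton_nonempty c)
      ⟨t, Metric.mem_closedBall_self hr.le⟩, convexHull_singleton,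
      (convex_closedBall t r).convexHull_eq, convexJoin_singleton_left]
    have : (⋃ y ∈ Metric.closedBall t r, segment ℝ c y) =
        (fun x : ℝ × ℂ => c + x.1 • (x.2 - c)) '' (Set.Icc 0 1 ×ˢ Metric.closedBall t r) := by
      ext z
      simp only [Set.mem_iUnion, segment_eq_image', Set.mem_image, Set.mem_prod, Prod.exists]
      constructor
      · rintro ⟨y, hy, σ, hσ, rfl⟩
        exact ⟨σ, y, ⟨hσ, hy⟩, rfl⟩
      · rintro ⟨σ, y, ⟨hσ, hy⟩, rfl⟩
        exact ⟨y, hy, σ, hσ, rfl⟩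
    rw [this]
    exact (isCompact_Icc.prod (isCompact_closedBall t r)).image (by fun_prop)
  obtain ⟨B, L, hB, hL, h⟩ := picardIterate_bound V hp hs hw hKcomp (convex_convexHull ℝ _) hKU
    (subset_convexHull ℝ _ (Set.mem_insert c _))
  refine ⟨r, hr, Metric.ball_subset_closedBall.trans hrU,
    fun n => B * (L ^ n / n.factorial), (Real.summable_pow_div_factorial L).mul_left B, ?_⟩
  intro n s hs σ h0 h1
  refine (h n s (subset_convexHull ℝ _ (Set.mem_insert_of_mem c
    (Metric.ball_subset_closedBall hs))) σ h0 h1).trans ?_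
  exact mul_le_of_le_one_right (by positivity) (pow_le_one₀ h0 h1)

include hp hU hUo hc hs hw in
/-- Existence of solutions on convex open sets that avoid the singular points. -/
theorem exists_isSol (hw' : ExpType w₀) :
    ∃ φ W, IsSol V p U φ W ∧ W c = w₀ := by
  set φn := picardIterate V p c w₀ with hφn
  have hsum := picardIterate_summable V hp hU hUo hc hs hw
  set φ : ℂ → ι → ℂ := fun t => ∑' n, φn n t with hφ
  have hdn : ∀ n, DifferentiableOn ℂ (φn n) U :=
    picardIterate_differentiableOn V hp hU hUo hc hs hw
  have hpt : ∀ t : ℂ, c + ((1 : ℝ) : ℂ) * (t - c) = t := fun t => by simp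
  have hd : DifferentiableOn ℂ φ U := by
    intro t ht
    obtain ⟨r, hr, hrU, u, hu, hbd⟩ := hsum t ht
    have := differentiableOn_tsum_of_summable_norm (F := φn) hu
      (fun n => (hdn n).mono hrU) Metric.isOpen_ball
      (fun n s hs => by simpa only [hpt] using hbd n s hs 1 zero_le_one le_rfl)
    exact (this.differentiableAt (Metric.ball_mem_nhds t hr)).differentiableWithinAt
  have hsn : ∀ t ∈ U, Summable fun n => φn n t := by
    intro t ht
    obtain ⟨r, hr, hrU, u, hu, hbd⟩ := hsum t ht
    exact Summable.of_norm_bounded hu fun n => by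
      simpa only [hpt] using hbd n t (Metric.mem_ball_self hr) 1 zero_le_one le_rfl
  -- the integral of the sum is the sum of the integrals
  have hint : ∀ t ∈ U, ∀ z, HasSum (fun n => history V p c (φn n) t z) (history V p c φ t z) := by
    intro t ht z
    obtain ⟨r, hr, hrU, u, hu, hbd⟩ := hsum t ht
    have hcont : ∀ ψ : ℂ → ι → ℂ, DifferentiableOn ℂ ψ U → ContinuousOn (fun σ : ℝ =>
        (t - c) • deriv p (c + σ * (t - c)) • V.ker (z - p (c + σ * (t - c)))
          (ψ (c + σ * (t - c)))) (Set.Icc 0 1) := fun ψ hψ =>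
      (segment_continuousOn hU hc
        (history_integrand_differentiableOn V hp hψ z).continuousOn ht).const_smul (t - c)
    have hkc : ContinuousOn (fun σ : ℝ => (t - c) • deriv p (c + σ * (t - c)) •
        V.ker (z - p (c + σ * (t - c)))) (Set.Icc 0 1) := by
      refine (segment_continuousOn hU hc (f := fun τ => deriv p τ • V.ker (z - p τ))
        (Continuous.continuousOn ?_) ht).const_smul (t - c)
      exact (differentiable_deriv_of_entire hp).continuous.smul
        (V.ker_diff.continuous.comp (continuous_const.sub hp.continuous))
    obtain ⟨M, hM⟩ := isCompact_Icc.exists_bound_of_continuousOn hkc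
    have hsub : Set.uIoc (0 : ℝ) 1 ⊆ Set.Icc 0 1 := by
      rw [Set.uIoc_of_le zero_le_one]; exact Set.Ioc_subset_Icc_self
    refine intervalIntegral.hasSum_integral_of_dominated_convergence
      (bound := fun n _ => M * u n) (fun n => ?_) (fun n => ?_) ?_ ?_ ?_
    · exact ((hcont _ (hdn n)).mono hsub).aestronglyMeasurable measurableSet_uIoc
    · refine Filter.Eventually.of_forall fun σ hσ => ?_
      have h1 := hM σ (hsub hσ)
      have h2 := hbd n t (Metric.mem_ball_self hr) σ (hsub hσ).1 (hsub hσ).2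
      calc _ = ‖((t - c) • deriv p (c + σ * (t - c)) • V.ker (z - p (c + σ * (t - c))))
            (φn n (c + σ * (t - c)))‖ := rfl
        _ ≤ M * u n := ContinuousLinearMap.le_of_opNorm_le_of_le _ h1 h2
    · exact Filter.Eventually.of_forall fun σ hσ => hu.mul_left M
    · simp
    · refine Filter.Eventually.of_forall fun σ hσ => ?_
      have hmem : c + σ * (t - c) ∈ U := segment_mem hU hc ht (hsub hσ).1 (hsub hσ).2
      exact ((t - c) • deriv p (c + σ * (t - c)) • V.ker (z - p (c + σ * (t - c)))).hasSum
        (hsn _ hmem).hasSum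
  refine ⟨φ, fun t z => w₀ z + history V p c φ t z, ⟨hd, ?_, ?_, ?_, ?_⟩, ?_⟩
  · exact fun t ht => hw.add (history_entire V hp hU hc hd ht)
  · exact fun t ht => hw'.add (history_expType V hp hU hc hd ht)
  · exact fun t ht z => (history_hasDerivAt V hp hU hUo hc hd ht z).const_add _
  · intro t ht i
    -- The zeroth iterate carries `w₀` and the others the histories of their predecessors, so
    -- summation gives the fixed point equation.
    have h1 : φ t = φn 0 t + ∑' n, φn (n + 1) t := (hsn t ht).tsum_eq_zero_add
    have h2 : HasSum (fun n => φn (n + 1) t) (invFactor V p t * history V p c φ t (p t)) :=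
      (hint t ht (p t)).mul_left (invFactor V p t)
    rw [h1, h2.tsum_eq]
    have hne : p t - V.sing i ≠ 0 := sub_ne_zero.2 (hs t ht i)
    simp only [hφn, picardIterate, Pi.add_apply, Pi.mul_apply, invFactor]
    field_simp
  · funext z
    simp [history, segInt_self]

end Existence

end LevelOne

end

/-! ### Grönwall estimates, uniqueness and uniform bounds for solutions -/

noncomputable section

namespace LevelOne

variable {ι : Type*} [Fintype ι]

/-- Grönwall's inequality in integral form. -/
lemma gronwall_integral {u k Q : ℝ → ℝ} {K a b : ℝ} (hu : ContinuousOn u (Set.Icc a b))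
    (hk : ContinuousOn k (Set.Icc a b)) (hk0 : ∀ x ∈ Set.Icc a b, 0 ≤ k x)
    (hQ : ∀ x, HasDerivAt Q (k x) x)
    (h : ∀ x ∈ Set.Icc a b, u x ≤ K + ∫ s in a..x, k s * u s) :
    ∀ x ∈ Set.Icc a b, u x ≤ K * Real.exp (Q x - Q a) := by
  intro x hx
  have hab : a ≤ b := hx.1.trans hx.2
  have hku : ContinuousOn (fun s => k s * u s) (Set.Icc a b) := hk.mul hu
  set J : ℝ → ℝ := fun x => K + ∫ s in a..x, k s * u s with hJ
  have hint : MeasureTheory.IntegrableOn (fun s => k s * u s) (Set.Icc a b) :=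
    hku.integrableOn_Icc
  have hJc : ContinuousOn J (Set.Icc a b) := by
    have := intervalIntegral.continuousOn_primitive_interval (μ := MeasureTheory.volume)
      (f := fun s => k s * u s) (a := a) (b := b) (by rwa [Set.uIcc_of_le hab])
    rw [Set.uIcc_of_le hab] at this
    exact continuousOn_const.add this
  have hJd : ∀ y ∈ Set.Ioo a b, HasDerivAt J (k y * u y) y := by
    intro y hy
    have hcy : ContinuousAt (fun s => k s * u s) y := hku.continuousAt (Icc_mem_nhds hy.1 hy.2)
    refine (intervalIntegral.integral_hasDerivAt_right ?_ ?_ hcy).const_add K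
    · refine (hku.mono ?_).intervalIntegrable
      rw [Set.uIcc_of_le hy.1.le]
      exact Set.Icc_subset_Icc_right hy.2.le
    · exact (hku.mono Set.Ioo_subset_Icc_self).stronglyMeasurableAtFilter isOpen_Ioo y hy
  have hQc : Continuous Q := continuous_iff_continuousAt.2 fun x => (hQ x).continuousAt
  -- `J' = k u ≤ k J`, so `J e^{-Q}` does not increase.
  set H : ℝ → ℝ := fun x => J x * Real.exp (-Q x) with hH
  have hHd : ∀ y ∈ Set.Ioo a b, HasDerivAt H
      (k y * u y * Real.exp (-Q y) + J y * (Real.exp (-Q y) * -k y)) y :=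
    fun y hy => (hJd y hy).mul ((hQ y).neg.exp)
  have hanti : AntitoneOn H (Set.Icc a b) := by
    refine antitoneOn_of_deriv_nonpos (convex_Icc a b)
      (hJc.mul (Real.continuous_exp.comp hQc.neg).continuousOn) ?_ ?_
    · rw [interior_Icc]
      exact fun y hy => (hHd y hy).differentiableAt.differentiableWithinAt
    · rw [interior_Icc]
      intro y hy
      rw [(hHd y hy).deriv]
      have h1 : u y ≤ J y := h y (Set.Ioo_subset_Icc_self hy)
      have h2 := hk0 y (Set.Ioo_subset_Icc_self hy)
      have h3 := Real.exp_pos (-Q y)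
      have : k y * Real.exp (-Q y) * (u y - J y) ≤ 0 :=
        mul_nonpos_of_nonneg_of_nonpos (by positivity) (by linarith)
      linarith
  have h1 : H x ≤ H a := hanti ⟨le_rfl, hab⟩ hx hx.1
  simp only [hH, hJ, intervalIntegral.integral_same, add_zero] at h1
  calc u x ≤ J x := h x hx
    _ = (J x * Real.exp (-Q x)) * Real.exp (Q x) := by
        rw [mul_assoc, ← Real.exp_add]; simp
    _ ≤ (K * Real.exp (-Q a)) * Real.exp (Q x) := by gcongr
    _ = K * Real.exp (Q x - Q a) := by rw [mul_assoc, ← Real.exp_add]; ring_nf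

namespace IsSol

variable {V : VolterraData ι} {p : ℂ → ℂ} {U : Set ℂ} {φ φ₁ φ₂ : ℂ → ι → ℂ}
  {W W₁ W₂ : ℂ → ℂ → ι → ℂ}

lemma mono (h : IsSol V p U φ W) {U' : Set ℂ} (hU : U' ⊆ U) : IsSol V p U' φ W :=
  ⟨h.diff.mono hU, fun t ht => h.entire t (hU ht), fun t ht => h.expType t (hU ht),
    fun t ht => h.hasDeriv t (hU ht), fun t ht => h.eq t (hU ht)⟩

lemma add (h₁ : IsSol V p U φ₁ W₁) (h₂ : IsSol V p U φ₂ W₂) :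
    IsSol V p U (fun t => φ₁ t + φ₂ t) (fun t z => W₁ t z + W₂ t z) where
  diff := h₁.diff.add h₂.diff
  entire t ht := (h₁.entire t ht).add (h₂.entire t ht)
  expType t ht := (h₁.expType t ht).add (h₂.expType t ht)
  hasDeriv t ht z := ((h₁.hasDeriv t ht z).add (h₂.hasDeriv t ht z)).congr_deriv (by simp)
  eq t ht i := by
    simp only [Pi.add_apply, mul_add, h₁.eq t ht i, h₂.eq t ht i]

lemma smul (h : IsSol V p U φ W) (c : ℂ) :
    IsSol V p U (fun t => c • φ t) (fun t z => c • W t z) where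
  diff := h.diff.const_smul c
  entire t ht := (h.entire t ht).const_smul c
  expType t ht := (h.expType t ht).const_smul c
  hasDeriv t ht z := ((h.hasDeriv t ht z).const_smul c).congr_deriv (by
    rw [map_smul, smul_comm])
  eq t ht i := by
    simp only [Pi.smul_apply, smul_eq_mul, ← h.eq t ht i]
    ring

lemma sub (h₁ : IsSol V p U φ₁ W₁) (h₂ : IsSol V p U φ₂ W₂) :
    IsSol V p U (fun t => φ₁ t - φ₂ t) (fun t z => W₁ t z - W₂ t z) := by
  have := h₁.add (h₂.smul (-1))
  simpa [sub_eq_add_neg] using this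

/-- The increment of `W · z` along a straight line. -/
lemma norm_sub_le_integral (h : IsSol V p U φ W) (hp : Differentiable ℂ p) {c v : ℂ} {a b : ℝ}
    (hab : a ≤ b) (hmem : ∀ x ∈ Set.Icc a b, c + x * v ∈ U) (z : ℂ) {B : ℝ → ℝ}
    (hB : ContinuousOn B (Set.Icc a b))
    (hle : ∀ x ∈ Set.Icc a b, ‖v‖ * (‖deriv p (c + x * v)‖ *
      ‖V.ker (z - p (c + x * v)) (φ (c + x * v))‖) ≤ B x) :
    ‖W (c + b * v) z - W (c + a * v) z‖ ≤ ∫ x in a..b, B x := by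
  set G : ℝ → ι → ℂ := fun x =>
    v • (deriv p (c + x * v) • V.ker (z - p (c + x * v)) (φ (c + x * v))) with hG
  have hd : ∀ x ∈ Set.uIcc a b, HasDerivAt (fun x : ℝ => W (c + x * v) z) (G x) x := by
    intro x hx
    rw [Set.uIcc_of_le hab] at hx
    have hl : HasDerivAt (fun x : ℝ => c + (x : ℂ) * v) v x := by
      have := ((Complex.ofRealCLM.hasDerivAt (x := x)).mul_const v).const_add c
      simpa using this
    exact (h.hasDeriv _ (hmem x hx) z).scomp x hl
  have hline : Continuous fun x : ℝ => c + (x : ℂ) * v := by fun_prop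
  have hGc : ContinuousOn G (Set.uIcc a b) := by
    rw [Set.uIcc_of_le hab]
    have h1 : Continuous fun x : ℝ => deriv p (c + x * v) :=
      (differentiable_deriv_of_entire hp).continuous.comp hline
    have h2 : Continuous fun x : ℝ => V.ker (z - p (c + x * v)) :=
      V.ker_diff.continuous.comp (continuous_const.sub (hp.continuous.comp hline))
    have h3 : ContinuousOn (fun x : ℝ => φ (c + x * v)) (Set.Icc a b) :=
      h.diff.continuousOn.comp hline.continuousOn hmem
    exact (h1.continuousOn.smul (h2.continuousOn.clm_apply h3)).const_smul v
  have := intervalIntegral.integral_eq_sub_of_hasDerivAt hd hGc.intervalIntegrable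
  rw [← this]
  refine intervalIntegral.norm_integral_le_of_norm_le hab ?_ ?_
  · refine Filter.Eventually.of_forall fun x hx => ?_
    refine le_trans (le_of_eq ?_) (hle x ⟨hx.1.le, hx.2⟩)
    rw [hG, norm_smul, norm_smul]
  · refine ContinuousOn.intervalIntegrable ?_
    rwa [Set.uIcc_of_le hab]

lemma apply_eq (h : IsSol V p U φ W) (hs : ∀ t ∈ U, ∀ i, p t ≠ V.sing i) {t : ℂ} (ht : t ∈ U) :
    φ t = invFactor V p t * W t (p t) := by
  funext i
  rw [Pi.mul_apply, ← h.eq t ht i, invFactor,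
    inv_mul_cancel_left₀ (sub_ne_zero.2 (hs t ht i))]

/-- A solution without history vanishes. -/
lemma eq_zero (h : IsSol V p U φ W) (hp : Differentiable ℂ p) (hU : Convex ℝ U)
    (hs : ∀ t ∈ U, ∀ i, p t ≠ V.sing i) {c : ℂ} (hc : c ∈ U) (hW : W c = 0) :
    ∀ t ∈ U, φ t = 0 ∧ W t = 0 := by
  have hφ0 : ∀ t ∈ U, φ t = 0 := by
    intro t ht
    obtain ⟨C, A, hC, hA, hker⟩ := V.ker_bound
    have hmem : ∀ x ∈ Set.Icc (0 : ℝ) 1, c + x * (t - c) ∈ U := fun x hx =>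
      segment_mem hU hc ht hx.1 hx.2
    obtain ⟨m, hm⟩ := isCompact_Icc.exists_bound_of_continuousOn
      (segment_continuousOn hU hc (invFactor_differentiableOn V hp hs).continuousOn ht)
    obtain ⟨P, hP⟩ := isCompact_Icc.exists_bound_of_continuousOn
      (segment_continuousOn hU hc hp.continuous.continuousOn ht)
    obtain ⟨P', hP'⟩ := isCompact_Icc.exists_bound_of_continuousOn
      (segment_continuousOn hU hc (differentiable_deriv_of_entire hp).continuous.continuousOn ht)
    have hm0 : 0 ≤ m := (norm_nonneg _).trans (hm 0 (by simp))
    have hP0 : 0 ≤ P' := (norm_nonneg _).trans (hP' 0 (by simp))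
    have hφc := segment_continuousOn hU hc h.diff.continuousOn ht
    set L := m * (‖t - c‖ * (P' * (C * Real.exp (A * (P + P))))) with hL
    have hL0 : 0 ≤ L := by positivity
    -- As `W c = 0`, the solution at each point of the segment is bounded by the integral of its own
    -- past alone: the additive constant in Grönwall's inequality is zero.
    have key := gronwall_integral (u := fun x => ‖φ (c + x * (t - c))‖) (k := fun _ => L)
      (Q := fun x => L * x) (K := 0) (a := 0) (b := 1) hφc.norm continuousOn_const
      (fun _ _ => hL0) (fun x => by simpa using (hasDerivAt_id x).const_mul L) ?_ 1 (by simp)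
    · have : ‖φ t‖ ≤ 0 := by simpa using key
      simpa using this
    intro x hx
    have hxI : ∀ y ∈ Set.Icc (0 : ℝ) x, y ∈ Set.Icc (0 : ℝ) 1 := fun y hy =>
      ⟨hy.1, hy.2.trans hx.2⟩
    have hb := h.norm_sub_le_integral hp (c := c) (v := t - c) hx.1 (fun y hy => hmem y (hxI y hy))
      (p (c + x * (t - c)))
      (B := fun y => ‖t - c‖ * (P' * (C * Real.exp (A * (P + P)) * ‖φ (c + y * (t - c))‖)))
      (by
        refine continuousOn_const.mul (continuousOn_const.mul (continuousOn_const.mul ?_))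
        exact hφc.norm.mono hxI)
      (fun y hy => by
        have hy' := hxI y hy
        gcongr
        · exact hP' y hy'
        · refine (hker _ _).trans ?_
          gcongr
          exact (norm_sub_le _ _).trans (add_le_add (hP x hx) (hP y hy')))
    rw [h.apply_eq hs (hmem x hx), zero_add]
    refine (norm_mul_le _ _).trans ?_
    simp only [Complex.ofReal_zero, zero_mul, add_zero, hW, Pi.zero_apply, sub_zero] at hb
    refine (mul_le_mul (hm x hx) hb (norm_nonneg _) hm0).trans (le_of_eq ?_)
    rw [← intervalIntegral.integral_const_mul]
    congr 1
    funext y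
    rw [hL]
    ring
  refine fun t ht => ⟨hφ0 t ht, ?_⟩
  funext z
  have hb := h.norm_sub_le_integral hp (c := c) (v := t - c) zero_le_one
    (fun y hy => segment_mem hU hc ht hy.1 hy.2) z (B := fun _ => 0) continuousOn_const
    (fun y hy => by
      rw [hφ0 _ (segment_mem hU hc ht hy.1 hy.2)]
      simp)
  simpa [hW] using hb

/-- Uniqueness of solutions on convex sets. -/
theorem unique (h₁ : IsSol V p U φ₁ W₁) (h₂ : IsSol V p U φ₂ W₂) (hp : Differentiable ℂ p)
    (hU : Convex ℝ U) (hs : ∀ t ∈ U, ∀ i, p t ≠ V.sing i) {c : ℂ} (hc : c ∈ U)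
    (hW : W₁ c = W₂ c) : ∀ t ∈ U, φ₁ t = φ₂ t ∧ W₁ t = W₂ t := by
  intro t ht
  have := (h₁.sub h₂).eq_zero hp hU hs hc (by rw [hW]; funext z; simp) t ht
  refine ⟨sub_eq_zero.1 this.1, ?_⟩
  funext z
  exact sub_eq_zero.1 (congrFun this.2 z)

/-- A uniform exponential bound for the history on compact convex sets. -/
lemma expType_uniform (h : IsSol V p U φ W) (hp : Differentiable ℂ p) {K : Set ℂ}
    (hK : IsCompact K) (hKc : Convex ℝ K) (hKU : K ⊆ U) :
    ∃ C A : ℝ, 0 ≤ C ∧ 0 ≤ A ∧ ∀ t ∈ K, ∀ z, ‖W t z‖ ≤ C * Real.exp (A * ‖z‖) := by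
  rcases K.eq_empty_or_nonempty with rfl | ⟨c, hc⟩
  · exact ⟨0, 0, le_rfl, le_rfl, by simp⟩
  obtain ⟨C₀, A₀, hC₀, hA₀, h₀⟩ := h.expType c (hKU hc)
  obtain ⟨C, A, hC, hA, hker⟩ := V.ker_bound
  obtain ⟨P, hP⟩ := hK.exists_bound_of_continuousOn hp.continuous.continuousOn
  obtain ⟨P', hP'⟩ := hK.exists_bound_of_continuousOn
    (differentiable_deriv_of_entire hp).continuous.continuousOn
  obtain ⟨B, hB⟩ := hK.exists_bound_of_continuousOn (h.diff.continuousOn.mono hKU)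
  obtain ⟨R, hR⟩ := hK.exists_bound_of_continuousOn
    (continuous_id.sub continuous_const : Continuous fun t : ℂ => t - c).continuousOn
  have hP0 : 0 ≤ P' := (norm_nonneg _).trans (hP' c hc)
  have hB0 : 0 ≤ B := (norm_nonneg _).trans (hB c hc)
  have hR0 : 0 ≤ R := (norm_nonneg _).trans (hR c hc)
  refine ⟨C₀ + R * (P' * (C * Real.exp (A * P) * B)), max A₀ A, by positivity,
    le_max_of_le_left hA₀, fun t ht z => ?_⟩
  have hb := h.norm_sub_le_integral hp (c := c) (v := t - c) zero_le_one
    (fun y hy => hKU (segment_mem hKc hc ht hy.1 hy.2)) z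
    (B := fun _ => R * (P' * (C * Real.exp (A * P) * B)) * Real.exp (A * ‖z‖)) continuousOn_const
    (fun y hy => by
      have hy' := segment_mem hKc hc ht hy.1 hy.2
      calc _ ≤ R * (P' * (C * Real.exp (A * (‖z‖ + P)) * B)) := by
            refine mul_le_mul (hR t ht) (mul_le_mul (hP' _ hy') ((hker _ _).trans ?_)
              (norm_nonneg _) hP0) (by positivity) hR0
            gcongr
            · exact (norm_sub_le _ _).trans (by gcongr; exact hP _ hy')
            · exact hB _ hy'
        _ = _ := by rw [mul_add, Real.exp_add]; ring)
  simp only [Complex.ofReal_one, one_mul, add_sub_cancel, Complex.ofReal_zero, zero_mul, add_zero,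
    intervalIntegral.integral_const, sub_zero, smul_eq_mul] at hb
  calc ‖W t z‖ = ‖W c z + (W t z - W c z)‖ := by congr 1; abel
    _ ≤ C₀ * Real.exp (A₀ * ‖z‖) + R * (P' * (C * Real.exp (A * P) * B)) * Real.exp (A * ‖z‖) :=
        (norm_add_le _ _).trans (add_le_add (h₀ z) hb)
    _ ≤ _ := by
        rw [add_mul]
        gcongr
        · exact le_max_left _ _
        · exact le_max_right _ _

/-- The derivative of `t ↦ (p t - sᵢ) φᵢ(t)`. -/
lemma hasDerivAt_history (h : IsSol V p U φ W) (hp : Differentiable ℂ p) (hUo : IsOpen U) {t : ℂ}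
    (ht : t ∈ U) : HasDerivAt (fun t => W t (p t))
      (deriv p t • (V.ker 0 (φ t) + deriv (W t) (p t))) t := by
  have hφc : ContinuousAt φ t := (h.diff.differentiableAt (hUo.mem_nhds ht)).continuousAt
  have h1 : ContinuousAt (fun x : ℂ × ℂ => φ x.1) (t, p t) :=
    ContinuousAt.comp (f := Prod.fst) (x := (t, p t)) hφc continuousAt_fst
  have h2 : Continuous fun x : ℂ × ℂ => V.ker (x.2 - p x.1) :=
    V.ker_diff.continuous.comp (continuous_snd.sub (hp.continuous.comp continuous_fst))
  have h3 : Continuous fun x : ℂ × ℂ => deriv p x.1 :=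
    (differentiable_deriv_of_entire hp).continuous.comp continuous_fst
  refine (hasDerivAt_diagonal hUo hp ht (h.entire t ht)
    (G := fun t z => deriv p t • V.ker (z - p t) (φ t)) (fun τ hτ z => h.hasDeriv τ hτ z)
    (h3.continuousAt.smul (h2.continuousAt.clm_apply h1))).congr_deriv ?_
  rw [sub_self, smul_add]

end IsSol

/-! ### Growth at infinity -/

lemma convex_logSector (ρ α β : ℝ) : Convex ℝ (logSector ρ α β) := by
  have : logSector ρ α β = {t : ℂ | ρ < t.re} ∩ ({t : ℂ | α < t.im} ∩ {t : ℂ | t.im < β}) := by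
    ext t; simp [logSector]
  rw [this]
  exact (convex_halfSpace_re_gt ρ).inter ((convex_halfSpace_im_gt α).inter
    (convex_halfSpace_im_lt β))

lemma isOpen_logSector (ρ α β : ℝ) : IsOpen (logSector ρ α β) := by
  have : logSector ρ α β = {t : ℂ | ρ < t.re} ∩ ({t : ℂ | α < t.im} ∩ {t : ℂ | t.im < β}) := by
    ext t; simp [logSector]
  rw [this]
  exact (isOpen_lt continuous_const Complex.continuous_re).inter
    ((isOpen_lt continuous_const Complex.continuous_im).inter
      (isOpen_lt Complex.continuous_im continuous_const))

lemma differentiable_add_exp (ω : ℂ) : Differentiable ℂ fun t => ω + exp t :=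
  Complex.differentiable_exp.const_add ω

lemma deriv_add_exp (ω t : ℂ) : deriv (fun t => ω + exp t) t = exp t := by
  simp

/-- On a ray from the origin the distance of two points is the difference of their moduli. This lets
the exponential bound of the kernel split into a quotient of weights. -/
lemma norm_exp_sub_exp_of_le {x s y : ℝ} (h : s ≤ x) :
    ‖exp (x + y * I) - exp (s + y * I)‖ = Real.exp x - Real.exp s := by
  rw [Complex.exp_add, Complex.exp_add, ← sub_mul, norm_mul, Complex.norm_exp_ofReal_mul_I,
    mul_one, ← Complex.ofReal_exp, ← Complex.ofReal_exp, ← Complex.ofReal_sub, Complex.norm_real,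
    Real.norm_of_nonneg (sub_nonneg.2 (Real.exp_le_exp.2 h))]

/-- The growth of solutions on a sector far away from the singular points. -/
lemma IsSol.growth_far {V : VolterraData ι} {ω : ℂ} {φ : ℂ → ι → ℂ} {W : ℂ → ℂ → ι → ℂ}
    {ρ α β : ℝ} (h : IsSol V (fun t => ω + exp t) (logSector ρ (α - 1) (β + 1)) φ W)
    (hfar : ∀ t ∈ logSector ρ (α - 1) (β + 1), ∀ i, 1 ≤ ‖ω + exp t - V.sing i‖) :
    ∃ C A M : ℝ, ∀ t : ℂ, α < t.im → t.im < β → M ≤ t.re →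
      ‖φ t‖ ≤ C * Real.exp (A * Real.exp t.re) := by
  have hp := differentiable_add_exp ω
  obtain ⟨C, A₁, hC, hA₁, hker₁⟩ := V.ker_bound
  set x₁ := ρ + 1 with hx₁
  -- The sector of the solution is wider by `1` on both sides, so the closed initial arc is a
  -- compact part of it and the histories there have a common exponential bound.
  have hK : IsCompact ({x₁} ×ℂ Set.Icc α β) := isCompact_singleton.reProdIm isCompact_Icc
  have hKc : Convex ℝ ({x₁} ×ℂ Set.Icc α β) :=
    ((convex_singleton x₁).linear_preimage Complex.reLm).inter
      ((convex_Icc α β).linear_preimage Complex.imLm)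
  have hKU : ({x₁} ×ℂ Set.Icc α β) ⊆ logSector ρ (α - 1) (β + 1) := by
    intro t ht
    obtain ⟨h1, h2⟩ := Complex.mem_reProdIm.1 ht
    refine ⟨?_, ?_, ?_⟩
    · rw [Set.mem_singleton_iff.1 h1, hx₁]; linarith
    · linarith [h2.1]
    · linarith [h2.2]
  obtain ⟨C₀, A₀, hC₀, hA₀, h₀⟩ := h.expType_uniform hp hK hKc hKU
  set A := max A₀ A₁ with hA
  have hA0 : 0 ≤ A := le_max_of_le_left hA₀
  refine ⟨C₀ * Real.exp (A * ‖ω‖) * Real.exp (-(C * Real.exp x₁)), C + A, x₁,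
    fun t hα hβ hM => ?_⟩
  have hmem : ∀ x ∈ Set.Icc x₁ t.re, (t.im * I + x * 1 : ℂ) ∈ logSector ρ (α - 1) (β + 1) := by
    intro x hx
    refine ⟨?_, ?_, ?_⟩
    · simp; linarith [hx.1]
    · simp; linarith
    · simp; linarith
  have hφc : ContinuousOn (fun x : ℝ => φ (t.im * I + x * 1)) (Set.Icc x₁ t.re) :=
    h.diff.continuousOn.comp (by fun_prop) hmem
  have hexp : ∀ x : ℝ, exp (t.im * I + x * 1) = exp (x + t.im * I) := fun x => by
    congr 1; ring
  have hre : ∀ x : ℝ, ‖exp (t.im * I + x * 1)‖ = Real.exp x := fun x => by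
    rw [Complex.norm_exp]; simp
  -- Along a ray the kernel is at most `C e^{A (e^x - e^y)}`. With the weight `e^{-A e^x}` this
  -- becomes the constant `C`, and the Jacobian turns it into `C e^y`, the derivative of `C e^y`
  -- itself.
  have key := gronwall_integral
    (u := fun x => ‖φ (t.im * I + x * 1)‖ * Real.exp (-(A * Real.exp x)))
    (k := fun x => C * Real.exp x) (Q := fun x => C * Real.exp x)
    (K := C₀ * Real.exp (A * ‖ω‖)) (a := x₁) (b := t.re)
    (hφc.norm.mul (by fun_prop)) (by fun_prop) (fun x _ => by positivity)
    (fun x => (Real.hasDerivAt_exp x).const_mul C) ?_ t.re ⟨hM, le_rfl⟩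
  · have e : (t.im * I + t.re * 1 : ℂ) = t := by
      rw [mul_one, add_comm, Complex.re_add_im]
    rw [e] at key
    calc ‖φ t‖ = ‖φ t‖ * Real.exp (-(A * Real.exp t.re)) * Real.exp (A * Real.exp t.re) := by
          rw [mul_assoc, ← Real.exp_add]; simp
      _ ≤ C₀ * Real.exp (A * ‖ω‖) * Real.exp (C * Real.exp t.re - C * Real.exp x₁) *
          Real.exp (A * Real.exp t.re) := by gcongr
      _ = _ := by
          rw [add_mul C A, Real.exp_add (C * _) (A * _), sub_eq_add_neg,
            Real.exp_add (C * _) (-(C * _))]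
          ring
  intro x hx
  have hxI : ∀ y ∈ Set.Icc x₁ x, y ∈ Set.Icc x₁ t.re := fun y hy => ⟨hy.1, hy.2.trans hx.2⟩
  set z := ω + exp (t.im * I + x * 1) with hz
  have hzn : ‖z‖ ≤ ‖ω‖ + Real.exp x := (norm_add_le _ _).trans (by rw [hre])
  have hb := h.norm_sub_le_integral hp (c := t.im * I) (v := 1) hx.1
    (fun y hy => hmem y (hxI y hy)) z
    (B := fun y => Real.exp (A * Real.exp x) * (C * Real.exp y *
      (‖φ (t.im * I + y * 1)‖ * Real.exp (-(A * Real.exp y)))))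
    (by
      refine continuousOn_const.mul (ContinuousOn.mul (by fun_prop) (ContinuousOn.mul ?_
        (by fun_prop)))
      exact hφc.norm.mono hxI)
    (fun y hy => by
      rw [deriv_add_exp, hre, norm_one, one_mul]
      have hzy : ‖z - (ω + exp (t.im * I + y * 1))‖ = Real.exp x - Real.exp y := by
        rw [hz, add_sub_add_left_eq_sub, hexp, hexp, norm_exp_sub_exp_of_le hy.2]
      have hxy : 0 ≤ Real.exp x - Real.exp y := sub_nonneg.2 (Real.exp_le_exp.2 hy.2)
      calc _ ≤ Real.exp y * (C * Real.exp (A * (Real.exp x - Real.exp y)) *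
              ‖φ (t.im * I + y * 1)‖) := by
            refine mul_le_mul_of_nonneg_left ((hker₁ _ _).trans ?_) (Real.exp_pos _).le
            rw [hzy]
            gcongr
            exact le_max_right _ _
        _ = _ := by rw [mul_sub, sub_eq_add_neg, Real.exp_add]; ring)
  have hφle : ‖φ (t.im * I + x * 1)‖ ≤ ‖W (t.im * I + x * 1) z‖ := by
    refine (pi_norm_le_iff_of_nonneg (norm_nonneg _)).2 fun i => ?_
    refine le_trans ?_ (norm_le_pi_norm _ i)
    rw [← h.eq _ (hmem x hx) i, norm_mul]
    exact le_mul_of_one_le_left (norm_nonneg _) (hfar _ (hmem x hx) i)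
  have hW0 : ‖W (t.im * I + x₁ * 1) z‖ ≤ C₀ * Real.exp (A * ‖ω‖) * Real.exp (A * Real.exp x) := by
    refine (h₀ _ ?_ z).trans ?_
    · rw [Complex.mem_reProdIm]
      simp [hα.le, hβ.le]
    · rw [mul_assoc, ← Real.exp_add, ← mul_add]
      gcongr
      exact le_max_left _ _
  have htot : ‖φ (t.im * I + x * 1)‖ ≤ C₀ * Real.exp (A * ‖ω‖) * Real.exp (A * Real.exp x) +
      Real.exp (A * Real.exp x) * ∫ y in x₁..x, C * Real.exp y *
      (‖φ (t.im * I + y * 1)‖ * Real.exp (-(A * Real.exp y))) := by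
    rw [← intervalIntegral.integral_const_mul]
    calc _ ≤ ‖W (t.im * I + x * 1) z‖ := hφle
      _ = ‖W (t.im * I + x₁ * 1) z + (W (t.im * I + x * 1) z - W (t.im * I + x₁ * 1) z)‖ := by
          congr 1; abel
      _ ≤ _ := (norm_add_le _ _).trans (add_le_add hW0 hb)
  calc _ ≤ (C₀ * Real.exp (A * ‖ω‖) * Real.exp (A * Real.exp x) +
      Real.exp (A * Real.exp x) * ∫ y in x₁..x, C * Real.exp y *
      (‖φ (t.im * I + y * 1)‖ * Real.exp (-(A * Real.exp y)))) * Real.exp (-(A * Real.exp x)) :=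
        mul_le_mul_of_nonneg_right htot (Real.exp_pos _).le
    _ = _ := by
        have : Real.exp (A * Real.exp x) * Real.exp (-(A * Real.exp x)) = 1 := by
          rw [← Real.exp_add]; simp
        linear_combination (C₀ * Real.exp (A * ‖ω‖) + ∫ y in x₁..x, C * Real.exp y *
          (‖φ (t.im * I + y * 1)‖ * Real.exp (-(A * Real.exp y)))) * this

/-- Solutions on a sector grow at most exponentially. -/
theorem IsSol.growth {V : VolterraData ι} {ω : ℂ} {φ : ℂ → ι → ℂ} {W : ℂ → ℂ → ι → ℂ}
    {ρ α β : ℝ} (h : IsSol V (fun t => ω + exp t) (logSector ρ α β) φ W) :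
    ∃ C A M : ℝ, ∀ t ∈ logSector ρ α β, M ≤ t.re →
      ‖φ t‖ ≤ C * Real.exp (A * Real.exp t.re) := by
  rcases (logSector ρ α β).eq_empty_or_nonempty with he | ⟨t₀, ht₀⟩
  · exact ⟨0, 0, 0, by simp [he]⟩
  have hp := differentiable_add_exp ω
  set R := ‖ω‖ + ∑ i, ‖V.sing i‖ + 1 with hR
  have hR0 : 0 < R := by positivity
  set ρ' := max (max ρ t₀.re) (Real.log R) with hρ'
  have hfar : ∀ t ∈ logSector ρ' (α - 1) (β + 1), ∀ i, 1 ≤ ‖ω + exp t - V.sing i‖ := by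
    intro t ht i
    have h1 : R ≤ ‖exp t‖ := by
      rw [Complex.norm_exp, ← Real.log_le_iff_le_exp hR0]
      exact (le_max_right _ _).trans ht.1.le
    have h2 : ‖V.sing i‖ ≤ ∑ i, ‖V.sing i‖ :=
      Finset.single_le_sum (f := fun i => ‖V.sing i‖) (fun _ _ => norm_nonneg _)
        (Finset.mem_univ i)
    have h3 : ‖exp t‖ ≤ ‖ω + exp t - V.sing i‖ + ‖ω‖ + ‖V.sing i‖ := by
      calc ‖exp t‖ = ‖(ω + exp t - V.sing i) - ω + V.sing i‖ := by congr 1; ring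
        _ ≤ _ := (norm_add_le _ _).trans (by gcongr; exact norm_sub_le _ _)
    linarith
  have hs : ∀ t ∈ logSector ρ' (α - 1) (β + 1), ∀ i, ω + exp t ≠ V.sing i := by
    intro t ht i he
    have := hfar t ht i
    rw [he, sub_self, norm_zero] at this
    linarith
  set t₁ : ℂ := ⟨ρ' + 1, t₀.im⟩ with ht₁
  have hρ : ρ ≤ ρ' := (le_max_left _ _).trans (le_max_left _ _)
  have ht₁U : t₁ ∈ logSector ρ α β := ⟨by simp [ht₁]; linarith, ht₀.2.1, ht₀.2.2⟩
  have ht₁U' : t₁ ∈ logSector ρ' (α - 1) (β + 1) :=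
    ⟨by simp [ht₁], by simp [ht₁]; linarith [ht₀.2.1], by simp [ht₁]; linarith [ht₀.2.2]⟩
  -- The given solution is not controlled near the sides of its sector. It is solved again, from its
  -- history at `t₁`, on a wider sector far from the singular points; uniqueness identifies both on
  -- the intersection.
  obtain ⟨φ', W', h', hW'⟩ := exists_isSol V hp (convex_logSector ρ' (α - 1) (β + 1))
    (isOpen_logSector _ _ _) ht₁U' hs (h.entire t₁ ht₁U) (h.expType t₁ ht₁U)
  obtain ⟨C, A, M, hb⟩ := h'.growth_far hfar
  refine ⟨C, A, max M (ρ' + 1), fun t ht hM => ?_⟩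
  have htU' : t ∈ logSector ρ' (α - 1) (β + 1) :=
    ⟨by linarith [(le_max_right _ _).trans hM], by linarith [ht.2.1], by linarith [ht.2.2]⟩
  have := (h.mono Set.inter_subset_left).unique (h'.mono Set.inter_subset_right) hp
    ((convex_logSector ρ α β).inter (convex_logSector ρ' (α - 1) (β + 1)))
    (fun t ht => hs t ht.2) ⟨ht₁U, ht₁U'⟩ hW'.symm t ⟨ht, htU'⟩
  rw [this.1]
  exact hb t ht.2.1 ht.2.2 ((le_max_left _ _).trans hM)

end LevelOne

end

noncomputable section

namespace LevelOne

variable {ι : Type*} [Fintype ι]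

/-! ### Analytic continuation along paths -/

/-- Two functions analytic on a ball that agree near one of its points agree on the ball. -/
lemma eqOn_ball_of_eventuallyEq {F : Type*} [NormedAddCommGroup F] [NormedSpace ℂ F]
    [CompleteSpace F] {f g : ℂ → F} {z w : ℂ} {r : ℝ}
    (hf : DifferentiableOn ℂ f (Metric.ball z r)) (hg : DifferentiableOn ℂ g (Metric.ball z r))
    (hw : w ∈ Metric.ball z r) (h : f =ᶠ[𝓝 w] g) : Set.EqOn f g (Metric.ball z r) :=
  (hf.analyticOnNhd Metric.isOpen_ball).eqOn_of_preconnected_of_eventuallyEq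
    (hg.analyticOnNhd Metric.isOpen_ball) (convex_ball z r).isPreconnected hw h

lemma AnalyticAt.exists_differentiableOn_ball {F : Type*} [NormedAddCommGroup F] [NormedSpace ℂ F]
    [CompleteSpace F] {f : ℂ → F} {z : ℂ} (hf : AnalyticAt ℂ f z) :
    ∃ r > 0, DifferentiableOn ℂ f (Metric.ball z r) := by
  obtain ⟨r, hr, h⟩ := Metric.eventually_nhds_iff_ball.1 hf.eventually_analyticAt
  exact ⟨r, hr, fun w hw => (h w hw).differentiableAt.differentiableWithinAt⟩

/-- Uniqueness of analytic continuation along a path. -/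
theorem IsContinuationAlong.unique {f : ℂ → ℂ} {γ : C(unitInterval, ℂ)}
    {g g' : unitInterval → ℂ → ℂ} (h : IsContinuationAlong f γ g)
    (h' : IsContinuationAlong f γ g') (s : unitInterval) : g s =ᶠ[𝓝 (γ s)] g' s := by
  -- By the identity theorem on a ball around `γ s`, agreement of the two germs is a locally
  -- constant property of the parameter; the unit interval is connected.
  set A : Set unitInterval := {s | g s =ᶠ[𝓝 (γ s)] g' s} with hA
  have hnear : ∀ s, ∀ᶠ s' in 𝓝 s, (s' ∈ A ↔ s ∈ A) := by
    intro s
    obtain ⟨r, hr, hd⟩ := AnalyticAt.exists_differentiableOn_ball (h.analytic s)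
    obtain ⟨r', hr', hd'⟩ := AnalyticAt.exists_differentiableOn_ball (h'.analytic s)
    have hm : 0 < min r r' := lt_min hr hr'
    have hd1 := hd.mono (Metric.ball_subset_ball (min_le_left r r'))
    have hd2 := hd'.mono (Metric.ball_subset_ball (min_le_right r r'))
    filter_upwards [h.coherent s, h'.coherent s,
      γ.continuous.continuousAt.eventually (Metric.ball_mem_nhds (γ s) hm)] with s' h1 h2 h3
    constructor
    · intro hs'
      have : g s =ᶠ[𝓝 (γ s')] g' s := h1.symm.trans (EventuallyEq.trans hs' h2)
      exact (eqOn_ball_of_eventuallyEq hd1 hd2 h3 this).eventuallyEq_of_mem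
        (Metric.ball_mem_nhds _ hm)
    · intro hs
      have := (eqOn_ball_of_eventuallyEq hd1 hd2 (Metric.mem_ball_self hm) hs).eventuallyEq_of_mem
        (Metric.isOpen_ball.mem_nhds h3)
      exact h1.trans (this.trans h2.symm)
  have hclopen : IsClopen A := by
    constructor
    · rw [← isOpen_compl_iff, isOpen_iff_mem_nhds]
      intro s hs
      filter_upwards [hnear s] with s' h1
      exact fun h2 => hs (h1.1 h2)
    · rw [isOpen_iff_mem_nhds]
      intro s hs
      filter_upwards [hnear s] with s' h1
      exact h1.2 hs
  have h0 : (0 : unitInterval) ∈ A := h.start.trans h'.start.symm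
  have := (isClopen_iff.1 hclopen).resolve_left (fun h => by rw [h] at h0; exact h0)
  have hs : s ∈ A := this ▸ Set.mem_univ s
  exact hs

/-- Solutions of the Volterra equation continue along every path that avoids the singular
points. -/
theorem IsSol.exists_continuation {V : VolterraData ι} {p : ℂ → ℂ} (hp : Differentiable ℂ p)
    (τ : C(unitInterval, ℂ)) (hτ : ∀ s i, p (τ s) ≠ V.sing i) {U : Set ℂ} (hUo : IsOpen U)
    (hτ0 : τ 0 ∈ U) {φ : ℂ → ι → ℂ} {W : ℂ → ℂ → ι → ℂ} (h : IsSol V p U φ W) :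
    ∃ Φ : unitInterval → ℂ → ι → ℂ, Φ 0 =ᶠ[𝓝 (τ 0)] φ ∧
      (∀ s, ∃ U', IsOpen U' ∧ τ s ∈ U' ∧ ∃ W', IsSol V p U' (Φ s) W') ∧
      ∀ s, ∀ᶠ s' in 𝓝 s, Φ s' =ᶠ[𝓝 (τ s')] Φ s := by
  set Ω : Set ℂ := {t | ∀ i, p t ≠ V.sing i} with hΩ
  have hΩo : IsOpen Ω := by
    have : Ω = ⋂ i, {t | p t ≠ V.sing i} := by ext; simp [hΩ]
    rw [this]
    exact isOpen_iInter_of_finite fun i => isOpen_ne_fun hp.continuous continuous_const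
  obtain ⟨ε, hε, hεΩ⟩ := (isCompact_range τ.continuous).exists_thickening_subset_open hΩo
    (by rintro _ ⟨s, rfl⟩; exact hτ s)
  have hball : ∀ s, Metric.ball (τ s) ε ⊆ Ω := fun s =>
    (Metric.ball_subset_thickening (Set.mem_range_self s) ε).trans hεΩ
  set q : ℝ → ℂ := fun x => τ (Set.projIcc 0 1 zero_le_one x) with hq
  obtain ⟨δ, hδ, hδε⟩ := Metric.uniformContinuous_iff.1
    (CompactSpace.uniformContinuous_of_continuous τ.continuous) ε hε
  have hqd : ∀ x y : ℝ, |x - y| < δ → dist (q x) (q y) < ε := fun x y hxy =>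
    hδε (lt_of_le_of_lt (by
      rw [Subtype.dist_eq, Real.dist_eq]
      exact Set.abs_projIcc_sub_projIcc zero_le_one) hxy)
  -- With `2 / N < δ`, a point of the path lies in the ball of its own node and also in the balls of
  -- nodes at parameter distance below `2 / N`.
  obtain ⟨N, hN⟩ := exists_nat_gt (2 / δ)
  have hN0 : (0 : ℝ) < N := lt_trans (by positivity) hN
  have hNδ : 2 / (N : ℝ) < δ := by
    rw [div_lt_iff₀ hN0]
    rw [div_lt_iff₀ hδ] at hN
    linarith
  have hqball : ∀ x : ℝ, ∀ t ∈ Metric.ball (q x) ε, ∀ i, p t ≠ V.sing i := fun x t ht =>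
    hball _ ht
  -- the chain of solutions on balls
  have hstep : ∀ (m : ℕ) (w : ℂ → ι → ℂ), Differentiable ℂ w → ExpType w →
      ∃ φ W, IsSol V p (Metric.ball (q (m / N)) ε) φ W ∧ W (q (m / N)) = w := fun m w hw hw' =>
    exists_isSol V hp (convex_ball _ _) Metric.isOpen_ball (Metric.mem_ball_self hε)
      (hqball _) hw hw'
  let P : ℕ → (ℂ → ι → ℂ) × (ℂ → ℂ → ι → ℂ) → Prop := fun m x =>
    IsSol V p (Metric.ball (q (m / N)) ε) x.1 x.2
  have hq01 : ∀ m : ℕ, q ((m + 1 : ℕ) / N) ∈ Metric.ball (q (m / N)) ε := by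
    intro m
    refine Metric.mem_ball.2 (hqd _ _ ?_)
    rw [← sub_div, abs_div, abs_of_pos hN0]
    push_cast
    rw [add_sub_cancel_left, abs_one]
    exact lt_of_le_of_lt (by gcongr; norm_num) hNδ
  have hchain : ∃ x : ℕ → (ℂ → ι → ℂ) × (ℂ → ℂ → ι → ℂ), (∀ m, P m (x m)) ∧
      (x 0).2 (q 0) = W (q 0) ∧
      ∀ m, (x (m + 1)).2 (q ((m + 1 : ℕ) / N)) = (x m).2 (q ((m + 1 : ℕ) / N)) := by
    have hq0 : q 0 = τ 0 := by simp [hq]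
    obtain ⟨φ₀, W₀, h₀, hW₀⟩ := hstep 0 (W (τ 0)) (h.entire _ hτ0) (h.expType _ hτ0)
    -- The history reached at the next centre becomes the initial history there; this is all that
    -- the continuation has to remember of the path.
    have hex : ∀ m : ℕ, ∀ x : {x // P m x}, ∃ y : {y // P (m + 1) y},
        y.1.2 (q ((m + 1 : ℕ) / N)) = x.1.2 (q ((m + 1 : ℕ) / N)) := by
      rintro m ⟨x, hx⟩
      obtain ⟨φ', W', h', hW'⟩ := hstep (m + 1) (x.2 (q ((m + 1 : ℕ) / N)))
        (hx.entire _ (hq01 m)) (hx.expType _ (hq01 m))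
      exact ⟨⟨(φ', W'), h'⟩, hW'⟩
    choose F hF using hex
    let x : ∀ m, {x // P m x} := fun m => Nat.rec ⟨(φ₀, W₀), h₀⟩ (fun m y => F m y) m
    refine ⟨fun m => (x m).1, fun m => (x m).2, ?_, fun m => hF m (x m)⟩
    have : (x 0).1.2 = W₀ := rfl
    simpa [hq0, this] using hW₀
  obtain ⟨x, hx, hx0, hxs⟩ := hchain
  have hagree : ∀ m, Set.EqOn (x (m + 1)).1 (x m).1
      (Metric.ball (q ((m + 1 : ℕ) / N)) ε ∩ Metric.ball (q (m / N)) ε) := fun m t ht =>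
    (((hx (m + 1)).mono Set.inter_subset_left).unique ((hx m).mono Set.inter_subset_right) hp
      ((convex_ball _ _).inter (convex_ball _ _)) (fun t ht => hqball _ t ht.1)
      ⟨Metric.mem_ball_self hε, hq01 m⟩ (hxs m) t ht).1
  -- At the parameter `s` the solution on the ball of the node just before `s` is used. Parameters
  -- closer than `1 / N` have node indices that differ by at most one.
  set k : unitInterval → ℕ := fun s => ⌊(N : ℝ) * s⌋₊ with hk
  have hkle : ∀ s : unitInterval, (k s : ℝ) / N ≤ s := fun s => by
    rw [div_le_iff₀ hN0, mul_comm]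
    exact Nat.floor_le (mul_nonneg hN0.le s.2.1)
  have hklt : ∀ s : unitInterval, (s : ℝ) < k s / N + 1 / N := fun s => by
    rw [← add_div, lt_div_iff₀ hN0, mul_comm]
    exact Nat.lt_floor_add_one _
  have hqs : ∀ s : unitInterval, q s = τ s := fun s => by simp [hq]
  have hmem2 : ∀ (s : unitInterval) (m : ℕ), |(s : ℝ) - m / N| < 2 / N →
      τ s ∈ Metric.ball (q (m / N)) ε := fun s m hsm => by
    rw [← hqs]
    exact Metric.mem_ball.2 (hqd _ _ (hsm.trans hNδ))
  have hinv : (2 : ℝ) / N = 1 / N + 1 / N := by ring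
  have hinv0 : (0 : ℝ) < 1 / N := by positivity
  have hmem1 : ∀ s : unitInterval, τ s ∈ Metric.ball (q (k s / N)) ε := fun s =>
    hmem2 s (k s) (by
      rw [abs_of_nonneg (sub_nonneg.2 (hkle s))]
      linarith [hklt s])
  refine ⟨fun s => (x (k s)).1, ?_, fun s => ⟨_, Metric.isOpen_ball, hmem1 s, _, hx (k s)⟩, ?_⟩
  · have hk0 : k 0 = 0 := by simp [hk]
    have hq0 : q 0 = τ 0 := by simp [hq]
    simp only [hk0]
    obtain ⟨r, hr, hrU⟩ := Metric.isOpen_iff.1 (hUo.inter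
      (Metric.isOpen_ball (x := q ((0 : ℕ) / N)) (ε := ε))) (τ 0)
      ⟨hτ0, by simp [hq0, hε]⟩
    filter_upwards [Metric.ball_mem_nhds (τ 0) hr] with t ht
    refine (((hx 0).mono (fun t ht => (hrU ht).2)).unique (h.mono fun t ht => (hrU ht).1) hp
      (convex_ball (τ 0) r) (fun t ht => hqball _ t (hrU ht).2) (Metric.mem_ball_self hr)
      (by rw [← hq0]; exact hx0) t ht).1
  · intro s
    have : ∀ᶠ s' : unitInterval in 𝓝 s, |(s' : ℝ) - s| < 1 / N := by
      have hc : ContinuousAt (fun s' : unitInterval => |(s' : ℝ) - s|) s := by fun_prop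
      refine hc.eventually (Iio_mem_nhds ?_)
      simpa only [sub_self, abs_zero] using hinv0
    filter_upwards [this] with s' hs'
    rw [abs_lt] at hs'
    have h1 := hkle s
    have h2 := hklt s
    have h3 := hkle s'
    have h4 := hklt s'
    have hm : τ s' ∈ Metric.ball (q (k s / N)) ε := hmem2 s' (k s) (by
      rw [abs_lt]; constructor <;> linarith)
    have hd1 : k s' < k s + 2 := by
      have : (k s' : ℝ) / N < (k s + 2) / N := by
        rw [add_div]; linarith
      rw [div_lt_div_iff_of_pos_right hN0] at this
      exact_mod_cast this
    have hd2 : k s < k s' + 2 := by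
      have : (k s : ℝ) / N < (k s' + 2) / N := by
        rw [add_div]; linarith
      rw [div_lt_div_iff_of_pos_right hN0] at this
      exact_mod_cast this
    rcases (by omega : k s' = k s ∨ k s' = k s + 1 ∨ k s = k s' + 1) with he | he | he
    · rw [he]
    · rw [he]
      refine (hagree (k s)).eventuallyEq_of_mem
        ((Metric.isOpen_ball.inter Metric.isOpen_ball).mem_nhds ⟨?_, hm⟩)
      have := hmem1 s'
      rwa [he] at this
    · rw [he]
      refine ((hagree (k s')).eventuallyEq_of_mem
        ((Metric.isOpen_ball.inter Metric.isOpen_ball).mem_nhds ⟨?_, hmem1 s'⟩)).symm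
      rwa [he] at hm

/-- Change of coordinate in a solution. -/
lemma IsSol.comp {V : VolterraData ι} {U U' : Set ℂ} {φ : ℂ → ι → ℂ} {W : ℂ → ℂ → ι → ℂ}
    (h : IsSol V (fun z => z) U φ W) {p : ℂ → ℂ} (hp : Differentiable ℂ p)
    (hU' : Set.MapsTo p U' U) :
    IsSol V p U' (fun t => φ (p t)) (fun t => W (p t)) where
  diff := h.diff.comp hp.differentiableOn hU'
  entire t ht := h.entire _ (hU' ht)
  expType t ht := h.expType _ (hU' ht)
  hasDeriv t ht z := by
    have := (h.hasDeriv _ (hU' ht) z).scomp t (hp t).hasDerivAt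
    refine this.congr_deriv ?_
    simp
  eq t ht i := h.eq _ (hU' ht) i

end LevelOne

end

noncomputable section

namespace LevelOne

variable {ι : Type*} [Fintype ι]

/-! ### The branch to the right of a half line -/

/-- The open strip of width `2δ` to the right of the line of direction `e^{iθ}`. -/
def rightStrip (θ δ : ℝ) : Set ℂ := {z | -(2 * δ) < (z * exp (-(θ * I))).im ∧
  (z * exp (-(θ * I))).im < 0}

lemma continuous_rotate_im (θ : ℝ) : Continuous fun z : ℂ => (z * exp (-(θ * I))).im :=
  Complex.continuous_im.comp (continuous_id.mul continuous_const)

lemma isOpen_rightStrip (θ δ : ℝ) : IsOpen (rightStrip θ δ) :=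
  (isOpen_lt continuous_const (continuous_rotate_im θ)).inter
    (isOpen_lt (continuous_rotate_im θ) continuous_const)

lemma convex_rightStrip (θ δ : ℝ) : Convex ℝ (rightStrip θ δ) := by
  have hl : IsLinearMap ℝ fun z : ℂ => (z * exp (-(θ * I))).im :=
    ⟨fun x y => by simp [add_mul], fun c x => by simp [mul_assoc]⟩
  exact (convex_halfSpace_gt hl (-(2 * δ))).inter (convex_halfSpace_lt hl 0)

lemma rotate_mul_exp (w : ℂ) (θ : ℝ) : w * exp (θ * I) * exp (-(θ * I)) = w := by
  rw [mul_assoc, ← Complex.exp_add]; simp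

/-- `ψ` is, near `z`, the extension of the function `φ` given on the strip. -/
def ExtendsAt (B : Set ℂ) (φ ψ : ℂ → ι → ℂ) (z : ℂ) : Prop :=
  ∃ ρ > 0, DifferentiableOn ℂ ψ (Metric.ball z ρ) ∧ ∀ w ∈ Metric.ball z ρ ∩ B, ψ w = φ w

/-- Every ball around a point of the closure meets `B`, and two analytic functions that agree near
one point of a ball agree on all of it. Germs at points of the boundary of the strip thus fit
together without any further choice. -/
lemma ExtendsAt.unique {B : Set ℂ} (hB : IsOpen B) {φ ψ ψ' : ℂ → ι → ℂ} {z : ℂ}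
    (hz : z ∈ closure B) (h : ExtendsAt B φ ψ z) (h' : ExtendsAt B φ ψ' z) : ψ =ᶠ[𝓝 z] ψ' := by
  obtain ⟨ρ, hρ, hd, he⟩ := h
  obtain ⟨ρ', hρ', hd', he'⟩ := h'
  have hm : 0 < min ρ ρ' := lt_min hρ hρ'
  have hs := Metric.ball_subset_ball (x := z) (min_le_left ρ ρ')
  have hs' := Metric.ball_subset_ball (x := z) (min_le_right ρ ρ')
  obtain ⟨w, hw, hwB⟩ := mem_closure_iff_nhds.1 hz _ (Metric.ball_mem_nhds z hm)
  refine (eqOn_ball_of_eventuallyEq (hd.mono hs) (hd'.mono hs') hw ?_).eventuallyEq_of_mem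
    (Metric.ball_mem_nhds z hm)
  filter_upwards [(Metric.isOpen_ball.inter hB).mem_nhds ⟨hw, hwB⟩] with v hv
  rw [he v ⟨hs hv.1, hv.2⟩, he' v ⟨hs' hv.1, hv.2⟩]

omit [Fintype ι] in
lemma ExtendsAt.eventually {B : Set ℂ} {φ ψ : ℂ → ι → ℂ} {z : ℂ} (h : ExtendsAt B φ ψ z) :
    ∀ᶠ w in 𝓝 z, ExtendsAt B φ ψ w := by
  obtain ⟨ρ, hρ, hd, he⟩ := h
  filter_upwards [Metric.ball_mem_nhds z hρ] with w hw
  obtain ⟨ρ', hρ', hsub⟩ := Metric.isOpen_iff.1 Metric.isOpen_ball w hw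
  exact ⟨ρ', hρ', hd.mono hsub, fun v hv => he v ⟨hsub hv.1, hv.2⟩⟩

lemma ExtendsAt.analyticAt {B : Set ℂ} {φ ψ : ℂ → ι → ℂ} {z : ℂ} (h : ExtendsAt B φ ψ z) :
    AnalyticAt ℂ ψ z := by
  obtain ⟨ρ, hρ, hd, -⟩ := h
  exact hd.analyticAt (Metric.ball_mem_nhds z hρ)

/-- Near every non-singular point of its closure, a solution given on a strip extends. -/
lemma IsSol.exists_extendsAt {V : VolterraData ι} {B : Set ℂ} (hB : Convex ℝ B)
    {φ : ℂ → ι → ℂ} {W : ℂ → ℂ → ι → ℂ}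
    (h : IsSol V (fun z => z) B φ W) {z : ℂ} (hz : z ∈ closure B) (hs : ∀ i, z ≠ V.sing i) :
    ∃ ψ, ExtendsAt B φ ψ z := by
  have hΩo : IsOpen {z : ℂ | ∀ i, z ≠ V.sing i} := by
    have : {z : ℂ | ∀ i, z ≠ V.sing i} = ⋂ i, {z | z ≠ V.sing i} := by ext; simp
    rw [this]
    exact isOpen_iInter_of_finite fun i => isOpen_ne_fun continuous_id continuous_const
  obtain ⟨ρ, hρ, hsub⟩ := Metric.isOpen_iff.1 hΩo z hs
  obtain ⟨w, hw, hwB⟩ := mem_closure_iff_nhds.1 hz _ (Metric.ball_mem_nhds z hρ)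
  obtain ⟨ψ, W', h', hW'⟩ := exists_isSol V differentiable_id (convex_ball z ρ)
    Metric.isOpen_ball hw (fun t ht => hsub ht) (h.entire w hwB) (h.expType w hwB)
  refine ⟨ψ, ρ, hρ, h'.diff, fun v hv => ?_⟩
  exact ((h'.mono Set.inter_subset_left).unique (h.mono Set.inter_subset_right) differentiable_id
    ((convex_ball z ρ).inter hB) (fun t ht => hsub ht.1) ⟨hw, hwB⟩ hW' v hv).1

/-- The set of `t = ln ξ` with `|ξ| < δ`. -/
def logDisc (δ : ℝ) : Set ℂ := {t | Real.exp t.re < δ}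

lemma isOpen_logDisc (δ : ℝ) : IsOpen (logDisc δ) :=
  isOpen_lt (Real.continuous_exp.comp Complex.continuous_re) continuous_const

lemma convex_logDisc (δ : ℝ) : Convex ℝ (logDisc δ) := by
  by_cases hδ : 0 < δ
  · have : logDisc δ = {t : ℂ | t.re < Real.log δ} := by
      ext t; exact (Real.lt_log_iff_exp_lt hδ).symm
    rw [this]
    exact convex_halfSpace_re_lt _
  · have : logDisc δ = ∅ := by
      ext t
      simp only [logDisc, Set.mem_ofPred_eq, Set.mem_empty_iff_false, iff_false, not_lt]
      exact (not_lt.1 hδ).trans (Real.exp_pos _).le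
    rw [this]
    exact convex_empty

/-- The strip has width `2 * δ`, so a point at depth at most `δ` stays inside when it is moved to
the right by `δ / (n + 2)`. -/
lemma mem_closure_rightStrip {θ δ : ℝ} (hδ : 0 < δ) {z : ℂ}
    (h1 : -δ ≤ (z * exp (-(θ * I))).im) (h2 : (z * exp (-(θ * I))).im ≤ 0) :
    z ∈ closure (rightStrip θ δ) := by
  refine mem_closure_iff_seq_limit.2 ⟨fun n => z - ((δ / (n + 2) : ℝ) * I) * exp (θ * I),
    fun n => ?_, ?_⟩
  · have hn : 0 < δ / (n + 2) := by positivity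
    have hn' : δ / ((n : ℝ) + 2) < δ := div_lt_self hδ (by linarith [n.cast_nonneg (α := ℝ)])
    have : ((z - ((δ / (n + 2) : ℝ) * I) * exp (θ * I)) * exp (-(θ * I))).im =
        (z * exp (-(θ * I))).im - δ / (n + 2) := by
      rw [sub_mul, rotate_mul_exp, Complex.sub_im, Complex.im_ofReal_mul, Complex.I_im, mul_one]
    rw [rightStrip, Set.mem_ofPred_eq, this]
    exact ⟨by linarith, by linarith⟩
  · have h3 : Tendsto (fun n : ℕ => ((δ / (n + 2) : ℝ) : ℂ)) atTop (𝓝 ((0 : ℝ) : ℂ)) :=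
      (Complex.continuous_ofReal.tendsto 0).comp
        (tendsto_const_nhds.div_atTop
          (tendsto_natCast_atTop_atTop.atTop_add tendsto_const_nhds))
    have := (tendsto_const_nhds (x := z)).sub ((h3.mul_const I).mul_const (exp (θ * I)))
    simpa using this

/-- The continuation of a solution to the right of a half line, up to a neighbourhood of `ω` on
the Riemann surface of the logarithm. -/
theorem IsSol.exists_rightBranch {V : VolterraData ι} {S : Set ℂ} (hS : S.Finite)
    (hVS : ∀ i, V.sing i ∈ S) {f : ℂ → ι → ℂ} {W : ℂ → ℂ → ι → ℂ} {r₀ : ℝ} (hr₀ : 0 < r₀)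
    (hf : IsSol V (fun z => z) (Metric.ball 0 r₀) f W) {θ : ℝ} {ω : ℂ}
    (hω : ω = ‖ω‖ * exp (θ * I)) :
    ∃ δ > 0, ∃ G W', IsSol V (fun t => ω + exp t) (logDisc δ) G W' ∧
      (∀ t ∈ logDisc δ, ∀ i, ω + exp t ≠ V.sing i) ∧
      ∀ i, IsRightBranch S θ ω (fun z => f z i) (fun t => G t i) := by
  -- the size of the deviation
  obtain ⟨δ, hδ, hδ1, hδ2⟩ : ∃ δ > 0, (∀ z ∈ S, z ∉ rightStrip θ δ) ∧
      ∀ z ∈ S, z ≠ ω → δ ≤ ‖z - ω‖ := by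
    have h1 : ∀ z ∈ S, ∃ d > 0, ∀ δ ≤ d, (z ∉ rightStrip θ δ) ∧ (z ≠ ω → δ ≤ ‖z - ω‖) := by
      intro z _
      by_cases hz : (z * exp (-(θ * I))).im < 0
      · by_cases hzω : z = ω
        · refine ⟨-(z * exp (-(θ * I))).im / 2, by linarith, fun δ hd => ⟨fun h => ?_, ?_⟩⟩
          · linarith [h.1]
          · exact fun h => absurd hzω h
        · refine ⟨min (-(z * exp (-(θ * I))).im / 2) ‖z - ω‖,
            lt_min (by linarith) (norm_pos_iff.2 (sub_ne_zero.2 hzω)), fun δ hd => ⟨fun h => ?_, ?_⟩⟩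
          · linarith [h.1, hd.trans (min_le_left _ _)]
          · exact fun _ => hd.trans (min_le_right _ _)
      · by_cases hzω : z = ω
        · exact ⟨1, one_pos, fun δ _ => ⟨fun h => hz h.2, fun h => absurd hzω h⟩⟩
        · exact ⟨‖z - ω‖, norm_pos_iff.2 (sub_ne_zero.2 hzω), fun δ hd =>
            ⟨fun h => hz h.2, fun _ => hd⟩⟩
    choose! d hd hd' using h1
    rcases S.eq_empty_or_nonempty with rfl | hne
    · exact ⟨1, one_pos, by simp, by simp⟩
    obtain ⟨z₀, hz₀, hmin⟩ := hS.exists_minimalFor d S hne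
    have hmin' : ∀ z ∈ S, d z₀ ≤ d z := fun z hz => by
      by_contra hlt
      exact hlt (hmin hz (not_le.1 hlt).le)
    exact ⟨d z₀, hd z₀ hz₀, fun z hz => (hd' z hz _ (hmin' z hz)).1,
      fun z hz => (hd' z hz _ (hmin' z hz)).2⟩
  set B := rightStrip θ δ with hBdef
  have hBo : IsOpen B := isOpen_rightStrip θ δ
  have hBc : Convex ℝ B := convex_rightStrip θ δ
  have hsB : ∀ t ∈ B, ∀ i, t ≠ V.sing i := fun t ht i he => hδ1 _ (hVS i) (he ▸ ht)
  have hsH : ∀ t ∈ logDisc δ, ∀ i, ω + exp t ≠ V.sing i := by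
    intro t ht i he
    have h1 := hδ2 _ (hVS i) (by rw [← he]; simp [Complex.exp_ne_zero])
    rw [← he, add_sub_cancel_left, Complex.norm_exp] at h1
    exact absurd ht (not_lt.2 h1)
  -- the solution on the strip
  have h0B : (0 : ℂ) ∈ closure B :=
    mem_closure_rightStrip hδ (by simp [hδ.le]) (by simp)
  obtain ⟨c, hc, hcB⟩ := mem_closure_iff_nhds.1 h0B _ (Metric.ball_mem_nhds 0 hr₀)
  obtain ⟨φ, Wφ, hφ, hWφ⟩ := exists_isSol V differentiable_id hBc hBo hcB hsB (hf.entire c hc)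
    (hf.expType c hc)
  have hfext : ExtendsAt B φ f 0 := ⟨r₀, hr₀, hf.diff, fun w hw =>
    ((hf.mono Set.inter_subset_left).unique (hφ.mono Set.inter_subset_right) differentiable_id
      ((convex_ball 0 r₀).inter hBc) (fun t ht => hsB t ht.2) ⟨hc, hcB⟩ hWφ.symm w hw).1⟩
  -- the solution near `ω`
  have hrot : ∀ t : ℂ, ((ω + exp t) * exp (-(θ * I))).im =
      Real.exp t.re * Real.sin (t.im - θ) := by
    intro t
    have h1 : ω * exp (-(θ * I)) = (‖ω‖ : ℂ) := by
      conv_lhs => rw [hω]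
      exact rotate_mul_exp _ _
    rw [add_mul, h1, ← Complex.exp_add, Complex.add_im, Complex.ofReal_im, zero_add,
      Complex.exp_im]
    simp [sub_eq_add_neg]
  have hmaps : ∀ t ∈ logDisc δ, θ - Real.pi < t.im → t.im < θ → ω + exp t ∈ B := by
    intro t ht h1 h2
    have hsin : Real.sin (t.im - θ) < 0 :=
      Real.sin_neg_of_neg_of_neg_pi_lt (by linarith) (by linarith)
    have hsin' := Real.neg_one_le_sin (t.im - θ)
    have he := Real.exp_pos t.re
    have ht' : Real.exp t.re < δ := ht
    rw [hBdef, rightStrip, Set.mem_ofPred_eq, hrot]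
    constructor
    · nlinarith
    · nlinarith
  -- Where `θ - π < arg ξ < θ`, the point `ω + ξ` lies in the strip. This region is convex in `t`,
  -- so the solution near `ω` with the history taken from the strip coincides there with the strip
  -- solution.
  set H' : Set ℂ := logDisc δ ∩ {t | θ - Real.pi < t.im ∧ t.im < θ} with hH'
  have hH'c : Convex ℝ H' := (convex_logDisc δ).inter
    ((convex_halfSpace_im_gt _).inter (convex_halfSpace_im_lt _))
  set t₁ : ℂ := ⟨Real.log (δ / 2), θ - Real.pi / 2⟩ with ht₁
  have ht₁H : t₁ ∈ logDisc δ := by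
    simp only [logDisc, Set.mem_ofPred_eq, ht₁]
    rw [Real.exp_log (by positivity)]
    linarith
  have ht₁H' : t₁ ∈ H' := ⟨ht₁H, by simp only [ht₁]; linarith [Real.pi_pos],
    by simp only [ht₁]; linarith [Real.pi_pos]⟩
  have ht₁B : ω + exp t₁ ∈ B := hmaps t₁ ht₁H ht₁H'.2.1 ht₁H'.2.2
  obtain ⟨G, WG, hG, hWG⟩ := exists_isSol V (differentiable_add_exp ω) (convex_logDisc δ)
    (isOpen_logDisc δ) ht₁H hsH (hφ.entire _ ht₁B) (hφ.expType _ ht₁B)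
  have hGφ : ∀ t ∈ H', G t = φ (ω + exp t) := fun t ht =>
    ((hG.mono Set.inter_subset_left).unique
      (hφ.comp (U' := H') (differentiable_add_exp ω) fun t ht => hmaps t ht.1 ht.2.1 ht.2.2)
      (differentiable_add_exp ω) hH'c (fun t ht => hsH t ht.1) ht₁H' hWG t ht).1
  refine ⟨δ, hδ, G, WG, hG, hsH, fun i => ⟨δ, hδ, ?_, ?_⟩⟩
  · exact ((differentiableOn_pi.1 hG.diff) i).analyticOnNhd (isOpen_logDisc δ)
  intro r hr hrδ y hy
  obtain ⟨hy0, hy1, hyb, hyS⟩ := hy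
  set γ := rightPath θ ω r y with hγ
  have hγim : ∀ s, (γ s * exp (-(θ * I))).im = -y s := by
    intro s
    have : γ s = (((s : ℝ) * (‖ω‖ + r) : ℝ) - (y s : ℝ) * I) * exp (θ * I) := rfl
    rw [this, rotate_mul_exp]
    simp
  have hγcl : ∀ s, γ s ∈ closure B := fun s => mem_closure_rightStrip hδ
    (by rw [hγim]; linarith [(hyb s).2]) (by rw [hγim]; linarith [(hyb s).1])
  have hγ0 : γ 0 = 0 := by
    have : γ 0 = ((((0 : unitInterval) : ℝ) * (‖ω‖ + r) : ℝ) - (y 0 : ℝ) * I) * exp (θ * I) := rfl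
    rw [this, hy0]
    simp
  have hγ1 : γ 1 = ω + r * exp (θ * I) := by
    have : γ 1 = ((((1 : unitInterval) : ℝ) * (‖ω‖ + r) : ℝ) - (y 1 : ℝ) * I) * exp (θ * I) := rfl
    rw [this, hy1]
    conv_rhs => rw [hω]
    push_cast
    simp
    ring
  have hex : ∀ s, ∃ ψ, ExtendsAt B φ ψ (γ s) := by
    intro s
    -- The starting point `0` may be a singular point of the equation; there the given germ `f`
    -- itself is the extension. At other parameters a singular point on the segment would force a
    -- positive deviation, hence a point of the open strip, which contains no singular point.
    by_cases hs : s = 0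
    · rw [hs, hγ0]
      exact ⟨f, hfext⟩
    refine hφ.exists_extendsAt hBc (hγcl s) fun i he => ?_
    have hmem : γ s ∈ S := he ▸ hVS i
    rcases (hyb s).1.eq_or_lt with h0 | h0
    · have hγs : γ s = (((s : ℝ) * (‖ω‖ + r) : ℝ) : ℂ) * exp (θ * I) := by
        have : γ s = (((s : ℝ) * (‖ω‖ + r) : ℝ) - (y s : ℝ) * I) * exp (θ * I) := rfl
        rw [this, ← h0]
        simp
      have := hyS s hs (hγs ▸ hmem)
      linarith
    · refine hδ1 _ hmem ⟨?_, ?_⟩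
      · rw [hγim]; linarith [(hyb s).2]
      · rw [hγim]; linarith
  choose ψ hψ using hex
  refine ⟨fun s z => ψ s z i, ⟨?_, ?_, ?_⟩, ?_⟩
  · have h1 : ψ 0 =ᶠ[𝓝 (γ 0)] f :=
      (hψ 0).unique hBo (hγcl 0) (by rw [hγ0]; exact hfext)
    exact h1.mono fun z hz => congrFun hz i
  · intro s
    exact analyticAt_pi_iff.1 (hψ s).analyticAt i
  · intro s
    filter_upwards [γ.continuous.continuousAt.eventually (hψ s).eventually] with s' hs'
    exact ((hψ s').unique hBo (hγcl s') hs').mono fun z hz => congrFun hz i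
  · set t₂ : ℂ := (Real.log r : ℂ) + θ * I with ht₂
    have hexp2 : exp t₂ = r * exp (θ * I) := by
      rw [ht₂, Complex.exp_add, ← Complex.ofReal_exp, Real.exp_log hr]
    have hp2 : ω + exp t₂ = γ 1 := by rw [hexp2, hγ1]
    have ht₂re : t₂.re = Real.log r := by simp [ht₂]
    have ht₂im : t₂.im = θ := by simp [ht₂]
    have ht₂H : t₂ ∈ logDisc δ := by
      rw [logDisc, Set.mem_ofPred_eq, ht₂re, Real.exp_log hr]
      exact hrδ
    obtain ⟨ρ, hρ, hd, he⟩ := hψ 1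
    have hcont : ContinuousAt (fun t => ω + exp t) t₂ := (differentiable_add_exp ω t₂).continuousAt
    have hnhds : ∀ᶠ t in 𝓝 t₂, ω + exp t ∈ Metric.ball (γ 1) ρ :=
      hcont.eventually (Metric.isOpen_ball.mem_nhds
        (show ω + exp t₂ ∈ Metric.ball (γ 1) ρ by rw [hp2]; exact Metric.mem_ball_self hρ))
    obtain ⟨ε, hε, hεsub⟩ := Metric.eventually_nhds_iff_ball.1
      (hnhds.and ((isOpen_logDisc δ).mem_nhds ht₂H))
    set η := min (ε / 2) (Real.pi / 2) with hη
    have hη0 : 0 < η := lt_min (by linarith) (by linarith [Real.pi_pos])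
    have hηε : η < ε := lt_of_le_of_lt (min_le_left _ _) (by linarith)
    have hηπ : η < Real.pi := lt_of_le_of_lt (min_le_right _ _) (by linarith [Real.pi_pos])
    -- The end point `t₂` has argument `θ`, on the boundary of `H'`. Slightly to the right, at `t₃`,
    -- both functions are the strip solution, and the identity theorem carries the equality back to
    -- `t₂`.
    set t₃ : ℂ := t₂ - η * I with ht₃
    have ht₃b : t₃ ∈ Metric.ball t₂ ε := by
      rw [Metric.mem_ball, dist_eq_norm, ht₃, sub_sub_cancel_left, norm_neg, norm_mul,
        Complex.norm_I, mul_one, Complex.norm_real, Real.norm_of_nonneg hη0.le]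
      exact hηε
    have ht₃im : t₃.im = θ - η := by rw [ht₃, Complex.sub_im, ht₂im]; simp
    have hd1 : DifferentiableOn ℂ G (Metric.ball t₂ ε) := hG.diff.mono fun t ht => (hεsub t ht).2
    have hd2 : DifferentiableOn ℂ (fun t => ψ 1 (ω + exp t)) (Metric.ball t₂ ε) :=
      hd.comp (differentiable_add_exp ω).differentiableOn fun t ht => (hεsub t ht).1
    have heq : G =ᶠ[𝓝 t₃] fun t => ψ 1 (ω + exp t) := by
      have hopen : IsOpen {t : ℂ | θ - Real.pi < t.im ∧ t.im < θ} :=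
        (isOpen_lt continuous_const Complex.continuous_im).inter
          (isOpen_lt Complex.continuous_im continuous_const)
      filter_upwards [Metric.isOpen_ball.mem_nhds ht₃b,
        hopen.mem_nhds (show t₃ ∈ _ from ⟨by rw [ht₃im]; linarith, by rw [ht₃im]; linarith⟩)]
        with t h1 h2
      rw [hGφ t ⟨(hεsub t h1).2, h2⟩,
        he _ ⟨(hεsub t h1).1, hmaps t (hεsub t h1).2 h2.1 h2.2⟩]
    filter_upwards [(eqOn_ball_of_eventuallyEq hd1 hd2 ht₃b heq).eventuallyEq_of_mem
      (Metric.ball_mem_nhds t₂ hε)] with t ht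
    rw [ht]

end LevelOne

end

noncomputable section

namespace LevelOne

variable {ι : Type*} [Fintype ι]

/-! ### Resurgent functions in the logarithmic coordinate -/

/-- At most exponential growth at infinity (with respect to `ζ = exp t`) on a sector. -/
def SectorGrowth (ρ α β : ℝ) (h : ℂ → ℂ) : Prop :=
  ∃ C A M : ℝ, ∀ t ∈ logSector ρ α β, M ≤ t.re → ‖h t‖ ≤ C * Real.exp (A * Real.exp t.re)

lemma SectorGrowth.mul {ρ α β : ℝ} {h k : ℂ → ℂ} (hh : SectorGrowth ρ α β h)
    (hk : SectorGrowth ρ α β k) : SectorGrowth ρ α β fun t => h t * k t := by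
  obtain ⟨C, A, M, H⟩ := hh
  obtain ⟨C', A', M', H'⟩ := hk
  refine ⟨C * C', A + A', max M M', fun t ht hM => ?_⟩
  have h1 := H t ht ((le_max_left _ _).trans hM)
  have h2 := H' t ht ((le_max_right _ _).trans hM)
  calc ‖h t * k t‖ = ‖h t‖ * ‖k t‖ := norm_mul _ _
    _ ≤ (C * Real.exp (A * Real.exp t.re)) * (C' * Real.exp (A' * Real.exp t.re)) :=
        mul_le_mul h1 h2 (norm_nonneg _) ((norm_nonneg _).trans h1)
    _ = _ := by rw [add_mul, Real.exp_add]; ring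

lemma SectorGrowth.add {ρ α β : ℝ} {h k : ℂ → ℂ} (hh : SectorGrowth ρ α β h)
    (hk : SectorGrowth ρ α β k) : SectorGrowth ρ α β fun t => h t + k t := by
  obtain ⟨C, A, M, H⟩ := hh
  obtain ⟨C', A', M', H'⟩ := hk
  refine ⟨|C| + |C'|, max A A', max M M', fun t ht hM => ?_⟩
  have h1 := H t ht ((le_max_left _ _).trans hM)
  have h2 := H' t ht ((le_max_right _ _).trans hM)
  refine (norm_add_le _ _).trans ?_
  rw [add_mul]
  refine add_le_add (h1.trans ?_) (h2.trans ?_)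
  · gcongr
    · exact le_abs_self _
    · exact le_max_left _ _
  · gcongr
    · exact le_abs_self _
    · exact le_max_right _ _

/-- `G`, a function of `t = ln ξ` near `Re t = -∞`, continues along all paths that avoid the
logarithms of `S`, with at most exponential growth on sectors. -/
def LogRes (S : Set ℂ) (G : ℂ → ℂ) : Prop :=
  ∃ x₀ : ℝ, AnalyticOnNhd ℂ G {t | t.re < x₀} ∧
    ∀ τ : C(unitInterval, ℂ), (τ 0).re < x₀ → (∀ s, exp (τ s) ∉ S) →
      ∃ g, IsContinuationAlong G τ g ∧ ∀ ρ α β : ℝ, (∀ t ∈ logSector ρ α β, exp t ∉ S) →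
        τ 1 ∈ logSector ρ α β → ∃ h, AnalyticOnNhd ℂ h (logSector ρ α β) ∧
          h =ᶠ[𝓝 (τ 1)] g 1 ∧ SectorGrowth ρ α β h

lemma eventually_logZero_iff {P : ℂ → Prop} :
    (∀ᶠ t in logZero, P t) ↔ ∃ x₀ : ℝ, ∀ t : ℂ, t.re < x₀ → P t := by
  rw [logZero, Filter.eventually_comap, Filter.eventually_atBot]
  constructor
  · rintro ⟨a, ha⟩
    exact ⟨a, fun t ht => ha t.re ht.le t rfl⟩
  · rintro ⟨a, ha⟩
    refine ⟨a - 1, fun b hb t ht => ha t (by rw [ht]; linarith)⟩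

namespace LogRes

variable {S : Set ℂ} {G G₁ G₂ : ℂ → ℂ}

lemma isOpen_re_lt (x₀ : ℝ) : IsOpen {t : ℂ | t.re < x₀} :=
  isOpen_lt Complex.continuous_re continuous_const

lemma congr (h : LogRes S G₁) (he : ∀ᶠ t in logZero, G₁ t = G₂ t) : LogRes S G₂ := by
  obtain ⟨x₀, han, hc⟩ := h
  obtain ⟨x₁, he⟩ := eventually_logZero_iff.1 he
  have hev : ∀ t : ℂ, t.re < min x₀ x₁ → G₁ =ᶠ[𝓝 t] G₂ := fun t ht => by
    filter_upwards [(isOpen_re_lt x₁).mem_nhds (lt_of_lt_of_le ht (min_le_right _ _))] with s hs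
    exact he s hs
  refine ⟨min x₀ x₁, fun t (ht : t.re < min x₀ x₁) => ?_, fun τ hτ hτS => ?_⟩
  · exact (han t (ht.trans_le (min_le_left x₀ x₁))).congr (hev t ht)
  · obtain ⟨g, hg, hgr⟩ := hc τ (lt_of_lt_of_le hτ (min_le_left _ _)) hτS
    exact ⟨g, ⟨hg.start.trans (hev _ hτ), hg.analytic, hg.coherent⟩, hgr⟩

/-- Both functions are continued along the same path and combined pointwise. Only the stability of
analyticity and of sectorial growth under the operation matters, so sums and products are treated
together. -/
lemma op₂ (op : ℂ → ℂ → ℂ)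
    (hop : ∀ {f g : ℂ → ℂ} {t : ℂ}, AnalyticAt ℂ f t → AnalyticAt ℂ g t →
      AnalyticAt ℂ (fun t => op (f t) (g t)) t)
    (hgrow : ∀ {ρ α β : ℝ} {h k : ℂ → ℂ}, SectorGrowth ρ α β h → SectorGrowth ρ α β k →
      SectorGrowth ρ α β fun t => op (h t) (k t))
    (h₁ : LogRes S G₁) (h₂ : LogRes S G₂) : LogRes S fun t => op (G₁ t) (G₂ t) := by
  obtain ⟨x₁, han₁, hc₁⟩ := h₁
  obtain ⟨x₂, han₂, hc₂⟩ := h₂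
  refine ⟨min x₁ x₂, fun t (ht : t.re < min x₁ x₂) => hop
    (han₁ t (ht.trans_le (min_le_left x₁ x₂))) (han₂ t (ht.trans_le (min_le_right x₁ x₂))), fun τ hτ hτS => ?_⟩
  obtain ⟨g₁, hg₁, hgr₁⟩ := hc₁ τ (lt_of_lt_of_le hτ (min_le_left _ _)) hτS
  obtain ⟨g₂, hg₂, hgr₂⟩ := hc₂ τ (lt_of_lt_of_le hτ (min_le_right _ _)) hτS
  refine ⟨fun s t => op (g₁ s t) (g₂ s t), ⟨?_, fun s => hop (hg₁.analytic s) (hg₂.analytic s),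
    fun s => ?_⟩, fun ρ α β hsec h1 => ?_⟩
  · filter_upwards [hg₁.start, hg₂.start] with t e1 e2
    rw [e1, e2]
  · filter_upwards [hg₁.coherent s, hg₂.coherent s] with s' e1 e2
    filter_upwards [e1, e2] with t e1 e2
    rw [e1, e2]
  · obtain ⟨k₁, ha₁, he₁, hb₁⟩ := hgr₁ ρ α β hsec h1
    obtain ⟨k₂, ha₂, he₂, hb₂⟩ := hgr₂ ρ α β hsec h1
    refine ⟨fun t => op (k₁ t) (k₂ t), fun t ht => hop (ha₁ t ht) (ha₂ t ht), ?_, hgrow hb₁ hb₂⟩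
    filter_upwards [he₁, he₂] with t e1 e2
    rw [e1, e2]

lemma add (h₁ : LogRes S G₁) (h₂ : LogRes S G₂) : LogRes S fun t => G₁ t + G₂ t :=
  op₂ (· + ·) (fun hf hg => hf.fun_add hg) (fun h k => h.add k) h₁ h₂

lemma mul (h₁ : LogRes S G₁) (h₂ : LogRes S G₂) : LogRes S fun t => G₁ t * G₂ t :=
  op₂ (· * ·) (fun hf hg => hf.fun_mul hg) (fun h k => h.mul k) h₁ h₂

lemma of_entire (hG : Differentiable ℂ G) (hgr : ∀ ρ α β, SectorGrowth ρ α β G) : LogRes S G := by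
  have ha : ∀ t, AnalyticAt ℂ G t := fun t => hG.analyticAt t
  exact ⟨0, fun t _ => ha t, fun τ _ _ => ⟨fun _ => G, ⟨EventuallyEq.rfl, fun s => ha _,
    fun s => Eventually.of_forall fun s' => EventuallyEq.rfl⟩, fun ρ α β _ _ =>
    ⟨G, fun t _ => ha t, EventuallyEq.rfl, hgr ρ α β⟩⟩⟩

lemma const (c : ℂ) : LogRes S fun _ => c :=
  of_entire (differentiable_const c) fun ρ α β => ⟨‖c‖, 0, 0, fun t _ _ => by simp⟩

lemma norm_le_of_mem_logSector {ρ α β : ℝ} {t : ℂ} (ht : t ∈ logSector ρ α β) (h0 : 0 ≤ t.re) :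
    ‖t‖ ≤ Real.exp t.re + (|α| + |β|) := by
  refine (Complex.norm_le_abs_re_add_abs_im t).trans ?_
  rw [abs_of_nonneg h0]
  refine add_le_add (by linarith [Real.add_one_le_exp t.re]) (abs_le.2 ⟨?_, ?_⟩)
  · linarith [neg_abs_le α, ht.2.1, abs_nonneg β]
  · linarith [le_abs_self β, ht.2.2, abs_nonneg α]

lemma exp_mul (μ : ℂ) : LogRes S fun t => exp (μ * t) := by
  refine of_entire (by fun_prop) fun ρ α β =>
    ⟨Real.exp (‖μ‖ * (|α| + |β|)), ‖μ‖, 0, fun t ht h0 => ?_⟩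
  rw [Complex.norm_exp, ← Real.exp_add, Real.exp_le_exp]
  refine (Complex.re_le_norm _).trans ?_
  rw [norm_mul, ← mul_add]
  gcongr
  linarith [norm_le_of_mem_logSector ht h0]

lemma id : LogRes S fun t => t := by
  refine of_entire differentiable_id fun ρ α β => ⟨1 + (|α| + |β|), 1, 0, fun t ht h0 => ?_⟩
  refine (norm_le_of_mem_logSector ht h0).trans ?_
  rw [add_mul, one_mul, one_mul]
  have h1 : Real.exp t.re ≤ Real.exp (Real.exp t.re) := by
    rw [Real.exp_le_exp]
    linarith [Real.add_one_le_exp t.re]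
  have h2 : 1 ≤ Real.exp (Real.exp t.re) := Real.one_le_exp (Real.exp_pos _).le
  exact add_le_add h1 (le_mul_of_one_le_right (by positivity) h2)

lemma const_mul (h : LogRes S G) (c : ℂ) : LogRes S fun t => c * G t := (const c).mul h

lemma sub (h₁ : LogRes S G₁) (h₂ : LogRes S G₂) : LogRes S fun t => G₁ t - G₂ t := by
  simpa [sub_eq_add_neg] using h₁.add (h₂.const_mul (-1))

/-- Path and sector are translated by `2πi`; by periodicity of the exponential they still avoid the
logarithms of `S`. -/
lemma shift (h : LogRes S G) : LogRes S fun t => G (t + 2 * Real.pi * I) := by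
  obtain ⟨x₀, han, hc⟩ := h
  have hre : ∀ t : ℂ, (t + 2 * Real.pi * I).re = t.re := fun t => by simp
  have hper : ∀ t : ℂ, exp (t + 2 * Real.pi * I) = exp t := Complex.exp_periodic
  have hcomp : ∀ {f : ℂ → ℂ} {t : ℂ}, AnalyticAt ℂ f (t + 2 * Real.pi * I) →
      AnalyticAt ℂ (fun t => f (t + 2 * Real.pi * I)) t := fun {f t} hf =>
    AnalyticAt.fun_comp (f := fun t : ℂ => t + 2 * Real.pi * I) hf (by fun_prop)
  have htend : ∀ t : ℂ, Tendsto (fun t : ℂ => t + 2 * Real.pi * I) (𝓝 t)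
      (𝓝 (t + 2 * Real.pi * I)) := fun t => (continuous_add_const _).tendsto t
  refine ⟨x₀, fun t ht => hcomp (han _ (by simpa [hre] using ht)), fun τ hτ hτS => ?_⟩
  let τ' : C(unitInterval, ℂ) := ⟨fun s => τ s + 2 * Real.pi * I, by fun_prop⟩
  obtain ⟨g, hg, hgr⟩ := hc τ' (by change (τ 0 + 2 * Real.pi * I).re < x₀; rwa [hre])
    (fun s => by change exp (τ s + 2 * Real.pi * I) ∉ S; rw [hper]; exact hτS s)
  refine ⟨fun s t => g s (t + 2 * Real.pi * I), ⟨?_, fun s => hcomp (hg.analytic s), fun s => ?_⟩,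
    fun ρ α β hsec h1 => ?_⟩
  · exact (htend (τ 0)).eventually hg.start
  · filter_upwards [hg.coherent s] with s' e
    exact (htend (τ s')).eventually e
  · have hmem : ∀ t : ℂ, t ∈ logSector ρ α β →
        t + 2 * Real.pi * I ∈ logSector ρ (α + 2 * Real.pi) (β + 2 * Real.pi) := fun t ht =>
      ⟨by rw [hre]; exact ht.1, by simp [ht.2.1], by simp [ht.2.2]⟩
    obtain ⟨k, ha, he, C, A, M, hb⟩ := hgr ρ (α + 2 * Real.pi) (β + 2 * Real.pi) (fun t ht => by
      have := hsec (t - 2 * Real.pi * I) ⟨by simpa using ht.1, by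
        simp; linarith [ht.2.1], by simp; linarith [ht.2.2]⟩
      rwa [← hper, sub_add_cancel] at this) (hmem _ h1)
    refine ⟨fun t => k (t + 2 * Real.pi * I), fun t ht => hcomp (ha _ (hmem t ht)),
      (htend (τ 1)).eventually he, C, A, M, fun t ht hM => ?_⟩
    have := hb _ (hmem t ht) (by rwa [hre])
    rwa [hre] at this

end LogRes

/-- The components of solutions are resurgent. -/
theorem IsSol.logRes {V : VolterraData ι} {S : Set ℂ} {ω : ℂ} (hS : ∀ i, V.sing i - ω ∈ S)
    {δ : ℝ} (hδ : 0 < δ) {G : ℂ → ι → ℂ} {W : ℂ → ℂ → ι → ℂ}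
    (h : IsSol V (fun t => ω + exp t) (logDisc δ) G W) (i : ι) : LogRes S fun t => G t i := by
  have hp := differentiable_add_exp ω
  have hmem : ∀ t : ℂ, t.re < Real.log δ → t ∈ logDisc δ := fun t ht =>
    (Real.lt_log_iff_exp_lt hδ).1 ht
  have hne : ∀ t : ℂ, exp t ∉ S → ∀ i, ω + exp t ≠ V.sing i := fun t ht i he =>
    ht (by rw [← add_sub_cancel_left ω (exp t), he]; exact hS i)
  refine ⟨Real.log δ, fun t ht => ?_, fun τ hτ hτS => ?_⟩
  · exact analyticAt_pi_iff.1 (h.diff.analyticAt ((isOpen_logDisc δ).mem_nhds (hmem t ht))) i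
  obtain ⟨Φ, h0, hsol, hcoh⟩ := h.exists_continuation hp τ (fun s => hne _ (hτS s))
    (isOpen_logDisc δ) (hmem _ hτ)
  refine ⟨fun s t => Φ s t i, ⟨?_, ?_, ?_⟩, fun ρ α β hsec h1 => ?_⟩
  · exact h0.mono fun t ht => congrFun ht i
  · intro s
    obtain ⟨U', hU', hs, W', h'⟩ := hsol s
    exact analyticAt_pi_iff.1 (h'.diff.analyticAt (hU'.mem_nhds hs)) i
  · intro s
    filter_upwards [hcoh s] with s' e
    exact e.mono fun t ht => congrFun ht i
  · obtain ⟨U', hU', hs, W', h'⟩ := hsol 1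
    obtain ⟨k, Wk, hk, hWk⟩ := exists_isSol V hp (convex_logSector ρ α β)
      (isOpen_logSector ρ α β) h1 (fun t ht => hne t (hsec t ht)) (h'.entire _ hs)
      (h'.expType _ hs)
    refine ⟨fun t => k t i, fun t ht => ?_, ?_, ?_⟩
    · exact analyticAt_pi_iff.1 (hk.diff.analyticAt ((isOpen_logSector ρ α β).mem_nhds ht)) i
    · obtain ⟨r, hr, hrs⟩ := Metric.isOpen_iff.1 (hU'.inter (isOpen_logSector ρ α β)) (τ 1)
        ⟨hs, h1⟩
      filter_upwards [Metric.ball_mem_nhds (τ 1) hr] with t ht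
      exact congrFun ((hk.mono fun t ht => (hrs ht).2).unique (h'.mono fun t ht => (hrs ht).1) hp
        (convex_ball (τ 1) r) (fun t ht => hne t (hsec t (hrs ht).2)) (Metric.mem_ball_self hr)
        hWk t ht).1 i
    · obtain ⟨C, A, M, hb⟩ := hk.growth
      exact ⟨C, A, M, fun t ht hM => (norm_le_pi_norm (k t) i).trans (hb t ht hM)⟩

/-! ### From the logarithmic coordinate back to germs at the origin -/

/-- Lifting a path through the exponential, with a prescribed end point. -/
lemma exists_log_lift (γ : C(unitInterval, ℂ)) (hγ : ∀ s, γ s ≠ 0) {e₁ : ℂ}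
    (he : exp e₁ = γ 1) : ∃ τ : C(unitInterval, ℂ), τ 1 = e₁ ∧ ∀ s, exp (τ s) = γ s := by
  have : ContractibleSpace unitInterval := (convex_Icc (0 : ℝ) 1).contractibleSpace ⟨0, by simp⟩
  have : LocallyPathConnectedSpace unitInterval := (convex_Icc (0 : ℝ) 1).locallyPathConnectedSpace
  obtain ⟨τ, ⟨h1, h2⟩, -⟩ := Complex.isCoveringMapOn_exp.existsUnique_continuousMap_lifts γ
    (a₀ := 1) (e₀ := e₁) he (fun s => by simpa using hγ s)
  exact ⟨τ, h1, fun s => congrFun h2 s⟩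

lemma IsContinuationAlong.comp_path {f : ℂ → ℂ} {γ : C(unitInterval, ℂ)}
    {g : unitInterval → ℂ → ℂ} (hg : IsContinuationAlong f γ g) (u : C(unitInterval, unitInterval))
    {f' : ℂ → ℂ} (hf' : g (u 0) =ᶠ[𝓝 (γ (u 0))] f') :
    IsContinuationAlong f' (γ.comp u) fun s => g (u s) where
  start := hf'
  analytic s := hg.analytic (u s)
  coherent s := u.continuous.continuousAt.eventually (hg.coherent (u s))

/-- The parameter `max s s₀`. -/
def paramMax (s₀ : unitInterval) : C(unitInterval, unitInterval) :=
  ⟨fun s => max s s₀, continuous_id.max continuous_const⟩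

/-- The parameter `min s s₀`. -/
def paramMin (s₀ : unitInterval) : C(unitInterval, unitInterval) :=
  ⟨fun s => min s s₀, continuous_id.min continuous_const⟩

lemma exists_initial_arc (γ : C(unitInterval, ℂ)) (hγ : γ 0 = 0) {r : ℝ} (hr : 0 < r) :
    ∃ s₀ : unitInterval, 0 < s₀ ∧ ∀ s ≤ s₀, ‖γ s‖ < r := by
  have h1 : ∀ᶠ s in 𝓝 (0 : unitInterval), ‖γ s‖ < r := by
    have : ContinuousAt (fun s => ‖γ s‖) 0 := by fun_prop
    exact this.eventually (Iio_mem_nhds (by simpa [hγ] using hr))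
  obtain ⟨ε, hε, h⟩ := Metric.eventually_nhds_iff.1 h1
  refine ⟨⟨min (ε / 2) 1, by positivity, min_le_right _ _⟩, ?_, fun s hs => h ?_⟩
  · exact Subtype.mk_lt_mk.2 (by positivity)
  · rw [Subtype.dist_eq, Real.dist_eq]
    have h2 : (s : ℝ) ≤ min (ε / 2) 1 := hs
    have h3 : min (ε / 2) 1 ≤ ε / 2 := min_le_left _ _
    have h4 : (0 : ℝ) ≤ s := s.2.1
    rw [abs_lt]
    constructor <;> simp <;> linarith

/-- The local inverse of the exponential with value `t₀` at `exp t₀`. -/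
def logAt (t₀ z : ℂ) : ℂ := t₀ + log (z / exp t₀)

lemma logAt_exp_self (t₀ : ℂ) : logAt t₀ (exp t₀) = t₀ := by
  rw [logAt, div_self (Complex.exp_ne_zero _), Complex.log_one, add_zero]

lemma exp_logAt {t₀ z : ℂ} (hz : z ≠ 0) : exp (logAt t₀ z) = z := by
  rw [logAt, Complex.exp_add, Complex.exp_log (div_ne_zero hz (Complex.exp_ne_zero _)),
    mul_div_cancel₀ _ (Complex.exp_ne_zero _)]

lemma analyticAt_logAt (t₀ : ℂ) : AnalyticAt ℂ (logAt t₀) (exp t₀) := by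
  have h1 : AnalyticAt ℂ (fun z => z / exp t₀) (exp t₀) := by fun_prop
  refine AnalyticAt.fun_add analyticAt_const (AnalyticAt.clog h1 ?_)
  rw [div_self (Complex.exp_ne_zero _)]
  exact Complex.one_mem_slitPlane

/-- Logarithms of one number differ by multiples of `2πi`, so closeness within `1` selects the
branch. This is how local logarithms are matched with the lifted path. -/
lemma eq_of_exp_eq_of_norm_sub_lt {x y : ℂ} (h : exp x = exp y) (hxy : ‖x - y‖ < 1) : x = y := by
  obtain ⟨n, hn⟩ := Complex.exp_eq_exp_iff_exists_int.1 h
  rw [hn, add_sub_cancel_left] at hxy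
  have hn0 : n = 0 := by
    by_contra hne
    have h3 : (1 : ℝ) ≤ |(n : ℝ)| := by
      exact_mod_cast Int.one_le_abs hne
    rw [norm_mul, Complex.norm_intCast] at hxy
    simp only [norm_mul, Complex.norm_ofNat, Complex.norm_real, Real.norm_eq_abs, Complex.norm_I,
      mul_one, abs_of_pos Real.pi_pos] at hxy
    nlinarith [Real.pi_gt_three]
  rw [hn, hn0]
  simp

lemma logAt_eventuallyEq {t₀ t₁ : ℂ} (h : ContinuousAt (logAt t₀) (exp t₁))
    (he : logAt t₀ (exp t₁) = t₁) : logAt t₀ =ᶠ[𝓝 (exp t₁)] logAt t₁ := by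
  have h1 : ContinuousAt (fun z => logAt t₀ z - logAt t₁ z) (exp t₁) :=
    h.sub (analyticAt_logAt t₁).continuousAt
  have h2 : ∀ᶠ z in 𝓝 (exp t₁), ‖logAt t₀ z - logAt t₁ z‖ < 1 :=
    h1.norm.eventually (Iio_mem_nhds (by simp [he, logAt_exp_self]))
  filter_upwards [h2, isOpen_ne.mem_nhds (Complex.exp_ne_zero t₁)] with z hz hz0
  exact eq_of_exp_eq_of_norm_sub_lt
    ((exp_logAt (t₀ := t₀) hz0).trans (exp_logAt (t₀ := t₁) hz0).symm) hz

/-- A germ at `0` that is resurgent in the logarithmic coordinate is summable-resurgent. -/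
theorem LogRes.isSummableResurgent {S : Set ℂ} {h : ℂ → ℂ} (hh : AnalyticAt ℂ h 0)
    (hL : LogRes S fun t => h (exp t)) : IsSummableResurgent S h := by
  obtain ⟨r, hr, hd⟩ := AnalyticAt.exists_differentiableOn_ball hh
  obtain ⟨x₀, -, hc⟩ := hL
  have hr₁ : 0 < min r (Real.exp x₀) := lt_min hr (Real.exp_pos _)
  -- lifting the path after an initial arc
  have hlift : ∀ γ, IsAdmissible S γ → ∃ s₀ : unitInterval, 0 < s₀ ∧
      (∀ s ≤ s₀, ‖γ s‖ < min r (Real.exp x₀)) ∧ ∀ e₁, exp e₁ = γ 1 →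
      ∃ τ : C(unitInterval, ℂ), τ 1 = e₁ ∧ (∀ s, exp (τ s) = γ (max s s₀)) ∧ (τ 0).re < x₀ ∧
        ∀ s, exp (τ s) ∉ S := by
    rintro γ ⟨hγ0, hγ⟩
    obtain ⟨s₀, hs₀, harc⟩ := exists_initial_arc γ hγ0 hr₁
    have hne : ∀ s, max s s₀ ≠ 0 := fun s => (lt_of_lt_of_le hs₀ (le_max_right _ _)).ne'
    refine ⟨s₀, hs₀, harc, fun e₁ he₁ => ?_⟩
    -- A path from `0` has no logarithm at its start. It is replaced by the path that waits at `γ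
    -- s₀` up to the parameter `s₀`; the arc before `s₀` stays in the disc where `h` is analytic.
    obtain ⟨τ, hτ1, hτ⟩ := exists_log_lift (γ.comp (paramMax s₀)) (fun s => (hγ _ (hne s)).2)
      (e₁ := e₁) (by
        rw [he₁]
        change γ 1 = γ (max 1 s₀)
        rw [max_eq_left unitInterval.le_one'])
    refine ⟨τ, hτ1, hτ, ?_, fun s => ?_⟩
    · have h1 : ‖exp (τ 0)‖ < Real.exp x₀ := by
        rw [hτ]
        refine (harc _ ?_).trans_le (min_le_right _ _)
        exact max_le hs₀.le le_rfl
      rwa [Complex.norm_exp, Real.exp_lt_exp] at h1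
    · rw [hτ]
      exact (hγ _ (hne s)).1
  refine ⟨hh, fun γ hγ => ?_, fun γ g hγ hg ν hν ρ α β hsec t₀ ht₀ hγ1 => ?_⟩
  · obtain ⟨s₀, hs₀, harc, hτ⟩ := hlift γ hγ
    have hne1 : γ 1 ≠ 0 := (hγ.2 1 one_ne_zero).2
    obtain ⟨τ, -, hexp, hre, hτS⟩ := hτ (log (γ 1)) (Complex.exp_log hne1)
    obtain ⟨g, hg, -⟩ := hc τ hre hτS
    have hball : ∀ s ≤ s₀, γ s ∈ Metric.ball (0 : ℂ) r := fun s hs => by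
      rw [mem_ball_zero_iff]
      exact (harc s hs).trans_le (min_le_left _ _)
    have hexp' : ∀ s, s₀ ≤ s → exp (τ s) = γ s := fun s hs => by
      rw [hexp, max_eq_left hs]
    have hlog : ∀ s, s₀ ≤ s → ∀ᶠ s' in 𝓝 s, s₀ ≤ s' →
        logAt (τ s) =ᶠ[𝓝 (γ s')] logAt (τ s') ∧
        Tendsto (logAt (τ s)) (𝓝 (γ s')) (𝓝 (τ s')) := by
      intro s hs
      have hcs : ContinuousAt (fun s' => logAt (τ s) (γ s')) s :=
        ContinuousAt.comp (g := logAt (τ s))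
          (by rw [← hexp' s hs]; exact (analyticAt_logAt (τ s)).continuousAt)
          γ.continuous.continuousAt
      have h1 : ∀ᶠ s' in 𝓝 s, ‖logAt (τ s) (γ s') - τ s'‖ < 1 := by
        refine (hcs.sub τ.continuous.continuousAt).norm.eventually (Iio_mem_nhds ?_)
        simp [← hexp' s hs, logAt_exp_self]
      have h2 : ∀ᶠ s' in 𝓝 s, ContinuousAt (logAt (τ s)) (γ s') := by
        refine γ.continuous.continuousAt.eventually ?_
        rw [← hexp' s hs]
        exact (analyticAt_logAt (τ s)).eventually_analyticAt.mono fun z hz => hz.continuousAt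
      filter_upwards [h1, h2] with s' h1 h2 hs'
      have hval : logAt (τ s) (γ s') = τ s' := by
        have hg0 : γ s' ≠ 0 := by rw [← hexp' s' hs']; exact Complex.exp_ne_zero _
        exact eq_of_exp_eq_of_norm_sub_lt
          ((exp_logAt (t₀ := τ s) hg0).trans (hexp' s' hs').symm) h1
      constructor
      · rw [← hexp' s' hs'] at h2 hval ⊢
        exact logAt_eventuallyEq h2 hval
      · have := h2.tendsto
        rwa [hval] at this
    -- On the initial arc the germ is `h` itself; afterwards it is the continuation in the
    -- logarithmic coordinate, composed with the local logarithm that follows the lifted path.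
    refine ⟨fun s => if s ≤ s₀ then h else fun z => g s (logAt (τ s) z), ⟨?_, ?_, ?_⟩⟩
    · rw [if_pos hs₀.le]
    · intro s
      split_ifs with hs
      · exact hd.analyticAt (Metric.isOpen_ball.mem_nhds (hball s hs))
      · rw [not_le] at hs
        rw [← hexp' s hs.le]
        refine AnalyticAt.fun_comp (f := logAt (τ s)) ?_ (analyticAt_logAt (τ s))
        rw [logAt_exp_self]
        exact hg.analytic s
    · intro s
      rcases lt_trichotomy s s₀ with hs | rfl | hs
      · filter_upwards [Iio_mem_nhds hs] with s' hs'
        rw [if_pos hs.le, if_pos (le_of_lt hs')]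
      · -- near the end of the initial arc
        have hg0 : ∀ s' ≤ s, g s' =ᶠ[𝓝 (τ s')] fun t => h (exp t) := by
          -- While the lifted path waits above one point, the continuation is still given by `h ∘
          -- exp`. This glues the two definitions at the end of the initial arc.
          have hτle : ∀ s', exp (τ (min s' s)) = γ s := fun s' => by
            rw [hexp, max_eq_right (min_le_right _ _)]
          have hu := hg.comp_path (paramMin s) (f' := fun t => h (exp t)) (by
            have : paramMin s 0 = 0 := min_eq_left hs₀.le
            rw [this]
            exact hg.start)
          have hconst : IsContinuationAlong (fun t => h (exp t)) (τ.comp (paramMin s))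
              (fun _ t => h (exp t)) := by
            refine ⟨EventuallyEq.rfl, fun s' => ?_, fun s' => Eventually.of_forall fun _ =>
              EventuallyEq.rfl⟩
            refine AnalyticAt.fun_comp (f := exp) ?_ (by fun_prop)
            change AnalyticAt ℂ h (exp (τ (min s' s)))
            rw [hτle]
            exact hd.analyticAt (Metric.isOpen_ball.mem_nhds (hball s le_rfl))
          intro s' hs'
          have := hu.unique hconst s'
          have hmin : paramMin s s' = s' := min_eq_left hs'
          simpa only [ContinuousMap.comp_apply, hmin] using this
        filter_upwards [hg.coherent s, τ.continuous.continuousAt.eventually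
          (hg0 s le_rfl).eventually_nhds] with s' h1 h2
        rw [if_pos le_rfl]
        split_ifs with hs'
        · rfl
        · rw [not_le] at hs'
          have h3 : g s' =ᶠ[𝓝 (τ s')] fun t => h (exp t) := h1.trans h2
          have h4 : Tendsto (logAt (τ s')) (𝓝 (γ s')) (𝓝 (τ s')) := by
            have := (analyticAt_logAt (τ s')).continuousAt.tendsto
            rwa [logAt_exp_self, hexp' s' hs'.le] at this
          have hγ0 : γ s' ≠ 0 := by rw [← hexp' s' hs'.le]; exact Complex.exp_ne_zero _
          filter_upwards [h4.eventually h3, isOpen_ne.mem_nhds hγ0] with z hz hz0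
          rw [hz, exp_logAt hz0]
      · filter_upwards [hlog s hs.le, hg.coherent s, Ioi_mem_nhds hs] with s' h1 h2 h3
        rw [if_neg (not_le.2 hs), if_neg (not_le.2 h3)]
        obtain ⟨h4, h5⟩ := h1 (le_of_lt h3)
        filter_upwards [h4, h5.eventually h2] with z e1 e2
        rw [← e1, e2]
  · obtain ⟨s₀, hs₀, harc, hτ⟩ := hlift γ hγ
    obtain ⟨τ, hτ1, hexp, hre, hτS⟩ := hτ t₀ hγ1.symm
    obtain ⟨g', hg', hgr⟩ := hc τ hre hτS
    obtain ⟨k, hk, hke, hkb⟩ := hgr ρ α β (fun t ht hS => by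
      have := hsec t ht _ hS
      rw [dist_self] at this
      linarith) (by rwa [hτ1])
    refine ⟨k, hk, ?_, hkb⟩
    rw [hτ1] at hke
    refine hke.trans ?_
    have hball : ∀ s ≤ s₀, γ s ∈ Metric.ball (0 : ℂ) r := fun s hs => by
      rw [mem_ball_zero_iff]
      exact (harc s hs).trans_le (min_le_left _ _)
    have hgs₀ : g s₀ =ᶠ[𝓝 (γ s₀)] h := by
      have hu := hg.comp_path (paramMin s₀) (f' := h) (by
        have : paramMin s₀ 0 = 0 := min_eq_left hs₀.le
        rw [this]
        exact hg.start)
      have hconst : IsContinuationAlong h (γ.comp (paramMin s₀)) (fun _ => h) :=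
        ⟨EventuallyEq.rfl, fun s' => hd.analyticAt (Metric.isOpen_ball.mem_nhds
          (hball _ (min_le_right _ _))), fun s' => Eventually.of_forall fun _ => EventuallyEq.rfl⟩
      have := hu.unique hconst s₀
      have hmin : paramMin s₀ s₀ = s₀ := min_self s₀
      simpa only [ContinuousMap.comp_apply, hmin] using this
    have htend : ∀ s, Tendsto exp (𝓝 (τ s)) (𝓝 (γ (max s s₀))) := fun s => by
      rw [← hexp s]
      exact Complex.continuous_exp.tendsto _
    -- Pulled back by the exponential, the given continuation is one along the lifted path; by
    -- uniqueness it agrees with the continuation that comes with a sectorial bound.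
    have hpull : IsContinuationAlong (fun t => h (exp t)) τ
        (fun s t => g (max s s₀) (exp t)) := by
      refine ⟨?_, fun s => ?_, fun s => ?_⟩
      · have := (htend 0).eventually (by
          rw [max_eq_right hs₀.le]; exact hgs₀)
        rw [max_eq_right hs₀.le]
        exact this
      · refine AnalyticAt.fun_comp (f := exp) ?_ (by fun_prop)
        rw [hexp]
        exact hg.analytic _
      · have := (paramMax s₀).continuous.continuousAt.eventually (hg.coherent (paramMax s₀ s))
        filter_upwards [this] with s' hs'
        exact (htend s').eventually hs'
    have := hg'.unique hpull 1
    rw [hτ1, max_eq_left unitInterval.le_one'] at this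
    exact this

end LevelOne

end

noncomputable section

namespace LevelOne

/-! ### The monodromy operator and expansions in powers of the logarithm -/

/-- The period of the exponential. -/
def period : ℂ := 2 * Real.pi * I

lemma period_ne_zero : period ≠ 0 := Complex.two_pi_I_ne_zero

/-- The monodromy operator `G ↦ G(· + 2πi)` on functions of `t = ln ξ`. -/
def monodromy : Module.End ℂ (ℂ → ℂ) := LinearMap.funLeft ℂ ℂ fun t => t + period

@[simp] lemma monodromy_apply (G : ℂ → ℂ) (t : ℂ) : monodromy G t = G (t + period) := rfl

/-- The Newton polynomials for the step `2πi`. -/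
def newtonPoly (m : ℕ) : Polynomial ℂ :=
  ∏ j ∈ Finset.range m, (Polynomial.X - Polynomial.C (j * period))

lemma newtonPoly_natDegree (m : ℕ) : (newtonPoly m).natDegree = m := by
  rw [newtonPoly, Polynomial.natDegree_prod_of_monic _ _ fun j _ => Polynomial.monic_X_sub_C _]
  simp only [Polynomial.natDegree_X_sub_C]
  simp

/-- In this basis the difference operator with step `2πi` acts as differentiation acts on powers, so
it is inverted by dividing coefficients. -/
lemma newtonPoly_step (m : ℕ) (t : ℂ) : (newtonPoly (m + 1)).eval (t + period) -
    (newtonPoly (m + 1)).eval t = (m + 1) * period * (newtonPoly m).eval t := by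
  have h1 : (newtonPoly (m + 1)).eval (t + period) = (newtonPoly m).eval t * (t + period) := by
    simp only [newtonPoly, Polynomial.eval_prod, Polynomial.eval_sub, Polynomial.eval_X,
      Polynomial.eval_C]
    rw [Finset.prod_range_succ']
    congr 1
    · refine Finset.prod_congr rfl fun j _ => ?_
      push_cast
      ring
    · simp
  have h2 : (newtonPoly (m + 1)).eval t = (newtonPoly m).eval t * (t - m * period) := by
    simp only [newtonPoly, Polynomial.eval_prod, Polynomial.eval_sub, Polynomial.eval_X,
      Polynomial.eval_C]
    rw [Finset.prod_range_succ]
  rw [h1, h2]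
  ring

/-- Functions killed by a power of `T - ζ` are polynomials in `t` with multipliers. -/
theorem exists_expansion_of_ker {ζ : ℂ} (hζ : ζ ≠ 0) (N : ℕ) {f : ℂ → ℂ}
    (hf : ((monodromy - algebraMap ℂ (Module.End ℂ (ℂ → ℂ)) ζ) ^ N) f = 0) :
    ∃ X : ℕ → ℂ → ℂ, (∀ m t, X m (t + period) = ζ * X m t) ∧ (∀ m, N ≤ m → X m = 0) ∧
      ∀ t, f t = ∑ m ∈ Finset.range N, t ^ m * X m t := by
  -- the expansion in the Newton basis
  have newton : ∀ N : ℕ, ∀ f : ℂ → ℂ,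
      ((monodromy - algebraMap ℂ (Module.End ℂ (ℂ → ℂ)) ζ) ^ N) f = 0 →
      ∃ Y : ℕ → ℂ → ℂ, (∀ m t, Y m (t + period) = ζ * Y m t) ∧
        ∀ t, f t = ∑ m ∈ Finset.range N, (newtonPoly m).eval t * Y m t := by
    intro N
    induction N with
    | zero =>
      intro f hf
      refine ⟨fun _ _ => 0, by simp, fun t => ?_⟩
      simpa using congrFun hf t
    | succ N ih =>
      intro f hf
      rw [pow_succ, Module.End.mul_apply] at hf
      obtain ⟨Y, hY, hsum⟩ := ih _ hf
      -- `R` is chosen so that `(T - ζ) R = (T - ζ) f`; then `f - R` is a multiplier and becomes the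
      -- coefficient of degree zero.
      set R : ℂ → ℂ := fun t => ∑ m ∈ Finset.range N,
        (newtonPoly (m + 1)).eval t * ((ζ * ((m + 1) * period))⁻¹ * Y m t) with hR
      refine ⟨fun m => if m = 0 then fun t => f t - R t else
        fun t => (ζ * ((((m - 1 : ℕ) : ℂ) + 1) * period))⁻¹ * Y (m - 1) t, ?_, ?_⟩
      · intro m t
        by_cases hm : m = 0
        · simp only [hm, if_true]
          have h1 : f (t + period) - ζ * f t =
              ∑ m ∈ Finset.range N, (newtonPoly m).eval t * Y m t := by
            rw [← hsum t]
            simp [Module.algebraMap_end_apply]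
          have h2 : R (t + period) - ζ * R t =
              ∑ m ∈ Finset.range N, (newtonPoly m).eval t * Y m t := by
            rw [hR]
            simp only [Finset.mul_sum]
            rw [← Finset.sum_sub_distrib]
            refine Finset.sum_congr rfl fun m _ => ?_
            have hm1 : ((m : ℂ) + 1) ≠ 0 := Nat.cast_add_one_ne_zero m
            have := newtonPoly_step m t
            rw [hY, ← mul_right_inj' (mul_ne_zero hm1 period_ne_zero), eq_comm, ← mul_assoc,
              ← this]
            have hp := period_ne_zero
            field_simp
          linear_combination h1 - h2
        · simp only [hm, if_false, hY]
          ring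
      · intro t
        rw [Finset.sum_range_succ']
        simp only [Nat.add_eq_zero_iff, one_ne_zero, and_false, if_false, if_true,
          Nat.add_sub_cancel]
        have : (newtonPoly 0).eval t = 1 := by simp [newtonPoly]
        rw [this, one_mul, hR]
        ring
  obtain ⟨Y, hY, hsum⟩ := newton N f hf
  refine ⟨fun j t => ∑ m ∈ Finset.range N, (newtonPoly m).coeff j * Y m t, fun j t => ?_,
    fun j hj => ?_, fun t => ?_⟩
  · rw [Finset.mul_sum]
    refine Finset.sum_congr rfl fun m _ => ?_
    rw [hY]
    ring
  · funext t
    refine Finset.sum_eq_zero fun m hm => ?_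
    rw [Polynomial.coeff_eq_zero_of_natDegree_lt, zero_mul]
    rw [newtonPoly_natDegree]
    exact lt_of_lt_of_le (Finset.mem_range.1 hm) hj
  · rw [hsum t]
    simp only [Finset.mul_sum]
    rw [Finset.sum_comm]
    refine Finset.sum_congr rfl fun m hm => ?_
    rw [Polynomial.eval_eq_sum_range' (n := N) (by
      rw [newtonPoly_natDegree]; exact Finset.mem_range.1 hm), Finset.sum_mul]
    refine Finset.sum_congr rfl fun j _ => ?_
    ring

/-- The effect of `T - ζ` on a polynomial in `t` with multipliers. -/
lemma monodromy_sub_apply_sum {ζ : ℂ} {X : ℕ → ℂ → ℂ}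
    (hX : ∀ m t, X m (t + period) = ζ * X m t) (N : ℕ) :
    ∃ X' : ℕ → ℂ → ℂ, (∀ m t, X' m (t + period) = ζ * X' m t) ∧
      ((monodromy - algebraMap ℂ (Module.End ℂ (ℂ → ℂ)) ζ)
        fun t => ∑ m ∈ Finset.range (N + 1), t ^ m * X m t) =
        (fun t => ∑ m ∈ Finset.range N, t ^ m * X' m t) ∧
      ∀ M, N = M + 1 → ∀ t, X' M t = ζ * (N * period) * X N t := by
  set c : ℕ → ℕ → ℂ := fun k m => if m < k then (k.choose m : ℂ) * period ^ (k - m) else 0 with hc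
  have hbin : ∀ k ∈ Finset.range (N + 1), ∀ t : ℂ, (t + period) ^ k - t ^ k =
      ∑ m ∈ Finset.range N, t ^ m * c k m := by
    intro k hk t
    have hkN : k ≤ N := Nat.lt_succ_iff.1 (Finset.mem_range.1 hk)
    rw [add_pow, Finset.sum_range_succ]
    simp only [Nat.sub_self, pow_zero, mul_one, Nat.choose_self, Nat.cast_one, add_sub_cancel_right]
    rw [← Finset.sum_subset (Finset.range_mono hkN)]
    · refine Finset.sum_congr rfl fun m hm => ?_
      rw [hc]
      simp only [Finset.mem_range.1 hm, if_true]
      ring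
    · intro m _ hm
      simp only [Finset.mem_range] at hm
      simp [hc, hm]
  refine ⟨fun m t => ζ * ∑ k ∈ Finset.range (N + 1), c k m * X k t, fun m t => ?_, ?_, ?_⟩
  · simp only [hX, Finset.mul_sum]
    refine Finset.sum_congr rfl fun k _ => ?_
    ring
  · funext t
    have : ∀ k ∈ Finset.range (N + 1), (t + period) ^ k * (ζ * X k t) - ζ * (t ^ k * X k t) =
        ∑ m ∈ Finset.range N, t ^ m * (ζ * (c k m * X k t)) := fun k hk => by
      rw [show (t + period) ^ k * (ζ * X k t) - ζ * (t ^ k * X k t) =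
        ((t + period) ^ k - t ^ k) * (ζ * X k t) by ring, hbin k hk t, Finset.sum_mul]
      refine Finset.sum_congr rfl fun m _ => ?_
      ring
    simp only [LinearMap.sub_apply, Pi.sub_apply, monodromy_apply, Module.algebraMap_end_apply,
      Pi.smul_apply, smul_eq_mul, hX, Finset.mul_sum]
    rw [← Finset.sum_sub_distrib, Finset.sum_congr rfl this, Finset.sum_comm]
  · rintro M rfl t
    change ζ * ∑ k ∈ Finset.range (M + 1 + 1), c k M * X k t = _
    rw [Finset.sum_range_succ, Finset.sum_eq_zero, zero_add]
    · simp only [hc, Nat.lt_succ_self, if_true, Nat.choose_succ_self_right,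
        Nat.add_sub_cancel_left, pow_one]
      ring
    · intro k hk
      have : ¬ M < k := not_lt.2 (Nat.lt_succ_iff.1 (Finset.mem_range.1 hk))
      simp [hc, this]

lemma monodromy_sub_pow_apply_sum {ζ : ℂ} (N : ℕ) : ∀ {X : ℕ → ℂ → ℂ},
    (∀ m t, X m (t + period) = ζ * X m t) →
      ((monodromy - algebraMap ℂ (Module.End ℂ (ℂ → ℂ)) ζ) ^ N)
        (fun t => ∑ m ∈ Finset.range N, t ^ m * X m t) = 0 := by
  induction N with
  | zero => intro X _; funext t; simp
  | succ N ih =>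
    intro X hX
    obtain ⟨X', hX', he, -⟩ := monodromy_sub_apply_sum hX N
    rw [pow_succ, Module.End.mul_apply, he, ih hX']

section Extraction

variable {𝒱 : Submodule ℂ (ℂ → ℂ)} (hT : ∀ G ∈ 𝒱, monodromy G ∈ 𝒱)
  (ht : ∀ G ∈ 𝒱, (fun t => t * G t) ∈ 𝒱)

include hT in
lemma aeval_monodromy_mem (P : Polynomial ℂ) {G : ℂ → ℂ} (hG : G ∈ 𝒱) :
    (Polynomial.aeval monodromy P) G ∈ 𝒱 := by
  induction P using Polynomial.induction_on with
  | C a => simpa [Module.algebraMap_end_apply] using 𝒱.smul_mem a hG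
  | add p q hp hq => simpa using 𝒱.add_mem hp hq
  | monomial n a h =>
    have : (Polynomial.aeval monodromy (Polynomial.C a * Polynomial.X ^ (n + 1))) G =
        monodromy ((Polynomial.aeval monodromy (Polynomial.C a * Polynomial.X ^ n)) G) := by
      rw [pow_succ', ← mul_assoc, mul_comm (Polynomial.C a), mul_assoc, map_mul,
        Polynomial.aeval_X, Module.End.mul_apply]
    rw [this]
    exact hT _ h

include ht in
lemma pow_mul_mem (m : ℕ) {G : ℂ → ℂ} (hG : G ∈ 𝒱) : (fun t => t ^ m * G t) ∈ 𝒱 := by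
  induction m with
  | zero => simpa using hG
  | succ m ih =>
    have := ht _ ih
    convert this using 1
    funext t
    ring

-- `T - ζ` lowers the degree in `t` by one and multiplies the top coefficient by the nonzero number
-- `ζ N · 2πi`. By induction the top coefficient is in the space; its term is then subtracted and
-- the lower ones follow.
include hT ht in
lemma extraction_single {ζ : ℂ} (hζ : ζ ≠ 0) (N : ℕ) : ∀ {X : ℕ → ℂ → ℂ},
    (∀ m t, X m (t + period) = ζ * X m t) →
    (fun t => ∑ m ∈ Finset.range N, t ^ m * X m t) ∈ 𝒱 → ∀ m < N, X m ∈ 𝒱 := by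
  induction N with
  | zero => intro X _ _ m hm; omega
  | succ N ih =>
    intro X hX hG
    obtain ⟨X', hX', he, htop⟩ := monodromy_sub_apply_sum hX N
    have h1 : (fun t => ∑ m ∈ Finset.range N, t ^ m * X' m t) ∈ 𝒱 := by
      rw [← he, LinearMap.sub_apply, Module.algebraMap_end_apply]
      exact 𝒱.sub_mem (hT _ hG) (𝒱.smul_mem _ hG)
    have hN : X N ∈ 𝒱 := by
      rcases N with _ | M
      · simpa using hG
      · have h2 := ih hX' h1 M (Nat.lt_succ_self M)
        have hne : ζ * (((M + 1 : ℕ) : ℂ) * period) ≠ 0 :=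
          mul_ne_zero hζ (mul_ne_zero (Nat.cast_ne_zero.2 (Nat.succ_ne_zero M)) period_ne_zero)
        have h3 := 𝒱.smul_mem (ζ * (((M + 1 : ℕ) : ℂ) * period))⁻¹ h2
        convert h3 using 1
        funext t
        rw [Pi.smul_apply, smul_eq_mul, htop M rfl t, inv_mul_cancel_left₀ hne]
    intro m hm
    rcases Nat.lt_succ_iff_lt_or_eq.1 hm with h | rfl
    · refine ih hX ?_ m h
      have := 𝒱.sub_mem hG (pow_mul_mem ht N hN)
      convert this using 1
      funext t
      simp [Finset.sum_range_succ]
    · exact hN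

lemma isCoprime_X_sub_C_pow {ζ ζ' : ℂ} (h : ζ ≠ ζ') (N N' : ℕ) :
    IsCoprime ((Polynomial.X - Polynomial.C ζ) ^ N) ((Polynomial.X - Polynomial.C ζ') ^ N') :=
  (Polynomial.isCoprime_X_sub_C_of_isUnit_sub (sub_ne_zero.2 h).isUnit).pow

lemma aeval_monodromy_X_sub_C_pow (ζ : ℂ) (N : ℕ) :
    Polynomial.aeval monodromy ((Polynomial.X - Polynomial.C ζ) ^ N) =
      (monodromy - algebraMap ℂ (Module.End ℂ (ℂ → ℂ)) ζ) ^ N := by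
  simp

variable {α : Type*} [DecidableEq α]

include hT ht in
/-- In an expansion in multipliers and powers of `t`, the coefficients inherit every property
that is linear and stable under monodromy and under multiplication by `t`. -/
theorem extraction {s : Finset α} {ζ : α → ℂ} (hinj : Set.InjOn ζ s) (hζ : ∀ i ∈ s, ζ i ≠ 0)
    {N : ℕ} {X : α → ℕ → ℂ → ℂ} (hX : ∀ i ∈ s, ∀ m t, X i m (t + period) = ζ i * X i m t)
    (hG : (fun t => ∑ i ∈ s, ∑ m ∈ Finset.range N, t ^ m * X i m t) ∈ 𝒱) :
    ∀ i ∈ s, ∀ m < N, X i m ∈ 𝒱 := by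
  intro i hi
  refine extraction_single hT ht (hζ i hi) N (hX i hi) ?_
  set G : α → ℂ → ℂ := fun i t => ∑ m ∈ Finset.range N, t ^ m * X i m t with hGdef
  set p := (Polynomial.X - Polynomial.C (ζ i)) ^ N with hp
  set q := ∏ j ∈ s.erase i, (Polynomial.X - Polynomial.C (ζ j)) ^ N with hq
  have hcop : IsCoprime p q := IsCoprime.prod_right fun j hj =>
    isCoprime_X_sub_C_pow (fun h => (Finset.ne_of_mem_erase hj)
      (hinj (Finset.mem_of_mem_erase hj) hi h.symm)) N N
  -- By Bézout, `b * q` evaluated at `T` is the projection onto the part with multiplier `ζ i`: it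
  -- kills the other parts and fixes this one.
  obtain ⟨a, b, hab⟩ := hcop
  have hker : ∀ j ∈ s,
      Polynomial.aeval monodromy ((Polynomial.X - Polynomial.C (ζ j)) ^ N) (G j) = 0 := by
    intro j hj
    rw [aeval_monodromy_X_sub_C_pow]
    exact monodromy_sub_pow_apply_sum N (hX j hj)
  have hqj : ∀ j ∈ s.erase i, Polynomial.aeval monodromy (b * q) (G j) = 0 := by
    intro j hj
    obtain ⟨q', hq'⟩ : (Polynomial.X - Polynomial.C (ζ j)) ^ N ∣ q :=
      Finset.dvd_prod_of_mem (fun j => (Polynomial.X - Polynomial.C (ζ j)) ^ N) hj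
    rw [hq', mul_comm ((Polynomial.X - Polynomial.C (ζ j)) ^ N) q', ← mul_assoc, map_mul,
      Module.End.mul_apply, hker j (Finset.mem_of_mem_erase hj), map_zero]
  have h1 : Polynomial.aeval monodromy (b * q) (fun t => ∑ i ∈ s, G i t) = G i := by
    have hsum : (fun t => ∑ i ∈ s, G i t) = ∑ i ∈ s, G i := by
      funext t; rw [Finset.sum_apply]
    rw [hsum, ← Finset.add_sum_erase s G hi, map_add, map_sum, Finset.sum_eq_zero hqj, add_zero]
    have h2 : Polynomial.aeval monodromy (a * p + b * q) (G i) = G i := by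
      rw [hab]; simp
    rw [map_add, LinearMap.add_apply, map_mul, Module.End.mul_apply, hker i hi, map_zero,
      zero_add] at h2
    exact h2
  change G i ∈ 𝒱
  rw [← h1]
  exact aeval_monodromy_mem hT _ hG

/-- Functions killed by a product of powers of `T - ζᵢ` have an expansion in multipliers and
powers of `t`. -/
theorem exists_expansion {s : Finset α} {ζ : α → ℂ} (hinj : Set.InjOn ζ s)
    (hζ : ∀ i ∈ s, ζ i ≠ 0) (N : α → ℕ) {f : ℂ → ℂ}
    (hf : Polynomial.aeval monodromy (∏ i ∈ s, (Polynomial.X - Polynomial.C (ζ i)) ^ N i) f = 0) :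
    ∃ X : α → ℕ → ℂ → ℂ, (∀ i ∈ s, ∀ m t, X i m (t + period) = ζ i * X i m t) ∧
      (∀ i ∈ s, ∀ m, N i ≤ m → X i m = 0) ∧
      ∀ t, f t = ∑ i ∈ s, ∑ m ∈ Finset.range (N i), t ^ m * X i m t := by
  induction s using Finset.induction_on generalizing f with
  | empty =>
    refine ⟨fun _ _ _ => 0, by simp, by simp, fun t => ?_⟩
    simpa using congrFun hf t
  | insert i s his ih =>
    rw [Finset.prod_insert his] at hf
    have hcop : IsCoprime ((Polynomial.X - Polynomial.C (ζ i)) ^ N i)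
        (∏ j ∈ s, (Polynomial.X - Polynomial.C (ζ j)) ^ N j) := IsCoprime.prod_right fun j hj =>
      isCoprime_X_sub_C_pow (fun h => his (by
        rw [hinj (Finset.mem_insert_self i s) (Finset.mem_insert_of_mem hj) h]; exact hj)) _ _
    -- For coprime factors the kernel of the product is the sum of the kernels, so one multiplier is
    -- split off at a time.
    have hmem : f ∈ LinearMap.ker (Polynomial.aeval monodromy
        ((Polynomial.X - Polynomial.C (ζ i)) ^ N i)) ⊔ LinearMap.ker (Polynomial.aeval monodromy
        (∏ j ∈ s, (Polynomial.X - Polynomial.C (ζ j)) ^ N j)) := by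
      rw [Polynomial.sup_ker_aeval_eq_ker_aeval_mul_of_coprime _ hcop]
      exact hf
    obtain ⟨u, hu, v, hv, rfl⟩ := Submodule.mem_sup.1 hmem
    obtain ⟨X, hX, hX0, hXs⟩ := ih (hinj.mono (by simp))
      (fun j hj => hζ j (Finset.mem_insert_of_mem hj)) hv
    rw [LinearMap.mem_ker, aeval_monodromy_X_sub_C_pow] at hu
    obtain ⟨Y, hY, hY0, hYs⟩ := exists_expansion_of_ker (hζ i (Finset.mem_insert_self i s)) _ hu
    have hne : ∀ j ∈ s, j ≠ i := fun j hj h => his (h ▸ hj)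
    refine ⟨fun j => if j = i then Y else X j, ?_, ?_, fun t => ?_⟩
    · intro j hj m t
      rcases Finset.mem_insert.1 hj with rfl | hj
      · simpa using hY m t
      · simpa [hne j hj] using hX j hj m t
    · intro j hj m hm
      rcases Finset.mem_insert.1 hj with rfl | hj
      · simpa using hY0 m hm
      · simpa [hne j hj] using hX0 j hj m hm
    · rw [Finset.sum_insert his, Pi.add_apply, hYs t, hXs t]
      congr 1
      · simp
      · refine Finset.sum_congr rfl fun j hj => ?_
        simp [hne j hj]

end Extraction

end LevelOne

end

noncomputable section

namespace LevelOne

/-! ### Orders of vanishing on the Riemann surface of the logarithm -/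

section Dec

variable {P F : Type*} [NormedAddCommGroup F] [NormedSpace ℂ F]

/-- The family `G(·, z)`, `z ∈ A`, of functions of `t = ln ξ` is uniformly `O(|ξ|^σ')`, for every
`σ' < σ`, on sectors of bounded opening at `ξ = 0`. -/
def Dec (A : Set P) (σ : ℝ) (G : ℂ → P → F) : Prop :=
  ∀ σ' < σ, ∀ Y : ℝ, ∃ C x₀ : ℝ, 0 ≤ C ∧ ∀ t : ℂ, t.re ≤ x₀ → |t.im| ≤ Y → ∀ z ∈ A,
    ‖G t z‖ ≤ C * Real.exp (σ' * t.re)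

variable {A : Set P} {σ τ : ℝ} {G H : ℂ → P → F}

omit [NormedSpace ℂ F] in
lemma Dec.mono_exponent (h : Dec A σ G) (hτ : τ ≤ σ) : Dec A τ G :=
  fun σ' hσ' => h σ' (hσ'.trans_le hτ)

omit [NormedSpace ℂ F] in
/-- Domination by a dominated family. -/
lemma Dec.of_norm_le {P' F' : Type*} [NormedAddCommGroup F'] {B : Set P'} {G' : ℂ → P' → F'}
    (h : Dec B σ G') (K : ℝ) (x₁ : ℝ)
    (hle : ∀ t : ℂ, t.re ≤ x₁ → ∀ z ∈ A, ∃ z' ∈ B, ‖G t z‖ ≤ K * ‖G' t z'‖) : Dec A σ G := by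
  intro σ' hσ' Y
  obtain ⟨C, x₀, hC, hb⟩ := h σ' hσ' Y
  refine ⟨|K| * C, min x₀ x₁, by positivity, fun t ht hY z hz => ?_⟩
  obtain ⟨z', hz', hle'⟩ := hle t (ht.trans (min_le_right _ _)) z hz
  calc ‖G t z‖ ≤ K * ‖G' t z'‖ := hle'
    _ ≤ |K| * ‖G' t z'‖ := by gcongr; exact le_abs_self _
    _ ≤ |K| * (C * Real.exp (σ' * t.re)) := by
        gcongr; exact hb t (ht.trans (min_le_left _ _)) hY z' hz'
    _ = _ := by ring

omit [NormedSpace ℂ F] in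
lemma Dec.congr (h : Dec A σ G) (he : ∀ᶠ t in logZero, ∀ z ∈ A, G t z = H t z) : Dec A σ H := by
  obtain ⟨x₁, hx₁⟩ := eventually_logZero_iff.1 he
  exact h.of_norm_le 1 (x₁ - 1) fun t ht z hz => ⟨z, hz, by
    rw [hx₁ t (by linarith) z hz, one_mul]⟩

omit [NormedSpace ℂ F] in
lemma Dec.add (hG : Dec A σ G) (hH : Dec A σ H) : Dec A σ fun t z => G t z + H t z := by
  intro σ' hσ' Y
  obtain ⟨C, x, hC, h⟩ := hG σ' hσ' Y
  obtain ⟨C', x', hC', h'⟩ := hH σ' hσ' Y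
  refine ⟨C + C', min x x', by positivity, fun t ht hY z hz => ?_⟩
  rw [add_mul]
  exact (norm_add_le _ _).trans (add_le_add (h t (ht.trans (min_le_left _ _)) hY z hz)
    (h' t (ht.trans (min_le_right _ _)) hY z hz))

lemma Dec.const_smul (hG : Dec A σ G) (c : ℂ) : Dec A σ fun t z => c • G t z :=
  hG.of_norm_le ‖c‖ 0 fun _ _ z hz => ⟨z, hz, (norm_smul _ _).le⟩

lemma Dec.sub (hG : Dec A σ G) (hH : Dec A σ H) : Dec A σ fun t z => G t z - H t z := by
  simpa [sub_eq_add_neg] using hG.add (hH.const_smul (-1))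

omit [NormedSpace ℂ F] in
lemma Dec.zero : Dec A σ fun _ _ => (0 : F) :=
  fun _ _ _ => ⟨0, 0, le_rfl, by simp⟩

omit [NormedSpace ℂ F] in
lemma Dec.sum {κ : Type*} (s : Finset κ) {G : κ → ℂ → P → F} (h : ∀ i ∈ s, Dec A σ (G i)) :
    Dec A σ fun t z => ∑ i ∈ s, G i t z := by
  classical
  induction s using Finset.induction_on with
  | empty => simpa using Dec.zero
  | insert i s hi ih =>
    simp only [Finset.sum_insert hi]
    exact (h i (Finset.mem_insert_self i s)).add
      (ih fun j hj => h j (Finset.mem_insert_of_mem hj))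

omit [NormedSpace ℂ F] in
lemma Dec.shift (hG : Dec A σ G) : Dec A σ fun t z => G (t + period) z := by
  intro σ' hσ' Y
  obtain ⟨C, x, hC, h⟩ := hG σ' hσ' (Y + 2 * Real.pi)
  have hre : ∀ t : ℂ, (t + period).re = t.re := fun t => by simp [period]
  have him : ∀ t : ℂ, (t + period).im = t.im + 2 * Real.pi := fun t => by simp [period]
  refine ⟨C, x, hC, fun t ht hY z hz => ?_⟩
  have := h (t + period) (by rwa [hre]) (by
    rw [him]
    refine (abs_add_le _ _).trans (add_le_add hY (le_of_eq (abs_of_pos Real.two_pi_pos)))) z hz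
  rwa [hre] at this

/-- On a set where `Im t` is bounded, `|e^{μ t}|` is comparable with `e^{Re μ · Re t}`; the constant
depends on the width of the set only. -/
lemma Dec.exp_smul (hG : Dec A σ G) (μ : ℂ) :
    Dec A (σ + μ.re) fun t z => exp (μ * t) • G t z := by
  intro σ' hσ' Y
  obtain ⟨C, x, hC, h⟩ := hG (σ' - μ.re) (by linarith) Y
  refine ⟨C * Real.exp (|μ.im| * Y), x, by positivity, fun t ht hY z hz => ?_⟩
  rw [norm_smul, Complex.norm_exp]
  have h1 : (μ * t).re ≤ μ.re * t.re + |μ.im| * Y := by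
    rw [Complex.mul_re]
    have : -(μ.im * t.im) ≤ |μ.im| * Y := (neg_le_abs _).trans (by rw [abs_mul]; gcongr)
    linarith
  calc Real.exp (μ * t).re * ‖G t z‖
      ≤ Real.exp (μ.re * t.re + |μ.im| * Y) * (C * Real.exp ((σ' - μ.re) * t.re)) := by
        gcongr
        exact h t ht hY z hz
    _ = C * Real.exp (|μ.im| * Y) *
        (Real.exp (μ.re * t.re) * Real.exp ((σ' - μ.re) * t.re)) := by
          rw [Real.exp_add]; ring
    _ = _ := by rw [← Real.exp_add]; congr 2; ring

/-- A factor `ln ξ` costs an arbitrarily small power of `ξ`. This is why orders are defined through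
all `σ' < σ`: powers of the logarithm do not change them. -/
lemma Dec.t_smul (hG : Dec A σ G) : Dec A σ fun t z => t • G t z := by
  intro σ' hσ' Y
  obtain ⟨C, x, hC, h⟩ := hG ((σ' + σ) / 2) (by linarith) Y
  set ε := (σ - σ') / 2 with hε
  have hε0 : 0 < ε := by linarith
  refine ⟨(1 / ε + |Y|) * C, min x 0, by positivity, fun t ht hY z hz => ?_⟩
  have ht0 : t.re ≤ 0 := ht.trans (min_le_right _ _)
  have h1 : ‖t‖ ≤ (1 / ε + |Y|) * Real.exp (-(ε * t.re)) := by
    have h2 : -(ε * t.re) ≤ Real.exp (-(ε * t.re)) := by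
      linarith [Real.add_one_le_exp (-(ε * t.re))]
    have h3 : 1 ≤ Real.exp (-(ε * t.re)) := by
      rw [Real.one_le_exp_iff]
      nlinarith
    have h4 : |t.re| ≤ 1 / ε * Real.exp (-(ε * t.re)) := by
      rw [abs_of_nonpos ht0, one_div, ← div_eq_inv_mul, le_div_iff₀ hε0]
      linarith
    calc ‖t‖ ≤ |t.re| + |t.im| := Complex.norm_le_abs_re_add_abs_im t
      _ ≤ 1 / ε * Real.exp (-(ε * t.re)) + |Y| * Real.exp (-(ε * t.re)) := by
          refine add_le_add h4 ((hY.trans (le_abs_self Y)).trans ?_)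
          exact le_mul_of_one_le_right (abs_nonneg _) h3
      _ = _ := by ring
  rw [norm_smul]
  calc ‖t‖ * ‖G t z‖ ≤ ((1 / ε + |Y|) * Real.exp (-(ε * t.re))) *
        (C * Real.exp ((σ' + σ) / 2 * t.re)) := by
        gcongr
        exact h t (ht.trans (min_le_left _ _)) hY z hz
    _ = (1 / ε + |Y|) * C * (Real.exp (-(ε * t.re)) * Real.exp ((σ' + σ) / 2 * t.re)) := by ring
    _ = _ := by rw [← Real.exp_add, hε]; congr 2; ring

/-- The increment along a horizontal line. -/
lemma norm_sub_le_of_deriv_le_exp {f f' : ℂ → F} {x₁ σ C : ℝ} (hσ : σ ≠ 0) {y a b : ℝ}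
    (hab : a ≤ b) (hb : b ≤ x₁) (hd : ∀ t : ℂ, t.re ≤ x₁ → HasDerivAt f (f' t) t)
    (hle : ∀ x : ℝ, x ≤ x₁ → ‖f' (x + y * I)‖ ≤ C * Real.exp (σ * x)) :
    ‖f (b + y * I) - f (a + y * I)‖ ≤ C / σ * (Real.exp (σ * b) - Real.exp (σ * a)) := by
  have hline : ∀ x : ℝ, HasDerivAt (fun x : ℝ => (x : ℂ) + y * I) 1 x := fun x => by
    simpa using (Complex.ofRealCLM.hasDerivAt (x := x)).add_const ((y : ℂ) * I)
  have hre : ∀ x : ℝ, ((x : ℂ) + y * I).re = x := fun x => by simp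
  have hd' : ∀ x : ℝ, x ≤ x₁ → HasDerivAt (fun x : ℝ => f (x + y * I) - f (a + y * I))
      (f' (x + y * I)) x := fun x hx => by
    have := (hd (x + y * I) (by rwa [hre])).scomp x (hline x)
    simpa using this.sub_const (f (a + y * I))
  refine image_norm_le_of_norm_deriv_right_le_deriv_boundary (a := a) (b := b)
    (f := fun x : ℝ => f (x + y * I) - f (a + y * I)) (f' := fun x : ℝ => f' (x + y * I))
    (B := fun x => C / σ * (Real.exp (σ * x) - Real.exp (σ * a)))
    (B' := fun x => C * Real.exp (σ * x)) ?_ ?_ ?_ ?_ ?_ ⟨hab, le_rfl⟩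
  · exact fun x hx => (hd' x (hx.2.trans hb)).continuousAt.continuousWithinAt
  · exact fun x hx => (hd' x (hx.2.le.trans hb)).hasDerivWithinAt
  · simp
  · intro x
    have h1 : HasDerivAt (fun x : ℝ => Real.exp (σ * x)) (Real.exp (σ * x) * σ) x := by
      simpa using ((hasDerivAt_id x).const_mul σ).exp
    refine ((h1.sub_const (Real.exp (σ * a))).const_mul (C / σ)).congr_deriv ?_
    field_simp
  · exact fun x hx => hle x (hx.2.le.trans hb)

lemma eq_re_add_im (t : ℂ) : t = ((t.re : ℂ) + t.im * I) := (Complex.re_add_im t).symm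

lemma tendsto_exp_mul_atBot {σ : ℝ} (hσ : 0 < σ) (C : ℝ) :
    Tendsto (fun x : ℝ => C * Real.exp (σ * x)) atBot (𝓝 0) := by
  have : Tendsto (fun x : ℝ => σ * x) atBot atBot := tendsto_id.const_mul_atBot hσ
  simpa using (Real.tendsto_exp_atBot.comp this).const_mul C

/-- Integration of dominated families. -/
lemma Dec.of_hasDerivAt {G' : ℂ → P → F} {x₁ s : ℝ}
    (hd : ∀ z ∈ A, ∀ t : ℂ, t.re < x₁ → HasDerivAt (fun τ => G τ z) (G' t z) t)
    (h' : Dec A s G')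
    (h : (s ≤ 0 ∧ ∀ x < x₁, ∀ Y : ℝ, ∃ C, ∀ y : ℝ, |y| ≤ Y → ∀ z ∈ A, ‖G (x + y * I) z‖ ≤ C) ∨
      ∃ s₀ > 0, Dec A s₀ G) : Dec A s G := by
  -- For `s ≤ 0` the derivative is integrated from the vertical line `Re t = x₂`; the bounded values
  -- on that line are absorbed by `e^{σ Re t}`, as `σ < 0`.
  by_cases hs : s ≤ 0
  · rcases h with ⟨-, h⟩ | ⟨s₀, hs₀, h⟩
    swap
    · exact h.mono_exponent (hs.trans hs₀.le)
    intro σ hσ Y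
    obtain ⟨C, x₀, hC, hb⟩ := h' σ hσ Y
    have hσ0 : σ < 0 := hσ.trans_le hs
    set x₂ := min x₀ (x₁ - 1) with hx₂
    obtain ⟨C₁, hC₁⟩ := h x₂ ((min_le_right _ _).trans_lt (by linarith)) Y
    refine ⟨|C₁| * Real.exp (-(σ * x₂)) + C / (-σ), x₂, by
      have : 0 < -σ := by linarith
      positivity, fun t ht hY z hz => ?_⟩
    have key := norm_sub_le_of_deriv_le_exp (f := fun τ => G τ z) (f' := fun τ => G' τ z)
      (y := t.im) hσ0.ne ht le_rfl (fun t ht => hd z hz t (ht.trans_lt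
        ((min_le_right _ _).trans_lt (by linarith)))) (fun x hx => by
        have := hb (x + t.im * I) (by simpa using hx.trans (min_le_left _ _)) (by simpa) z hz
        simpa using this)
    rw [← eq_re_add_im] at key
    have h1 := hC₁ t.im hY z hz
    have h2 : |C₁| ≤ |C₁| * Real.exp (-(σ * x₂)) * Real.exp (σ * t.re) := by
      rw [mul_assoc, ← Real.exp_add]
      refine le_mul_of_one_le_right (abs_nonneg _) ?_
      rw [Real.one_le_exp_iff]
      nlinarith
    have h3 : C / σ * (Real.exp (σ * x₂) - Real.exp (σ * t.re)) ≤
        C / (-σ) * Real.exp (σ * t.re) := by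
      have h4 : 0 ≤ C / (-σ) := div_nonneg hC (by linarith)
      have h5 : C / σ = -(C / (-σ)) := by rw [div_neg, neg_neg]
      rw [h5]
      nlinarith [Real.exp_pos (σ * x₂)]
    calc ‖G t z‖ = ‖G (x₂ + t.im * I) z - (G (x₂ + t.im * I) z - G t z)‖ := by
          congr 1; abel
      _ ≤ C₁ + C / σ * (Real.exp (σ * x₂) - Real.exp (σ * t.re)) :=
          (norm_sub_le _ _).trans (add_le_add h1 key)
      _ ≤ _ := by
          rw [add_mul]
          exact add_le_add ((le_abs_self C₁).trans h2) h3
  · push Not at hs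
    rcases h with ⟨h0, -⟩ | ⟨s₀, hs₀, h⟩
    · exact absurd hs (not_lt.2 h0)
    intro σ' hσ' Y
    -- For `s > 0` the integration starts at `Re t = -∞`, where the positive order already known
    -- removes the initial value. The maximum keeps the rate positive when `σ'` is not.
    set σ := max σ' (s / 2) with hσdef
    have hσ0 : 0 < σ := lt_max_of_lt_right (by linarith)
    obtain ⟨C, x₀, hC, hb⟩ := h' σ (max_lt hσ' (by linarith)) Y
    obtain ⟨C₀, x₀', hC₀, hb₀⟩ := h (s₀ / 2) (by linarith) Y
    set x₂ := min (min x₀ (x₁ - 1)) 0 with hx₂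
    refine ⟨C / σ, x₂, by positivity, fun t ht hY z hz => ?_⟩
    have ht1 : t.re ≤ min x₀ (x₁ - 1) := ht.trans (min_le_left _ _)
    have ht0 : t.re ≤ 0 := ht.trans (min_le_right _ _)
    have key : ∀ x : ℝ, x ≤ t.re → ‖G t z‖ ≤ C / σ * Real.exp (σ * t.re) + ‖G (x + t.im * I) z‖ := by
      intro x hx
      have key := norm_sub_le_of_deriv_le_exp (f := fun τ => G τ z) (f' := fun τ => G' τ z)
        (y := t.im) hσ0.ne' hx ht1 (fun t ht => hd z hz t (ht.trans_lt
          ((min_le_right _ _).trans_lt (by linarith)))) (fun x hx => by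
          have := hb (x + t.im * I) (by simpa using hx.trans (min_le_left _ _)) (by simpa) z hz
          simpa using this)
      rw [← eq_re_add_im] at key
      have h6 : 0 ≤ C / σ * Real.exp (σ * x) := by positivity
      calc ‖G t z‖ = ‖(G t z - G (x + t.im * I) z) + G (x + t.im * I) z‖ := by congr 1; abel
        _ ≤ _ := norm_add_le _ _
        _ ≤ _ := by gcongr; linarith
    have hlim : Tendsto (fun x : ℝ => C / σ * Real.exp (σ * t.re) +
        C₀ * Real.exp (s₀ / 2 * x)) atBot (𝓝 (C / σ * Real.exp (σ * t.re) + 0)) :=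
      tendsto_const_nhds.add (tendsto_exp_mul_atBot (by linarith) C₀)
    have h7 : ‖G t z‖ ≤ C / σ * Real.exp (σ * t.re) + 0 := by
      refine ge_of_tendsto hlim ?_
      filter_upwards [eventually_le_atBot t.re, eventually_le_atBot x₀'] with x hx hx'
      refine (key x hx).trans ?_
      gcongr
      have := hb₀ (x + t.im * I) (by simpa using hx') (by simpa) z hz
      simpa using this
    rw [add_zero] at h7
    refine h7.trans ?_
    have h8 : σ * t.re ≤ σ' * t.re := mul_le_mul_of_nonpos_right (le_max_left _ _) ht0
    gcongr

end Dec

end LevelOne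

end

/-! ### Orders of single functions and the scalar equation `g' - μ g = ρ` -/

noncomputable section

namespace LevelOne

section Scalar

variable {F : Type*} [NormedAddCommGroup F] [NormedSpace ℂ F]

/-- A single function of `t = ln ξ` is `O(|ξ|^σ')` for every `σ' < σ` at `ξ = 0`. -/
abbrev Decays (σ : ℝ) (G : ℂ → F) : Prop := Dec (Set.univ : Set Unit) σ fun t _ => G t

lemma decays_pi {ι : Type*} [Fintype ι] {σ : ℝ} {G : ℂ → ι → ℂ} :
    Decays σ G ↔ ∀ i, Decays σ fun t => G t i := by
  constructor
  · exact fun h i => h.of_norm_le 1 0 fun t _ z hz => ⟨z, hz, by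
      rw [one_mul]; exact norm_le_pi_norm (G t) i⟩
  · intro h σ' hσ' Y
    choose C x hC hb using fun i => h i σ' hσ' Y
    obtain ⟨x₀, hx₀⟩ : ∃ x₀, ∀ i, x₀ ≤ x i := (Set.finite_range x).bddBelow.imp
      fun _ h i => h ⟨i, rfl⟩
    refine ⟨∑ i, C i, x₀, Finset.sum_nonneg fun i _ => hC i, fun t ht hY z hz => ?_⟩
    have h0 : 0 ≤ ∑ i, C i := Finset.sum_nonneg fun i _ => hC i
    refine (pi_norm_le_iff_of_nonneg (by positivity)).2 fun i => ?_
    refine (hb i t (ht.trans (hx₀ i)) hY z hz).trans ?_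
    gcongr
    exact Finset.single_le_sum (f := C) (fun j _ => hC j) (Finset.mem_univ i)

omit [NormedSpace ℂ F] in
lemma Decays.congr {σ : ℝ} {G H : ℂ → F} (h : Decays σ G) (he : ∀ᶠ t in logZero, G t = H t) :
    Decays σ H := Dec.congr h (he.mono fun _ ht _ _ => ht)

omit [NormedSpace ℂ F] in
lemma Decays.add {σ : ℝ} {G H : ℂ → F} (hG : Decays σ G) (hH : Decays σ H) :
    Decays σ fun t => G t + H t := Dec.add hG hH

lemma Decays.sub {σ : ℝ} {G H : ℂ → F} (hG : Decays σ G) (hH : Decays σ H) :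
    Decays σ fun t => G t - H t := Dec.sub hG hH

lemma Decays.exp_mul {σ : ℝ} {G : ℂ → ℂ} (h : Decays σ G) (μ : ℂ) :
    Decays (σ + μ.re) fun t => exp (μ * t) * G t := h.exp_smul μ

lemma Decays.const_mul {σ : ℝ} {G : ℂ → ℂ} (h : Decays σ G) (c : ℂ) :
    Decays σ fun t => c * G t := h.const_smul c

/-- The functions of order at least `σ` form a space stable under monodromy and under
multiplication by `t`. -/
def decaySubmodule (σ : ℝ) : Submodule ℂ (ℂ → ℂ) where
  carrier := {G | Decays σ G}
  add_mem' := fun h₁ h₂ => Dec.add h₁ h₂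
  zero_mem' := Dec.zero
  smul_mem' := fun c _ h => Dec.const_smul h c

lemma mem_decaySubmodule {σ : ℝ} {G : ℂ → ℂ} : G ∈ decaySubmodule σ ↔ Decays σ G := Iff.rfl

/-- If `f'` has positive order, then `f` has a limit. -/
lemma exists_limit_of_deriv_decays {f f' : ℂ → ℂ} {x₁ s : ℝ} (hs : 0 < s)
    (hd : ∀ t : ℂ, t.re < x₁ → HasDerivAt f (f' t) t) (h' : Decays s f') :
    ∃ c, Decays s fun t => f t - c := by
  -- it suffices to have a limit of some positive order
  suffices h : ∃ c, Decays (s / 2) fun t => f t - c by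
    obtain ⟨c, hc⟩ := h
    refine ⟨c, Dec.of_hasDerivAt (G := fun t (_ : Unit) => f t - c) (G' := fun t _ => f' t)
      (x₁ := x₁) (fun _ _ t ht => (hd t ht).sub_const c) h' (Or.inr ⟨s / 2, by linarith, hc⟩)⟩
  obtain ⟨C, x₀, hC, hb⟩ := h' (s / 2) (by linarith) 0
  set σ := s / 2 with hσ
  have hσ0 : 0 < σ := by linarith
  set x₂ := min x₀ (x₁ - 1) with hx₂
  have hd' : ∀ t : ℂ, t.re ≤ x₂ → HasDerivAt f (f' t) t := fun t ht =>
    hd t (ht.trans_lt ((min_le_right _ _).trans_lt (by linarith)))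
  have hinc : ∀ a b : ℝ, a ≤ b → b ≤ x₂ → ‖f b - f a‖ ≤ C / σ * Real.exp (σ * b) := by
    intro a b hab hbx
    have := norm_sub_le_of_deriv_le_exp (f := f) (f' := f') (y := 0) (C := C) hσ0.ne' hab hbx hd'
      (fun x hx => by
        have := hb x (by simpa using hx.trans (min_le_left _ _)) (by simp) () trivial
        simpa using this)
    simp only [Complex.ofReal_zero, zero_mul, add_zero] at this
    refine this.trans ?_
    have : 0 ≤ C / σ * Real.exp (σ * a) := by positivity
    linarith
  -- The candidate for the limit is taken along real points tending to `-∞`, where the increments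
  -- are dominated by `e^{σ b}` at the right end.
  obtain ⟨c, hc⟩ : ∃ c, Tendsto (fun n : ℕ => f ((x₂ - n : ℝ) : ℂ)) atTop (𝓝 c) := by
    refine cauchySeq_tendsto_of_complete
      (cauchySeq_of_le_tendsto_0 (fun n : ℕ => 2 * (C / σ * Real.exp (σ * (x₂ - n)))) ?_ ?_)
    · intro n m N hn hm
      have key : ∀ n : ℕ, N ≤ n → ‖f ((x₂ - N : ℝ) : ℂ) - f ((x₂ - n : ℝ) : ℂ)‖ ≤
          C / σ * Real.exp (σ * (x₂ - N)) := fun n hn => by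
        refine hinc _ _ ?_ ?_
        · have : (N : ℝ) ≤ n := Nat.cast_le.2 hn
          linarith
        · have : (0 : ℝ) ≤ N := Nat.cast_nonneg N
          linarith
      rw [dist_eq_norm]
      calc ‖f ((x₂ - n : ℝ) : ℂ) - f ((x₂ - m : ℝ) : ℂ)‖ =
            ‖(f ((x₂ - N : ℝ) : ℂ) - f ((x₂ - m : ℝ) : ℂ)) -
              (f ((x₂ - N : ℝ) : ℂ) - f ((x₂ - n : ℝ) : ℂ))‖ := by congr 1; abel
        _ ≤ _ := norm_sub_le _ _
        _ ≤ _ := by linarith [key n hn, key m hm]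
    · have h1 : Tendsto (fun n : ℕ => x₂ - (n : ℝ)) atTop atBot := by
        have := tendsto_neg_atTop_atBot.comp (tendsto_natCast_atTop_atTop (R := ℝ))
        simpa [sub_eq_add_neg] using tendsto_atBot_add_const_left atTop x₂ this
      have := ((tendsto_exp_mul_atBot hσ0 (C / σ)).comp h1).const_mul 2
      simpa using this
  refine ⟨c, fun σ' hσ' Y => ?_⟩
  obtain ⟨C₁, x₁', hC₁, hb₁⟩ := h' σ (by linarith) |Y|
  refine ⟨C₁ * |Y| + C / σ, min (min x₁' x₂) 0, by positivity, fun t ht hY _ _ => ?_⟩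
  have ht0 : t.re ≤ 0 := ht.trans (min_le_right _ _)
  have ht1 : t.re ≤ x₁' := ht.trans ((min_le_left _ _).trans (min_le_left _ _))
  have ht2 : t.re ≤ x₂ := ht.trans ((min_le_left _ _).trans (min_le_right _ _))
  -- The increment along a vertical segment of bounded length has the order of `f'`, so the same
  -- limit serves all arguments of `ξ`.
  have hvert : ‖f t - f t.re‖ ≤ C₁ * |Y| * Real.exp (σ * t.re) := by
    have hconv : Convex ℝ {w : ℂ | w.re = t.re ∧ |w.im| ≤ |Y|} := by
      have h1 : Convex ℝ (Complex.reLm ⁻¹' {t.re}) := (convex_singleton _).linear_preimage _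
      have h2 : Convex ℝ (Complex.imLm ⁻¹' Set.Icc (-|Y|) |Y|) :=
        (convex_Icc _ _).linear_preimage _
      convert h1.inter h2 using 1
      ext w
      simp [abs_le]
    have := hconv.norm_image_sub_le_of_norm_hasDerivWithin_le (f := f) (f' := f')
      (C := C₁ * Real.exp (σ * t.re)) (x := t.re) (y := t)
      (fun w hw => (hd' w (hw.1.le.trans ht2)).hasDerivWithinAt)
      (fun w hw => by
        have := hb₁ w (hw.1.le.trans ht1) hw.2 () trivial
        rwa [hw.1] at this) (by simp) ⟨rfl, hY.trans (le_abs_self Y)⟩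
    refine this.trans ?_
    have h3 : ‖t - t.re‖ ≤ |Y| := by
      have : t - t.re = t.im * I := by
        nth_rewrite 1 [← Complex.re_add_im t]
        ring
      rw [this]
      simpa using hY.trans (le_abs_self Y)
    calc C₁ * Real.exp (σ * t.re) * ‖t - t.re‖ ≤ C₁ * Real.exp (σ * t.re) * |Y| := by gcongr
      _ = _ := by ring
  have hhor : ‖f t.re - c‖ ≤ C / σ * Real.exp (σ * t.re) := by
    have hl : Tendsto (fun n : ℕ => ‖f t.re - f ((x₂ - n : ℝ) : ℂ)‖) atTop (𝓝 ‖f t.re - c‖) :=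
      (tendsto_const_nhds.sub hc).norm
    refine le_of_tendsto hl ?_
    obtain ⟨n₀, hn₀⟩ := exists_nat_ge (x₂ - t.re)
    filter_upwards [eventually_ge_atTop n₀] with n hn
    refine hinc _ _ ?_ ht2
    have : (n₀ : ℝ) ≤ n := Nat.cast_le.2 hn
    linarith
  have h8 : Real.exp (σ * t.re) ≤ Real.exp (σ' * t.re) :=
    Real.exp_le_exp.2 (mul_le_mul_of_nonpos_right hσ'.le ht0)
  calc ‖f t - c‖ = ‖(f t - f t.re) + (f t.re - c)‖ := by congr 1; abel
    _ ≤ C₁ * |Y| * Real.exp (σ * t.re) + C / σ * Real.exp (σ * t.re) :=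
        (norm_add_le _ _).trans (add_le_add hvert hhor)
    _ = (C₁ * |Y| + C / σ) * Real.exp (σ * t.re) := by ring
    _ ≤ _ := by gcongr

lemma hasDerivAt_exp_neg_mul {g : ℂ → ℂ} {g' t : ℂ} (μ : ℂ) (h : HasDerivAt g g' t) :
    HasDerivAt (fun t => exp (-μ * t) * g t) (exp (-μ * t) * (g' - μ * g t)) t := by
  have h1 : HasDerivAt (fun t => exp (-μ * t)) (exp (-μ * t) * -μ) t := by
    simpa using ((hasDerivAt_id t).const_mul (-μ)).cexp
  refine (h1.mul h).congr_deriv ?_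
  ring

lemma exp_mul_exp_neg_mul (μ t w : ℂ) : exp (μ * t) * (exp (-μ * t) * w) = w := by
  rw [← mul_assoc, ← Complex.exp_add]
  simp

/-- Solutions of `g' - μ g = ρ` when the order of `ρ` exceeds `Re μ`. -/
lemma exists_exp_of_deriv_sub_decays {g g' : ℂ → ℂ} {x₁ s : ℝ} {μ : ℂ} (hs : μ.re < s)
    (hd : ∀ t : ℂ, t.re < x₁ → HasDerivAt g (g' t) t) (h' : Decays s fun t => g' t - μ * g t) :
    ∃ c, Decays s fun t => g t - c * exp (μ * t) := by
  obtain ⟨c, hc⟩ := exists_limit_of_deriv_decays (s := s - μ.re) (by linarith)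
    (fun t ht => hasDerivAt_exp_neg_mul μ (hd t ht))
    ((h'.exp_mul (-μ)).mono_exponent (by simp [sub_eq_add_neg]))
  refine ⟨c, Decays.congr ((hc.exp_mul μ).mono_exponent (by linarith))
    (Eventually.of_forall fun t => ?_)⟩
  rw [mul_sub, exp_mul_exp_neg_mul]
  ring

/-- Solutions of `g' - μ g = ρ` have the order of `ρ` if this is at most `Re μ`, or if they are
known to have an order larger than `Re μ`. -/
lemma decays_of_deriv_sub_decays {g g' : ℂ → ℂ} {x₁ s : ℝ} {μ : ℂ}
    (hd : ∀ t : ℂ, t.re < x₁ → HasDerivAt g (g' t) t) (h' : Decays s fun t => g' t - μ * g t)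
    (h : s ≤ μ.re ∨ ∃ s₀ > μ.re, Decays s₀ g) : Decays s g := by
  have key := Dec.of_hasDerivAt (A := (Set.univ : Set Unit)) (s := s - μ.re) (x₁ := x₁)
    (G := fun t _ => exp (-μ * t) * g t) (G' := fun t _ => exp (-μ * t) * (g' t - μ * g t))
    (fun _ _ t ht => hasDerivAt_exp_neg_mul μ (hd t ht))
    ((h'.exp_mul (-μ)).mono_exponent (by simp [sub_eq_add_neg])) ?_
  · refine Decays.congr ((Decays.exp_mul key μ).mono_exponent (by linarith))
      (Eventually.of_forall fun t => ?_)
    rw [exp_mul_exp_neg_mul]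
  · rcases h with h | ⟨s₀, hs₀, h⟩
    · refine Or.inl ⟨by linarith, fun x hx Y => ?_⟩
      have hcont : ContinuousOn (fun y : ℝ => exp (-μ * (x + y * I)) * g (x + y * I))
          (Set.Icc (-Y) Y) := fun y _ => by
        have h1 : ContinuousAt g (x + y * I) := (hd _ (by simpa using hx)).continuousAt
        have h2 : ContinuousAt (fun y : ℝ => (x : ℂ) + y * I) y := by fun_prop
        have h3 : ContinuousAt (fun y : ℝ => g (x + y * I)) y :=
          ContinuousAt.comp (f := fun y : ℝ => (x : ℂ) + y * I) h1 h2
        exact (ContinuousAt.mul (by fun_prop) h3).continuousWithinAt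
      obtain ⟨C, hC⟩ := isCompact_Icc.exists_bound_of_continuousOn hcont
      exact ⟨C, fun y hy _ _ => hC y (abs_le.1 hy)⟩
    · exact Or.inr ⟨s₀ - μ.re, by linarith, (h.exp_mul (-μ)).mono_exponent
        (by simp [sub_eq_add_neg])⟩

end Scalar

end LevelOne

end

noncomputable section

namespace LevelOne

variable {ι : Type*} [Fintype ι]

/-! ### Solutions near a singular point of the equation -/

/-- The structure of the kernel of the Volterra equation at the singular point `ω`: the matrix `K`
of `κ(0)` is, on the indices `i` with `sᵢ = ω`, triangular with respect to `ord`, has the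
diagonal entries `μᵢ` with `-e ≤ Re μᵢ < 1 - e`, and only links indices with the same `μᵢ`. -/
structure Resonance (V : VolterraData ι) (ω : ℂ) (e : ℝ) (μ : ι → ℂ) (ord : ι → ℕ)
    (K : ι → ι → ℂ) : Prop where
  ker_zero : ∀ v i, V.ker 0 v i = ∑ i', K i i' * v i'
  diag : ∀ i, V.sing i = ω → K i i = μ i
  offdiag : ∀ i i', V.sing i = ω → V.sing i' = ω → i ≠ i' → K i i' ≠ 0 →
    μ i' = μ i ∧ ord i' < ord i
  le_re : ∀ i, V.sing i = ω → -e ≤ (μ i).re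
  re_lt : ∀ i, V.sing i = ω → (μ i).re < 1 - e
  nonneg : 0 ≤ e
  lt_one : e < 1

lemma norm_exp_le_one {t : ℂ} (ht : t.re ≤ 0) : ‖exp t‖ ≤ 1 := by
  rw [Complex.norm_exp]
  simpa using ht

lemma tendsto_exp_logZero : Tendsto (fun t : ℂ => exp t) logZero (𝓝 0) := by
  rw [tendsto_zero_iff_norm_tendsto_zero]
  simp only [Complex.norm_exp]
  exact Real.tendsto_exp_atBot.comp tendsto_comap

/-- Away from `ω`, the singular factors are bounded. -/
lemma VolterraData.exists_inv_bound (V : VolterraData ι) (ω : ℂ) : ∃ m x₂ : ℝ, 1 ≤ m ∧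
    ∀ t : ℂ, t.re ≤ x₂ → ∀ i, V.sing i ≠ ω → ‖(ω + exp t - V.sing i)⁻¹‖ ≤ m := by
  have h1 : ∀ i, V.sing i ≠ ω →
      ∀ᶠ t in logZero, ‖(ω + exp t - V.sing i)⁻¹‖ < ‖(ω - V.sing i)⁻¹‖ + 1 := by
    intro i hi
    have hl : Tendsto (fun t : ℂ => (ω + exp t - V.sing i)⁻¹) logZero
        (𝓝 (ω + 0 - V.sing i)⁻¹) :=
      ((tendsto_const_nhds.add tendsto_exp_logZero).sub_const _).inv₀
        (by rw [add_zero]; exact sub_ne_zero.2 hi.symm)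
    rw [add_zero] at hl
    exact hl.norm.eventually_lt_const (lt_add_one _)
  have h2 : ∀ᶠ t in logZero, ∀ i, V.sing i ≠ ω →
      ‖(ω + exp t - V.sing i)⁻¹‖ < ‖(ω - V.sing i)⁻¹‖ + 1 := by
    rw [eventually_all]
    intro i
    by_cases hi : V.sing i = ω
    · exact Eventually.of_forall fun t h => absurd hi h
    · exact (h1 i hi).mono fun t ht _ => ht
  obtain ⟨x, hx⟩ := eventually_logZero_iff.1 h2
  refine ⟨∑ i, ‖(ω - V.sing i)⁻¹‖ + 1, x - 1, ?_, fun t ht i hi => ?_⟩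
  · have : 0 ≤ ∑ i, ‖(ω - V.sing i)⁻¹‖ := Finset.sum_nonneg fun _ _ => norm_nonneg _
    linarith
  · refine (hx t (by linarith) i hi).le.trans ?_
    gcongr
    exact Finset.single_le_sum (f := fun i => ‖(ω - V.sing i)⁻¹‖) (fun _ _ => norm_nonneg _)
      (Finset.mem_univ i)

namespace IsSol

variable {V : VolterraData ι} {ω : ℂ} {x₁ : ℝ} {φ : ℂ → ι → ℂ} {W : ℂ → ℂ → ι → ℂ}

lemma mem_closedBall_exp {t : ℂ} (ω : ℂ) (ht : t.re ≤ 0) :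
    ω + exp t ∈ Metric.closedBall ω 1 := by
  rw [Metric.mem_closedBall, dist_eq_norm, add_sub_cancel_left]
  exact norm_exp_le_one ht

variable (h : IsSol V (fun t => ω + exp t) {t | t.re < x₁} φ W)
  (hne : ∀ t : ℂ, t.re < x₁ → ∀ i, ω + exp t ≠ V.sing i)

include h hne

lemma apply_eq_inv_mul {t : ℂ} (ht : t.re < x₁) (i : ι) :
    φ t i = (ω + exp t - V.sing i)⁻¹ * W t (ω + exp t) i := by
  rw [← h.eq t ht i, inv_mul_cancel_left₀ (sub_ne_zero.2 (hne t ht i))]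

/-- The resonant factors are exactly `1 / ξ` and the others are bounded near `ω`, so one factor
`|ξ|` compensates for the singularity of the equation. -/
lemma crude_bound : ∃ m x₂ : ℝ, 1 ≤ m ∧ x₂ ≤ 0 ∧ x₂ < x₁ ∧ ∀ t : ℂ, t.re ≤ x₂ →
    Real.exp t.re * ‖φ t‖ ≤ m * ‖W t (ω + exp t)‖ := by
  obtain ⟨m, x₂, hm, hb⟩ := V.exists_inv_bound ω
  refine ⟨m, min (min x₂ 0) (x₁ - 1), hm, (min_le_left _ _).trans (min_le_right _ _),
    (min_le_right _ _).trans_lt (by linarith), fun t ht => ?_⟩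
  have ht0 : t.re ≤ 0 := ht.trans ((min_le_left _ _).trans (min_le_right _ _))
  have ht2 : t.re ≤ x₂ := ht.trans ((min_le_left _ _).trans (min_le_left _ _))
  have ht1 : t.re < x₁ := ht.trans_lt ((min_le_right _ _).trans_lt (by linarith))
  rw [← le_div_iff₀' (Real.exp_pos _)]
  refine (pi_norm_le_iff_of_nonneg (by positivity)).2 fun i => ?_
  rw [le_div_iff₀' (Real.exp_pos _), h.apply_eq_inv_mul hne ht1 i, norm_mul, ← mul_assoc]
  have h1 : ‖W t (ω + exp t) i‖ ≤ ‖W t (ω + exp t)‖ := norm_le_pi_norm _ i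
  have h2 : Real.exp t.re * ‖(ω + exp t - V.sing i)⁻¹‖ ≤ m := by
    by_cases hi : V.sing i = ω
    · rw [hi, add_sub_cancel_left, norm_inv, Complex.norm_exp, mul_inv_cancel₀ (Real.exp_ne_zero _)]
      exact hm
    · calc Real.exp t.re * ‖(ω + exp t - V.sing i)⁻¹‖ ≤ 1 * m := by
            gcongr
            · simpa using ht0
            · exact hb t ht2 i hi
        _ = m := one_mul m
  gcongr

/-- A Grönwall bound along horizontal lines, in both directions. -/
lemma norm_le_of_history : ∃ m L x₂ : ℝ, 0 ≤ m ∧ 0 ≤ L ∧ x₂ ≤ 0 ∧ x₂ < x₁ ∧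
    ∀ (c : ℂ) (v b : ℝ), |v| = 1 → 0 ≤ b → c.re ≤ x₂ → c.re + b * v ≤ x₂ → ∀ M : ℝ,
      (∀ z ∈ Metric.closedBall ω 1, ‖W c z‖ ≤ M) →
      Real.exp (c.re + b * v) * ‖φ (c + b * v)‖ ≤ m * M * Real.exp (L * b) := by
  obtain ⟨m, x₂, hm, hx0, hx1, hb⟩ := h.crude_bound hne
  obtain ⟨C, A, hC, hA, hker⟩ := V.ker_bound
  have hm0 : 0 ≤ m := by linarith
  set k := C * Real.exp (A * 2) with hk
  have hk0 : 0 ≤ k := by positivity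
  refine ⟨m, m * k, x₂, hm0, by positivity, hx0, hx1, ?_⟩
  intro c v b hv hb0 hc hcb M hM
  have hre : ∀ x : ℝ, (c + (x : ℂ) * v).re = c.re + x * v := fun x => by simp
  have hmem : ∀ x ∈ Set.Icc 0 b, (c + (x : ℂ) * v).re ≤ x₂ := by
    intro x hx
    rw [hre]
    rcases le_total 0 v with h0 | h0
    · nlinarith [hx.2]
    · nlinarith [hx.1]
  have hmemU : ∀ x ∈ Set.Icc 0 b, c + (x : ℂ) * v ∈ {t : ℂ | t.re < x₁} := fun x hx =>
    (hmem x hx).trans_lt hx1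
  have hline : Continuous fun x : ℝ => c + (x : ℂ) * v := by fun_prop
  have hφc : ContinuousOn (fun x : ℝ => φ (c + (x : ℂ) * v)) (Set.Icc 0 b) :=
    h.diff.continuousOn.comp hline.continuousOn hmemU
  have hu : ContinuousOn (fun x : ℝ => Real.exp (c + (x : ℂ) * v).re * ‖φ (c + (x : ℂ) * v)‖)
      (Set.Icc 0 b) :=
    (by fun_prop : Continuous fun x : ℝ => Real.exp (c + (x : ℂ) * v).re).continuousOn.mul hφc.norm
  -- By `crude_bound`, `|ξ| ‖φ‖` is at most a multiple of the history. The rate of change of the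
  -- history in `t` contains the Jacobian `ξ` and is bounded by the same quantity, which closes the
  -- inequality for both directions `v = ±1`.
  have key := gronwall_integral (u := fun x => Real.exp (c + (x : ℂ) * v).re * ‖φ (c + (x : ℂ) * v)‖)
    (k := fun _ => m * k) (Q := fun x => m * k * x) (K := m * M) (a := 0) (b := b) hu
    continuousOn_const (fun _ _ => by positivity)
    (fun x => by simpa using (hasDerivAt_id x).const_mul (m * k)) ?_ b ⟨hb0, le_rfl⟩
  · simpa [hre] using key
  intro x hx
  have hxI : ∀ y ∈ Set.Icc (0 : ℝ) x, y ∈ Set.Icc (0 : ℝ) b := fun y hy => ⟨hy.1, hy.2.trans hx.2⟩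
  set z := ω + exp (c + (x : ℂ) * v) with hz
  have hzb : ∀ y ∈ Set.Icc (0 : ℝ) b, ω + exp (c + (y : ℂ) * v) ∈ Metric.closedBall ω 1 :=
    fun y hy => mem_closedBall_exp ω ((hmem y hy).trans hx0)
  have hinc := h.norm_sub_le_integral (differentiable_add_exp ω) (c := c) (v := v) hx.1
    (fun y hy => hmemU y (hxI y hy)) z
    (B := fun y => k * (Real.exp (c + (y : ℂ) * v).re * ‖φ (c + (y : ℂ) * v)‖))
    (continuousOn_const.mul (hu.mono hxI)) (fun y hy => by
      have hd : ‖z - (ω + exp (c + (y : ℂ) * v))‖ ≤ 2 := by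
        have h1 := Metric.mem_closedBall.1 (hzb x hx)
        have h2 := Metric.mem_closedBall.1 (hzb y (hxI y hy))
        rw [← dist_eq_norm]
        linarith [dist_triangle_right z (ω + exp (c + (y : ℂ) * v)) ω]
      rw [deriv_add_exp, Complex.norm_exp, Complex.norm_real, Real.norm_eq_abs, hv, one_mul]
      calc Real.exp (c + (y : ℂ) * v).re * ‖V.ker (z - (ω + exp (c + (y : ℂ) * v)))
            (φ (c + (y : ℂ) * v))‖
          ≤ Real.exp (c + (y : ℂ) * v).re * (k * ‖φ (c + (y : ℂ) * v)‖) := by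
            gcongr
            refine (hker _ _).trans ?_
            rw [hk]
            gcongr
        _ = _ := by ring)
  refine (hb _ (hmem x hx)).trans ?_
  have h3 : ‖W (c + (x : ℂ) * v) z‖ ≤
      M + ∫ y in (0 : ℝ)..x, k * (Real.exp (c + (y : ℂ) * v).re * ‖φ (c + (y : ℂ) * v)‖) := by
    simp only [Complex.ofReal_zero, zero_mul, add_zero] at hinc
    calc ‖W (c + (x : ℂ) * v) z‖ = ‖W c z + (W (c + (x : ℂ) * v) z - W c z)‖ := by
          congr 1; abel
      _ ≤ _ := (norm_add_le _ _).trans (add_le_add (hM z (hzb x hx)) hinc)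
  calc m * ‖W (c + (x : ℂ) * v) (ω + exp (c + (x : ℂ) * v))‖
      ≤ m * (M + ∫ y in (0 : ℝ)..x,
          k * (Real.exp (c + (y : ℂ) * v).re * ‖φ (c + (y : ℂ) * v)‖)) := by gcongr
    _ = _ := by
        rw [mul_add, ← intervalIntegral.integral_const_mul]
        congr 2
        funext y
        ring

omit hne in
/-- The histories are bounded on vertical segments. -/
lemma history_bounded_vertical {x : ℝ} (hx : x < x₁) (Y : ℝ) : ∃ C, ∀ y : ℝ, |y| ≤ Y →
    ∀ z ∈ Metric.closedBall ω 2, ‖W (x + y * I) z‖ ≤ C := by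
  set S : Set ℂ := {t | t.re = x ∧ |t.im| ≤ Y} with hS
  have hSU : S ⊆ {t : ℂ | t.re < x₁} := fun t (ht : t.re = x ∧ |t.im| ≤ Y) => by
    rw [Set.mem_ofPred_eq, ht.1]; exact hx
  have hSe : S = (Complex.reLm ⁻¹' {x}) ∩ (Complex.imLm ⁻¹' Set.Icc (-Y) Y) := by
    ext t
    simp [hS, abs_le]
  have hconv : Convex ℝ S := by
    rw [hSe]
    exact ((convex_singleton _).linear_preimage _).inter ((convex_Icc _ _).linear_preimage _)
  have hcpt : IsCompact S := by
    have : S = (fun y : ℝ => (x : ℂ) + y * I) '' Set.Icc (-Y) Y := by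
      ext t
      constructor
      · rintro ⟨h1, h2⟩
        exact ⟨t.im, abs_le.1 h2, by rw [← h1]; exact Complex.re_add_im t⟩
      · rintro ⟨y, hy, rfl⟩
        exact ⟨by simp, by simpa using abs_le.2 hy⟩
    rw [this]
    exact isCompact_Icc.image (by fun_prop)
  obtain ⟨C, A, hC, hA, hb⟩ := h.expType_uniform (differentiable_add_exp ω) hcpt hconv hSU
  refine ⟨C * Real.exp (A * (‖ω‖ + 2)), fun y hy z hz => ?_⟩
  refine (hb _ ⟨by simp, by simpa using hy⟩ z).trans ?_
  gcongr
  have := Metric.mem_closedBall.1 hz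
  rw [dist_eq_norm] at this
  calc ‖z‖ = ‖ω + (z - ω)‖ := by congr 1; abel
    _ ≤ _ := (norm_add_le _ _).trans (by gcongr)

/-- An a priori bound for solutions. -/
lemma exists_decays : ∃ σ : ℝ, Decays σ φ := by
  obtain ⟨m, L, x₂, hm, hL, hx0, hx1, hb⟩ := h.norm_le_of_history hne
  -- Moving left from `Re t = x₂` costs `e^{L (x₂ - Re t)}`, and dividing by `|ξ|` costs one more
  -- order.
  refine ⟨-(1 + L), fun σ' hσ' Y => ?_⟩
  obtain ⟨M, hM⟩ := h.history_bounded_vertical hx1 Y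
  refine ⟨m * |M| * Real.exp (L * x₂), x₂, by positivity, fun t ht hY _ _ => ?_⟩
  have key := hb (x₂ + t.im * I) (-1) (x₂ - t.re) (by simp) (by linarith) (by simp)
    (by simp only [add_re, ofReal_re, mul_re, I_re, mul_zero, ofReal_im, I_im, mul_one, sub_self,
          add_zero]; linarith) |M|
    (fun z hz => (hM t.im hY z (Metric.closedBall_subset_closedBall (by norm_num) hz)).trans
      (le_abs_self M))
  have he : ((x₂ : ℂ) + t.im * I + ((x₂ - t.re : ℝ) : ℂ) * ((-1 : ℝ) : ℂ)) = t := by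
    nth_rewrite 3 [eq_re_add_im t]
    push_cast
    ring
  have he' : ((x₂ : ℂ) + t.im * I).re + (x₂ - t.re) * (-1) = t.re := by
    simp
  rw [he, he'] at key
  have h1 : Real.exp (-(1 + L) * t.re) ≤ Real.exp (σ' * t.re) :=
    Real.exp_le_exp.2 (mul_le_mul_of_nonpos_right hσ'.le (ht.trans hx0))
  calc ‖φ t‖ = Real.exp (-t.re) * (Real.exp t.re * ‖φ t‖) := by
        rw [← mul_assoc, ← Real.exp_add]; simp
    _ ≤ Real.exp (-t.re) * (m * |M| * Real.exp (L * (x₂ - t.re))) := by gcongr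
    _ = m * |M| * Real.exp (L * x₂) * Real.exp (-(1 + L) * t.re) := by
        rw [mul_comm, mul_assoc, mul_assoc (m * |M|), ← Real.exp_add, ← Real.exp_add]
        congr 2
        ring
    _ ≤ _ := by gcongr

-- The integrand of the history contains the Jacobian `ξ` of `ξ = e^t`, so it vanishes to one order
-- more than `φ`. This gain drives all bootstrap arguments below.
omit h hne in
lemma dec_history_deriv {σ : ℝ} (hφ : Decays σ φ) : Dec (Metric.closedBall ω 2) (σ + 1)
    fun t z => deriv (fun t => ω + exp t) t • V.ker (z - (ω + exp t)) (φ t) := by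
  obtain ⟨C, A, hC, hA, hker⟩ := V.ker_bound
  refine Dec.of_norm_le (hφ.exp_smul 1) (C * Real.exp (A * 3)) 0 fun t ht z hz => ⟨(), trivial, ?_⟩
  rw [deriv_add_exp, one_mul, norm_smul, norm_smul]
  have hd : ‖z - (ω + exp t)‖ ≤ 3 := by
    have h1 := Metric.mem_closedBall.1 hz
    have h2 := Metric.mem_closedBall.1 (mem_closedBall_exp ω ht)
    rw [← dist_eq_norm]
    linarith [dist_triangle_right z (ω + exp t) ω]
  calc ‖exp t‖ * ‖V.ker (z - (ω + exp t)) (φ t)‖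
      ≤ ‖exp t‖ * (C * Real.exp (A * 3) * ‖φ t‖) := by
        gcongr
        refine (hker _ _).trans ?_
        gcongr
    _ = _ := by ring

omit hne in
/-- Orders of the histories. -/
lemma dec_history {σ : ℝ} (hφ : Decays σ φ)
    (hW : σ + 1 ≤ 0 ∨ ∃ s₀ > 0, Dec (Metric.closedBall ω 2) s₀ W) :
    Dec (Metric.closedBall ω 2) (σ + 1) W := by
  refine Dec.of_hasDerivAt (x₁ := x₁) (fun z _ t ht => h.hasDeriv t ht z)
    (dec_history_deriv hφ) ?_
  rcases hW with hs | hs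
  · exact Or.inl ⟨hs, fun x hx Y => h.history_bounded_vertical hx Y⟩
  · exact Or.inr hs

/-- The non-resonant components. -/
lemma decays_of_nonresonant {τ : ℝ} (hW : Dec (Metric.closedBall ω 2) τ W) {i : ι}
    (hi : V.sing i ≠ ω) : Decays τ fun t => φ t i := by
  obtain ⟨m, x₂, hm, hb⟩ := V.exists_inv_bound ω
  refine hW.of_norm_le m (min (min x₂ 0) (x₁ - 1)) fun t ht _ _ => ⟨ω + exp t, ?_, ?_⟩
  · exact Metric.closedBall_subset_closedBall (by norm_num) (mem_closedBall_exp ω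
      (ht.trans ((min_le_left _ _).trans (min_le_right _ _))))
  · beta_reduce
    rw [h.apply_eq_inv_mul hne (ht.trans_lt ((min_le_right _ _).trans_lt (by linarith))) i, norm_mul]
    gcongr
    · exact hb t (ht.trans ((min_le_left _ _).trans (min_le_left _ _))) i hi
    · exact norm_le_pi_norm (W t (ω + exp t)) i

-- Cauchy's estimate on the unit circle around `ω + ξ`. Histories are bounded on the ball of radius
-- `2` so that this circle lies inside when `|ξ| ≤ 1`.
omit hne in
lemma decays_deriv_history {τ : ℝ} (hW : Dec (Metric.closedBall ω 2) τ W) :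
    Decays τ fun t => deriv (W t) (ω + exp t) := by
  intro σ' hσ' Y
  obtain ⟨C, x₀, hC, hb⟩ := hW σ' hσ' Y
  refine ⟨C, min (min x₀ 0) (x₁ - 1), hC, fun t ht hY _ _ => ?_⟩
  have ht0 : t.re ≤ 0 := ht.trans ((min_le_left _ _).trans (min_le_right _ _))
  have ht1 : t.re < x₁ := ht.trans_lt ((min_le_right _ _).trans_lt (by linarith))
  have := Complex.norm_deriv_le_of_forall_mem_sphere_norm_le (c := ω + exp t) (R := 1)
    (f := W t) (C := C * Real.exp (σ' * t.re)) one_pos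
    (h.entire t ht1).diffContOnCl (fun z hz => by
      refine hb t (ht.trans ((min_le_left _ _).trans (min_le_left _ _))) hY z ?_
      rw [Metric.mem_closedBall]
      have h1 := Metric.mem_closedBall.1 (mem_closedBall_exp ω ht0)
      have h2 := Metric.mem_sphere.1 hz
      linarith [dist_triangle z (ω + exp t) ω])
  simpa using this

end IsSol

end LevelOne

end

/-! ### Resonant components: sharp order and leading terms -/

noncomputable section

namespace LevelOne

variable {ι : Type*} [Fintype ι] [DecidableEq ι]

namespace Resonance

variable {V : VolterraData ι} {ω : ℂ} {e : ℝ} {μ : ι → ℂ} {ord : ι → ℕ} {K : ι → ι → ℂ}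
  {x₁ : ℝ} {φ : ℂ → ι → ℂ} {W : ℂ → ℂ → ι → ℂ}

/-- The indices linked to `i` by the resonant part of the kernel. -/
def linked (V : VolterraData ι) (ω : ℂ) (i : ι) : Finset ι :=
  Finset.univ.filter fun i' => V.sing i' = ω ∧ i' ≠ i

/-- The inhomogeneous term of the differential equation satisfied by the resonant components. -/
def forcing (V : VolterraData ι) (ω : ℂ) (K : ι → ι → ℂ) (φ : ℂ → ι → ℂ) (W : ℂ → ℂ → ι → ℂ)
    (i : ι) (t : ℂ) : ℂ :=
  exp t * (∑ i' with V.sing i' ≠ ω, K i i' * φ t i' + deriv (W t) (ω + exp t) i)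

variable (hR : Resonance V ω e μ ord K)
  (h : IsSol V (fun t => ω + exp t) {t | t.re < x₁} φ W)
  (hne : ∀ t : ℂ, t.re < x₁ → ∀ i, ω + exp t ≠ V.sing i)

include hR h in
/-- The differential equation satisfied by the resonant components. -/
lemma hasDerivAt_resonant {i : ι} (hi : V.sing i = ω) {t : ℂ} (ht : t.re < x₁) :
    HasDerivAt (fun t => exp t * φ t i) (μ i * (exp t * φ t i) +
      (∑ i' ∈ linked V ω i, K i i' * (exp t * φ t i') + forcing V ω K φ W i t)) t := by
  have h1 := hasDerivAt_pi.1
    (h.hasDerivAt_history (differentiable_add_exp ω) (LogRes.isOpen_re_lt x₁) ht) i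
  -- At a resonant index the diagonal factor is `ω + ξ - ω = ξ`, so `ξ φ_i` is the history on the
  -- diagonal, whose derivative is known.
  have he : (fun t => exp t * φ t i) =ᶠ[𝓝 t] fun t => W t (ω + exp t) i := by
    filter_upwards [(LogRes.isOpen_re_lt x₁).mem_nhds ht] with τ hτ
    rw [← h.eq τ hτ i, hi, add_sub_cancel_left]
  refine (h1.congr_of_eventuallyEq he).congr_deriv ?_
  rw [Pi.smul_apply, Pi.add_apply, smul_eq_mul, deriv_add_exp, hR.ker_zero, forcing,
    ← Finset.sum_filter_add_sum_filter_not Finset.univ (fun i' => V.sing i' = ω)]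
  have h2 : Finset.univ.filter (fun i' => V.sing i' = ω) = insert i (linked V ω i) := by
    ext i'
    simp only [linked, Finset.mem_filter, Finset.mem_univ, true_and, Finset.mem_insert]
    constructor
    · intro h'
      by_cases hii : i' = i
      · exact Or.inl hii
      · exact Or.inr ⟨h', hii⟩
    · rintro (rfl | h')
      · exact hi
      · exact h'.1
  have h3 : i ∉ linked V ω i := by simp [linked]
  rw [h2, Finset.sum_insert h3, hR.diag i hi]
  have h4 : ∑ i' ∈ linked V ω i, K i i' * (exp t * φ t i') =
      exp t * ∑ i' ∈ linked V ω i, K i i' * φ t i' := by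
    rw [Finset.mul_sum]
    exact Finset.sum_congr rfl fun _ _ => by ring
  rw [h4]
  ring

-- The non-resonant components and the derivative of the history have the order of the history; the
-- factor `ξ` in front adds one.
include h hne in
omit [DecidableEq ι] in
lemma decays_forcing {τ : ℝ} (hW : Dec (Metric.closedBall ω 2) τ W) (i : ι) :
    Decays (τ + 1) (forcing V ω K φ W i) := by
  have h1 : Decays τ fun t => ∑ i' with V.sing i' ≠ ω, K i i' * φ t i' +
      deriv (W t) (ω + exp t) i := by
    refine Dec.add (Dec.sum _ fun i' hi' => ?_) (decays_pi.1 (h.decays_deriv_history hW) i)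
    exact Decays.const_mul (h.decays_of_nonresonant hne hW (Finset.mem_filter.1 hi').2) _
  refine Decays.congr (Decays.exp_mul h1 1) (Eventually.of_forall fun t => ?_)
  rw [one_mul, forcing]

include hR h hne in
/-- Orders of the resonant components. -/
lemma decays_resonant {τ s : ℝ} (hW : Dec (Metric.closedBall ω 2) τ W) (hs : s ≤ τ + 1)
    (hint : ∀ i, V.sing i = ω → s ≤ (μ i).re ∨ ∃ s₀ > (μ i).re, Decays s₀ fun t => exp t * φ t i) :
    ∀ i, V.sing i = ω → Decays s fun t => exp t * φ t i := by
  -- Links between resonant indices strictly lower `ord`, so the system is solved one scalar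
  -- equation at a time.
  suffices H : ∀ n, ∀ i, ord i = n → V.sing i = ω → Decays s fun t => exp t * φ t i from
    fun i hi => H _ i rfl hi
  intro n
  induction n using Nat.strong_induction_on with
  | _ n ih =>
    intro i hin hi
    refine decays_of_deriv_sub_decays (fun t ht => hR.hasDerivAt_resonant h hi ht) ?_ (hint i hi)
    simp only [add_sub_cancel_left]
    refine Dec.add (Dec.sum _ fun i' hi' => ?_) ((decays_forcing h hne hW i).mono_exponent hs)
    obtain ⟨hi'ω, hi'i⟩ := (Finset.mem_filter.1 hi').2
    by_cases hK : K i i' = 0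
    · simpa [hK] using Dec.zero
    · exact Decays.const_mul (ih _ (hin ▸ (hR.offdiag i i' hi hi'ω hi'i.symm hK).2) i' rfl hi'ω) _

omit [Fintype ι] [DecidableEq ι] in
lemma decays_of_exp_mul {s : ℝ} {i : ι} (hg : Decays s fun t => exp t * φ t i) :
    Decays (s - 1) fun t => φ t i := by
  refine Decays.congr ((Decays.exp_mul hg (-1)).mono_exponent (by simp [sub_eq_add_neg]))
    (Eventually.of_forall fun t => ?_)
  rw [← mul_assoc, ← Complex.exp_add]
  simp

include hR h hne in
/-- The sharp order of solutions. -/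
lemma decays_solution : Decays (-1 - e) φ := by
  obtain ⟨σ, hσ⟩ := h.exists_decays hne
  have he := hR.nonneg
  -- Each round gains one order: the history gains one over `φ`, and the scalar equations pass this
  -- on. The gain stops at `-1 - e`, because homogeneous solutions `ξ^μ` of order as low as `-e` may
  -- occur in `ξ φ_i`.
  have key : ∀ n : ℕ, Decays (min (-1 - e) (σ + n)) φ := by
    intro n
    induction n with
    | zero => exact hσ.mono_exponent ((min_le_right _ _).trans (by simp))
    | succ n ih =>
      set s := min (-1 - e) (σ + n) with hs
      have hs1 : s ≤ -1 - e := min_le_left _ _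
      have hW := h.dec_history ih (Or.inl (by linarith))
      have hle : min (-1 - e) (σ + (n + 1 : ℕ)) ≤ s + 1 := by
        push_cast
        rcases min_cases (-1 - e) (σ + n) with ⟨h1, h2⟩ | ⟨h1, h2⟩ <;>
        rcases min_cases (-1 - e) (σ + (n + 1)) with ⟨h3, h4⟩ | ⟨h3, h4⟩ <;> linarith
      refine decays_pi.2 fun i => ?_
      by_cases hi : V.sing i = ω
      · have hg := hR.decays_resonant h hne hW (s := min (-e) (s + 2))
          ((min_le_right _ _).trans (by linarith))
          (fun i hi => Or.inl ((min_le_left _ _).trans (hR.le_re i hi))) i hi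
        refine (decays_of_exp_mul hg).mono_exponent ?_
        have : min (-1 - e) (σ + (n + 1 : ℕ)) + 1 ≤ min (-e) (s + 2) := by
          refine le_min ?_ (by linarith)
          linarith [min_le_left (-1 - e) (σ + (n + 1 : ℕ))]
        linarith
      · exact (h.decays_of_nonresonant hne hW hi).mono_exponent hle
  obtain ⟨n, hn⟩ := exists_nat_ge (-1 - e - σ)
  have := key n
  rwa [min_eq_left (by linarith)] at this

include hR h hne in
lemma dec_history : Dec (Metric.closedBall ω 2) (-e) W := by
  have := h.dec_history (hR.decays_solution h hne) (Or.inl (by linarith [hR.nonneg]))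
  exact this.mono_exponent (by linarith)

lemma exists_antiderivative (p : Polynomial ℂ) : ∃ q : Polynomial ℂ, q.derivative = p := by
  induction p using Polynomial.induction_on' with
  | add p q hp hq =>
    obtain ⟨p', hp'⟩ := hp
    obtain ⟨q', hq'⟩ := hq
    exact ⟨p' + q', by rw [Polynomial.derivative_add, hp', hq']⟩
  | monomial n a =>
    refine ⟨Polynomial.monomial (n + 1) (a / (n + 1)), ?_⟩
    rw [Polynomial.derivative_monomial]
    have : (n : ℂ) + 1 ≠ 0 := Nat.cast_add_one_ne_zero n
    simp [div_mul_cancel₀ _ this]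

lemma hasDerivAt_exp_mul_eval (μ : ℂ) (q : Polynomial ℂ) (t : ℂ) :
    HasDerivAt (fun t => exp (μ * t) * q.eval t)
      (μ * (exp (μ * t) * q.eval t) + exp (μ * t) * q.derivative.eval t) t := by
  have h1 : HasDerivAt (fun t => exp (μ * t)) (exp (μ * t) * μ) t := by
    simpa using ((hasDerivAt_id t).const_mul μ).cexp
  refine (h1.mul (q.hasDerivAt t)).congr_deriv ?_
  ring

include hR h hne in
/-- The leading part of the resonant components. -/
lemma exists_leading : ∃ Q : ι → Polynomial ℂ, ∀ i, V.sing i = ω →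
    (Q i).derivative = ∑ i' ∈ linked V ω i, Polynomial.C (K i i') * Q i' ∧
    Decays (1 - e) fun t => exp t * φ t i - exp (μ i * t) * (Q i).eval t := by
  suffices H : ∀ n : ℕ, ∃ Q : ι → Polynomial ℂ, ∀ i, V.sing i = ω → ord i < n →
      (Q i).derivative = ∑ i' ∈ linked V ω i, Polynomial.C (K i i') * Q i' ∧
      Decays (1 - e) fun t => exp t * φ t i - exp (μ i * t) * (Q i).eval t by
    obtain ⟨Q, hQ⟩ := H (Finset.univ.sup ord + 1)
    exact ⟨Q, fun i hi => hQ i hi (Nat.lt_succ_of_le (Finset.le_sup (Finset.mem_univ i)))⟩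
  intro n
  induction n with
  | zero => exact ⟨0, fun i _ hi => absurd hi (Nat.not_lt_zero _)⟩
  | succ n ih =>
    obtain ⟨Q, hQ⟩ := ih
    have hstep : ∀ i, V.sing i = ω → ord i = n → ∃ q : Polynomial ℂ,
        q.derivative = ∑ i' ∈ linked V ω i, Polynomial.C (K i i') * Q i' ∧
        Decays (1 - e) fun t => exp t * φ t i - exp (μ i * t) * q.eval t := by
      intro i hi hin
      obtain ⟨p, hp⟩ := exists_antiderivative
        (∑ i' ∈ linked V ω i, Polynomial.C (K i i') * Q i')
      -- After subtraction of the primitive `p`, what is left satisfies a scalar equation with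
      -- right-hand side of order `1 - e > Re μ_i`. It therefore equals `c ξ^{μ_i}` up to that
      -- order, and `c` is the constant of integration in `Q i`.
      obtain ⟨c, hc⟩ := exists_exp_of_deriv_sub_decays (s := 1 - e) (hR.re_lt i hi)
        (fun t ht => (hR.hasDerivAt_resonant h hi ht).sub (hasDerivAt_exp_mul_eval (μ i) p t))
        (by
          have hsum : Decays (1 - e) fun t => ∑ i' ∈ linked V ω i,
              K i i' * (exp t * φ t i' - exp (μ i' * t) * (Q i').eval t) := by
            refine Dec.sum _ fun i' hi' => ?_
            obtain ⟨hi'ω, hi'i⟩ := (Finset.mem_filter.1 hi').2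
            by_cases hK : K i i' = 0
            · simpa [hK] using Dec.zero
            · exact Decays.const_mul (hQ i' hi'ω
                (hin ▸ (hR.offdiag i i' hi hi'ω hi'i.symm hK).2)).2 _
          have hf : Decays (1 - e) (forcing V ω K φ W i) :=
            (decays_forcing h hne (hR.dec_history h hne) i).mono_exponent (by linarith)
          refine Decays.congr (Decays.add hsum hf) (Eventually.of_forall fun t => ?_)
          have h5 : exp (μ i * t) * p.derivative.eval t =
              ∑ i' ∈ linked V ω i, K i i' * (exp (μ i' * t) * (Q i').eval t) := by
            rw [hp, Polynomial.eval_finsetSum, Finset.mul_sum]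
            refine Finset.sum_congr rfl fun i' hi' => ?_
            obtain ⟨hi'ω, hi'i⟩ := (Finset.mem_filter.1 hi').2
            rw [Polynomial.eval_mul, Polynomial.eval_C]
            by_cases hK : K i i' = 0
            · simp [hK]
            · rw [(hR.offdiag i i' hi hi'ω hi'i.symm hK).1]
              ring
          rw [h5]
          simp only [mul_sub, Finset.sum_sub_distrib, Pi.sub_apply]
          ring)
      refine ⟨p + Polynomial.C c, by simp [hp], Decays.congr hc (Eventually.of_forall fun t => ?_)⟩
      rw [Polynomial.eval_add, Polynomial.eval_C]
      simp only [Pi.sub_apply]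
      ring
    choose! q hq using hstep
    refine ⟨fun i => if ord i = n then q i else Q i, fun i hi hin => ?_⟩
    -- Nonzero links lead to smaller `ord`, so redefining the polynomials at level `n` leaves the
    -- equations up to that level intact.
    have hlow : ∑ i' ∈ linked V ω i, Polynomial.C (K i i') *
        (if ord i' = n then q i' else Q i') =
        ∑ i' ∈ linked V ω i, Polynomial.C (K i i') * Q i' := by
      refine Finset.sum_congr rfl fun i' hi' => ?_
      obtain ⟨hi'ω, hi'i⟩ := (Finset.mem_filter.1 hi').2
      by_cases hK : K i i' = 0
      · simp [hK]
      · have := (hR.offdiag i i' hi hi'ω hi'i.symm hK).2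
        rw [if_neg (by omega)]
    simp only [hlow]
    by_cases hin' : ord i = n
    · simp only [hin', if_true]
      exact hq i hi hin'
    · simp only [hin', if_false]
      exact hQ i hi (by omega)

end Resonance

end LevelOne

end

noncomputable section

namespace LevelOne

variable {ι : Type*} [Fintype ι]

/-! ### The monodromy of solutions -/

lemma period_re (t : ℂ) : (t + period).re = t.re := by simp [period]

lemma exp_add_period (t : ℂ) : exp (t + period) = exp t := Complex.exp_periodic t

/-- The difference is the integral of the derivative over a vertical segment of length `2π`, so no
constant of integration enters. In this way `T - 1` yields a history of positive order. -/
lemma Dec.shift_sub {P F : Type*} [NormedAddCommGroup F] [NormedSpace ℂ F] {A : Set P}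
    {G G' : ℂ → P → F} {x₁ s : ℝ}
    (hd : ∀ z ∈ A, ∀ t : ℂ, t.re < x₁ → HasDerivAt (fun τ => G τ z) (G' t z) t)
    (h' : Dec A s G') : Dec A s fun t z => G (t + period) z - G t z := by
  intro σ hσ Y
  obtain ⟨C, x₀, hC, hb⟩ := h' σ hσ (Y + 2 * Real.pi)
  refine ⟨C * ‖period‖, min x₀ (x₁ - 1), by positivity, fun t ht hY z hz => ?_⟩
  set S : Set ℂ := Complex.reLm ⁻¹' {t.re} ∩ Complex.imLm ⁻¹' Set.Icc (-(Y + 2 * Real.pi))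
    (Y + 2 * Real.pi) with hS
  have hconv : Convex ℝ S := ((convex_singleton _).linear_preimage _).inter
    ((convex_Icc _ _).linear_preimage _)
  have hpi := Real.two_pi_pos
  have hY' := abs_le.1 hY
  have := hconv.norm_image_sub_le_of_norm_hasDerivWithin_le (f := fun τ => G τ z)
    (f' := fun τ => G' τ z) (C := C * Real.exp (σ * t.re)) (x := t) (y := t + period)
    (fun w hw => (hd z hz w (by
      rw [show w.re = t.re from hw.1]
      exact ht.trans_lt ((min_le_right _ _).trans_lt (by linarith)))).hasDerivWithinAt)
    (fun w hw => by
      have hre : w.re = t.re := hw.1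
      have := hb w (hre.le.trans (ht.trans (min_le_left _ _))) (abs_le.2 hw.2) z hz
      rwa [hre] at this)
    ⟨rfl, ⟨by simp only [imLm_coe]; linarith, by simp only [imLm_coe]; linarith⟩⟩
    ⟨by simp [period], ⟨by simp [period]; linarith, by simp [period]; linarith⟩⟩
  rw [add_sub_cancel_left] at this
  exact this.trans (le_of_eq (by ring))

namespace IsSol

variable {V : VolterraData ι} {ω : ℂ} {x₁ : ℝ} {φ : ℂ → ι → ℂ} {W : ℂ → ℂ → ι → ℂ}

/-- The monodromy of a solution is a solution. -/
lemma shift (h : IsSol V (fun t => ω + exp t) {t | t.re < x₁} φ W) :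
    IsSol V (fun t => ω + exp t) {t | t.re < x₁} (fun t => φ (t + period))
      (fun t => W (t + period)) := by
  have hmem : ∀ t ∈ {t : ℂ | t.re < x₁}, t + period ∈ {t : ℂ | t.re < x₁} :=
    fun t (ht : t.re < x₁) => by rw [Set.mem_ofPred_eq, period_re]; exact ht
  refine ⟨?_, fun t ht => h.entire _ (hmem t ht), fun t ht => h.expType _ (hmem t ht), ?_, ?_⟩
  · exact h.diff.comp (differentiable_id.add_const period).differentiableOn hmem
  · intro t ht z
    have := (h.hasDeriv _ (hmem t ht) z).comp_add_const t period
    simpa only [deriv_add_exp, exp_add_period] using this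
  · intro t ht i
    have := h.eq _ (hmem t ht) i
    simpa only [exp_add_period] using this

/-- Polynomials in the monodromy operator act on solutions. -/
lemma exists_aeval (h : IsSol V (fun t => ω + exp t) {t | t.re < x₁} φ W) (p : Polynomial ℂ) :
    ∃ W', IsSol V (fun t => ω + exp t) {t | t.re < x₁}
      (fun t i => Polynomial.aeval monodromy p (fun t => φ t i) t) W' := by
  induction p using Polynomial.induction_on with
  | C a =>
    refine ⟨fun t z => a • W t z, ?_⟩
    convert h.smul a using 1
    funext t i
    simp [Module.algebraMap_end_apply]
  | add p q hp hq =>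
    obtain ⟨W₁, h₁⟩ := hp
    obtain ⟨W₂, h₂⟩ := hq
    refine ⟨fun t z => W₁ t z + W₂ t z, ?_⟩
    convert h₁.add h₂ using 1
    funext t i
    simp
  | monomial n a hn =>
    obtain ⟨W₁, h₁⟩ := hn
    refine ⟨fun t => W₁ (t + period), ?_⟩
    convert h₁.shift using 1
    funext t i
    rw [pow_succ', ← mul_assoc, mul_comm (Polynomial.C a), mul_assoc, map_mul,
      Polynomial.aeval_X, Module.End.mul_apply, monodromy_apply]

end IsSol

section Kill

variable [DecidableEq ι]

/-- `T - ζ` to a high power kills `ξ^μ q(ln ξ)`. -/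
lemma aeval_monodromy_exp_mul_eval {μ ν : ℂ} (hν : exp (ν * period) = exp (μ * period))
    (q : Polynomial ℂ) {D : ℕ} (hD : q.natDegree < D) :
    Polynomial.aeval monodromy ((Polynomial.X - Polynomial.C (exp (μ * period))) ^ D)
      (fun t => exp (ν * t) * q.eval t) = 0 := by
  rw [aeval_monodromy_X_sub_C_pow]
  have := monodromy_sub_pow_apply_sum (ζ := exp (μ * period)) D
    (X := fun m t => q.coeff m * exp (ν * t)) (fun m t => by
      rw [mul_add, Complex.exp_add, hν]; ring)
  rw [← this]
  congr 1
  funext t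
  rw [Polynomial.eval_eq_sum_range' hD, Finset.mul_sum]
  exact Finset.sum_congr rfl fun m _ => by ring

lemma exp_sub_one_mul_period (μ : ℂ) : exp ((μ - 1) * period) = exp (μ * period) := by
  rw [sub_mul, one_mul, ← exp_add_period, sub_add_cancel]

lemma monodromy_mem_decaySubmodule {σ : ℝ} (G : ℂ → ℂ) (h : G ∈ decaySubmodule σ) :
    monodromy G ∈ decaySubmodule σ := Dec.shift h

lemma t_mul_mem_decaySubmodule {σ : ℝ} (G : ℂ → ℂ) (h : G ∈ decaySubmodule σ) :
    (fun t => t * G t) ∈ decaySubmodule σ := Dec.t_smul h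

namespace Resonance

variable {V : VolterraData ι} {ω : ℂ} {e : ℝ} {μ : ι → ℂ} {ord : ι → ℕ} {K : ι → ι → ℂ}
  {x₁ : ℝ} {φ : ℂ → ι → ℂ} {W : ℂ → ℂ → ι → ℂ}
  (hR : Resonance V ω e μ ord K)
  (h : IsSol V (fun t => ω + exp t) {t | t.re < x₁} φ W)
  (hne : ∀ t : ℂ, t.re < x₁ → ∀ i, ω + exp t ≠ V.sing i)

include hR h hne in
/-- Solutions that vanish at the singular point, together with their history, to a sufficient
order are zero. -/
lemma eventually_eq_zero (hφ : Decays (-e) φ) (hW : ∃ s₀ > 0, Dec (Metric.closedBall ω 2) s₀ W) :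
    ∀ᶠ t in logZero, φ t = 0 := by
  have hg : ∀ i, V.sing i = ω → Decays (1 - e) fun t => exp t * φ t i := fun i _ => by
    refine Decays.congr ((Decays.exp_mul (decays_pi.1 hφ i) 1).mono_exponent (by simp [sub_eq_neg_add]))
      (Eventually.of_forall fun t => ?_)
    rw [one_mul]
  -- `ξ φ_i` has order `1 - e`, above that of every homogeneous solution `ξ^μ`, and the history
  -- vanishes at `ω`. No constant of integration can appear, so the order rises without bound.
  have key : ∀ n : ℕ, Decays (-e + n) φ := by
    intro n
    induction n with
    | zero => simpa using hφ
    | succ n ih =>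
      have hWn := h.dec_history ih (Or.inr hW)
      refine decays_pi.2 fun i => ?_
      by_cases hi : V.sing i = ω
      · have := hR.decays_resonant h hne hWn le_rfl
          (fun i hi => Or.inr ⟨1 - e, hR.re_lt i hi, hg i hi⟩) i hi
        exact (decays_of_exp_mul this).mono_exponent (by push_cast; linarith)
      · exact (h.decays_of_nonresonant hne hWn hi).mono_exponent (by push_cast; linarith)
  obtain ⟨m, L, x₂, hm, hL, hx0, hx1, hb⟩ := h.norm_le_of_history hne
  -- With `n > L + e` the history is `O(e^{(L + 1) x})` on `Re t = x`. Grönwall's inequality from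
  -- there to `t` costs `e^{L (Re t - x)}`, so the bound tends to zero as `x → -∞`.
  obtain ⟨n, hn⟩ := exists_nat_gt (L + e)
  have hWn := h.dec_history (key n) (Or.inr hW)
  refine eventually_logZero_iff.2 ⟨x₂, fun t ht => ?_⟩
  obtain ⟨C, x₀, hC, hbW⟩ := hWn (L + 1) (by linarith) |t.im|
  have hle : ∀ᶠ x : ℝ in atBot, Real.exp t.re * ‖φ t‖ ≤
      m * C * Real.exp (L * t.re) * Real.exp (1 * x) := by
    filter_upwards [eventually_le_atBot t.re, eventually_le_atBot x₀] with x hx hx'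
    have := hb (x + t.im * I) 1 (t.re - x) (by simp) (by linarith)
      (by simpa using hx.trans ht.le) (by simpa using ht.le) (C * Real.exp ((L + 1) * x))
      (fun z hz => by
        have := hbW (x + t.im * I) (by simpa using hx') (by simp) z
          (Metric.closedBall_subset_closedBall (by norm_num) hz)
        simpa using this)
    have he : ((x : ℂ) + t.im * I + ((t.re - x : ℝ) : ℂ) * ((1 : ℝ) : ℂ)) = t := by
      nth_rewrite 3 [eq_re_add_im t]
      push_cast
      ring
    have he' : ((x : ℂ) + t.im * I).re + (t.re - x) * 1 = t.re := by simp
    rw [he, he'] at this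
    refine this.trans (le_of_eq ?_)
    rw [← mul_assoc, mul_assoc (m * C), mul_assoc (m * C), ← Real.exp_add, ← Real.exp_add]
    congr 2
    ring
  have h0 := ge_of_tendsto (tendsto_exp_mul_atBot one_pos (m * C * Real.exp (L * t.re))) hle
  have : ‖φ t‖ ≤ 0 := by
    by_contra hpos
    push Not at hpos
    exact absurd h0 (not_le.2 (by positivity))
  simpa using this

/-- The exponents of the resonant components. -/
def exponents (V : VolterraData ι) (ω : ℂ) (μ : ι → ℂ) : Finset ℂ :=
  (Finset.univ.filter fun i => V.sing i = ω).image μ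

omit [DecidableEq ι] in
/-- The leading terms of the solutions are killed by a polynomial in the monodromy. -/
lemma aeval_exponents_leading {V : VolterraData ι} {ω : ℂ} {μ : ι → ℂ} {i : ι}
    {q : Polynomial ℂ} {D : ℕ} (hq : V.sing i ≠ ω → q = 0) (hD : q.natDegree < D) :
    Polynomial.aeval monodromy
      (∏ ν ∈ exponents V ω μ, (Polynomial.X - Polynomial.C (exp (ν * period))) ^ D)
      (fun t => exp ((μ i - 1) * t) * q.eval t) = 0 := by
  by_cases hi : V.sing i = ω
  · have hmem : μ i ∈ exponents V ω μ :=
      Finset.mem_image_of_mem μ (Finset.mem_filter.2 ⟨Finset.mem_univ i, hi⟩)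
    rw [← Finset.prod_erase_mul _ _ hmem, map_mul, Module.End.mul_apply,
      aeval_monodromy_exp_mul_eval (exp_sub_one_mul_period (μ i)) q hD, map_zero]
  · have : (fun t => exp ((μ i - 1) * t) * q.eval t) = 0 := by
      funext t
      simp [hq hi]
    rw [this, map_zero]

include hR h hne in
/-- The leading part of a solution, and a polynomial in the monodromy that kills the solution. -/
theorem exists_leading_and_kill : ∃ (Q : ι → Polynomial ℂ) (D : ℕ),
    (∀ i, V.sing i ≠ ω → Q i = 0) ∧
    (∀ i, V.sing i = ω →
      (Q i).derivative = ∑ i' ∈ linked V ω i, Polynomial.C (K i i') * Q i') ∧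
    (∀ i, (Q i).natDegree < D) ∧
    (∀ i, Decays (-e) fun t => φ t i - exp ((μ i - 1) * t) * (Q i).eval t) ∧
    ∀ᶠ t in logZero, ∀ i, Polynomial.aeval monodromy ((Polynomial.X - Polynomial.C 1) *
      ∏ ν ∈ exponents V ω μ, (Polynomial.X - Polynomial.C (exp (ν * period))) ^ D)
      (fun t => φ t i) t = 0 := by
  obtain ⟨Q₀, hQ₀⟩ := hR.exists_leading h hne
  set Q : ι → Polynomial ℂ := fun i => if V.sing i = ω then Q₀ i else 0 with hQdef
  have hQR : ∀ i, V.sing i = ω → Q i = Q₀ i := fun i hi => by simp [hQdef, hi]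
  have hQN : ∀ i, V.sing i ≠ ω → Q i = 0 := fun i hi => by simp [hQdef, hi]
  set D := Finset.univ.sup (fun i => (Q i).natDegree) + 1 with hD
  have hDi : ∀ i, (Q i).natDegree < D := fun i => Nat.lt_succ_of_le
    (Finset.le_sup (f := fun i => (Q i).natDegree) (Finset.mem_univ i))
  set p := ∏ ν ∈ exponents V ω μ, (Polynomial.X - Polynomial.C (exp (ν * period))) ^ D with hp
  have hψ : ∀ i, Decays (-e) fun t => φ t i - exp ((μ i - 1) * t) * (Q i).eval t := by
    intro i
    by_cases hi : V.sing i = ω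
    · have h1 := (hQ₀ i hi).2
      refine Decays.congr ((Decays.exp_mul h1 (-1)).mono_exponent (by simp))
        (Eventually.of_forall fun t => ?_)
      rw [hQR i hi, mul_sub, ← mul_assoc, ← mul_assoc, ← Complex.exp_add, ← Complex.exp_add,
        show -1 * t + t = 0 by ring, Complex.exp_zero, one_mul,
        show -1 * t + μ i * t = (μ i - 1) * t by ring]
    · simpa [hQN i hi] using h.decays_of_nonresonant hne (hR.dec_history h hne) hi
  refine ⟨Q, D, hQN, fun i hi => ?_, hDi, hψ, ?_⟩
  · rw [hQR i hi, (hQ₀ i hi).1]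
    refine Finset.sum_congr rfl fun i' hi' => ?_
    rw [hQR i' (Finset.mem_filter.1 hi').2.1]
  -- the image of the solution under `p`
  have hlead : ∀ i, Polynomial.aeval monodromy p
      (fun t => exp ((μ i - 1) * t) * (Q i).eval t) = 0 :=
    fun i => aeval_exponents_leading (hQN i) (hDi i)
  have hpφ : Decays (-e) fun t i => Polynomial.aeval monodromy p (fun t => φ t i) t := by
    refine decays_pi.2 fun i => ?_
    have h1 := aeval_monodromy_mem (monodromy_mem_decaySubmodule (σ := -e)) p
      (mem_decaySubmodule.2 (hψ i))
    have h2 : (fun t => φ t i - exp ((μ i - 1) * t) * (Q i).eval t) =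
        (fun t => φ t i) - fun t => exp ((μ i - 1) * t) * (Q i).eval t := rfl
    rw [h2, map_sub, hlead i, sub_zero] at h1
    exact h1
  obtain ⟨W', hsol⟩ := h.exists_aeval p
  -- Solutions are stable under `T`, as the exponential is periodic. `p(T) φ` has order `-e`, so its
  -- history has a derivative of order `1 - e > 0`; applying `T - 1` gives the history itself this
  -- order, and the resulting solution must vanish.
  have hsol' := hsol.shift.sub hsol
  have he1 : 0 < 1 - e := by linarith [hR.lt_one]
  have hW' : Dec (Metric.closedBall ω 2) (1 - e) fun t z => W' (t + period) z - W' t z := by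
    refine Dec.shift_sub (fun z _ t ht => hsol.hasDeriv t ht z) ?_
    exact (IsSol.dec_history_deriv hpφ).mono_exponent (by linarith)
  have hφ'' : Decays (-e) fun t => (fun i => Polynomial.aeval monodromy p (fun t => φ t i)
      (t + period)) - fun i => Polynomial.aeval monodromy p (fun t => φ t i) t :=
    Decays.sub (G := fun t i => Polynomial.aeval monodromy p (fun t => φ t i) (t + period))
      (Dec.shift hpφ) hpφ
  have := hR.eventually_eq_zero hsol' hne hφ'' ⟨1 - e, he1, hW'⟩
  filter_upwards [this] with t ht i
  have hi := congrFun ht i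
  rw [map_mul, Module.End.mul_apply]
  simpa [sub_eq_zero] using hi

end Resonance

end Kill

end LevelOne

end

noncomputable section

namespace LevelOne

/-! ### The structure of solutions near a singular point -/

/-- Periodic functions of `t = ln ξ` of order larger than `-1` are holomorphic functions of `ξ`. -/
theorem exists_analyticAt_of_periodic {Y : ℂ → ℂ} (hper : ∀ t, Y (t + period) = Y t) {x₀ σ : ℝ}
    (han : AnalyticOnNhd ℂ Y {t | t.re < x₀}) (hσ : -1 < σ) (hY : Decays σ Y) :
    ∃ H : ℂ → ℂ, AnalyticAt ℂ H 0 ∧ ∀ t, Y t = H (exp t) := by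
  set h : ℝ := 2 * Real.pi with hh
  have hpos : 0 < h := Real.two_pi_pos
  -- The factor `ξ` makes the function tend to `0`, as the order of `Y` exceeds `-1`. The cusp
  -- function of a `2π`-periodic function is then holomorphic at the origin.
  set f : ℂ → ℂ := fun z => exp (I * z) * Y (I * z) with hf
  have hfp : Function.Periodic f h := fun z => by
    have h1 : I * (z + h) = I * z + period := by
      rw [hh, period]; push_cast; ring
    simp only [hf, h1, exp_add_period, hper]
  have hq : ∀ z, Function.Periodic.qParam h z = exp (I * z) := fun z => by
    rw [Function.Periodic.qParam, hh]
    congr 1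
    have : (Real.pi : ℂ) ≠ 0 := Complex.ofReal_ne_zero.2 Real.pi_ne_zero
    push_cast
    field_simp
  have hre : ∀ z : ℂ, (I * z).re = -z.im := fun z => by simp
  have hhol : ∀ᶠ z in comap Complex.im atTop, DifferentiableAt ℂ f z := by
    have hev : ∀ᶠ y : ℝ in atTop, -x₀ < y := eventually_gt_atTop _
    refine (hev.comap Complex.im).mono fun z hz => ?_
    have h1 : DifferentiableAt ℂ Y (I * z) := (han _ (by
      rw [Set.mem_ofPred_eq, hre]; linarith)).differentiableAt
    have h2 : DifferentiableAt ℂ (fun z : ℂ => I * z) z := by fun_prop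
    exact (by fun_prop : DifferentiableAt ℂ (fun z => exp (I * z)) z).mul
      (DifferentiableAt.comp (g := Y) z h1 h2)
  have hzero : Tendsto f (comap Complex.im atTop) (𝓝 0) := by
    obtain ⟨C, x, hC, hb⟩ := Decays.exp_mul hY 1 ((σ + 1) / 2) (by simp; linarith) h
    have hlim := (tendsto_exp_mul_atBot (σ := (σ + 1) / 2) (by linarith) C).comp
      tendsto_neg_atTop_atBot
    refine squeeze_zero_norm' ?_ (hlim.comp tendsto_comap)
    have hev : ∀ᶠ y : ℝ in atTop, -x ≤ y := eventually_ge_atTop _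
    refine (hev.comap Complex.im).mono fun z hz => ?_
    -- Orders are uniform only for bounded `Im t`; periodicity moves the point into one fundamental
    -- strip.
    set n : ℤ := ⌊z.re / h⌋ with hn
    have h3 : f (z - n * h) = f z := by
      have := hfp.sub_zsmul_eq n (x := z)
      simpa using this
    have him : (I * (z - n * h)).im = z.re - n * h := by simp
    have hre' : (I * (z - n * h)).re = -z.im := by simp
    have h4 := hb (I * (z - n * h)) (by rw [hre']; linarith) (by
      rw [him, abs_le]
      have h5 := Int.floor_le (z.re / h)
      have h6 := Int.lt_floor_add_one (z.re / h)
      rw [← hn, le_div_iff₀ hpos] at h5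
      rw [← hn, div_lt_iff₀ hpos] at h6
      constructor <;> nlinarith) () trivial
    simp only [hre', one_mul] at h4
    rw [← h3]
    exact h4
  have hbd : Filter.BoundedAtFilter (comap Complex.im atTop) f :=
    Filter.ZeroAtFilter.boundedAtFilter hzero
  set k := Function.Periodic.cuspFunction h f with hk
  have hk0 : k 0 = 0 := Function.Periodic.cuspFunction_zero_of_zero_at_inf hpos hzero
  have hkan : AnalyticAt ℂ k 0 := by
    rw [Complex.analyticAt_iff_eventually_differentiableAt]
    have h1 := Function.Periodic.eventually_differentiableAt_cuspFunction_nhds_ne_zero hpos hfp hhol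
    have h2 := Function.Periodic.differentiableAt_cuspFunction_zero hpos hfp hhol hbd
    rw [eventually_nhdsWithin_iff] at h1
    filter_upwards [h1] with q hq
    by_cases hq0 : q = 0
    · rw [hq0]; exact h2
    · exact hq hq0
  -- Division by `ξ` undoes the auxiliary factor; the quotient is holomorphic because `k 0 = 0`.
  refine ⟨dslope k 0, ?_, fun t => ?_⟩
  · obtain ⟨r, hr, hd⟩ := AnalyticAt.exists_differentiableOn_ball hkan
    have := (Complex.differentiableOn_dslope (Metric.ball_mem_nhds (0 : ℂ) hr)).2 hd
    exact this.analyticAt (Metric.ball_mem_nhds _ hr)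
  · have h1 : k (exp t) = exp t * Y t := by
      have := Function.Periodic.eq_cuspFunction hpos.ne' hfp (-I * t)
      rw [hq] at this
      have h2 : I * (-I * t) = t := by
        rw [← mul_assoc]; simp
      rw [h2] at this
      rw [hk, this, hf]
      simp only [h2]
    rw [dslope_of_ne _ (Complex.exp_ne_zero t), slope_def_field, h1, hk0, sub_zero, sub_zero,
      mul_div_cancel_left₀ _ (Complex.exp_ne_zero t)]

/-- Resurgent functions in the logarithmic coordinate form a space stable under monodromy and
under multiplication by `t`. -/
def logResSubmodule (S : Set ℂ) : Submodule ℂ (ℂ → ℂ) where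
  carrier := {G | LogRes S G}
  add_mem' := fun h₁ h₂ => LogRes.add h₁ h₂
  zero_mem' := LogRes.const 0
  smul_mem' := fun c _ h => LogRes.const_mul h c

lemma mem_logResSubmodule {S : Set ℂ} {G : ℂ → ℂ} : G ∈ logResSubmodule S ↔ LogRes S G := Iff.rfl

lemma monodromy_mem_logResSubmodule {S : Set ℂ} (G : ℂ → ℂ) (h : G ∈ logResSubmodule S) :
    monodromy G ∈ logResSubmodule S := LogRes.shift h

lemma t_mul_mem_logResSubmodule {S : Set ℂ} (G : ℂ → ℂ) (h : G ∈ logResSubmodule S) :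
    (fun t => t * G t) ∈ logResSubmodule S := LogRes.mul LogRes.id h

/-- Truncation commutes with the monodromy. -/
lemma aeval_monodromy_ite (p : Polynomial ℂ) (x₀ : ℝ) (f : ℂ → ℂ) :
    Polynomial.aeval monodromy p (fun t => if t.re < x₀ then f t else 0) =
      fun t => if t.re < x₀ then Polynomial.aeval monodromy p f t else 0 := by
  induction p using Polynomial.induction_on with
  | C a =>
    funext t
    by_cases ht : t.re < x₀ <;> simp [Module.algebraMap_end_apply, ht]
  | add p q hp hq =>
    funext t
    rw [map_add, LinearMap.add_apply, hp, hq]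
    by_cases ht : t.re < x₀ <;> simp [ht]
  | monomial n a hn =>
    rw [pow_succ', ← mul_assoc, mul_comm (Polynomial.C a), mul_assoc, map_mul,
      Polynomial.aeval_X, Module.End.mul_apply, hn]
    funext t
    rw [monodromy_apply, period_re, Module.End.mul_apply, monodromy_apply]

/-- Equal multipliers mean that the exponents differ by an integer, which is zero for real parts in
a half-open interval of length one. -/
lemma exp_mul_period_injOn {s : Set ℂ} {c : ℝ} (hs : ∀ ν ∈ s, c ≤ ν.re ∧ ν.re < c + 1) :
    Set.InjOn (fun ν => exp (ν * period)) s := by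
  intro ν hν ν' hν' he
  obtain ⟨n, hn⟩ := Complex.exp_eq_exp_iff_exists_int.1 he
  have h1 : ν = ν' + n := by
    have h2 : ν * period = (ν' + n) * period := by rw [hn, period]; ring
    exact mul_right_cancel₀ period_ne_zero h2
  have h3 : ν.re = ν'.re + n := by rw [h1]; simp
  have h4 := hs ν hν
  have h5 := hs ν' hν'
  have h6 : ((n : ℤ) : ℝ) < 1 := by linarith [h4.2, h5.1]
  have h7 : (-1 : ℝ) < n := by linarith [h4.1, h5.2]
  have h8 : n = 0 := by
    have h6' : n < 1 := by exact_mod_cast h6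
    have h7' : -1 < n := by exact_mod_cast h7
    omega
  rw [h1, h8]
  simp

/-- The factor `X - 1` belongs to the exponent `0`, which may already be one of the exponents in
`E`; the multiplicities are added. -/
lemma prod_insert_zero (E : Finset ℂ) (D : ℕ) :
    ∏ ν ∈ insert 0 E, (Polynomial.X - Polynomial.C (exp (ν * period))) ^
      ((if ν ∈ E then D else 0) + if ν = 0 then 1 else 0) =
    (Polynomial.X - Polynomial.C 1) *
      ∏ ν ∈ E, (Polynomial.X - Polynomial.C (exp (ν * period))) ^ D := by
  simp only [pow_add, Finset.prod_mul_distrib]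
  rw [mul_comm]
  congr 1
  · rw [Finset.prod_eq_single_of_mem 0 (Finset.mem_insert_self 0 E)]
    · simp
    · intro ν _ hν
      simp [hν]
  · symm
    refine (Finset.prod_congr rfl fun ν hν => ?_).trans
      (Finset.prod_subset (Finset.subset_insert 0 E) fun ν _ hν => ?_)
    · rw [if_pos hν]
    · rw [if_neg hν, pow_zero]

/-- The structure of functions of `t = ln ξ` killed by a polynomial in the monodromy. -/
theorem exists_log_expansion {S : Set ℂ} {e : ℝ} (he : 0 ≤ e) (he1 : e < 1) {E : Finset ℂ}
    (hE : ∀ ν ∈ E, -e ≤ ν.re ∧ ν.re < 1 - e) {D : ℕ} {ψ : ℂ → ℂ} (hψ : Decays (-e) ψ)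
    (hL : LogRes S ψ)
    (hkill : ∀ᶠ t in logZero, Polynomial.aeval monodromy ((Polynomial.X - Polynomial.C 1) *
      ∏ ν ∈ E, (Polynomial.X - Polynomial.C (exp (ν * period))) ^ D) ψ t = 0) :
    ∃ H : ℂ → ℕ → ℂ → ℂ,
      (∀ ν ∈ insert 0 E, ∀ m, AnalyticAt ℂ (H ν m) 0 ∧ LogRes S fun t => H ν m (exp t)) ∧
      (0 ∉ E → ∀ m, 1 ≤ m → H 0 m = 0) ∧
      ∀ᶠ t in logZero, ψ t = ∑ ν ∈ insert 0 E, exp (ν * t) *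
        ∑ m ∈ Finset.range (D + 1), H ν m (exp t) * t ^ m := by
  obtain ⟨x₀, hx₀⟩ := eventually_logZero_iff.1 hkill
  have hE' : ∀ ν ∈ ((insert 0 E : Finset ℂ) : Set ℂ), -e ≤ ν.re ∧ ν.re < -e + 1 := by
    intro ν hν
    rcases Finset.mem_insert.1 (Finset.mem_coe.1 hν) with rfl | hν
    · simp only [Complex.zero_re]
      constructor <;> linarith
    · have := hE ν hν
      constructor <;> linarith
  -- The algebra of the monodromy acts on functions on the whole plane, while the relation holds
  -- only near `ξ = 0`. Truncation in `Re t` is compatible with translations by `2πi` and makes the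
  -- relation global.
  set f : ℂ → ℂ := fun t => if t.re < x₀ then ψ t else 0 with hf
  have hfψ : ∀ᶠ t in logZero, ψ t = f t :=
    eventually_logZero_iff.2 ⟨x₀, fun t ht => by simp [hf, ht]⟩
  set N : ℂ → ℕ := fun ν => (if ν ∈ E then D else 0) + if ν = 0 then 1 else 0 with hN
  have hND : ∀ ν, N ν ≤ D + 1 := fun ν => by
    simp only [hN]
    split_ifs <;> omega
  have hinj := exp_mul_period_injOn hE'
  obtain ⟨X, hX, hX0, hXs⟩ := exists_expansion (s := insert 0 E)
    (ζ := fun ν => exp (ν * period)) hinj (fun _ _ => Complex.exp_ne_zero _) N (f := f) (by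
      rw [hN, prod_insert_zero, hf, aeval_monodromy_ite]
      funext t
      by_cases ht : t.re < x₀
      · simp only [ht, if_true]
        exact hx₀ t ht
      · simp [ht])
  have hXs' : f = fun t => ∑ ν ∈ insert 0 E, ∑ m ∈ Finset.range (D + 1), t ^ m * X ν m t := by
    funext t
    rw [hXs t]
    refine Finset.sum_congr rfl fun ν hν => Finset.sum_subset (Finset.range_mono (hND ν)) ?_
    intro m _ hm
    rw [hX0 ν hν m (by simpa using hm)]
    simp
  have hXdec : ∀ ν ∈ insert 0 E, ∀ m < D + 1, X ν m ∈ decaySubmodule (-e) :=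
    extraction monodromy_mem_decaySubmodule t_mul_mem_decaySubmodule hinj
      (fun _ _ => Complex.exp_ne_zero _) hX (by
        rw [← hXs']
        exact mem_decaySubmodule.2 (Decays.congr hψ hfψ))
  have hXres : ∀ ν ∈ insert 0 E, ∀ m < D + 1, X ν m ∈ logResSubmodule S :=
    extraction monodromy_mem_logResSubmodule t_mul_mem_logResSubmodule hinj
      (fun _ _ => Complex.exp_ne_zero _) hX (by
        rw [← hXs']
        exact mem_logResSubmodule.2 (hL.congr hfψ))
  have key : ∀ ν ∈ insert 0 E, ∀ m < D + 1, ∃ H : ℂ → ℂ, (N ν ≤ m → H = 0) ∧ AnalyticAt ℂ H 0 ∧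
      (LogRes S fun t => H (exp t)) ∧ ∀ t, X ν m t = exp (ν * t) * H (exp t) := by
    intro ν hν m hm
    by_cases hmN : N ν ≤ m
    · refine ⟨0, fun _ => rfl, analyticAt_const, LogRes.const 0, fun t => ?_⟩
      rw [hX0 ν hν m hmN]
      simp
    -- Multiplied by `ξ^{-ν}` the coefficient is single-valued, of order `-e - Re ν > -1`, hence
    -- holomorphic at `ξ = 0`.
    have hYL : LogRes S fun t => exp (-ν * t) * X ν m t :=
      (LogRes.exp_mul (-ν)).mul (mem_logResSubmodule.1 (hXres ν hν m hm))
    have hYd := Decays.exp_mul (mem_decaySubmodule.1 (hXdec ν hν m hm)) (-ν)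
    obtain ⟨x₂, han, -⟩ := id hYL
    obtain ⟨H, hH, hHe⟩ := exists_analyticAt_of_periodic (fun t => by
      rw [hX ν hν m t, mul_add, Complex.exp_add, neg_mul ν period, Complex.exp_neg (ν * period)]
      have := Complex.exp_ne_zero (ν * period)
      field_simp) han (by
        rw [Complex.neg_re]
        have := (hE' ν (Finset.mem_coe.2 hν)).2
        linarith) hYd
    refine ⟨H, fun h => absurd h hmN, hH, ?_, fun t => ?_⟩
    · exact hYL.congr (Eventually.of_forall hHe)
    · rw [← hHe t, exp_mul_exp_neg_mul]
  choose! H hH0 hHan hHres hHe using key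
  refine ⟨fun ν m => if m < D + 1 then H ν m else 0, fun ν hν m => ?_, fun h0 m hm => ?_, ?_⟩
  · by_cases hm : m < D + 1
    · simp only [hm, if_true]
      exact ⟨hHan ν hν m hm, hHres ν hν m hm⟩
    · simp only [hm, if_false]
      exact ⟨analyticAt_const, LogRes.const 0⟩
  · by_cases hmD : m < D + 1
    · simp only [hmD, if_true]
      refine hH0 0 (Finset.mem_insert_self 0 E) m hmD ?_
      simp only [hN, h0, if_false, if_true]
      omega
    · simp [hmD]
  · filter_upwards [hfψ] with t ht
    rw [ht, hXs']
    refine Finset.sum_congr rfl fun ν hν => ?_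
    rw [Finset.mul_sum]
    refine Finset.sum_congr rfl fun m hm => ?_
    rw [hHe ν hν m (Finset.mem_range.1 hm) t]
    simp only [Finset.mem_range.1 hm, if_true]
    ring

end LevelOne

end

noncomputable section

namespace LevelOne

/-! ### Exponential generating series and their convolution -/

/-- The exponential generating series of a sequence. -/
def egf (x : ℕ → ℂ) (z : ℂ) : ℂ := ∑' n : ℕ, x n / (n.factorial : ℂ) * z ^ n

lemma norm_div_factorial (c : ℂ) (n : ℕ) : ‖c / (n.factorial : ℂ)‖ = ‖c‖ / n.factorial := by
  rw [norm_div, Complex.norm_natCast]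

section Local

variable {x : ℕ → ℂ} {K ρ : ℝ} (hx : ∀ n, ‖x n‖ / n.factorial ≤ K * ρ ^ n)

include hx

lemma norm_egf_term_le {r : ℝ} {z : ℂ} (hz : ‖z‖ ≤ r) (n : ℕ) :
    ‖x n / (n.factorial : ℂ) * z ^ n‖ ≤ K * (ρ * r) ^ n := by
  rw [norm_mul, norm_pow, norm_div_factorial, mul_pow, ← mul_assoc]
  refine mul_le_mul (hx n) (pow_le_pow_left₀ (norm_nonneg _) hz n) (by positivity) ?_
  exact le_trans (by positivity) (hx n)

lemma hasSum_egf (hρ : 0 ≤ ρ) {z : ℂ} (hz : ρ * ‖z‖ < 1) :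
    HasSum (fun n => x n / (n.factorial : ℂ) * z ^ n) (egf x z) :=
  (Summable.of_norm_bounded ((summable_geometric_of_lt_one (by positivity) hz).mul_left K)
    fun n => norm_egf_term_le hx le_rfl n).hasSum

lemma differentiableOn_egf (hρ : 0 ≤ ρ) {r : ℝ} (hr : 0 ≤ r) (hρr : ρ * r < 1) :
    DifferentiableOn ℂ (egf x) (Metric.ball 0 r) := by
  refine differentiableOn_tsum_of_summable_norm
    ((summable_geometric_of_lt_one (mul_nonneg hρ hr) hρr).mul_left K)
    (fun n => by fun_prop) Metric.isOpen_ball fun n z hz => norm_egf_term_le hx ?_ n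
  simpa using (Metric.mem_ball.1 hz).le

end Local

section Entire

variable {x : ℕ → ℂ} {C R : ℝ} (hx : ∀ n, ‖x n‖ ≤ C * R ^ n)

include hx

lemma norm_egf_term_le' {r : ℝ} {z : ℂ} (hz : ‖z‖ ≤ r) (n : ℕ) :
    ‖x n / (n.factorial : ℂ) * z ^ n‖ ≤ C * ((R * r) ^ n / n.factorial) := by
  rw [norm_mul, norm_pow, norm_div_factorial, mul_pow]
  calc ‖x n‖ / n.factorial * ‖z‖ ^ n ≤ (C * R ^ n) / n.factorial * r ^ n := by
        have h0 : 0 ≤ C * R ^ n := (norm_nonneg _).trans (hx n)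
        gcongr
        exact hx n
    _ = _ := by ring

lemma hasSum_egf' (z : ℂ) : HasSum (fun n => x n / (n.factorial : ℂ) * z ^ n) (egf x z) :=
  (Summable.of_norm_bounded ((Real.summable_pow_div_factorial (R * ‖z‖)).mul_left C)
    fun n => norm_egf_term_le' hx le_rfl n).hasSum

lemma differentiable_egf : Differentiable ℂ (egf x) := by
  intro z
  have : DifferentiableOn ℂ (egf x) (Metric.ball 0 (‖z‖ + 1)) :=
    differentiableOn_tsum_of_summable_norm
      ((Real.summable_pow_div_factorial (R * (‖z‖ + 1))).mul_left C)
      (fun n => by fun_prop) Metric.isOpen_ball fun n z hz => norm_egf_term_le' hx (by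
        simpa using (Metric.mem_ball.1 hz).le) n
  exact this.differentiableAt (Metric.isOpen_ball.mem_nhds (by simp))

lemma expType_egf (hR : 0 ≤ R) : ExpType (egf x) := by
  have hC : 0 ≤ C := by simpa using (norm_nonneg _).trans (hx 0)
  refine ⟨C, R, hC, hR, fun z => ?_⟩
  have h1 : HasSum (fun n : ℕ => C * ((R * ‖z‖) ^ n / n.factorial)) (C * Real.exp (R * ‖z‖)) := by
    rw [Real.exp_eq_exp_ℝ]
    exact (NormedSpace.expSeries_div_hasSum_exp (R * ‖z‖)).mul_left C
  exact tsum_of_norm_bounded h1 fun n => norm_egf_term_le' hx le_rfl n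

end Entire

/-- The convolution of monomials. -/
lemma segInt_monomial (a : ℕ) : ∀ (b : ℕ) (t : ℂ),
    segInt 0 t (fun y => (t - y) ^ a / (a.factorial : ℂ) * (y ^ b / (b.factorial : ℂ))) =
      t ^ (a + b + 1) / ((a + b + 1).factorial : ℂ) := by
  suffices H : ∀ (b : ℕ) (t : ℂ), ∃ g : ℂ → ℂ, (∀ y, HasDerivAt g
      ((t - y) ^ a / (a.factorial : ℂ) * (y ^ b / (b.factorial : ℂ))) y) ∧ g 0 = 0 ∧
      g t = t ^ (a + b + 1) / ((a + b + 1).factorial : ℂ) by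
    intro b t
    obtain ⟨g, hg, h0, ht⟩ := H b t
    rw [segInt_eq_sub convex_univ (Set.mem_univ _) (Set.mem_univ _)
      (by fun_prop : Continuous _).continuousOn (fun y _ => hg y), h0, ht, sub_zero]
  have hpow : ∀ (b : ℕ) (y : ℂ), HasDerivAt (fun y : ℂ => y ^ (b + 1) / ((b + 1).factorial : ℂ))
      (y ^ b / (b.factorial : ℂ)) y := by
    intro b y
    refine ((hasDerivAt_pow (b + 1) y).div_const _).congr_deriv ?_
    rw [Nat.factorial_succ]
    have h1 : (b.factorial : ℂ) ≠ 0 := Nat.cast_ne_zero.2 b.factorial_ne_zero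
    have h2 : (b : ℂ) + 1 ≠ 0 := Nat.cast_add_one_ne_zero b
    push_cast
    rw [mul_div_mul_left _ _ h2]
  induction a with
  | zero =>
    intro b t
    refine ⟨fun y => y ^ (b + 1) / ((b + 1).factorial : ℂ), fun y => ?_, by simp, by
      rw [Nat.zero_add]⟩
    simpa using hpow b y
  | succ a ih =>
    intro b t
    obtain ⟨g, hg, h0, ht⟩ := ih (b + 1) t
    -- Integration by parts; the boundary term vanishes at `0` and at `t`.
    refine ⟨fun y => (t - y) ^ (a + 1) / ((a + 1).factorial : ℂ) *
      (y ^ (b + 1) / ((b + 1).factorial : ℂ)) + g y, fun y => ?_, by simp [h0], ?_⟩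
    · have h1 : HasDerivAt (fun y : ℂ => (t - y) ^ (a + 1) / ((a + 1).factorial : ℂ))
          (-((t - y) ^ a / (a.factorial : ℂ))) y := by
        refine ((hpow a (t - y)).comp y ((hasDerivAt_id y).const_sub t)).congr_deriv ?_
        simp
      refine ((h1.mul (hpow b y)).add (hg y)).congr_deriv ?_
      ring
    · simp only [sub_self, ne_eq, Nat.add_eq_zero_iff, one_ne_zero, and_false, not_false_eq_true,
        zero_pow, zero_div, zero_mul, zero_add, ht]
      rw [show a + (b + 1) + 1 = a + 1 + b + 1 by ring]

/-- The convolution of two exponential generating series. -/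
theorem hasSum_convolution {α x : ℕ → ℂ} {C R K ρ : ℝ} (hα : ∀ n, ‖α n‖ ≤ C * R ^ n)
    (hx : ∀ n, ‖x n‖ / n.factorial ≤ K * ρ ^ n) (hR : 0 ≤ R) (hρ : 0 ≤ ρ) {t : ℂ}
    (ht : ρ * ‖t‖ < 1) :
    HasSum (fun n : ℕ => (∑ ab ∈ Finset.HasAntidiagonal.antidiagonal n, α ab.1 * x ab.2) *
      (t ^ (n + 1) / ((n + 1).factorial : ℂ))) (segInt 0 t fun y => egf α (t - y) * egf x y) := by
  have hC : 0 ≤ C := by simpa using (norm_nonneg _).trans (hα 0)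
  have hK : 0 ≤ K := by
    have := hx 0
    simp only [Nat.factorial_zero, Nat.cast_one, div_one, pow_zero, mul_one] at this
    exact (norm_nonneg _).trans this
  have hs1 : Summable fun n : ℕ => C * ((R * ‖t‖) ^ n / n.factorial) :=
    (Real.summable_pow_div_factorial (R * ‖t‖)).mul_left C
  have hs2 : Summable fun n : ℕ => K * (ρ * ‖t‖) ^ n :=
    (summable_geometric_of_lt_one (by positivity) ht).mul_left K
  have hs : Summable fun ab : ℕ × ℕ => ‖t‖ * ((C * ((R * ‖t‖) ^ ab.1 / ab.1.factorial)) *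
      (K * (ρ * ‖t‖) ^ ab.2)) :=
    (hs1.mul_of_nonneg hs2 (fun n => by positivity) (fun n => by positivity)).mul_left _
  set T : ℕ × ℕ → ℝ → ℂ := fun ab σ => t * ((α ab.1 / (ab.1.factorial : ℂ) * (t - σ * t) ^ ab.1) *
    (x ab.2 / (ab.2.factorial : ℂ) * (σ * t) ^ ab.2)) with hT
  have hn1 : ∀ σ ∈ Set.uIoc (0 : ℝ) 1, ‖t - σ * t‖ ≤ ‖t‖ ∧ ‖(σ : ℂ) * t‖ ≤ ‖t‖ := by
    intro σ hσ
    rw [Set.uIoc_of_le zero_le_one] at hσ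
    have h1 : t - σ * t = ((1 - σ : ℝ) : ℂ) * t := by push_cast; ring
    rw [h1, norm_mul, norm_mul, Complex.norm_real, Complex.norm_real, Real.norm_eq_abs,
      Real.norm_eq_abs, abs_of_nonneg (by linarith [hσ.2]), abs_of_nonneg hσ.1.le]
    constructor <;> nlinarith [norm_nonneg t, hσ.1, hσ.2]
  have hsum : HasSum (fun ab : ℕ × ℕ => ∫ σ in (0 : ℝ)..1, T ab σ)
      (segInt 0 t fun y => egf α (t - y) * egf x y) := by
    rw [segInt]
    simp only [sub_zero, zero_add, smul_eq_mul]
    refine intervalIntegral.hasSum_integral_of_dominated_convergence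
      (fun ab _ => ‖t‖ * ((C * ((R * ‖t‖) ^ ab.1 / ab.1.factorial)) * (K * (ρ * ‖t‖) ^ ab.2)))
      (fun ab => ?_) (fun ab => Eventually.of_forall fun σ hσ => ?_)
      (Eventually.of_forall fun σ _ => hs) intervalIntegrable_const
      (Eventually.of_forall fun σ hσ => ?_)
    · exact (by fun_prop : Continuous (T ab)).aestronglyMeasurable
    · rw [hT]
      simp only
      rw [norm_mul t, norm_mul (α ab.1 / _ * _)]
      exact mul_le_mul_of_nonneg_left (mul_le_mul (norm_egf_term_le' hα (hn1 σ hσ).1 _)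
        (norm_egf_term_le hx (hn1 σ hσ).2 _) (norm_nonneg _) (by positivity)) (norm_nonneg _)
    · have h2 : ρ * ‖(σ : ℂ) * t‖ < 1 :=
        (mul_le_mul_of_nonneg_left (hn1 σ hσ).2 hρ).trans_lt ht
      have h3 := hasSum_egf' hα (t - σ * t)
      have h4 := hasSum_egf hx hρ h2
      have h5 : Summable fun ab : ℕ × ℕ => (α ab.1 / (ab.1.factorial : ℂ) * (t - σ * t) ^ ab.1) *
          (x ab.2 / (ab.2.factorial : ℂ) * (σ * t) ^ ab.2) :=
        summable_mul_of_summable_norm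
          (f := fun n : ℕ => α n / (n.factorial : ℂ) * (t - σ * t) ^ n)
          (g := fun n : ℕ => x n / (n.factorial : ℂ) * (σ * t) ^ n)
          (Summable.of_nonneg_of_le (fun _ => norm_nonneg _)
            (fun n => norm_egf_term_le' hα (hn1 σ hσ).1 n) hs1)
          (Summable.of_nonneg_of_le (fun _ => norm_nonneg _)
            (fun n => norm_egf_term_le hx (hn1 σ hσ).2 n) hs2)
      exact (h3.mul h4 h5).mul_left t
  have hterm : ∀ ab : ℕ × ℕ, ∫ σ in (0 : ℝ)..1, T ab σ =
      α ab.1 * x ab.2 * (t ^ (ab.1 + ab.2 + 1) / ((ab.1 + ab.2 + 1).factorial : ℂ)) := by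
    intro ab
    rw [← segInt_monomial ab.1 ab.2 t, segInt, ← intervalIntegral.integral_const_mul]
    congr 1
    funext σ
    rw [hT]
    simp only [sub_zero, zero_add, smul_eq_mul]
    ring
  simp only [hterm] at hsum
  -- The double series is regrouped by total degree.
  have h5 := (Finset.HasAntidiagonal.sigmaAntidiagonalEquivProd (A := ℕ)).hasSum_iff.2 hsum
  have h6 := h5.sigma (g := fun n : ℕ => (∑ ab ∈ Finset.HasAntidiagonal.antidiagonal n, α ab.1 * x ab.2) *
      (t ^ (n + 1) / ((n + 1).factorial : ℂ))) fun n => by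
    have h7 : (∑ ab ∈ Finset.HasAntidiagonal.antidiagonal n, α ab.1 * x ab.2) *
        (t ^ (n + 1) / ((n + 1).factorial : ℂ)) = ∑ c : Finset.HasAntidiagonal.antidiagonal n,
          α (c : ℕ × ℕ).1 * x (c : ℕ × ℕ).2 * (t ^ ((c : ℕ × ℕ).1 + (c : ℕ × ℕ).2 + 1) /
            (((c : ℕ × ℕ).1 + (c : ℕ × ℕ).2 + 1).factorial : ℂ)) := by
      rw [Finset.sum_mul, Finset.sum_coe_sort (Finset.HasAntidiagonal.antidiagonal n) fun c : ℕ × ℕ =>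
        α c.1 * x c.2 * (t ^ (c.1 + c.2 + 1) / ((c.1 + c.2 + 1).factorial : ℂ))]
      refine Finset.sum_congr rfl fun c hc => ?_
      rw [Finset.HasAntidiagonal.mem_antidiagonal.1 hc]
    rw [h7]
    exact hasSum_fintype _
  exact h6

/-! ### Volterra equations with a kernel given by generating series -/

section Data

variable {ι : Type*} [Fintype ι] [DecidableEq ι]

/-- The elementary matrices as operators. -/
def elemCLM (i i' : ι) : (ι → ℂ) →L[ℂ] (ι → ℂ) :=
  (ContinuousLinearMap.proj (R := ℂ) (φ := fun _ : ι => ℂ) i').smulRight (Pi.single i 1)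

/-- The Volterra equation with kernel the exponential generating series of the matrices `M n`. -/
def egfData (sing : ι → ℂ) (M : ℕ → ι → ι → ℂ) {C R : ℝ} (hR : 0 ≤ R)
    (hM : ∀ n i i', ‖M n i i'‖ ≤ C * R ^ n) : VolterraData ι where
  sing := sing
  ker := fun z => ∑ i, ∑ i', egf (fun n => M n i i') z • elemCLM i i'
  ker_diff := Differentiable.fun_sum fun i _ => Differentiable.fun_sum fun i' _ =>
    (differentiable_egf fun n => hM n i i').smul_const _
  ker_exp := by
    have h0 : ExpType fun _ : ℂ => (0 : (ι → ℂ) →L[ℂ] (ι → ℂ)) :=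
      ⟨0, 0, le_rfl, le_rfl, by simp⟩
    have hsum : ∀ {κ : Type _} (s : Finset κ) (f : κ → ℂ → (ι → ℂ) →L[ℂ] (ι → ℂ)),
        (∀ i ∈ s, ExpType (f i)) → ExpType fun z => ∑ i ∈ s, f i z := by
      classical
      intro κ s f hf
      induction s using Finset.induction_on with
      | empty => simpa using h0
      | insert i s hi ih =>
        simp only [Finset.sum_insert hi]
        exact (hf i (Finset.mem_insert_self i s)).add
          (ih fun j hj => hf j (Finset.mem_insert_of_mem hj))
    refine hsum _ _ fun i _ => hsum _ _ fun i' _ => ?_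
    obtain ⟨C', A, hC', hA, hb⟩ := expType_egf (fun n => hM n i i') hR
    refine ⟨C' * ‖elemCLM i i'‖, A, by positivity, hA, fun z => ?_⟩
    rw [norm_smul]
    calc _ ≤ C' * Real.exp (A * ‖z‖) * ‖elemCLM i i'‖ := by gcongr; exact hb z
      _ = _ := by ring

lemma egfData_ker_apply (sing : ι → ℂ) (M : ℕ → ι → ι → ℂ) {C R : ℝ} (hR : 0 ≤ R)
    (hM : ∀ n i i', ‖M n i i'‖ ≤ C * R ^ n) (z : ℂ) (v : ι → ℂ) (i : ι) :
    (egfData sing M hR hM).ker z v i = ∑ i', egf (fun n => M n i i') z * v i' := by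
  simp only [egfData, elemCLM, _root_.sum_apply, _root_.smul_apply,
    ContinuousLinearMap.smulRight_apply, ContinuousLinearMap.proj_apply, Finset.sum_apply,
    Pi.smul_apply, smul_eq_mul]
  rw [Finset.sum_eq_single i]
  · refine Finset.sum_congr rfl fun i' _ => ?_
    simp
  · intro j _ hj
    refine Finset.sum_eq_zero fun i' _ => ?_
    simp [hj.symm]
  · simp

lemma egf_zero (x : ℕ → ℂ) : egf x 0 = x 0 := by
  rw [egf, tsum_eq_single 0]
  · simp
  · intro n hn
    simp [hn]

omit [DecidableEq ι] in
lemma segInt_apply {t : ℂ} {f : ℂ → ι → ℂ} {r : ℝ} (ht : t ∈ Metric.ball (0 : ℂ) r)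
    (hf : ContinuousOn f (Metric.ball 0 r)) (i : ι) :
    segInt 0 t f i = segInt 0 t fun y => f y i := by
  have h0 : (0 : ℂ) ∈ Metric.ball (0 : ℂ) r :=
    Metric.mem_ball_self (dist_nonneg.trans_lt (Metric.mem_ball.1 ht))
  have hc := segment_continuousOn (convex_ball (0 : ℂ) r) h0 hf ht
  have hint : IntervalIntegrable (fun σ : ℝ => (t - 0) • f (0 + σ * (t - 0)))
      MeasureTheory.volume 0 1 := by
    refine ContinuousOn.intervalIntegrable ?_
    rw [Set.uIcc_of_le zero_le_one]
    exact hc.const_smul (t - 0)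
  have := (ContinuousLinearMap.proj (R := ℂ) (φ := fun _ : ι => ℂ) i).intervalIntegral_comp_comm
    hint
  rw [segInt, segInt]
  exact this.symm

/-- Sequences that satisfy the recurrence give solutions of the Volterra equation near `0`. -/
theorem isSol_egf (sing : ι → ℂ) (M : ℕ → ι → ι → ℂ) {C R : ℝ} (hR : 0 ≤ R)
    (hM : ∀ n i i', ‖M n i i'‖ ≤ C * R ^ n) {x β : ℕ → ι → ℂ} {K ρ : ℝ} (hρ : 0 < ρ)
    (hx : ∀ n i, ‖x n i‖ / n.factorial ≤ K * ρ ^ n) (hβ : ∀ n i, ‖β n i‖ ≤ C * R ^ n)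
    (hzero : ∀ i, -(sing i) * x 0 i = β 0 i)
    (hrec : ∀ n i, (n + 1) * x n i - sing i * x (n + 1) i = β (n + 1) i +
      ∑ ab ∈ Finset.HasAntidiagonal.antidiagonal n, ∑ i', M ab.1 i i' * x ab.2 i') :
    ∃ W, IsSol (egfData sing M hR hM) (fun z => z) (Metric.ball 0 (2 * ρ)⁻¹)
      (fun z i => egf (fun n => x n i) z) W := by
  set V := egfData sing M hR hM with hV
  set φ : ℂ → ι → ℂ := fun z i => egf (fun n => x n i) z with hφ
  have hr : (0 : ℝ) < (2 * ρ)⁻¹ := by positivity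
  have hρr : ρ * (2 * ρ)⁻¹ < 1 := by
    rw [mul_inv, mul_comm (2⁻¹ : ℝ), ← mul_assoc, mul_inv_cancel₀ hρ.ne']
    norm_num
  have hφd : DifferentiableOn ℂ φ (Metric.ball 0 (2 * ρ)⁻¹) :=
    differentiableOn_pi.2 fun i => differentiableOn_egf (fun n => hx n i) hρ.le hr.le hρr
  have h0 : (0 : ℂ) ∈ Metric.ball (0 : ℂ) (2 * ρ)⁻¹ := Metric.mem_ball_self hr
  have hconv := convex_ball (0 : ℂ) (2 * ρ)⁻¹
  have hid : Differentiable ℂ fun z : ℂ => z := differentiable_id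
  have hβd : Differentiable ℂ fun z i => egf (fun n => β n i) z :=
    differentiable_pi.2 fun i => differentiable_egf fun n => hβ n i
  refine ⟨fun t z => (fun i => egf (fun n => β n i) z) + history V (fun z => z) 0 φ t z, hφd,
    fun t ht => hβd.add (history_entire V hid hconv h0 hφd ht), fun t ht => ?_, fun t ht z => ?_,
    fun t ht i => ?_⟩
  · refine ExpType.add ?_ (history_expType V hid hconv h0 hφd ht)
    choose C' A hC' hA hb using fun i => expType_egf (fun n => hβ n i) hR
    refine ⟨∑ i, C' i, ∑ i, A i, Finset.sum_nonneg fun i _ => hC' i,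
      Finset.sum_nonneg fun i _ => hA i, fun z => ?_⟩
    have hCs : 0 ≤ ∑ i, C' i := Finset.sum_nonneg fun i _ => hC' i
    refine (pi_norm_le_iff_of_nonneg (by positivity)).2 fun i => (hb i z).trans ?_
    gcongr
    · exact Finset.single_le_sum (f := C') (fun j _ => hC' j) (Finset.mem_univ i)
    · exact Finset.single_le_sum (f := A) (fun j _ => hA j) (Finset.mem_univ i)
  · exact (history_hasDerivAt V hid hconv Metric.isOpen_ball h0 hφd ht z).const_add _
  · have htr : ρ * ‖t‖ < 1 := by
      have : ‖t‖ < (2 * ρ)⁻¹ := by simpa using ht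
      exact (mul_lt_mul_of_pos_left this hρ).trans hρr
    have hhist : HasSum (fun n : ℕ => (∑ ab ∈ Finset.HasAntidiagonal.antidiagonal n, ∑ i', M ab.1 i i' * x ab.2 i') *
        (t ^ (n + 1) / ((n + 1).factorial : ℂ))) (history V (fun z => z) 0 φ t t i) := by
      have hd := (history_integrand_differentiableOn V hid hφd t).continuousOn
      rw [history, segInt_apply ht hd]
      simp only [deriv_id'', one_smul, hV, egfData_ker_apply]
      have hsegsum : segInt 0 t (fun y => ∑ i', egf (fun n => M n i i') (t - y) * φ y i') =
          ∑ i', segInt 0 t fun y => egf (fun n => M n i i') (t - y) * φ y i' := by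
        simp only [segInt, Finset.smul_sum]
        rw [intervalIntegral.integral_finsetSum]
        intro i' _
        refine ContinuousOn.intervalIntegrable ?_
        rw [Set.uIcc_of_le zero_le_one]
        refine ContinuousOn.const_smul (ContinuousOn.mul ?_ ?_) (t - 0)
        · have h1 : Continuous fun σ : ℝ => t - (0 + σ * (t - 0)) := by fun_prop
          exact ((differentiable_egf fun n => hM n i i').continuous.comp h1).continuousOn
        · exact segment_continuousOn hconv h0 (differentiableOn_pi.1 hφd i').continuousOn ht
      rw [hsegsum]
      have := hasSum_sum (s := Finset.univ) fun i' (_ : i' ∈ Finset.univ) =>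
        hasSum_convolution (fun n => hM n i i') (fun n => hx n i') hR hρ.le htr
      refine this.congr_fun fun n => ?_
      rw [Finset.sum_comm, Finset.sum_mul]
    have hφs := hasSum_egf (fun n => hx n i) hρ.le htr
    have hβs := hasSum_egf' (fun n => hβ n i) t
    have hβs' := (hasSum_nat_add_iff' 1).2 hβs
    have hφs' := (hasSum_nat_add_iff' 1).2 hφs
    -- With the constant terms split off, the coefficients of `t ^ (n + 1) / (n + 1)!` on both sides
    -- are compared; this is the recurrence. The constant terms are matched by `hzero`.
    have hlhs : HasSum (fun n : ℕ => t * (x n i / (n.factorial : ℂ) * t ^ n) -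
        sing i * (x (n + 1) i / ((n + 1).factorial : ℂ) * t ^ (n + 1)))
        (t * φ t i - sing i * (φ t i - x 0 i)) := by
      refine (hφs.mul_left t).sub ((HasSum.mul_left (sing i) ?_))
      simpa using hφs'
    have hrhs : HasSum (fun n : ℕ => t * (x n i / (n.factorial : ℂ) * t ^ n) -
        sing i * (x (n + 1) i / ((n + 1).factorial : ℂ) * t ^ (n + 1)))
        ((egf (fun n => β n i) t - β 0 i) + history V (fun z => z) 0 φ t t i) := by
      refine HasSum.congr_fun (HasSum.add (by simpa using hβs') hhist) fun n => ?_
      have hf : ((n + 1).factorial : ℂ) = (n + 1) * (n.factorial : ℂ) := by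
        rw [Nat.factorial_succ]; push_cast; ring
      have h1 : (n.factorial : ℂ) ≠ 0 := Nat.cast_ne_zero.2 n.factorial_ne_zero
      have h2 : (n : ℂ) + 1 ≠ 0 := Nat.cast_add_one_ne_zero n
      have h3 := hrec n i
      rw [hf]
      field_simp
      linear_combination (t * t ^ n) * h3
    have := hlhs.unique hrhs
    rw [Pi.add_apply]
    change (t - sing i) * φ t i = _
    linear_combination this + hzero i

end Data

end LevelOne

end

noncomputable section

namespace LevelOne

/-! ### The recurrence for the coefficients of the formal solution -/

section Recurrence

variable {J : ℕ} {n : Fin J → ℕ} {a lam : Fin J → ℂ} {A F : Matrix (Idx n) (Idx n) ℂ⟦X⟧}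

/-- The entries of `L` outside of the diagonal blocks vanish. -/
lemma monodromyExponent_apply_of_ne {p q : Idx n} (h : p.1 ≠ q.1) :
    monodromyExponent n lam p q = 0 :=
  Matrix.blockDiagonal'_apply_ne _ _ _ h

lemma monodromyExponent_apply_eq (j : Fin J) (r s : Fin (n j)) :
    monodromyExponent n lam ⟨j, r⟩ ⟨j, s⟩ =
      (if r = s then lam j else 0) + if (r : ℕ) + 1 = s then 1 else 0 := by
  rw [monodromyExponent, Matrix.blockDiagonal'_apply_eq, Matrix.add_apply, Matrix.smul_apply,
    Matrix.one_apply, jordanNilpotent, Matrix.of_apply]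
  simp

lemma coeff_mul_normalForm (m : ℕ) (p q : Idx n) :
    PowerSeries.coeff (m + 1) ((F * normalForm n a lam) p q) =
      PowerSeries.coeff (m + 1) (F p q) * a q.1 +
        ∑ r, PowerSeries.coeff m (F p r) * monodromyExponent n lam r q := by
  rw [normalForm, mul_add, Matrix.add_apply, map_add, Matrix.mul_diagonal,
    PowerSeries.coeff_mul_C, Matrix.mul_apply, map_sum]
  congr 1
  refine Finset.sum_congr rfl fun r _ => ?_
  rw [Matrix.smul_apply, Matrix.map_apply, smul_eq_mul, mul_left_comm,
    PowerSeries.coeff_succ_X_mul, PowerSeries.coeff_mul_C]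

variable (hF0 : F.map PowerSeries.constantCoeff = 1) (hF : IsFormalSolution n a lam A F)

include hF0 in
lemma coeff_zero_solution (p q : Idx n) :
    PowerSeries.coeff 0 (F p q) = if p = q then 1 else 0 := by
  have := congrFun (congrFun hF0 p) q
  rw [Matrix.map_apply, Matrix.one_apply] at this
  rw [PowerSeries.coeff_zero_eq_constantCoeff_apply, this]

include hF0 hF in
lemma coeff_zero_system (p q : Idx n) :
    PowerSeries.coeff 0 (A p q) = if p = q then a q.1 else 0 := by
  have h := congrArg (PowerSeries.coeff 0) (congrFun (congrFun hF p) q)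
  have h1 : PowerSeries.coeff 0 ((A * F) p q) = PowerSeries.coeff 0 (A p q) := by
    rw [Matrix.mul_apply, map_sum, Finset.sum_eq_single q]
    · rw [PowerSeries.coeff_mul, Finset.HasAntidiagonal.antidiagonal_zero, Finset.sum_singleton,
        coeff_zero_solution hF0, if_pos rfl, mul_one]
    · intro r _ hr
      rw [PowerSeries.coeff_mul, Finset.HasAntidiagonal.antidiagonal_zero, Finset.sum_singleton,
        coeff_zero_solution hF0, if_neg hr, mul_zero]
    · simp
  have h2 : PowerSeries.coeff 0 ((F * normalForm n a lam) p q) = if p = q then a q.1 else 0 := by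
    rw [normalForm, mul_add, Matrix.add_apply, map_add, Matrix.mul_diagonal,
      PowerSeries.coeff_mul_C, coeff_zero_solution hF0, Matrix.mul_apply, map_sum,
      Finset.sum_eq_zero]
    · simp
    · intro r _
      rw [Matrix.smul_apply, smul_eq_mul, mul_left_comm, PowerSeries.coeff_zero_X_mul]
  rw [Matrix.add_apply, map_add, h1, h2, Matrix.smul_apply, smul_eq_mul,
    PowerSeries.coeff_X_pow_mul', if_neg (by norm_num), zero_add] at h
  exact h.symm

include hF0 hF in
/-- The recurrence for the coefficients of the formal solution. -/
lemma recurrence (m : ℕ) (p q : Idx n) :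
    (a p.1 - a q.1) * PowerSeries.coeff (m + 1) (F p q) = m * PowerSeries.coeff m (F p q) +
      ∑ r, PowerSeries.coeff m (F p r) * monodromyExponent n lam r q -
      ∑ ab ∈ Finset.HasAntidiagonal.antidiagonal m, ∑ r,
        PowerSeries.coeff (ab.1 + 1) (A p r) * PowerSeries.coeff ab.2 (F r q) := by
  have h := congrArg (PowerSeries.coeff (m + 1)) (congrFun (congrFun hF p) q)
  have h1 : PowerSeries.coeff (m + 1) ((A * F) p q) = a p.1 * PowerSeries.coeff (m + 1) (F p q) +
      ∑ ab ∈ Finset.HasAntidiagonal.antidiagonal m, ∑ r,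
        PowerSeries.coeff (ab.1 + 1) (A p r) * PowerSeries.coeff ab.2 (F r q) := by
    rw [Matrix.mul_apply, map_sum]
    simp only [PowerSeries.coeff_mul, Finset.Nat.sum_antidiagonal_succ]
    rw [Finset.sum_add_distrib]
    congr 1
    · simp only [coeff_zero_system hF0 hF]
      rw [Finset.sum_eq_single p]
      · simp
      · intro r _ hr
        simp [hr.symm]
      · simp
    · rw [Finset.sum_comm]
  have h2 : PowerSeries.coeff (m + 1)
      (((PowerSeries.X ^ 2 : ℂ⟦X⟧) • F.map (PowerSeries.derivative ℂ)) p q) =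
      m * PowerSeries.coeff m (F p q) := by
    rw [Matrix.smul_apply, smul_eq_mul, PowerSeries.coeff_X_pow_mul', Matrix.map_apply]
    rcases m with _ | m
    · simp
    · rw [if_pos (by omega), show m + 1 + 1 - 2 = m by omega, PowerSeries.coeff_derivative]
      push_cast
      ring
  rw [Matrix.add_apply, map_add, h1, h2, coeff_mul_normalForm] at h
  linear_combination -h

end Recurrence

/-! ### Gevrey bounds -/

/-- With `ρ = R (1 + C)` the sequence `ρ ^ m` is a supersolution of the recurrence. The sum of the
first terms serves as constant to start the induction after `m₀`. -/
lemma geometric_of_recurrence {c : ℕ → ℝ} (hc : ∀ m, 0 ≤ c m) {C R : ℝ} (hC : 0 ≤ C) (hR : 1 ≤ R)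
    {m₀ : ℕ} (h : ∀ m, m₀ ≤ m → c (m + 1) ≤ C * ∑ j ∈ Finset.range (m + 1), R ^ (m + 1 - j) * c j) :
    ∃ K ρ : ℝ, 0 ≤ K ∧ 1 ≤ ρ ∧ ∀ m, c m ≤ K * ρ ^ m := by
  set ρ := R * (1 + C) with hρ
  have hρ1 : 1 ≤ ρ := by nlinarith
  have hR0 : 0 ≤ R := by linarith
  set K := ∑ j ∈ Finset.range (m₀ + 1), c j with hK
  have hK0 : 0 ≤ K := Finset.sum_nonneg fun j _ => hc j
  have hS : ∀ m : ℕ, C * ∑ j ∈ Finset.range (m + 1), R ^ (m + 1 - j) * ρ ^ j ≤ ρ ^ (m + 1) := by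
    intro m
    induction m with
    | zero =>
      simp only [zero_add, Finset.range_one, Finset.sum_singleton, tsub_zero, pow_one, pow_zero,
        mul_one]
      nlinarith
    | succ m ih =>
      rw [Finset.sum_range_succ]
      have h1 : ∑ j ∈ Finset.range (m + 1), R ^ (m + 1 + 1 - j) * ρ ^ j =
          R * ∑ j ∈ Finset.range (m + 1), R ^ (m + 1 - j) * ρ ^ j := by
        rw [Finset.mul_sum]
        refine Finset.sum_congr rfl fun j hj => ?_
        have := Finset.mem_range.1 hj
        rw [show m + 1 + 1 - j = (m + 1 - j) + 1 by omega, pow_succ]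
        ring
      rw [h1, show m + 1 + 1 - (m + 1) = 1 by omega, pow_one]
      calc C * (R * ∑ j ∈ Finset.range (m + 1), R ^ (m + 1 - j) * ρ ^ j + R * ρ ^ (m + 1))
          = R * (C * ∑ j ∈ Finset.range (m + 1), R ^ (m + 1 - j) * ρ ^ j) +
            C * R * ρ ^ (m + 1) := by ring
        _ ≤ R * ρ ^ (m + 1) + C * R * ρ ^ (m + 1) := by gcongr
        _ = ρ ^ (m + 1 + 1) := by rw [pow_succ ρ (m + 1), hρ]; ring
  refine ⟨K, ρ, hK0, hρ1, fun m => ?_⟩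
  induction m using Nat.strong_induction_on with
  | _ m ih =>
    by_cases hm : m ≤ m₀
    · calc c m ≤ K := Finset.single_le_sum (f := c) (fun j _ => hc j)
            (Finset.mem_range.2 (by omega))
        _ ≤ K * ρ ^ m := le_mul_of_one_le_right hK0 (one_le_pow₀ hρ1)
    · obtain ⟨m, rfl⟩ : ∃ k, m = k + 1 := ⟨m - 1, by omega⟩
      calc c (m + 1) ≤ C * ∑ j ∈ Finset.range (m + 1), R ^ (m + 1 - j) * c j := h m (by omega)
        _ ≤ C * ∑ j ∈ Finset.range (m + 1), R ^ (m + 1 - j) * (K * ρ ^ j) := by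
            gcongr with j hj
            exact ih j (Finset.mem_range.1 hj)
        _ = K * (C * ∑ j ∈ Finset.range (m + 1), R ^ (m + 1 - j) * ρ ^ j) := by
            simp only [Finset.mul_sum]
            exact Finset.sum_congr rfl fun j _ => by ring
        _ ≤ K * ρ ^ (m + 1) := by gcongr; exact hS m

/-- Cauchy bounds for a finite family of convergent series. -/
lemma exists_bound_of_convergent {κ : Type*} [Fintype κ] {φ : κ → ℂ⟦X⟧}
    (h : ∀ i, IsConvergent (φ i)) :
    ∃ C R : ℝ, 0 ≤ C ∧ 1 ≤ R ∧ ∀ i m, ‖PowerSeries.coeff m (φ i)‖ ≤ C * R ^ m := by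
  choose r hr hs using h
  set B : κ → ℝ := fun i => ∑' m, ‖PowerSeries.coeff m (φ i)‖ * r i ^ m with hB
  have hB0 : ∀ i, 0 ≤ B i := fun i =>
    tsum_nonneg fun m => mul_nonneg (norm_nonneg _) (pow_nonneg (hr i).le m)
  have hr0 : ∀ i, 0 ≤ (r i)⁻¹ := fun i => inv_nonneg.2 (hr i).le
  have hRs : 0 ≤ ∑ i, (r i)⁻¹ := Finset.sum_nonneg fun i _ => hr0 i
  refine ⟨∑ i, B i, 1 + ∑ i, (r i)⁻¹, Finset.sum_nonneg fun i _ => hB0 i, by linarith,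
    fun i m => ?_⟩
  have h1 : ‖PowerSeries.coeff m (φ i)‖ * r i ^ m ≤ B i :=
    (hs i).le_tsum m fun j _ => mul_nonneg (norm_nonneg _) (pow_nonneg (hr i).le j)
  have h2 : ‖PowerSeries.coeff m (φ i)‖ ≤ B i * (r i)⁻¹ ^ m := by
    rw [inv_pow, ← div_eq_mul_inv, le_div_iff₀ (pow_pos (hr i) m)]
    exact h1
  have h3 : (r i)⁻¹ ≤ ∑ i, (r i)⁻¹ :=
    Finset.single_le_sum (f := fun i => (r i)⁻¹) (fun j _ => hr0 j) (Finset.mem_univ i)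
  calc _ ≤ B i * (r i)⁻¹ ^ m := h2
    _ ≤ (∑ i, B i) * (1 + ∑ i, (r i)⁻¹) ^ m := by
        refine mul_le_mul (Finset.single_le_sum (f := B) (fun j _ => hB0 j) (Finset.mem_univ i))
          (pow_le_pow_left₀ (hr0 i) (by linarith) m) (pow_nonneg (hr0 i) m)
          (Finset.sum_nonneg fun i _ => hB0 i)

section Gevrey

variable {J : ℕ} {n : Fin J → ℕ} {a lam : Fin J → ℂ} {A F : Matrix (Idx n) (Idx n) ℂ⟦X⟧}
  (hF0 : F.map PowerSeries.constantCoeff = 1) (hF : IsFormalSolution n a lam A F)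

/-- The size of the coefficients of order `m`. -/
def coeffNorm (F : Matrix (Idx n) (Idx n) ℂ⟦X⟧) (m : ℕ) : ℝ :=
  ∑ p, ∑ q, ‖PowerSeries.coeff m (F p q)‖

lemma coeffNorm_nonneg (F : Matrix (Idx n) (Idx n) ℂ⟦X⟧) (m : ℕ) : 0 ≤ coeffNorm F m :=
  Finset.sum_nonneg fun _ _ => Finset.sum_nonneg fun _ _ => norm_nonneg _

lemma sum_row_le_coeffNorm (F : Matrix (Idx n) (Idx n) ℂ⟦X⟧) (m : ℕ) (p : Idx n) :
    ∑ q, ‖PowerSeries.coeff m (F p q)‖ ≤ coeffNorm F m :=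
  Finset.single_le_sum (f := fun p => ∑ q, ‖PowerSeries.coeff m (F p q)‖)
    (fun _ _ => Finset.sum_nonneg fun _ _ => norm_nonneg _) (Finset.mem_univ p)

lemma norm_le_coeffNorm (F : Matrix (Idx n) (Idx n) ℂ⟦X⟧) (m : ℕ) (p q : Idx n) :
    ‖PowerSeries.coeff m (F p q)‖ ≤ coeffNorm F m :=
  (Finset.single_le_sum (f := fun q => ‖PowerSeries.coeff m (F p q)‖)
    (fun _ _ => norm_nonneg _) (Finset.mem_univ q)).trans (sum_row_le_coeffNorm F m p)

lemma sum_col_le_coeffNorm (F : Matrix (Idx n) (Idx n) ℂ⟦X⟧) (m : ℕ) (q : Idx n) :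
    ∑ p, ‖PowerSeries.coeff m (F p q)‖ ≤ coeffNorm F m := by
  rw [coeffNorm, Finset.sum_comm]
  exact Finset.single_le_sum (f := fun q => ∑ p, ‖PowerSeries.coeff m (F p q)‖)
    (fun _ _ => Finset.sum_nonneg fun _ _ => norm_nonneg _) (Finset.mem_univ q)

include hF0 hF in
/-- The formal solution is of Gevrey order one. -/
theorem gevrey (hA : ∀ p q, IsConvergent (A p q)) : ∃ K ρ : ℝ, 0 ≤ K ∧ 1 ≤ ρ ∧
    ∀ m, coeffNorm F m / m.factorial ≤ K * ρ ^ m := by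
  obtain ⟨C, R, hC, hR, hb⟩ := exists_bound_of_convergent
    (φ := fun pq : Idx n × Idx n => A pq.1 pq.2) fun pq => hA pq.1 pq.2
  have hR0 : 0 ≤ R := by linarith
  set u := coeffNorm F with hu
  have hu0 : ∀ m, 0 ≤ u m := coeffNorm_nonneg F
  set ℓ : ℝ := ∑ p, ∑ q, ‖monodromyExponent n lam p q‖ with hℓ
  have hℓ0 : 0 ≤ ℓ := Finset.sum_nonneg fun _ _ => Finset.sum_nonneg fun _ _ => norm_nonneg _
  have hLle : ∀ p q, ‖monodromyExponent n lam p q‖ ≤ ℓ := fun p q =>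
    (Finset.single_le_sum (f := fun q => ‖monodromyExponent n lam p q‖)
      (fun _ _ => norm_nonneg _) (Finset.mem_univ q)).trans
      (Finset.single_le_sum (f := fun p => ∑ q, ‖monodromyExponent n lam p q‖)
        (fun _ _ => Finset.sum_nonneg fun _ _ => norm_nonneg _) (Finset.mem_univ p))
  set d : ℝ := ∑ p : Idx n, ∑ q : Idx n, ‖(a p.1 - a q.1)⁻¹‖ with hd
  have hd0 : 0 ≤ d := Finset.sum_nonneg fun _ _ => Finset.sum_nonneg fun _ _ => norm_nonneg _
  have hdle : ∀ p q : Idx n, ‖(a p.1 - a q.1)⁻¹‖ ≤ d := fun p q =>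
    (Finset.single_le_sum (f := fun q : Idx n => ‖(a p.1 - a q.1)⁻¹‖)
      (fun _ _ => norm_nonneg _) (Finset.mem_univ q)).trans
      (Finset.single_le_sum (f := fun p : Idx n => ∑ q : Idx n, ‖(a p.1 - a q.1)⁻¹‖)
        (fun _ _ => Finset.sum_nonneg fun _ _ => norm_nonneg _) (Finset.mem_univ p))
  -- bounds of the terms of the recurrence
  have hFL : ∀ m p q, ‖∑ r, PowerSeries.coeff m (F p r) * monodromyExponent n lam r q‖ ≤
      ℓ * u m := by
    intro m p q
    calc _ ≤ ∑ r, ‖PowerSeries.coeff m (F p r)‖ * ℓ := by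
          refine (norm_sum_le _ _).trans (Finset.sum_le_sum fun r _ => ?_)
          rw [norm_mul]
          gcongr
          exact hLle r q
      _ = ℓ * ∑ r, ‖PowerSeries.coeff m (F p r)‖ := by rw [← Finset.sum_mul, mul_comm]
      _ ≤ ℓ * u m := by gcongr; exact sum_row_le_coeffNorm F m p
  have hAF : ∀ i j p q, ‖∑ r, PowerSeries.coeff i (A p r) * PowerSeries.coeff j (F r q)‖ ≤
      C * R ^ i * u j := by
    intro i j p q
    calc _ ≤ ∑ r, C * R ^ i * ‖PowerSeries.coeff j (F r q)‖ := by
          refine (norm_sum_le _ _).trans (Finset.sum_le_sum fun r _ => ?_)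
          rw [norm_mul]
          gcongr
          exact hb (p, r) i
      _ = C * R ^ i * ∑ r, ‖PowerSeries.coeff j (F r q)‖ := by rw [← Finset.mul_sum]
      _ ≤ C * R ^ i * u j := by gcongr; exact sum_col_le_coeffNorm F j q
  have hsum : ∀ m p q, ‖∑ ab ∈ Finset.HasAntidiagonal.antidiagonal m, ∑ r,
      PowerSeries.coeff (ab.1 + 1) (A p r) * PowerSeries.coeff ab.2 (F r q)‖ ≤
      C * ∑ j ∈ Finset.range (m + 1), R ^ (m + 1 - j) * u j := by
    intro m p q
    rw [Finset.mul_sum]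
    refine (norm_sum_le _ _).trans ?_
    rw [Finset.Nat.sum_antidiagonal_eq_sum_range_succ_mk, ← Finset.sum_range_reflect]
    refine Finset.sum_le_sum fun j hj => ?_
    have hj' := Finset.mem_range.1 hj
    have h1 : m + 1 - 1 - j = m - j := by omega
    have h2 : m - (m - j) = j := by omega
    have h3 : m - j + 1 = m + 1 - j := by omega
    simp only [h1, h2, h3]
    refine (hAF _ _ p q).trans (le_of_eq (by ring))
  set N : ℝ := Fintype.card (Idx n) * Fintype.card (Idx n) with hN
  have hN0 : 0 ≤ N := by positivity
  set Sg : ℕ → ℝ := fun m => ∑ j ∈ Finset.range (m + 1), R ^ (m + 1 - j) * u j with hSg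
  have hSg0 : ∀ m, 0 ≤ Sg m := fun m => Finset.sum_nonneg fun j _ =>
    mul_nonneg (pow_nonneg hR0 _) (hu0 j)
  have hsum' : ∀ m p q, ‖∑ ab ∈ Finset.HasAntidiagonal.antidiagonal m, ∑ r,
      PowerSeries.coeff (ab.1 + 1) (A p r) * PowerSeries.coeff ab.2 (F r q)‖ ≤ C * Sg m := hsum
  have hule : ∀ m p q, ‖PowerSeries.coeff m (F p q)‖ ≤ u m := norm_le_coeffNorm F
  have husum : ∀ m (B : ℝ), (∀ p q, ‖PowerSeries.coeff m (F p q)‖ ≤ B) → u m ≤ N * B := by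
    intro m B hB
    calc u m ≤ ∑ _p : Idx n, ∑ _q : Idx n, B :=
          Finset.sum_le_sum fun p _ => Finset.sum_le_sum fun q _ => hB p q
      _ = _ := by
          simp only [Finset.sum_const, Finset.card_univ, nsmul_eq_mul, hN]
          ring
  clear_value Sg u ℓ d N
  -- From `m₀` on, the term with `u (m + 1)` on the right of the estimate has total weight at most
  -- `1 / 2` and is absorbed by the left-hand side.
  obtain ⟨m₀, hm₀⟩ := exists_nat_ge (2 * N * (ℓ + C * R))
  -- the off-diagonal entries, and the diagonal entries by means of the next equation
  have hentry : ∀ m, ∀ p q, ‖PowerSeries.coeff (m + 1) (F p q)‖ ≤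
      d * ((m + ℓ) * u m + C * Sg m) + C * R * Sg m +
        (ℓ + C * R) / (m + 1) * u (m + 1) := by
    intro m p q
    have hum := hu0 m
    have hum1 := hu0 (m + 1)
    have hSgm := hSg0 m
    have hm1 : (0 : ℝ) < (m : ℝ) + 1 := by positivity
    by_cases hpq : a p.1 = a q.1
    · have hrec := recurrence hF0 hF (m + 1) p q
      rw [hpq, sub_self, zero_mul, Finset.Nat.sum_antidiagonal_succ] at hrec
      have h1 : ∑ ab ∈ Finset.HasAntidiagonal.antidiagonal m, ∑ r,
          PowerSeries.coeff (ab.1 + 1 + 1) (A p r) * PowerSeries.coeff ab.2 (F r q) =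
          ∑ ab ∈ Finset.HasAntidiagonal.antidiagonal m, ∑ r,
          PowerSeries.coeff (ab.1 + 2) (A p r) * PowerSeries.coeff ab.2 (F r q) := rfl
      have h2 : ‖∑ ab ∈ Finset.HasAntidiagonal.antidiagonal m, ∑ r,
          PowerSeries.coeff (ab.1 + 2) (A p r) * PowerSeries.coeff ab.2 (F r q)‖ ≤
          C * R * Sg m := by
        rw [hSg, Finset.mul_sum]
        refine (norm_sum_le _ _).trans ?_
        rw [Finset.Nat.sum_antidiagonal_eq_sum_range_succ_mk, ← Finset.sum_range_reflect]
        refine Finset.sum_le_sum fun j hj => ?_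
        have hj' := Finset.mem_range.1 hj
        have h1 : m + 1 - 1 - j = m - j := by omega
        have h2 : m - (m - j) = j := by omega
        have h3 : m - j + 2 = (m + 1 - j) + 1 := by omega
        simp only [h1, h2, h3]
        refine (hAF _ _ p q).trans (le_of_eq (by rw [pow_succ]; ring))
      rw [h1] at hrec
      push_cast at hrec
      have h3 : ((m : ℂ) + 1) * PowerSeries.coeff (m + 1) (F p q) =
          (∑ r, PowerSeries.coeff (0 + 1) (A p r) * PowerSeries.coeff (m + 1) (F r q) +
          ∑ ab ∈ Finset.HasAntidiagonal.antidiagonal m, ∑ r,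
          PowerSeries.coeff (ab.1 + 2) (A p r) * PowerSeries.coeff ab.2 (F r q)) -
          ∑ r, PowerSeries.coeff (m + 1) (F p r) * monodromyExponent n lam r q := by
        linear_combination -hrec
      have h4 : ((m : ℝ) + 1) * ‖PowerSeries.coeff (m + 1) (F p q)‖ ≤
          C * R * u (m + 1) + C * R * Sg m + ℓ * u (m + 1) := by
        have h5 : ‖(m : ℂ) + 1‖ = (m : ℝ) + 1 := by
          have := Complex.norm_natCast (m + 1)
          push_cast at this
          exact this
        rw [← h5, ← norm_mul, h3]
        have h9 := hAF (0 + 1) (m + 1) p q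
        rw [zero_add, pow_one] at h9
        rw [zero_add]
        exact (norm_sub_le _ _).trans (add_le_add ((norm_add_le _ _).trans
          (add_le_add h9 h2)) (hFL (m + 1) p q))
      have h6 : ‖PowerSeries.coeff (m + 1) (F p q)‖ ≤
          (C * R * u (m + 1) + C * R * Sg m + ℓ * u (m + 1)) / (m + 1) := by
        rw [le_div_iff₀ hm1, mul_comm]
        exact h4
      have h7 : C * R * Sg m / (m + 1) ≤ C * R * Sg m :=
        div_le_self (by positivity) (by linarith [(Nat.cast_nonneg m : (0 : ℝ) ≤ m)])
      have h8 : 0 ≤ d * ((m + ℓ) * u m + C * Sg m) := by positivity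
      calc _ ≤ _ := h6
        _ = C * R * Sg m / (m + 1) + (ℓ + C * R) / (m + 1) * u (m + 1) := by ring
        _ ≤ _ := by linarith
    · have hne : a p.1 - a q.1 ≠ 0 := sub_ne_zero.2 hpq
      have hrec := recurrence hF0 hF m p q
      have h1 : PowerSeries.coeff (m + 1) (F p q) = (a p.1 - a q.1)⁻¹ *
          (m * PowerSeries.coeff m (F p q) +
          ∑ r, PowerSeries.coeff m (F p r) * monodromyExponent n lam r q -
          ∑ ab ∈ Finset.HasAntidiagonal.antidiagonal m, ∑ r,
          PowerSeries.coeff (ab.1 + 1) (A p r) * PowerSeries.coeff ab.2 (F r q)) := by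
        rw [← hrec, inv_mul_cancel_left₀ hne]
      have h2 : ‖PowerSeries.coeff (m + 1) (F p q)‖ ≤ d * ((m + ℓ) * u m + C * Sg m) := by
        rw [h1, norm_mul]
        refine mul_le_mul (hdle p q) ?_ (norm_nonneg _) hd0
        refine (norm_sub_le _ _).trans (add_le_add ((norm_add_le _ _).trans ?_) (hsum' m p q))
        rw [add_mul]
        refine add_le_add ?_ (hFL m p q)
        rw [norm_mul, Complex.norm_natCast]
        gcongr
        exact hule m p q
      have h3 : 0 ≤ C * R * Sg m + (ℓ + C * R) / (m + 1) * u (m + 1) := by positivity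
      linarith
  have hstep : ∀ m, m₀ ≤ m → u (m + 1) ≤
      2 * (N * (d * ((m + ℓ) * u m + C * Sg m) + C * R * Sg m)) := by
    intro m hm
    set B := d * ((m + ℓ) * u m + C * Sg m) + C * R * Sg m with hB
    have h1 : u (m + 1) ≤ N * (B + (ℓ + C * R) / (m + 1) * u (m + 1)) :=
      husum (m + 1) _ (hentry m)
    have h2 : N * ((ℓ + C * R) / (m + 1)) ≤ 1 / 2 := by
      have hm' : (m₀ : ℝ) ≤ m := Nat.cast_le.2 hm
      have hm1 : (0 : ℝ) < (m : ℝ) + 1 := by positivity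
      rw [← mul_div_assoc, div_le_iff₀ hm1]
      linarith
    nlinarith [hu0 (m + 1)]
  -- division by the factorials
  set c : ℕ → ℝ := fun m => u m / m.factorial with hc
  have hc0 : ∀ m, 0 ≤ c m := fun m => div_nonneg (hu0 m) (by positivity)
  have hfac : ∀ m : ℕ, (0 : ℝ) < m.factorial := fun m => by exact_mod_cast m.factorial_pos
  refine geometric_of_recurrence (C := 2 * N * (d * (1 + ℓ + C) + C * R)) (R := R) (m₀ := m₀) hc0
    (by positivity) hR fun m hm => ?_
  set T := ∑ j ∈ Finset.range (m + 1), R ^ (m + 1 - j) * c j with hT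
  have hSgT : Sg m ≤ (m + 1).factorial * T := by
    rw [hT, Finset.mul_sum, hSg]
    refine Finset.sum_le_sum fun j hj => ?_
    have hj' := Finset.mem_range.1 hj
    have h1 : u j = j.factorial * c j := by
      rw [hc]
      simp only
      rw [mul_div_cancel₀ _ (hfac j).ne']
    have h2 : (j.factorial : ℝ) ≤ (m + 1).factorial := by
      exact_mod_cast Nat.factorial_le (by omega)
    have h3 := hc0 j
    calc R ^ (m + 1 - j) * u j = j.factorial * (R ^ (m + 1 - j) * c j) := by rw [h1]; ring
      _ ≤ _ := by gcongr
  have humT : (m + 1) * u m ≤ (m + 1).factorial * T := by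
    have h1 : (m + 1) * u m = (m + 1).factorial * c m := by
      rw [hc, Nat.factorial_succ]
      simp only
      have := (hfac m).ne'
      push_cast
      field_simp
    rw [h1]
    gcongr
    have h2 : R ^ (m + 1 - m) * c m ≤ T :=
      Finset.single_le_sum (f := fun j => R ^ (m + 1 - j) * c j)
        (fun j _ => mul_nonneg (pow_nonneg hR0 _) (hc0 j)) (Finset.self_mem_range_succ m)
    rw [show m + 1 - m = 1 by omega, pow_one] at h2
    nlinarith [hc0 m]
  have hmℓ : (m + ℓ) * u m ≤ (1 + ℓ) * ((m + 1) * u m) := by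
    have h1 : (m : ℝ) + ℓ ≤ (1 + ℓ) * (m + 1) := by
      nlinarith [(Nat.cast_nonneg m : (0 : ℝ) ≤ m)]
    calc (m + ℓ) * u m ≤ ((1 + ℓ) * (m + 1)) * u m := by
          gcongr
          exact hu0 m
      _ = _ := by ring
  rw [div_le_iff₀ (hfac (m + 1))]
  refine (hstep m hm).trans ?_
  set G := ((m + 1).factorial : ℝ) * T with hG
  calc 2 * (N * (d * ((m + ℓ) * u m + C * Sg m) + C * R * Sg m))
      ≤ 2 * (N * (d * ((1 + ℓ) * G + C * G) + C * R * G)) := by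
        have h1 : (m + ℓ) * u m ≤ (1 + ℓ) * G := hmℓ.trans (by gcongr)
        gcongr
    _ = 2 * N * (d * (1 + ℓ + C) + C * R) * T * ((m + 1).factorial : ℝ) := by rw [hG]; ring

end Gevrey

end LevelOne

end

noncomputable section

namespace LevelOne

/-! ### The Borel transform as a solution of a Volterra equation -/

section Borel

variable {J : ℕ} {n : Fin J → ℕ} {a lam : Fin J → ℂ} {A F : Matrix (Idx n) (Idx n) ℂ⟦X⟧}

lemma seriesSum_borelSeries (φ : ℂ⟦X⟧) :
    seriesSum (borelSeries φ) = egf fun m => PowerSeries.coeff (m + 1) φ := by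
  funext ξ
  simp [seriesSum, borelSeries, egf]

variable (hF0 : F.map PowerSeries.constantCoeff = 1) (hF : IsFormalSolution n a lam A F)
  (hA : ∀ p q, IsConvergent (A p q))

include hF0 hF hA in
/-- Bounds for the coefficients of the Borel transform. -/
lemma borel_bound : ∃ K ρ : ℝ, 0 ≤ K ∧ 1 ≤ ρ ∧ ∀ m p q,
    ‖PowerSeries.coeff (m + 1) (F p q)‖ / m.factorial ≤ K * ρ ^ m := by
  obtain ⟨K, ρ, hK, hρ, hb⟩ := gevrey hF0 hF hA
  refine ⟨2 * K * ρ, 2 * ρ, by positivity, by linarith, fun m p q => ?_⟩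
  have hf : (0 : ℝ) < m.factorial := by exact_mod_cast m.factorial_pos
  have h1 := hb (m + 1)
  rw [Nat.factorial_succ, div_le_iff₀ (by positivity)] at h1
  -- The passage from `(m + 1)!` to `m!` loses a factor `m + 1`, paid for by doubling `ρ`.
  have h2 : ((m + 1 : ℕ) : ℝ) ≤ 2 ^ (m + 1) := by
    exact_mod_cast (Nat.lt_two_pow_self (n := m + 1)).le
  rw [div_le_iff₀ hf]
  calc _ ≤ coeffNorm F (m + 1) := norm_le_coeffNorm F _ p q
    _ ≤ K * ρ ^ (m + 1) * (((m + 1) * m.factorial : ℕ) : ℝ) := h1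
    _ = K * ρ ^ (m + 1) * ((m + 1 : ℕ) : ℝ) * m.factorial := by push_cast; ring
    _ ≤ K * ρ ^ (m + 1) * 2 ^ (m + 1) * m.factorial := by gcongr
    _ = _ := by rw [pow_succ, pow_succ, mul_pow]; ring

include hF0 hF hA in
theorem isConvergent_borelSeries (p q : Idx n) : IsConvergent (borelSeries (F p q)) := by
  obtain ⟨K, ρ, hK, hρ, hb⟩ := borel_bound hF0 hF hA
  have hρ0 : 0 < ρ := by linarith
  refine ⟨(2 * ρ)⁻¹, by positivity, ?_⟩
  have hs : Summable fun m : ℕ => K * (1 / 2 : ℝ) ^ m := summable_geometric_two.mul_left K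
  refine Summable.of_nonneg_of_le (fun m => by positivity) (fun m => ?_) hs
  rw [borelSeries, PowerSeries.coeff_mk, norm_div_factorial]
  calc _ ≤ K * ρ ^ m * (2 * ρ)⁻¹ ^ m := by gcongr; exact hb m p q
    _ = K * (ρ * (2 * ρ)⁻¹) ^ m := by rw [mul_pow]; ring
    _ = _ := by
        congr 2
        field_simp

/-- The index set of the columns of the `k`-th block. -/
abbrev ColIdx (n : Fin J → ℕ) (k : Fin J) : Type := Idx n × Fin (n k)

/-- The kernel of the Volterra equation for the `k`-th column block. -/
def colKernel (A : Matrix (Idx n) (Idx n) ℂ⟦X⟧) (lam : Fin J → ℂ) (k : Fin J) (m : ℕ)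
    (i i' : ColIdx n k) : ℂ :=
  (if i.2 = i'.2 then PowerSeries.coeff (m + 1) (A i.1 i'.1) else 0) -
    if m = 0 ∧ i.1 = i'.1 then monodromyExponent n lam ⟨k, i'.2⟩ ⟨k, i.2⟩ else 0

/-- The inhomogeneous term of the Volterra equation for the `k`-th column block. -/
def colForcing (A : Matrix (Idx n) (Idx n) ℂ⟦X⟧) (lam : Fin J → ℂ) (k : Fin J) (m : ℕ)
    (i : ColIdx n k) : ℂ :=
  PowerSeries.coeff (m + 1) (A i.1 ⟨k, i.2⟩) -
    if m = 0 then monodromyExponent n lam i.1 ⟨k, i.2⟩ else 0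

/-- Right multiplication by the block diagonal `L` mixes only columns of the same block. Hence each
column block gives a closed Volterra system. -/
lemma sum_mul_monodromyExponent (v : Idx n → ℂ) (k : Fin J) (s : Fin (n k)) :
    ∑ r, v r * monodromyExponent n lam r ⟨k, s⟩ =
      ∑ s', v ⟨k, s'⟩ * monodromyExponent n lam ⟨k, s'⟩ ⟨k, s⟩ := by
  rw [Fintype.sum_sigma, Finset.sum_eq_single k]
  · intro j _ hj
    refine Finset.sum_eq_zero fun r _ => ?_
    rw [monodromyExponent_apply_of_ne hj, mul_zero]
  · simp

lemma sum_colKernel (k : Fin J) (m : ℕ) (i : ColIdx n k) (v : ColIdx n k → ℂ) :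
    ∑ i', colKernel A lam k m i i' * v i' =
      ∑ r, PowerSeries.coeff (m + 1) (A i.1 r) * v (r, i.2) -
        if m = 0 then ∑ s', v (i.1, s') * monodromyExponent n lam ⟨k, s'⟩ ⟨k, i.2⟩ else 0 := by
  simp only [colKernel, sub_mul, Finset.sum_sub_distrib, ite_mul, zero_mul]
  congr 1
  · rw [Fintype.sum_prod_type]
    refine Finset.sum_congr rfl fun r _ => ?_
    rw [Finset.sum_eq_single i.2]
    · simp
    · intro s _ hs
      simp [hs.symm]
    · simp
  · by_cases hm : m = 0
    · simp only [hm, true_and, if_true]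
      rw [Fintype.sum_prod_type, Finset.sum_eq_single i.1]
      · refine Finset.sum_congr rfl fun s _ => ?_
        simp [mul_comm]
      · intro r _ hr
        refine Finset.sum_eq_zero fun s _ => ?_
        simp [hr.symm]
      · simp
    · simp [hm]

include hA in
lemma exists_colKernel_bound (lam : Fin J → ℂ) (k : Fin J) : ∃ C R : ℝ, 0 ≤ R ∧
    (∀ m i i', ‖colKernel A lam k m i i'‖ ≤ C * R ^ m) ∧
    ∀ m i, ‖colForcing A lam k m i‖ ≤ C * R ^ m := by
  obtain ⟨C, R, hC, hR, hb⟩ := exists_bound_of_convergent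
    (φ := fun pq : Idx n × Idx n => A pq.1 pq.2) fun pq => hA pq.1 pq.2
  obtain ⟨ℓ, hℓ⟩ : ∃ ℓ : ℝ, ∀ pq : Idx n × Idx n, ‖monodromyExponent n lam pq.1 pq.2‖ ≤ ℓ :=
    (Set.finite_range fun pq : Idx n × Idx n => ‖monodromyExponent n lam pq.1 pq.2‖).bddAbove.imp
      fun _ h pq => h ⟨pq, rfl⟩
  have hR0 : 0 ≤ R := by linarith
  have hCR : ∀ m : ℕ, C * R ^ (m + 1) = C * R * R ^ m := fun m => by rw [pow_succ]; ring
  have hL : ∀ (m : ℕ) (P : Prop) [Decidable P] (p q : Idx n),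
      ‖if P then monodromyExponent n lam p q else 0‖ ≤ |ℓ| * R ^ m := by
    intro m P _ p q
    have h1 : |ℓ| ≤ |ℓ| * R ^ m := le_mul_of_one_le_right (abs_nonneg _) (one_le_pow₀ hR)
    split_ifs
    · exact ((hℓ (p, q)).trans (le_abs_self ℓ)).trans h1
    · simp only [norm_zero]
      positivity
  refine ⟨C * R + |ℓ|, R, hR0, fun m i i' => ?_, fun m i => ?_⟩
  · rw [colKernel, add_mul]
    refine (norm_sub_le _ _).trans (add_le_add ?_ (hL m _ _ _))
    split_ifs
    · rw [← hCR]
      exact hb (i.1, i'.1) (m + 1)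
    · simp only [norm_zero]
      positivity
  · rw [colForcing, add_mul]
    refine (norm_sub_le _ _).trans (add_le_add ?_ (hL m _ _ _))
    rw [← hCR]
    exact hb (i.1, ⟨k, i.2⟩) (m + 1)

include hF0 hF in
lemma col_recurrence_zero (k : Fin J) (i : ColIdx n k) :
    -(a i.1.1 - a k) * PowerSeries.coeff (0 + 1) (F i.1 ⟨k, i.2⟩) = colForcing A lam k 0 i := by
  have h := recurrence hF0 hF 0 i.1 ⟨k, i.2⟩
  simp only [coeff_zero_solution hF0, Finset.HasAntidiagonal.antidiagonal_zero,
    Finset.sum_singleton] at h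
  simp only [ite_mul, one_mul, zero_mul, mul_ite, mul_one, mul_zero, Finset.sum_ite_eq,
    Finset.sum_ite_eq', Finset.mem_univ, if_true, Nat.cast_zero, zero_add, ite_self] at h
  rw [colForcing, if_pos rfl, zero_add]
  linear_combination -h

-- The constant term `I` of `F` is no function in the Borel plane. Its contributions to the
-- recurrence are moved to the inhomogeneous term.
include hF0 hF in
lemma col_recurrence (k : Fin J) (m : ℕ) (i : ColIdx n k) :
    (m + 1) * PowerSeries.coeff (m + 1) (F i.1 ⟨k, i.2⟩) -
      (a i.1.1 - a k) * PowerSeries.coeff (m + 1 + 1) (F i.1 ⟨k, i.2⟩) =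
      colForcing A lam k (m + 1) i + ∑ ab ∈ Finset.HasAntidiagonal.antidiagonal m,
        ∑ i', colKernel A lam k ab.1 i i' * PowerSeries.coeff (ab.2 + 1) (F i'.1 ⟨k, i'.2⟩) := by
  have h := recurrence hF0 hF (m + 1) i.1 ⟨k, i.2⟩
  rw [Finset.Nat.sum_antidiagonal_succ'] at h
  have h1 : ∑ r, PowerSeries.coeff (m + 1 + 1) (A i.1 r) *
      PowerSeries.coeff 0 (F r ⟨k, i.2⟩) = PowerSeries.coeff (m + 1 + 1) (A i.1 ⟨k, i.2⟩) := by
    simp only [coeff_zero_solution hF0]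
    simp
  rw [h1, sum_mul_monodromyExponent] at h
  have h2 : ∑ ab ∈ Finset.HasAntidiagonal.antidiagonal m,
      (if ab.1 = 0 then ∑ s', PowerSeries.coeff (ab.2 + 1) (F i.1 ⟨k, s'⟩) *
        monodromyExponent n lam ⟨k, s'⟩ ⟨k, i.2⟩ else 0) =
      ∑ s', PowerSeries.coeff (m + 1) (F i.1 ⟨k, s'⟩) *
        monodromyExponent n lam ⟨k, s'⟩ ⟨k, i.2⟩ := by
    rw [Finset.sum_eq_single (0, m)]
    · simp
    · rintro ⟨x, y⟩ hxy hne
      have h3 := Finset.HasAntidiagonal.mem_antidiagonal.1 hxy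
      rw [if_neg]
      rintro rfl
      exact hne (by rw [← h3]; simp)
    · intro h3
      exact absurd (Finset.HasAntidiagonal.mem_antidiagonal.2 (zero_add m)) h3
  simp only [sum_colKernel, Finset.sum_sub_distrib, h2]
  rw [colForcing, if_neg (Nat.succ_ne_zero m)]
  push_cast at h
  linear_combination -h

include hF0 hF hA in
/-- The `k`-th column block of the Borel transform solves a Volterra equation. -/
theorem exists_isSol_borel (k : Fin J) : ∃ (V : VolterraData (ColIdx n k)) (r₀ : ℝ)
    (W : ℂ → ℂ → ColIdx n k → ℂ), 0 < r₀ ∧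
    IsSol V (fun z => z) (Metric.ball 0 r₀)
      (fun z i => seriesSum (borelSeries (F i.1 ⟨k, i.2⟩)) z) W ∧
    (∀ i, V.sing i = a i.1.1 - a k) ∧
    ∀ v i, V.ker 0 v i = ∑ i', colKernel A lam k 0 i i' * v i' := by
  obtain ⟨K, ρ, hK, hρ, hb⟩ := borel_bound hF0 hF hA
  obtain ⟨C, R, hR, hM, hβ⟩ := exists_colKernel_bound hA lam k
  have hρ0 : 0 < ρ := by linarith
  obtain ⟨W, hW⟩ := isSol_egf (fun i : ColIdx n k => a i.1.1 - a k) (colKernel A lam k) hR hM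
    (x := fun m i => PowerSeries.coeff (m + 1) (F i.1 ⟨k, i.2⟩)) (β := colForcing A lam k) hρ0
    (fun m i => hb m i.1 ⟨k, i.2⟩) hβ (fun i => col_recurrence_zero hF0 hF k i)
    (fun m i => col_recurrence hF0 hF k m i)
  refine ⟨egfData (fun i : ColIdx n k => a i.1.1 - a k) (colKernel A lam k) hR hM, (2 * ρ)⁻¹, W,
    by positivity, ?_, fun i => rfl, fun v i => ?_⟩
  · simpa only [seriesSum_borelSeries] using hW
  · rw [egfData_ker_apply]
    simp only [egf_zero]

include hF0 hF in
/-- On the blocks with the same `aⱼ`, the coefficient of order one of the system is `L`. -/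
lemma coeff_one_system {p q : Idx n} (h : a p.1 = a q.1) :
    PowerSeries.coeff 1 (A p q) = monodromyExponent n lam p q := by
  have := col_recurrence_zero hF0 hF q.1 (p, q.2)
  rw [colForcing, if_pos rfl] at this
  simp only [h, sub_self, neg_zero, zero_mul, zero_add] at this
  exact sub_eq_zero.1 this.symm

include hF0 hF in
/-- The resonance structure of the Volterra equation for the `k`-th column block. -/
theorem resonance_borel (hlam : ∀ j, 0 ≤ (lam j).re ∧ (lam j).re < 1) {k : Fin J}
    {V : VolterraData (ColIdx n k)} (hs : ∀ i, V.sing i = a i.1.1 - a k)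
    (hk : ∀ v i, V.ker 0 v i = ∑ i', colKernel A lam k 0 i i' * v i') (ω : ℂ) :
    Resonance V ω (lam k).re (fun i => lam i.1.1 - lam k)
      (fun i => (n i.1.1 - (i.1.2 : ℕ)) + (i.2 : ℕ)) (colKernel A lam k 0) where
  ker_zero := hk
  diag := by
    rintro ⟨⟨j, r⟩, s⟩ _
    simp only [colKernel, if_true, true_and, zero_add]
    rw [coeff_one_system hF0 hF rfl, monodromyExponent_apply_eq, monodromyExponent_apply_eq]
    simp
  -- A nonzero link comes either from `L` acting on rows, which raises `r` by one within its block,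
  -- or from `L` acting on columns, which lowers `s` by one. Both lower `(n_j - r) + s` and keep
  -- `λ_j - λ_k`.
  offdiag := by
    rintro ⟨⟨j, r⟩, s⟩ ⟨⟨j', r'⟩, s'⟩ hi hi' hne hK
    rw [hs] at hi hi'
    simp only at hi hi'
    have haj : a j = a j' := by linear_combination hi - hi'
    simp only [colKernel, true_and, zero_add] at hK ⊢
    by_cases hss : s = s'
    · subst hss
      have hne' : (⟨j, r⟩ : Idx n) ≠ ⟨j', r'⟩ := fun h => hne (by rw [h])
      rw [if_pos rfl, if_neg hne', sub_zero, coeff_one_system hF0 hF (by exact haj)] at hK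
      have hjj : j = j' := by
        by_contra h
        exact hK (monodromyExponent_apply_of_ne h)
      subst hjj
      rw [monodromyExponent_apply_eq, if_neg (fun h => hne' (by rw [h])), zero_add] at hK
      have hr : (r : ℕ) + 1 = r' := by
        by_contra h
        exact hK (if_neg h)
      refine ⟨rfl, ?_⟩
      have := r'.isLt
      omega
    · rw [if_neg hss, zero_sub] at hK
      have hpp : (⟨j, r⟩ : Idx n) = ⟨j', r'⟩ := by
        by_contra h
        exact hK (by rw [if_neg h, neg_zero])
      rw [if_pos hpp, monodromyExponent_apply_eq, if_neg (Ne.symm hss), zero_add] at hK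
      have hs' : (s' : ℕ) + 1 = s := by
        by_contra h
        exact hK (by rw [if_neg h, neg_zero])
      cases hpp
      refine ⟨rfl, ?_⟩
      omega
  le_re i _ := by
    rw [Complex.sub_re]
    linarith [(hlam i.1.1).1]
  re_lt i _ := by
    rw [Complex.sub_re]
    linarith [(hlam i.1.1).2]
  nonneg := (hlam k).1
  lt_one := (hlam k).2

end Borel

end LevelOne

end

noncomputable section

namespace LevelOne

/-! ### The leading term -/

section Leading

open scoped Matrix.Norms.Operator

variable {m : Type*} [Fintype m] [DecidableEq m]

/-- The solutions of `W' = L W - W L` are conjugates of constants by `exp (t L)`. -/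
theorem eq_exp_mul_exp_of_hasDerivAt {L : Matrix m m ℂ} {W : ℂ → Matrix m m ℂ}
    (hW : ∀ t p q, HasDerivAt (fun t => W t p q) ((L * W t - W t * L) p q) t) (t : ℂ) :
    W t = NormedSpace.exp (t • L) * W 0 * NormedSpace.exp (-(t • L)) := by
  have hWm : ∀ t, HasDerivAt W (L * W t - W t * L) t := by
    intro t
    have h1 : W = fun t => ∑ p, ∑ q, W t p q • Matrix.single p q (1 : ℂ) := by
      funext t
      conv_lhs => rw [Matrix.matrix_eq_sum_single (W t)]
      simp [Matrix.smul_single]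
    rw [h1]
    have h2 := HasDerivAt.fun_sum (u := Finset.univ) fun p (_ : p ∈ Finset.univ) =>
      HasDerivAt.fun_sum (u := Finset.univ) fun q (_ : q ∈ Finset.univ) =>
        (hW t p q).smul_const (Matrix.single p q (1 : ℂ))
    refine h2.congr_deriv ?_
    rw [← h1]
    conv_rhs => rw [Matrix.matrix_eq_sum_single (L * W t - W t * L)]
    simp [Matrix.smul_single]
  have hexp : ∀ (X : Matrix m m ℂ) t, HasDerivAt (fun t : ℂ => NormedSpace.exp (t • X))
      (NormedSpace.exp (t • X) * X) t := fun X t => hasDerivAt_exp_smul_const X t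
  have hexp' : ∀ (X : Matrix m m ℂ) t, HasDerivAt (fun t : ℂ => NormedSpace.exp (t • X))
      (X * NormedSpace.exp (t • X)) t := fun X t => hasDerivAt_exp_smul_const' X t
  -- Variation of constants: `e^{-tL} W e^{tL}` has zero derivative.
  have hconst : ∀ t, HasDerivAt
      (fun t : ℂ => NormedSpace.exp (t • -L) * W t * NormedSpace.exp (t • L)) 0 t := by
    intro t
    refine (((hexp (-L) t).mul (hWm t)).mul (hexp' L t)).congr_deriv ?_
    rw [Pi.mul_apply]
    noncomm_ring
  have hinv : ∀ t : ℂ, NormedSpace.exp (t • L) * NormedSpace.exp (-(t • L)) = 1 := fun t => by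
    rw [← Matrix.exp_add_of_commute _ _ (Commute.neg_right (Commute.refl (t • L))),
      add_neg_cancel, NormedSpace.exp_zero]
  have h := is_const_of_deriv_eq_zero (fun t => (hconst t).differentiableAt)
    (fun t => (hconst t).deriv) t 0
  simp only [zero_smul, NormedSpace.exp_zero, one_mul, mul_one] at h
  rw [← h, smul_neg]
  calc W t = (NormedSpace.exp (t • L) * NormedSpace.exp (-(t • L))) * W t *
        (NormedSpace.exp (t • L) * NormedSpace.exp (-(t • L))) := by rw [hinv]; simp
    _ = _ := by noncomm_ring

end Leading

lemma LogRes.eval {S : Set ℂ} (q : Polynomial ℂ) : LogRes S fun t => q.eval t := by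
  induction q using Polynomial.induction_on with
  | C c => simpa using LogRes.const c
  | add p q hp hq => simpa using hp.add hq
  | monomial k c hk =>
    have := hk.mul LogRes.id
    simpa [pow_succ, mul_assoc] using this

/-- Sums over the image of a map as weighted sums over its source. -/
lemma sum_image_eq_sum_inv_card_mul {α β : Type*} [DecidableEq β] (s : Finset α) (g : α → β)
    (f : β → ℂ) : ∑ b ∈ s.image g, f b =
      ∑ x ∈ s, ((s.filter fun y => g y = g x).card : ℂ)⁻¹ * f (g x) := by
  rw [Finset.sum_comp (fun b => ((s.filter fun y => g y = b).card : ℂ)⁻¹ * f b) g]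
  refine Finset.sum_congr rfl fun b hb => ?_
  obtain ⟨x, hx, rfl⟩ := Finset.mem_image.1 hb
  have : ((s.filter fun y => g y = g x).card : ℂ) ≠ 0 :=
    Nat.cast_ne_zero.2 (Finset.card_ne_zero_of_mem (Finset.mem_filter.2 ⟨hx, rfl⟩))
  rw [nsmul_eq_mul, mul_inv_cancel_left₀ this]

/-! ### Principal expansion of a solution at `ω` -/

section Expansion

variable {ι : Type*} [Fintype ι] [DecidableEq ι]

/-- The expansion at `ω` of the solutions: a leading term, a holomorphic function, and subdominant
terms with continuable coefficients. -/
theorem Resonance.exists_principal_expansion {V : VolterraData ι} {ω : ℂ} {e : ℝ} {μ : ι → ℂ}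
    {ord : ι → ℕ} {K : ι → ι → ℂ} {δ : ℝ} {φ : ℂ → ι → ℂ} {W : ℂ → ℂ → ι → ℂ} {S : Set ℂ}
    (hR : Resonance V ω e μ ord K) (hδ : 0 < δ)
    (h : IsSol V (fun t => ω + exp t) (logDisc δ) φ W)
    (hne : ∀ t ∈ logDisc δ, ∀ i, ω + exp t ≠ V.sing i) (hS : ∀ i, V.sing i - ω ∈ S) :
    ∃ (Q : ι → Polynomial ℂ) (N : ℕ) (u : ι → ℂ → ℂ) (H : ℂ → ℕ → ι → ℂ → ℂ),
      (∀ i, V.sing i ≠ ω → Q i = 0) ∧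
      (∀ i, V.sing i = ω →
        (Q i).derivative = ∑ i' ∈ linked V ω i, Polynomial.C (K i i') * Q i') ∧
      (∀ i, AnalyticAt ℂ (u i) 0) ∧
      (∀ ν ∈ exponents V ω μ, ∀ m i,
        AnalyticAt ℂ (H ν m i) 0 ∧ LogRes S fun t => H ν m i (exp t)) ∧
      (∀ i, H 0 0 i = 0) ∧
      ∀ i, ∀ M, N ≤ M → ∀ᶠ t in logZero, φ t i = exp ((μ i - 1) * t) * (Q i).eval t +
        u i (exp t) + ∑ ν ∈ exponents V ω μ, exp (ν * t) *
          ∑ m ∈ Finset.range M, H ν m i (exp t) * t ^ m := by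
  have hsub : {t : ℂ | t.re < Real.log δ} ⊆ logDisc δ := fun t ht =>
    (Real.lt_log_iff_exp_lt hδ).1 ht
  obtain ⟨Q, D, hQ0, hQ', hQD, hdec, hkill⟩ :=
    hR.exists_leading_and_kill (h.mono hsub) fun t ht i => hne t (hsub ht) i
  have hE : ∀ ν ∈ exponents V ω μ, -e ≤ ν.re ∧ ν.re < 1 - e := by
    intro ν hν
    obtain ⟨i, hi, rfl⟩ := Finset.mem_image.1 hν
    have hi' := (Finset.mem_filter.1 hi).2
    exact ⟨hR.le_re i hi', hR.re_lt i hi'⟩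
  have key : ∀ i, ∃ H : ℂ → ℕ → ℂ → ℂ,
      (∀ ν ∈ insert 0 (exponents V ω μ), ∀ m,
        AnalyticAt ℂ (H ν m) 0 ∧ LogRes S fun t => H ν m (exp t)) ∧
      (0 ∉ exponents V ω μ → ∀ m, 1 ≤ m → H 0 m = 0) ∧
      ∀ᶠ t in logZero, φ t i - exp ((μ i - 1) * t) * (Q i).eval t =
        ∑ ν ∈ insert 0 (exponents V ω μ), exp (ν * t) *
          ∑ m ∈ Finset.range (D + 1), H ν m (exp t) * t ^ m := by
    intro i
    refine exists_log_expansion hR.nonneg hR.lt_one hE (hdec i) ?_ ?_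
    · exact (IsSol.logRes hS hδ h i).sub ((LogRes.exp_mul _).mul (LogRes.eval _))
    · filter_upwards [hkill] with t ht
      have h1 : (fun t => φ t i - exp ((μ i - 1) * t) * (Q i).eval t) =
          (fun t => φ t i) - fun t => exp ((μ i - 1) * t) * (Q i).eval t := rfl
      rw [h1, map_sub, Pi.sub_apply, ht i, map_mul, Module.End.mul_apply,
        aeval_exponents_leading (hQ0 i) (hQD i), map_zero]
      simp
  choose H hH hH0 hHs using key
  -- The coefficient of `ξ^0 (ln ξ)^0` is holomorphic at `ω`. It is moved out of the expansion,
  -- which normalizes the subdominant terms.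
  refine ⟨Q, D + 1, fun i => H i 0 0,
    fun ν m i => if m < D + 1 ∧ ¬ (ν = 0 ∧ m = 0) then H i ν m else 0, hQ0, hQ',
    fun i => (hH i 0 (Finset.mem_insert_self _ _) 0).1, fun ν hν m i => ?_, fun i => by simp,
    fun i M hM => ?_⟩
  · by_cases hc : m < D + 1 ∧ ¬ (ν = 0 ∧ m = 0)
    · simp only [hc, not_false_eq_true, and_self, if_true]
      exact hH i ν (Finset.mem_insert_of_mem hν) m
    · simp only [hc, if_false]
      exact ⟨analyticAt_const, LogRes.const 0⟩
  filter_upwards [hHs i] with t ht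
  have h1 : ∀ ν, ∑ m ∈ Finset.range M,
      (if m < D + 1 ∧ ¬ (ν = 0 ∧ m = 0) then H i ν m else 0) (exp t) * t ^ m =
      ∑ m ∈ Finset.range (D + 1), H i ν m (exp t) * t ^ m -
        if ν = 0 then H i ν 0 (exp t) else 0 := by
    intro ν
    rw [← Finset.sum_subset (Finset.range_mono hM) (fun m _ hm => by
      rw [if_neg (fun hc => hm (Finset.mem_range.2 hc.1))]
      simp), Finset.sum_range_succ', Finset.sum_range_succ', add_sub_assoc]
    congr 1
    · refine Finset.sum_congr rfl fun m hm => ?_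
      rw [if_pos ⟨by have := Finset.mem_range.1 hm; omega, fun hc => Nat.succ_ne_zero m hc.2⟩]
    · by_cases hν : ν = 0 <;> simp [hν]
  simp only [h1]
  rw [← sub_eq_iff_eq_add', ← sub_sub, ht]
  -- If `0` is not an exponent, the summand `ν = 0` stems from the factor `T - 1` alone and consists
  -- of the holomorphic term only.
  by_cases h0 : (0 : ℂ) ∈ exponents V ω μ
  · rw [Finset.insert_eq_of_mem h0]
    simp only [mul_sub, Finset.sum_sub_distrib, mul_ite, mul_zero, Finset.sum_ite_eq', h0, if_true]
    simp
  · rw [Finset.sum_insert h0]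
    have h2 : ∑ m ∈ Finset.range (D + 1), H i 0 m (exp t) * t ^ m = H i 0 0 (exp t) := by
      rw [Finset.sum_range_succ', Finset.sum_eq_zero fun m _ => by rw [hH0 i h0 _ (by omega)]; simp]
      simp
    rw [h2, zero_mul, Complex.exp_zero, one_mul, add_sub_cancel_left]
    refine Finset.sum_congr rfl fun ν hν => ?_
    rw [if_neg (fun hc : ν = 0 => h0 (hc ▸ hν)), sub_zero]

end Expansion

end LevelOne

end

noncomputable section

namespace LevelOne

/-! ### Existence of the principal major -/

section Existence

variable {J : ℕ} {n : Fin J → ℕ} {a lam : Fin J → ℂ} {A F : Matrix (Idx n) (Idx n) ℂ⟦X⟧}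

variable (hF0 : F.map PowerSeries.constantCoeff = 1) (hF : IsFormalSolution n a lam A F)

include hF0 hF in
/-- The leading terms of the columns make up `(1/ξ) ξ^L K ξ^{-L}`. -/
theorem exists_leadingTerm_eq (hlam : ∀ j, 0 ≤ (lam j).re ∧ (lam j).re < 1) {ω : ℂ}
    {V : ∀ k, VolterraData (ColIdx n k)} (hs : ∀ k i, (V k).sing i = a i.1.1 - a k)
    (hk : ∀ k v i, (V k).ker 0 v i = ∑ i', colKernel A lam k 0 i i' * v i')
    {Q : ∀ k, ColIdx n k → Polynomial ℂ} (hQ0 : ∀ k i, (V k).sing i ≠ ω → Q k i = 0)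
    (hQ' : ∀ k i, (V k).sing i = ω → (Q k i).derivative =
      ∑ i' ∈ Resonance.linked (V k) ω i, Polynomial.C (colKernel A lam k 0 i i') * Q k i') :
    ∃ K : Matrix (Idx n) (Idx n) ℂ, (∀ p q, a p.1 - a q.1 ≠ ω → K p q = 0) ∧
      ∀ t p q, leadingTerm n lam K t p q =
        exp ((lam p.1 - lam q.1 - 1) * t) * (Q q.1 (p, q.2)).eval t := by
  -- `W` is `ξ` times the leading parts of all columns. The equations for the polynomials `Q` amount
  -- to `W' = L W - W L`.
  set W : ℂ → Matrix (Idx n) (Idx n) ℂ := fun t => Matrix.of fun p q =>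
    exp ((lam p.1 - lam q.1) * t) * (Q q.1 (p, q.2)).eval t with hW
  have hWa : ∀ t p q, W t p q = exp ((lam p.1 - lam q.1) * t) * (Q q.1 (p, q.2)).eval t :=
    fun _ _ _ => rfl
  have hW0 : ∀ t p q, a p.1 - a q.1 ≠ ω → W t p q = 0 := fun t p q h => by
    rw [hWa, hQ0 q.1 (p, q.2) (by rw [hs]; exact h)]
    simp
  have hL : ∀ t p q, (monodromyExponent n lam * W t - W t * monodromyExponent n lam) p q =
      ∑ r, monodromyExponent n lam p r * W t r q -
        ∑ s', W t p ⟨q.1, s'⟩ * monodromyExponent n lam ⟨q.1, s'⟩ q := fun t p q => by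
    rw [Matrix.sub_apply, Matrix.mul_apply, Matrix.mul_apply]
    congr 1
    exact sum_mul_monodromyExponent (W t p) q.1 q.2
  have hder : ∀ t p q, HasDerivAt (fun t => W t p q)
      ((monodromyExponent n lam * W t - W t * monodromyExponent n lam) p q) t := by
    intro t p q
    rw [hL]
    by_cases hpq : a p.1 - a q.1 = ω
    · set i : ColIdx n q.1 := (p, q.2) with hi
      have hR := resonance_borel hF0 hF hlam (hs q.1) (hk q.1) ω
      have hsi : (V q.1).sing i = ω := by rw [hs]; exact hpq
      refine (Resonance.hasDerivAt_exp_mul_eval (lam p.1 - lam q.1) (Q q.1 i) t).congr_deriv ?_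
      have hsum := sum_colKernel (A := A) (lam := lam) q.1 0 i
        fun i' => W t i'.1 ⟨q.1, i'.2⟩
      rw [if_pos rfl] at hsum
      -- Rows `r` with `a_r - a_k = ω` have the same `a` as the row `p`, and there the coefficient
      -- of order one of `A` is `L`; in the other rows `W` vanishes.
      have h2 : ∑ r, monodromyExponent n lam p r * W t r q =
          ∑ r, PowerSeries.coeff (0 + 1) (A p r) * W t r q := by
        refine Finset.sum_congr rfl fun r _ => ?_
        by_cases hr : a r.1 - a q.1 = ω
        · rw [zero_add, coeff_one_system hF0 hF (by linear_combination hpq - hr)]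
        · rw [hW0 t r q hr, mul_zero, mul_zero]
      rw [h2]
      refine Eq.trans ?_ hsum
      rw [← Finset.add_sum_erase _ _ (Finset.mem_univ i), hR.diag i hsi]
      congr 1
      · rw [hQ' q.1 i hsi, Polynomial.eval_finsetSum, Finset.mul_sum]
        refine Finset.sum_subset_zero_on_sdiff (fun i' hi' =>
          Finset.mem_erase.2 ⟨(Finset.mem_filter.1 hi').2.2, Finset.mem_univ _⟩) ?_ ?_
        · intro i' hi'
          obtain ⟨h3, h4⟩ := Finset.mem_sdiff.1 hi'
          rw [hW0 t i'.1 ⟨q.1, i'.2⟩ (fun h5 => h4 (Finset.mem_filter.2 ⟨Finset.mem_univ _,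
            by rw [hs]; exact h5, Finset.ne_of_mem_erase h3⟩)), mul_zero]
        · intro i' hi'
          obtain ⟨-, h3, h4⟩ := Finset.mem_filter.1 hi'
          rw [Polynomial.eval_mul, Polynomial.eval_C]
          by_cases h5 : colKernel A lam q.1 0 i i' = 0
          · simp [h5]
          · have h6 := (hR.offdiag i i' hsi h3 (Ne.symm h4) h5).1
            rw [hWa]
            rw [h6]
            ring
    · have h1 : (fun t => W t p q) = fun _ => 0 := funext fun t => hW0 t p q hpq
      rw [h1]
      refine (hasDerivAt_const t (0 : ℂ)).congr_deriv ?_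
      rw [Finset.sum_eq_zero, Finset.sum_eq_zero, sub_zero]
      · intro s' _
        rw [hW0 t p ⟨q.1, s'⟩ hpq, zero_mul]
      · intro r _
        by_cases hr : p.1 = r.1
        · rw [hW0 t r q (by rw [← hr]; exact hpq), mul_zero]
        · rw [monodromyExponent_apply_of_ne hr, zero_mul]
  refine ⟨W 0, fun p q h => hW0 0 p q h, fun t p q => ?_⟩
  rw [leadingTerm, ← eq_exp_mul_exp_of_hasDerivAt hder t, Matrix.smul_apply, hWa, smul_eq_mul,
    ← mul_assoc, ← Complex.exp_add]
  congr 2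
  ring

lemma finite_stokesValues (a : Fin J → ℂ) : (stokesValues a).Finite := by
  refine (Set.finite_range fun x : Fin J × Fin J => a x.1 - a x.2).subset ?_
  rintro z ⟨j, k, rfl⟩
  exact ⟨(j, k), rfl⟩

/-- Blocks are nonempty, so each `l` with `a_l - a_k = ω` is seen by at least one index of the
Volterra system. -/
lemma exponents_borel (hn : ∀ j, 0 < n j) {k : Fin J} {V : VolterraData (ColIdx n k)}
    (hs : ∀ i, V.sing i = a i.1.1 - a k) (ω : ℂ) :
    Resonance.exponents V ω (fun i => lam i.1.1 - lam k) =
      (Finset.univ.filter fun l => a l - a k = ω).image fun l => lam l - lam k := by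
  ext ν
  simp only [Resonance.exponents, Finset.mem_image, Finset.mem_filter, Finset.mem_univ, true_and,
    hs]
  constructor
  · rintro ⟨i, hi, rfl⟩
    exact ⟨i.1.1, hi, rfl⟩
  · rintro ⟨l, hl, rfl⟩
    exact ⟨(⟨l, ⟨0, hn l⟩⟩, ⟨0, hn k⟩), hl, rfl⟩

include hF0 hF in
/-- Existence of the principal major. -/
theorem exists_isPrincipalMajor (hn : ∀ j, 0 < n j)
    (hlam : ∀ j, 0 ≤ (lam j).re ∧ (lam j).re < 1) (hA : ∀ p q, IsConvergent (A p q))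
    {θ : ℝ} {ω : ℂ} (hθ : ω = (‖ω‖ : ℂ) * exp (θ * I)) :
    ∃ (Φ : ℂ → Matrix (Idx n) (Idx n) ℂ) (K : Matrix (Idx n) (Idx n) ℂ),
      IsPrincipalMajor n a lam F θ ω Φ K ∧ ∀ p q, a p.1 - a q.1 ≠ ω → K p q = 0 := by
  choose V r₀ W hr₀ hsol hs hk using fun k => exists_isSol_borel hF0 hF hA k
  choose δ hδ G W' hG hne hbr using fun k => IsSol.exists_rightBranch (finite_stokesValues a)
    (fun i => (⟨i.1.1, k, hs k i⟩ : (V k).sing i ∈ stokesValues a)) (hr₀ k) (hsol k) hθ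
  choose Q N u H hQ0 hQ' hu hH hH0 hexp using fun k =>
    (resonance_borel hF0 hF hlam (hs k) (hk k) ω).exists_principal_expansion (hδ k) (hG k)
      (hne k) (S := {z | ∃ i, z = a i - a k - ω}) fun i => ⟨i.1.1, by rw [hs]⟩
  obtain ⟨K, hK, hlead⟩ := exists_leadingTerm_eq hF0 hF hlam hs hk hQ0 hQ'
  set M := Finset.univ.sup N with hM
  have hNM : ∀ k, N k ≤ M := fun k => Finset.le_sup (Finset.mem_univ k)
  -- The expansion has one term for each exponent, the remainder one for each `l`. If several `l`
  -- share an exponent, its coefficient is divided evenly among them.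
  set h : Fin J → ℕ → Idx n → Idx n → ℂ → ℂ := fun l m p q z =>
    ((((Finset.univ.filter fun l => a l - a q.1 = ω).filter fun l' =>
      lam l' - lam q.1 = lam l - lam q.1).card : ℂ))⁻¹ *
      H q.1 (lam l - lam q.1) m (p, q.2) z with hh
  set Rem : ℂ → Matrix (Idx n) (Idx n) ℂ := fun t => Matrix.of fun p q =>
    ∑ l with a l - a q.1 = ω, exp ((lam l - lam q.1) * t) *
      ∑ m ∈ Finset.range M, h l m p q (exp t) * t ^ m with hRem
  refine ⟨fun t => leadingTerm n lam K t + Rem t, K, ⟨fun p q => ?_, Rem,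
    ⟨M, h, fun l m p q hl => ?_, fun l p q hl hll => ?_, Eventually.of_forall fun t p q => rfl⟩,
    Eventually.of_forall fun t => rfl⟩, hK⟩
  · refine ⟨fun t => G q.1 t (p, q.2), fun z => u q.1 (p, q.2) (z - ω), hbr q.1 (p, q.2), ?_, ?_⟩
    · have h1 : AnalyticAt ℂ (fun z : ℂ => z - ω) ω := analyticAt_id.sub analyticAt_const
      refine AnalyticAt.fun_comp (g := u q.1 (p, q.2)) ?_ h1
      rw [sub_self]
      exact hu q.1 (p, q.2)
    · filter_upwards [hexp q.1 (p, q.2) M (hNM q.1)] with t ht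
      rw [ht, Matrix.add_apply, hlead, add_sub_cancel_left, exponents_borel hn (hs q.1) ω,
        sum_image_eq_sum_inv_card_mul, add_right_comm]
      congr 2
      rw [hRem]
      simp only [Matrix.of_apply, hh]
      refine Finset.sum_congr rfl fun l _ => ?_
      rw [mul_left_comm, Finset.mul_sum]
      simp only [mul_assoc]
  · have hmem : lam l - lam q.1 ∈
        Resonance.exponents (V q.1) ω fun i => lam i.1.1 - lam q.1 := by
      rw [exponents_borel hn (hs q.1) ω]
      exact Finset.mem_image_of_mem (fun l => lam l - lam q.1)
        (Finset.mem_filter.2 ⟨Finset.mem_univ l, hl⟩)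
    obtain ⟨h1, h2⟩ := hH q.1 _ hmem m (p, q.2)
    exact LogRes.isSummableResurgent (analyticAt_const.mul h1) (h2.const_mul _)
  · funext z
    simp only [hh]
    rw [hll, sub_self, hH0]
    simp

end Existence

end LevelOne

end

noncomputable section

namespace LevelOne

/-! ### Uniqueness of the principal major -/

/-- Two continuations along the paths `γ⁺` coincide. -/
theorem IsRightBranch.unique {S : Set ℂ} (hS : S.Finite) {θ : ℝ} {ω : ℂ} {f G G' : ℂ → ℂ}
    (hθ : ω = (‖ω‖ : ℂ) * exp (θ * I)) (hG : IsRightBranch S θ ω f G)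
    (hG' : IsRightBranch S θ ω f G') : ∀ᶠ t in logZero, G t = G' t := by
  obtain ⟨δ, hδ, han, hbr⟩ := hG
  obtain ⟨δ', hδ', han', hbr'⟩ := hG'
  set ε := min δ δ' with hε
  have hε0 : 0 < ε := lt_min hδ hδ'
  -- The deviation vanishes at the end of the path, so an admissible deviation exists only if the
  -- end point is not in `S`; finiteness of `S` leaves such an `r`.
  obtain ⟨r, ⟨hr0, hrε⟩, hrS⟩ : ∃ r ∈ Set.Ioo 0 ε,
      ((‖ω‖ + r : ℝ) : ℂ) * exp (θ * I) ∉ S := by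
    have hinj : Set.InjOn (fun r : ℝ => ((‖ω‖ + r : ℝ) : ℂ) * exp (θ * I))
        ((fun r : ℝ => ((‖ω‖ + r : ℝ) : ℂ) * exp (θ * I)) ⁻¹' S) := by
      intro r _ r' _ h
      have h1 := mul_right_cancel₀ (Complex.exp_ne_zero _) h
      have h2 : ‖ω‖ + r = ‖ω‖ + r' := by exact_mod_cast h1
      linarith
    obtain ⟨r, hr, hr'⟩ := ((Set.Ioo_infinite hε0).sdiff (hS.preimage hinj)).nonempty
    exact ⟨r, hr, hr'⟩
  -- Positive between the end points and at most `ε`, this deviation is admissible for both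
  -- branches; both are thus compared along one path.
  set y : C(unitInterval, ℝ) := ⟨fun s => ε * ((s : ℝ) * (1 - s)), by fun_prop⟩ with hy
  have hdev : ∀ d, ε ≤ d → IsRightDeviation S θ ω r d y := by
    intro d hd
    refine ⟨by simp [hy], by simp [hy], fun s => ?_, fun s hs0 hsS => ?_⟩
    · have h0 := s.2.1
      have h1 := s.2.2
      refine ⟨mul_nonneg hε0.le (mul_nonneg h0 (by linarith)), le_trans ?_ hd⟩
      change ε * ((s : ℝ) * (1 - s)) ≤ ε
      nlinarith [mul_nonneg hε0.le (sq_nonneg (s : ℝ)), mul_nonneg hε0.le (sub_nonneg.2 h1)]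
    · have h0 : (0 : ℝ) < s := lt_of_le_of_ne s.2.1 fun h => hs0 (Subtype.ext h.symm)
      have h1 : (s : ℝ) < 1 := by
        refine lt_of_le_of_ne s.2.2 fun h => hrS ?_
        rw [h, one_mul] at hsS
        exact hsS
      exact mul_pos hε0 (mul_pos h0 (by linarith))
  obtain ⟨g, hg, hgG⟩ := hbr r hr0 (hrε.trans_le (min_le_left _ _)) y (hdev δ (min_le_left _ _))
  obtain ⟨g', hg', hgG'⟩ :=
    hbr' r hr0 (hrε.trans_le (min_le_right _ _)) y (hdev δ' (min_le_right _ _))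
  have hend : rightPath θ ω r y 1 = ω + exp ((Real.log r : ℂ) + θ * I) := by
    rw [Complex.exp_add, ← Complex.ofReal_exp, Real.exp_log hr0]
    nth_rewrite 2 [hθ]
    simp [rightPath, hy]
    ring
  have hgg := hg.unique hg' 1
  rw [hend] at hgg
  have hcont : Continuous fun t : ℂ => ω + exp t := by fun_prop
  have hpull := (hcont.tendsto ((Real.log r : ℂ) + θ * I)).eventually hgg
  have hloc : G =ᶠ[𝓝 ((Real.log r : ℂ) + θ * I)] G' := by
    filter_upwards [hgG, hgG', hpull] with t h1 h2 h3
    rw [h1, h2, h3]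
  have hmem : ((Real.log r : ℂ) + θ * I) ∈ logDisc ε := by
    change Real.exp (((Real.log r : ℂ) + θ * I).re) < ε
    simpa [Real.exp_log hr0] using hrε
  have hsub : logDisc ε ⊆ {t : ℂ | Real.exp t.re < δ} := fun t (ht : Real.exp t.re < ε) =>
    ht.trans_le (min_le_left _ _)
  have hsub' : logDisc ε ⊆ {t : ℂ | Real.exp t.re < δ'} := fun t (ht : Real.exp t.re < ε) =>
    ht.trans_le (min_le_right _ _)
  have heq : Set.EqOn G G' (logDisc ε) := (han.mono hsub).eqOn_of_preconnected_of_eventuallyEq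
    (han'.mono hsub') (convex_logDisc ε).isPreconnected hmem hloc
  exact eventually_logZero_iff.2 ⟨Real.log ε, fun t ht =>
    heq ((Real.lt_log_iff_exp_lt hε0).1 ht)⟩

/-- The functions that vanish near `ξ = 0`. -/
def zeroSubmodule : Submodule ℂ (ℂ → ℂ) where
  carrier := {G | ∀ᶠ t in logZero, G t = 0}
  add_mem' := fun {G₁ G₂} (h₁ : ∀ᶠ t in logZero, G₁ t = 0) (h₂ : ∀ᶠ t in logZero, G₂ t = 0) => by
    change ∀ᶠ t in logZero, (G₁ + G₂) t = 0
    filter_upwards [h₁, h₂] with t h₁ h₂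
    simp [h₁, h₂]
  zero_mem' := by
    change ∀ᶠ t in logZero, (0 : ℂ → ℂ) t = 0
    exact Eventually.of_forall fun _ => rfl
  smul_mem' := fun c G (h : ∀ᶠ t in logZero, G t = 0) => by
    change ∀ᶠ t in logZero, (c • G) t = 0
    filter_upwards [h] with t h
    simp [h]

lemma mem_zeroSubmodule {G : ℂ → ℂ} : G ∈ zeroSubmodule ↔ ∀ᶠ t in logZero, G t = 0 := Iff.rfl

lemma neBot_logZero : logZero.NeBot := by
  rw [logZero]
  exact comap_neBot_iff_frequently.2 (Eventually.frequently
    (Eventually.of_forall fun x => ⟨(x : ℂ), Complex.ofReal_re x⟩))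

/-- A vanishing sum of powers of `ξ` and `ln ξ`, with coefficients that have at most a simple pole
at `ξ = 0`, has vanishing coefficients. -/
theorem coeff_eq_zero_of_sum_eq_zero {s : Finset ℂ} {c : ℝ}
    (hs : ∀ ν ∈ s, c ≤ ν.re ∧ ν.re < c + 1) {N : ℕ} {b : ℂ → ℕ → ℂ} {g : ℂ → ℕ → ℂ → ℂ}
    (hg : ∀ ν ∈ s, ∀ m, AnalyticAt ℂ (g ν m) 0)
    (h : ∀ᶠ t in logZero, ∑ ν ∈ s, exp (ν * t) *
      ∑ m ∈ Finset.range N, (b ν m * exp (-t) + g ν m (exp t)) * t ^ m = 0) :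
    ∀ ν ∈ s, ∀ m < N, b ν m = 0 ∧ ∀ᶠ t in logZero, g ν m (exp t) = 0 := by
  have hper : exp period = 1 := Complex.exp_two_pi_mul_I
  -- Functions vanishing near `ξ = 0` form a space to which `extraction` applies, and a pole `1 / ξ`
  -- does not affect the multiplier `e^{2πi ν}`.
  have hX := extraction (𝒱 := zeroSubmodule)
    (fun G hG => by
      obtain ⟨x₀, hx₀⟩ := eventually_logZero_iff.1 (mem_zeroSubmodule.1 hG)
      exact eventually_logZero_iff.2 ⟨x₀, fun t ht => hx₀ _ (by rw [period_re]; exact ht)⟩)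
    (fun G hG => by
      filter_upwards [mem_zeroSubmodule.1 hG] with t ht
      rw [ht, mul_zero])
    (exp_mul_period_injOn hs) (fun _ _ => Complex.exp_ne_zero _) (N := N)
    (X := fun ν m t => exp (ν * t) * (b ν m * exp (-t) + g ν m (exp t)))
    (fun ν _ m t => by
      rw [neg_add, Complex.exp_add (-t), Complex.exp_add t, mul_add ν, Complex.exp_add (ν * t),
        Complex.exp_neg period, hper]
      simp only [inv_one, mul_one]
      ring)
    (by
      refine mem_zeroSubmodule.2 ?_
      filter_upwards [h] with t ht
      rw [← ht]
      refine Finset.sum_congr rfl fun ν _ => ?_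
      rw [Finset.mul_sum]
      refine Finset.sum_congr rfl fun m _ => ?_
      ring)
  intro ν hν m hm
  have h1 : ∀ᶠ t in logZero, b ν m * exp (-t) + g ν m (exp t) = 0 := by
    filter_upwards [mem_zeroSubmodule.1 (hX ν hν m hm)] with t ht
    exact (mul_eq_zero.1 ht).resolve_left (Complex.exp_ne_zero _)
  -- The relation is multiplied by `ξ` and `ξ → 0`.
  have hb : b ν m = 0 := by
    have hlim : Tendsto (fun t => -(exp t * g ν m (exp t))) logZero (𝓝 (-(0 * g ν m 0))) :=
      (tendsto_exp_logZero.mul ((hg ν hν m).continuousAt.tendsto.comp tendsto_exp_logZero)).neg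
    have hev : ∀ᶠ t in logZero, -(exp t * g ν m (exp t)) = b ν m := by
      filter_upwards [h1] with t ht
      have h2 : exp t * exp (-t) = 1 := by rw [← Complex.exp_add, add_neg_cancel, Complex.exp_zero]
      linear_combination b ν m * h2 - exp t * ht
    have := neBot_logZero
    have := tendsto_nhds_unique (tendsto_const_nhds.congr' (hev.mono fun t ht => ht.symm)) hlim
    simpa using this
  refine ⟨hb, ?_⟩
  filter_upwards [h1] with t ht
  simpa [hb] using ht

/-! ### Powers and polynomials in `ln ξ` in the leading term -/

section LeadingTerm

variable {J : ℕ} {n : Fin J → ℕ} {lam : Fin J → ℂ}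

/-- The nilpotent part of `L`. -/
def nilpotentPart (n : Fin J → ℕ) : Matrix (Idx n) (Idx n) ℂ :=
  Matrix.blockDiagonal' fun j => jordanNilpotent (n j)

lemma monodromyExponent_eq_add : monodromyExponent n lam =
    Matrix.diagonal (fun p => lam p.1) + nilpotentPart n := by
  rw [monodromyExponent, nilpotentPart]
  have h1 : (fun j => lam j • (1 : Matrix (Fin (n j)) (Fin (n j)) ℂ) + jordanNilpotent (n j)) =
      (fun j => Matrix.diagonal fun _ => lam j) + fun j => jordanNilpotent (n j) := by
    funext j
    rw [Pi.add_apply, Matrix.smul_one_eq_diagonal]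
  rw [h1, Matrix.blockDiagonal'_add, Matrix.blockDiagonal'_diagonal]

lemma nilpotentPart_apply_ne_zero {p q : Idx n} (h : nilpotentPart n p q ≠ 0) :
    p.1 = q.1 ∧ (p.2 : ℕ) + 1 = q.2 := by
  obtain ⟨j, r⟩ := p
  obtain ⟨j', s⟩ := q
  rw [nilpotentPart] at h
  by_cases hj : j = j'
  · subst hj
    rw [Matrix.blockDiagonal'_apply_eq] at h
    refine ⟨rfl, ?_⟩
    by_contra hc
    exact h (if_neg hc)
  · exact absurd (Matrix.blockDiagonal'_apply_ne _ _ _ hj) h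

lemma exists_nilpotentPart_pow_eq_zero (n : Fin J → ℕ) : ∃ M, ∀ m, M ≤ m →
    nilpotentPart n ^ m = 0 := by
  have key : ∀ m (p q : Idx n), (nilpotentPart n ^ m) p q ≠ 0 → (p.2 : ℕ) + m = q.2 := by
    intro m
    induction m with
    | zero =>
      intro p q h
      rw [pow_zero] at h
      have : p = q := by
        by_contra hpq
        exact h (Matrix.one_apply_ne hpq)
      rw [this, add_zero]
    | succ m ih =>
      intro p q h
      rw [pow_succ, Matrix.mul_apply] at h
      obtain ⟨r, -, hr⟩ := Finset.exists_ne_zero_of_sum_ne_zero h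
      have h1 := ih p r (left_ne_zero_of_mul hr)
      have h2 := (nilpotentPart_apply_ne_zero (right_ne_zero_of_mul hr)).2
      omega
  refine ⟨Finset.univ.sup n, fun m hm => ?_⟩
  ext p q
  by_contra h
  have h1 := key m p q h
  have h2 : n q.1 ≤ Finset.univ.sup n := Finset.le_sup (Finset.mem_univ q.1)
  have h3 := q.2.isLt
  omega

lemma commute_diagonal_nilpotentPart (lam : Fin J → ℂ) :
    Commute (Matrix.diagonal fun p : Idx n => lam p.1) (nilpotentPart n) := by
  ext p q
  rw [Matrix.diagonal_mul, Matrix.mul_diagonal]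
  by_cases h : nilpotentPart n p q = 0
  · rw [h, zero_mul, mul_zero]
  · rw [(nilpotentPart_apply_ne_zero h).1, mul_comm]

lemma exists_exp_nilpotentPart (n : Fin J → ℕ) : ∃ E : Idx n → Idx n → Polynomial ℂ,
    ∀ (t : ℂ) p q, NormedSpace.exp (t • nilpotentPart n) p q = (E p q).eval t := by
  obtain ⟨M, hM⟩ := exists_nilpotentPart_pow_eq_zero n
  refine ⟨fun p q => ∑ m ∈ Finset.range M,
    Polynomial.C ((m.factorial : ℂ)⁻¹ * (nilpotentPart n ^ m) p q) * Polynomial.X ^ m,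
    fun t p q => ?_⟩
  rw [NormedSpace.exp_eq_tsum ℂ]
  simp only
  rw [tsum_eq_sum (s := Finset.range M)]
  · rw [Matrix.sum_apply, Polynomial.eval_finsetSum]
    refine Finset.sum_congr rfl fun m _ => ?_
    rw [smul_pow, Matrix.smul_apply, Matrix.smul_apply]
    simp only [smul_eq_mul, Polynomial.eval_mul, Polynomial.eval_C, Polynomial.eval_pow,
      Polynomial.eval_X]
    ring
  · intro m hm
    rw [smul_pow, hM m (by simpa using hm), smul_zero, smul_zero]

/-- `L` is the sum of a diagonal matrix and a nilpotent one that commute. The first exponentiates to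
powers of `ξ`, the second to polynomials in `ln ξ`. -/
lemma exists_exp_monodromyExponent (n : Fin J → ℕ) (lam : Fin J → ℂ) :
    ∃ E : Idx n → Idx n → Polynomial ℂ, ∀ (t : ℂ) p q,
      NormedSpace.exp (t • monodromyExponent n lam) p q = exp (lam p.1 * t) * (E p q).eval t ∧
      NormedSpace.exp (-(t • monodromyExponent n lam)) p q =
        exp (-(lam q.1 * t)) * ((E p q).comp (-Polynomial.X)).eval t := by
  obtain ⟨E, hE⟩ := exists_exp_nilpotentPart n
  have hdiag : ∀ t : ℂ, NormedSpace.exp (t • Matrix.diagonal fun p : Idx n => lam p.1) =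
      Matrix.diagonal fun p : Idx n => exp (lam p.1 * t) := by
    intro t
    rw [← Matrix.diagonal_smul, Matrix.exp_diagonal]
    congr 1
    funext p
    rw [Pi.exp_def]
    simp only [Pi.smul_apply, smul_eq_mul]
    rw [← Complex.exp_eq_exp_ℂ, mul_comm]
  have hexp : ∀ t : ℂ, NormedSpace.exp (t • monodromyExponent n lam) =
      (Matrix.diagonal fun p : Idx n => exp (lam p.1 * t)) *
        NormedSpace.exp (t • nilpotentPart n) := by
    intro t
    rw [monodromyExponent_eq_add, smul_add, Matrix.exp_add_of_commute _ _
      (((commute_diagonal_nilpotentPart lam).smul_left t).smul_right t), hdiag]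
  have hexp' : ∀ t : ℂ, NormedSpace.exp (t • monodromyExponent n lam) =
      NormedSpace.exp (t • nilpotentPart n) *
        (Matrix.diagonal fun p : Idx n => exp (lam p.1 * t)) := by
    intro t
    rw [monodromyExponent_eq_add, add_comm, smul_add, Matrix.exp_add_of_commute _ _
      (((commute_diagonal_nilpotentPart lam).symm.smul_left t).smul_right t), hdiag]
  refine ⟨E, fun t p q => ⟨?_, ?_⟩⟩
  · rw [hexp, Matrix.diagonal_mul, hE]
  · rw [← neg_smul, hexp', Matrix.mul_diagonal, hE, mul_comm, mul_neg]
    simp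

/-- The exponents of an arbitrary entry of `K` cancel out: conjugation moves entries only within
blocks, on which `λ` is constant. The leading term thus has the form to which the independence of
powers and logarithms applies. -/
lemma exists_leadingTerm_eq_eval (n : Fin J → ℕ) (lam : Fin J → ℂ)
    (K : Matrix (Idx n) (Idx n) ℂ) : ∃ P : Idx n → Idx n → Polynomial ℂ, ∀ t p q,
      leadingTerm n lam K t p q = exp ((lam p.1 - lam q.1 - 1) * t) * (P p q).eval t := by
  obtain ⟨E, hE⟩ := exists_exp_monodromyExponent n lam
  refine ⟨fun p q => ∑ s, (∑ r, E p r * Polynomial.C (K r s)) * (E s q).comp (-Polynomial.X),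
    fun t p q => ?_⟩
  rw [leadingTerm, Matrix.smul_apply, Matrix.mul_apply, smul_eq_mul, Polynomial.eval_finsetSum,
    Finset.mul_sum, Finset.mul_sum]
  refine Finset.sum_congr rfl fun s _ => ?_
  rw [Matrix.mul_apply, (hE t s q).2, Polynomial.eval_mul, Polynomial.eval_finsetSum,
    Finset.sum_mul, Finset.sum_mul, Finset.mul_sum, Finset.mul_sum]
  refine Finset.sum_congr rfl fun r _ => ?_
  rw [(hE t p r).1, Polynomial.eval_mul, Polynomial.eval_C,
    show (lam p.1 - lam q.1 - 1) * t = -t + lam p.1 * t + -(lam q.1 * t) by ring,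
    Complex.exp_add, Complex.exp_add]
  ring

lemma leadingTerm_sub (K K' : Matrix (Idx n) (Idx n) ℂ) (t : ℂ) :
    leadingTerm n lam (K - K') t = leadingTerm n lam K t - leadingTerm n lam K' t := by
  rw [leadingTerm, leadingTerm, leadingTerm, ← smul_sub, mul_sub, sub_mul]

lemma eq_zero_of_leadingTerm_eq_zero {K : Matrix (Idx n) (Idx n) ℂ}
    (h : leadingTerm n lam K 0 = 0) : K = 0 := by
  simpa [leadingTerm, NormedSpace.exp_zero] using h

end LeadingTerm

section Uniqueness

variable {J : ℕ} {n : Fin J → ℕ} {a lam : Fin J → ℂ} {F : Matrix (Idx n) (Idx n) ℂ⟦X⟧}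

/-- Uniqueness of the principal major and of its constant matrix. -/
theorem IsPrincipalMajor.unique (hlam : ∀ j, 0 ≤ (lam j).re ∧ (lam j).re < 1) {θ : ℝ} {ω : ℂ}
    (hθ : ω = (‖ω‖ : ℂ) * exp (θ * I)) {Φ Φ' : ℂ → Matrix (Idx n) (Idx n) ℂ}
    {K K' : Matrix (Idx n) (Idx n) ℂ} (h : IsPrincipalMajor n a lam F θ ω Φ K)
    (h' : IsPrincipalMajor n a lam F θ ω Φ' K') :
    (∀ᶠ t in logZero, Φ t = Φ' t) ∧ K = K' := by
  obtain ⟨hmaj, Rem, ⟨N, c, hc, hc0, hRem⟩, hΦ⟩ := h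
  obtain ⟨hmaj', Rem', ⟨N', c', hc', hc0', hRem'⟩, hΦ'⟩ := h'
  obtain ⟨P, hP⟩ := exists_leadingTerm_eq_eval n lam (K - K')
  have key : ∀ p q, (∀ᶠ t in logZero, Φ t p q = Φ' t p q) ∧ P p q = 0 := by
    intro p q
    obtain ⟨G, u, hG, hu, hGu⟩ := hmaj p q
    obtain ⟨G', u', hG', hu', hGu'⟩ := hmaj' p q
    -- `M` exceeds the degrees in `ln ξ` of both remainders and of the leading term, and is positive
    -- so that `m = 0` is available.
    set M := N + N' + (P p q).natDegree + 1 with hM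
    set s : Finset ℂ := Finset.univ.image fun l => lam l - lam q.1 with hs
    have hsre : ∀ ν ∈ s, -(lam q.1).re ≤ ν.re ∧ ν.re < -(lam q.1).re + 1 := by
      intro ν hν
      obtain ⟨l, -, rfl⟩ := Finset.mem_image.1 hν
      rw [Complex.sub_re]
      have := hlam l
      constructor <;> linarith [this.1, this.2]
    have hmem : ∀ l, lam l - lam q.1 ∈ s := fun l => Finset.mem_image_of_mem _ (Finset.mem_univ l)
    have h0mem : (0 : ℂ) ∈ s := by simpa using hmem q.1
    set d : Fin J → ℕ → ℂ → ℂ := fun l m z =>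
      (if m < N then c l m p q z else 0) - if m < N' then c' l m p q z else 0 with hd
    have hdan : ∀ l m, a l - a q.1 = ω → AnalyticAt ℂ (d l m) 0 := by
      intro l m hl
      refine AnalyticAt.sub ?_ ?_
      · by_cases hm : m < N
        · simpa only [hm, if_true] using (hc l m p q hl).analytic
        · simpa only [hm, if_false] using analyticAt_const
      · by_cases hm : m < N'
        · simpa only [hm, if_true] using (hc' l m p q hl).analytic
        · simpa only [hm, if_false] using analyticAt_const
    set b : ℂ → ℕ → ℂ := fun ν m => if ν = lam p.1 - lam q.1 then (P p q).coeff m else 0 with hb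
    -- The difference of the two holomorphic parts is the coefficient of `ξ^0 (ln ξ)^0`, where it
    -- meets the remainder terms with `λ_l = λ_k`.
    set g : ℂ → ℕ → ℂ → ℂ := fun ν m z =>
      ∑ l with a l - a q.1 = ω, (if lam l - lam q.1 = ν then d l m z else 0) +
        if ν = 0 ∧ m = 0 then u (ω + z) - u' (ω + z) else 0 with hg
    have hgan : ∀ ν ∈ s, ∀ m, AnalyticAt ℂ (g ν m) 0 := by
      intro ν _ m
      refine AnalyticAt.add (Finset.analyticAt_fun_sum _ fun l hl => ?_) ?_
      · by_cases hν : lam l - lam q.1 = ν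
        · simpa only [hν, if_true] using hdan l m (Finset.mem_filter.1 hl).2
        · simpa only [hν, if_false] using analyticAt_const
      · by_cases hν : ν = 0 ∧ m = 0
        · simp only [hν, and_self, if_true]
          have h1 : AnalyticAt ℂ (fun z : ℂ => ω + z) 0 := analyticAt_const.add analyticAt_id
          exact (AnalyticAt.fun_comp (g := u) (by rwa [add_zero]) h1).sub
            (AnalyticAt.fun_comp (g := u') (by rwa [add_zero]) h1)
        · simpa only [hν, if_false] using analyticAt_const
    have hzero := coeff_eq_zero_of_sum_eq_zero hsre hgan (N := M) (b := b) (by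
      filter_upwards [hGu, hGu', hΦ, hΦ', hRem, hRem',
        IsRightBranch.unique (finite_stokesValues a) hθ hG hG'] with t h1 h2 h3 h4 h5 h6 h7
      have hlead := hP t p q
      rw [leadingTerm_sub, Matrix.sub_apply] at hlead
      rw [h1, h2, h3, h4, Matrix.add_apply, Matrix.add_apply, h5, h6] at h7
      have hext : ∀ (N₁ : ℕ) (x : ℕ → ℂ), N₁ ≤ M → ∑ m ∈ Finset.range N₁, x m * t ^ m =
          ∑ m ∈ Finset.range M, (if m < N₁ then x m else 0) * t ^ m := by
        intro N₁ x hN₁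
        rw [← Finset.sum_subset (Finset.range_mono hN₁) (fun m _ hm => by
          rw [if_neg (by simpa using hm), zero_mul])]
        refine Finset.sum_congr rfl fun m hm => ?_
        rw [if_pos (Finset.mem_range.1 hm)]
      have hd' : ∑ l with a l - a q.1 = ω, exp ((lam l - lam q.1) * t) *
          ∑ m ∈ Finset.range M, d l m (exp t) * t ^ m =
          ∑ l with a l - a q.1 = ω, exp ((lam l - lam q.1) * t) *
            ∑ m ∈ Finset.range N, c l m p q (exp t) * t ^ m -
          ∑ l with a l - a q.1 = ω, exp ((lam l - lam q.1) * t) *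
            ∑ m ∈ Finset.range N', c' l m p q (exp t) * t ^ m := by
        rw [← Finset.sum_sub_distrib]
        refine Finset.sum_congr rfl fun l _ => ?_
        rw [hext N _ (by omega), hext N' _ (by omega), ← mul_sub, ← Finset.sum_sub_distrib]
        simp only [hd, sub_mul]
      have hg1 : ∑ ν ∈ s, exp (ν * t) * ∑ m ∈ Finset.range M, b ν m * exp (-t) * t ^ m =
          exp ((lam p.1 - lam q.1 - 1) * t) * (P p q).eval t := by
        rw [Finset.sum_eq_single_of_mem _ (hmem p.1) (fun ν _ hν => by simp [hb, hν])]
        rw [Polynomial.eval_eq_sum_range' (show (P p q).natDegree < M by omega), Finset.mul_sum,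
          Finset.mul_sum]
        refine Finset.sum_congr rfl fun m _ => ?_
        simp only [hb, if_true]
        rw [show (lam p.1 - lam q.1 - 1) * t = (lam p.1 - lam q.1) * t + -t by ring,
          Complex.exp_add]
        ring
      have hg2 : ∑ ν ∈ s, exp (ν * t) * ∑ m ∈ Finset.range M,
          (∑ l with a l - a q.1 = ω, if lam l - lam q.1 = ν then d l m (exp t) else 0) * t ^ m =
          ∑ l with a l - a q.1 = ω, exp ((lam l - lam q.1) * t) *
            ∑ m ∈ Finset.range M, d l m (exp t) * t ^ m := by
        simp only [Finset.sum_mul, Finset.mul_sum]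
        rw [Finset.sum_congr rfl fun ν _ => Finset.sum_comm, Finset.sum_comm]
        refine Finset.sum_congr rfl fun l _ => ?_
        rw [Finset.sum_eq_single_of_mem _ (hmem l) (fun ν _ hν => by simp [Ne.symm hν])]
        simp
      have hg3 : ∑ ν ∈ s, exp (ν * t) * ∑ m ∈ Finset.range M,
          (if ν = 0 ∧ m = 0 then u (ω + exp t) - u' (ω + exp t) else 0) * t ^ m =
          u (ω + exp t) - u' (ω + exp t) := by
        rw [Finset.sum_eq_single_of_mem _ h0mem (fun ν _ hν => by simp [hν]),
          Finset.sum_eq_single_of_mem 0 (Finset.mem_range.2 (by omega))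
            (fun m _ hm => by simp [hm])]
        simp
      simp only [hg, add_mul, Finset.sum_add_distrib, mul_add]
      rw [hg1, hg2, hg3, hd', ← hlead]
      linear_combination h7)
    have hP0 : P p q = 0 := by
      ext m
      rw [Polynomial.coeff_zero]
      by_cases hm : m < M
      · simpa [hb] using (hzero _ (hmem p.1) m hm).1
      · exact Polynomial.coeff_eq_zero_of_natDegree_lt (by omega)
    refine ⟨?_, hP0⟩
    -- At `ν = 0`, `m = 0` the normalization of the remainders removes their contribution. Hence the
    -- two holomorphic parts agree near `ω`, and with them the majors.
    filter_upwards [hGu, hGu', (hzero 0 h0mem 0 (by omega)).2,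
      IsRightBranch.unique (finite_stokesValues a) hθ hG hG'] with t h1 h2 h3 h4
    simp only [hg, and_self, if_true] at h3
    rw [Finset.sum_eq_zero, zero_add] at h3
    · rw [h1, h2] at h4
      linear_combination h4 - h3
    · intro l hl
      split_ifs with hll
      · have hl' := (Finset.mem_filter.1 hl).2
        simp [hd, hc0 l p q hl' (sub_eq_zero.1 hll), hc0' l p q hl' (sub_eq_zero.1 hll)]
      · rfl
  refine ⟨?_, ?_⟩
  · have h1 : ∀ᶠ t in logZero, ∀ p q, Φ t p q = Φ' t p q :=
      eventually_all.2 fun p => eventually_all.2 fun q => (key p q).1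
    filter_upwards [h1] with t ht
    ext p q
    exact ht p q
  · refine sub_eq_zero.1 (eq_zero_of_leadingTerm_eq_zero (n := n) (lam := lam) ?_)
    ext p q
    rw [hP, (key p q).2]
    simp

end Uniqueness

end LevelOne

end

open LevelOne in
/-- The system `x² Y' = A(x) Y`, with `A` convergent, has a formal fundamental solution
`F(x) x^L e^{Q(1/x)}` with `F(0) = 1`, single level one and exponents `0 ≤ Re λ_j < 1`. The real
number `θ` is a determination of an anti-Stokes direction; the principal one is the choice
`-2π < θ ≤ 0`. -/
theorem mainTheorem5 {J : ℕ} (n : Fin J → ℕ) (hn : ∀ j, 0 < n j) (a lam : Fin J → ℂ)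
    (hlam : ∀ j, 0 ≤ (lam j).re ∧ (lam j).re < 1)
    (A F : Matrix (Idx n) (Idx n) (PowerSeries ℂ))
    (hA : ∀ p q, IsConvergent (A p q))
    (hF0 : F.map PowerSeries.constantCoeff = 1)
    (hF : IsFormalSolution n a lam A F)
    (θ : ℝ) (ω : ℂ) (hω : ω ∈ stokesValuesOnRay a θ) :
    (∀ p q, IsConvergent (borelSeries (F p q))) ∧
    ∃ (Φ : ℂ → Matrix (Idx n) (Idx n) ℂ) (K : Matrix (Idx n) (Idx n) ℂ),
      IsPrincipalMajor n a lam F θ ω Φ K ∧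
      (∀ Φ' K', IsPrincipalMajor n a lam F θ ω Φ' K' →
        (∀ᶠ t in logZero, Φ' t = Φ t) ∧ K' = K) ∧
      (∀ j k, a j - a k ≠ ω → ∀ r s, K ⟨j, r⟩ ⟨k, s⟩ = 0) ∧
      ∀ j r s, K ⟨j, r⟩ ⟨j, s⟩ = 0 := by
  obtain ⟨-, hω0, hθ⟩ := hω
  obtain ⟨Φ, K, hΦ, hK⟩ := exists_isPrincipalMajor hF0 hF hn hlam hA hθ
  refine ⟨isConvergent_borelSeries hF0 hF hA, Φ, K, hΦ, fun Φ' K' h' => h'.unique hlam hθ hΦ,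
    fun j k h r s => hK ⟨j, r⟩ ⟨k, s⟩ h, fun j r s => hK ⟨j, r⟩ ⟨j, s⟩ ?_⟩
  rw [sub_self]
  exact hω0.symm
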